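/- Conventions. A $G$-variety $(X,G)$ is a complex quasi-projective variety $X$ (possibly reducible or empty) with an action of a finite group $G$. $K_0({\rm Var}_{\mathbb C})$ is the Grothendieck ring of complex quasi-projective varieties. $K_0^{\rm fGr}({\rm Var}_{\mathbb C})$ is the abelian group generated by the isomorphism classes $[(X,G)]$ of $G$-varieties (for all finite groups $G$; an isomorphism $(X,G)\to(X',G')$ consists of an isomorphism $X\to X'$ that is equivariant with respect to a group isomorphism $G\to G'$), modulo the relations $[(X,G)]=[(Y,G)]+[(X\setminus Y,G)]$ for Zariski closed $G$-invariant $Y\subset X$, and $[({\rm Ind}_G^H X,H)]=[(X,G)]$ for $G\subset H$; the product is $[(X_1,G_1)]\cdot[(X_2,G_2)]=[(X_1\times X_2,G_1\times G_2)]$. A $\lambda$-structure on a commutative ring $R$ is a map $R\to 1+tR[[t]]$, $a\mapsto\lambda_a(t)=1+at+\ldots$, with $\lambda_{a+b}(t)=\lambda_a(t)\lambda_b(t)$. A ring homomorphism $\varphi:R_1\to R_2$ is a $\lambda$-ring homomorphism if $\lambda_{\varphi(a)}(t)=\varphi_*\lambda_a(t)$ for all $a\in R_1$. A power structure over $R$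 is a map $(1+tR[[t]])\times R\to 1+tR[[t]]$, $(A(t),m)\mapsto (A(t))^m$, such that $A^0=1$, $A^1=A$, $(AB)^m=A^mB^m$, $A^{m+n}=A^mA^n$, $A^{mn}=(A^n)^m$, $(1+a_1t+\ldots)^m=1+ma_1t+\ldots$, and $(A(t^k))^m=(A(t))^m|_{t\mapsto t^k}$ for $k\ge 1$. Theorem. For every $G$-variety $(X,G)$ the quotient $X/G$ exists as a quasi-projective variety, and the following hold. (a) There are ring homomorphisms $p:K_0^{\rm fGr}({\rm Var}_{\mathbb C})\to K_0({\rm Var}_{\mathbb C})$ with $p[(X,G)]=[X/G]$, and $\alpha:K_0^{\rm fGr}({\rm Var}_{\mathbb C})\to K_0^{\rm fGr}({\rm Var}_{\mathbb C})$ with $\alpha[(X,G)]=\sum_{[g]\in{\rm Conj}\,G}[(X^{\langle g\rangle},C_G(g))]$. There is a $\lambda$-structure $\zeta$ on $K_0^{\rm fGr}({\rm Var}_{\mathbb C})$ with $\zeta_{(X,G)}(t)=1+\sum_{n\ge1}[(X^n,G_n)]t^n$, where $G_n=G^n\rtimes S_n$ is the wreath product. There is a power structure over $K_0({\rm Var}_{\mathbb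 C})$ such that for all quasi-projective varieties $A_1,A_2,\ldots$ and $M$ $$(1+[A_1]t+[A_2]t^2+\ldots)^{[M]}=1+\sum_{n\ge1}\Bigl(\sum_{\sum_i ik_i=n}\Bigl[\bigl((M^{\sum_i k_i}\setminus\Delta)\times\prod_iA_i^{k_i}\bigr)/\prod_iS_{k_i}\Bigr]\Bigr)t^n,$$ where $\Delta$ is the big diagonal and $S_{k_i}$ permutes simultaneously the components of $M^{k_i}$ and of $A_i^{k_i}$. (b) Let $k\ge0$ and let the generalized Euler characteristic of order $k$ be defined by $\chi_{\rm g}^{(0)}(X,G)=[X/G]$ and $\chi_{\rm g}^{(k)}(X,G)=\sum_{[g]\in{\rm Conj}\,G}\chi_{\rm g}^{(k-1)}(X^{\langle g\rangle},C_G(g))$ for $k\ge 1$. Then the ring homomorphism $p\circ\alpha^k$ takes the value $\chi_{\rm g}^{(k)}(X,G)$ on $[(X,G)]$. The series $$\lambda^{(k)}_a(t)=\Bigl(\prod_{r_1,\ldots,r_k\ge1}\bigl(1-t^{r_1r_2\cdots r_k}\bigr)^{r_2r_3^2\cdots r_k^{k-1}}\Bigr)^{-a},\qquad a\in K_0({\rm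 Var}_{\mathbb C}),$$ with the power taken in the power structure of (a), define a $\lambda$-structure on $K_0({\rm Var}_{\mathbb C})$ (for $k=0$ the product is $1-t$). The homomorphism $\chi_{\rm g}^{(k)}=p\circ\alpha^k$ is a $\lambda$-ring homomorphism for the $\lambda$-structures $\zeta$ on the source and $\lambda^{(k)}$ on the target; that is, $$\chi_{\rm g}^{(k)}\bigl(\zeta_{(X,G)}(t)\bigr)=\lambda^{(k)}_{\chi_{\rm g}^{(k)}(X,G)}(t).$$ -/

import Mathlib

noncomputable section

namespace Motivic

open MvPolynomial Topology

/-! ### Complex quasi-projective varieties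

A complex quasi-projective variety is a Zariski locally closed subset of a complex projective
space (it may be reducible, disconnected or empty).  The homogeneous coordinates are indexed by an
arbitrary finite type. -/

/-- The complex projective space with homogeneous coordinates indexed by `σ`. -/
def ProjSpace (σ : Type) : Type := Projectivization ℂ (σ → ℂ)

namespace ProjSpace

variable {σ : Type}

/-- A vector of homogeneous coordinates of a point. -/
def coords (p : ProjSpace σ) : σ → ℂ := Projectivization.rep p

/-- The point with given homogeneous coordinates. -/
def point (v : σ → ℂ) (hv : v ≠ 0) : ProjSpace σ := Projectivization.mk ℂ v hv

theorem coords_ne_zero (p : ProjSpace σ) : p.coords ≠ 0 := Projectivization.rep_nonzero p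

theorem point_coords (p : ProjSpace σ) : point p.coords p.coords_ne_zero = p :=
  Projectivization.mk_rep p

theorem point_eq_iff (v w : σ → ℂ) (hv : v ≠ 0) (hw : w ≠ 0) :
    point v hv = point w hw ↔ ∃ a : ℂ, a • w = v :=
  Projectivization.mk_eq_mk_iff' ℂ v w hv hw

theorem coords_point (v : σ → ℂ) (hv : v ≠ 0) :
    ∃ a : ℂ, a ≠ 0 ∧ (point v hv).coords = a • v := by
  obtain ⟨a, ha⟩ := Projectivization.exists_smul_eq_mk_rep ℂ v hv
  exact ⟨a, a.ne_zero, ha.symm⟩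

/-- The Zariski topology: a basis consists of the sets where some homogeneous polynomial does
not vanish. -/
instance zariski : TopologicalSpace (ProjSpace σ) :=
  TopologicalSpace.generateFrom
    {U | ∃ (d : ℕ) (F : MvPolynomial σ ℂ), F.IsHomogeneous d ∧
      U = {p : ProjSpace σ | eval p.coords F ≠ 0}}

theorem eval_smul {d : ℕ} {F : MvPolynomial σ ℂ} (hF : F.IsHomogeneous d) (a : ℂ) (v : σ → ℂ) :
    eval (a • v) F = a ^ d * eval v F := by
  rw [eval_eq, eval_eq, Finset.mul_sum]
  refine Finset.sum_congr rfl fun m hm => ?_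
  have h := hF.degree_eq_sum_deg_support hm
  simp only [Pi.smul_apply, smul_eq_mul, mul_pow, Finset.prod_mul_distrib]
  rw [Finset.prod_pow_eq_pow_sum, ← h]
  ring

theorem isOpen_basic {d : ℕ} {F : MvPolynomial σ ℂ} (hF : F.IsHomogeneous d) :
    IsOpen {p : ProjSpace σ | eval p.coords F ≠ 0} :=
  TopologicalSpace.isOpen_generateFrom_of_mem ⟨d, F, hF, rfl⟩

end ProjSpace

/-- A complex quasi-projective variety: a locally closed subset of a projective space. -/
structure QPVar : Type 1 where
  /-- The index set of the homogeneous coordinates of the ambient projective space. -/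
  σ : Type
  [finite : Finite σ]
  /-- The set of points. -/
  carrier : Set (ProjSpace σ)
  isLocallyClosed : IsLocallyClosed carrier

attribute [instance] QPVar.finite

namespace QPVar

instance : CoeSort QPVar Type := ⟨fun X => X.carrier⟩

/-- Homogeneous coordinates of a point of a variety. -/
def coords {X : QPVar} (x : X) : X.σ → ℂ := x.1.coords

theorem coords_ne_zero {X : QPVar} (x : X) : coords x ≠ 0 := x.1.coords_ne_zero

/-- A map of quasi-projective varieties is regular if near each point it is given by forms of one
and the same degree (without a common zero there). -/
def IsRegular {X Y : QPVar} (φ : X → Y) : Prop :=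
  ∀ x : X, ∃ (d : ℕ) (F : Y.σ → MvPolynomial X.σ ℂ), (∀ i, (F i).IsHomogeneous d) ∧
    (fun i => eval (coords x) (F i)) ≠ 0 ∧
    ∀ (y : X) (hy : (fun i => eval (coords y) (F i)) ≠ 0),
      (φ y).1 = ProjSpace.point (fun i => eval (coords y) (F i)) hy

/-- A function on a variety is regular at the point `x` if near `x` it is a quotient of two forms
of the same degree, the denominator not vanishing at `x`. -/
def RegularAt {X : QPVar} (f : X → ℂ) (x : X) : Prop :=
  ∃ (d : ℕ) (P Q : MvPolynomial X.σ ℂ), P.IsHomogeneous d ∧ Q.IsHomogeneous d ∧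
    eval (coords x) Q ≠ 0 ∧
    ∀ y : X, eval (coords y) Q ≠ 0 → f y = eval (coords y) P / eval (coords y) Q

/-- Isomorphism of varieties: a bijection that is regular in both directions. -/
def Iso (X Y : QPVar) : Prop := ∃ e : X ≃ Y, IsRegular e ∧ IsRegular e.symm

/-- A locally closed subset of a variety, as a variety. -/
def sub (X : QPVar) (Z : Set X) (hZ : IsLocallyClosed Z) : QPVar where
  σ := X.σ
  carrier := Subtype.val '' Z
  isLocallyClosed := by
    refine hZ.image IsInducing.subtypeVal ?_
    simpa using X.isLocallyClosed

/-- The inclusion of a subvariety. -/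
def incl {X : QPVar} {Z : Set X} {hZ : IsLocallyClosed Z} (z : X.sub Z hZ) : X :=
  ⟨z.1, by obtain ⟨_, ⟨x, _, rfl⟩⟩ := z; exact x.2⟩

theorem incl_mem {X : QPVar} {Z : Set X} {hZ : IsLocallyClosed Z} (z : X.sub Z hZ) :
    incl z ∈ Z := by
  obtain ⟨_, ⟨x, hx, rfl⟩⟩ := z; exact hx

/-- The point of a subvariety defined by a point of the variety. -/
def toSub {X : QPVar} {Z : Set X} {hZ : IsLocallyClosed Z} (x : X) (hx : x ∈ Z) : X.sub Z hZ :=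
  ⟨x.1, ⟨x, hx, rfl⟩⟩

@[simp] theorem incl_toSub {X : QPVar} {Z : Set X} {hZ : IsLocallyClosed Z} (x : X) (hx : x ∈ Z) :
    incl (toSub (hZ := hZ) x hx) = x := rfl

theorem incl_injective {X : QPVar} {Z : Set X} {hZ : IsLocallyClosed Z} :
    Function.Injective (incl : X.sub Z hZ → X) := fun a b h => by
  apply Subtype.ext
  exact congrArg (fun t : X => t.1) h

/-! ### Elementary facts on regular maps -/

theorem isRegular_id (X : QPVar) : IsRegular (fun x : X => x) := by
  intro x
  refine ⟨1, fun i => MvPolynomial.X i, fun i => isHomogeneous_X _ i, ?_, ?_⟩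
  · simpa using coords_ne_zero x
  · intro y hy
    simp only [eval_X]
    exact (y.1.point_coords).symm

theorem isRegular_const {X Y : QPVar} (y : Y) : IsRegular (fun _ : X => y) := by
  intro x
  refine ⟨0, fun i => C (coords y i), fun i => isHomogeneous_C _ _, ?_, ?_⟩
  · simpa using coords_ne_zero y
  · intro z hz
    simp only [eval_C]
    exact (y.1.point_coords).symm

theorem IsRegular.comp {X Y Z : QPVar} {ψ : Y → Z} {φ : X → Y} (hψ : IsRegular ψ)
    (hφ : IsRegular φ) : IsRegular (fun x => ψ (φ x)) := by
  intro x
  obtain ⟨d, F, hF, hFx, hFy⟩ := hφ x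
  obtain ⟨e, G, hG, hGx, hGy⟩ := hψ (φ x)
  obtain ⟨i₀, hi₀⟩ := Function.ne_iff.1 hFx
  have key : ∀ (y : X), (fun i => eval (coords y) (F i)) ≠ 0 → ∃ a : ℂ, a ≠ 0 ∧
      ∀ j, eval (coords (φ y)) (G j) = a * eval (coords y) (bind₁ F (G j)) := by
    intro y hy
    have h1 := hFy y hy
    obtain ⟨a, ha, h2⟩ := ProjSpace.coords_point _ hy
    refine ⟨a ^ e, pow_ne_zero _ ha, fun j => ?_⟩
    have h3 : coords (φ y) = a • fun i => eval (coords y) (F i) := by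
      rw [← h2, ← h1]; rfl
    rw [h3, ProjSpace.eval_smul (hG j)]
    congr 1
    exact (eval₂Hom_bind₁ (RingHom.id ℂ) _ _ _).symm
  refine ⟨d + d * e, fun j => F i₀ * bind₁ F (G j),
    fun j => (hF i₀).mul ((hG j).aeval F hF), ?_, ?_⟩
  · obtain ⟨a, ha, h⟩ := key x hFx
    obtain ⟨j, hj⟩ := Function.ne_iff.1 hGx
    refine Function.ne_iff.2 ⟨j, ?_⟩
    rw [h j] at hj
    simpa using ⟨hi₀, right_ne_zero_of_mul hj⟩
  · intro y hy
    obtain ⟨j, hj⟩ := Function.ne_iff.1 hy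
    have hj' : eval (coords y) (F i₀) ≠ 0 ∧ eval (coords y) (bind₁ F (G j)) ≠ 0 := by
      simpa using hj
    have hFy0 : (fun i => eval (coords y) (F i)) ≠ 0 := Function.ne_iff.2 ⟨i₀, hj'.1⟩
    obtain ⟨a, ha, h⟩ := key y hFy0
    have hG0 : (fun i => eval (coords (φ y)) (G i)) ≠ 0 :=
      Function.ne_iff.2 ⟨j, by simpa [h j] using ⟨ha, hj'.2⟩⟩
    rw [hGy (φ y) hG0, ProjSpace.point_eq_iff]
    refine ⟨a / eval (coords y) (F i₀), funext fun k => ?_⟩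
    have h0 := hj'.1
    simp only [Pi.smul_apply, smul_eq_mul, map_mul, h k]
    field_simp

theorem isRegular_incl {X : QPVar} {Z : Set X} {hZ : IsLocallyClosed Z} :
    IsRegular (incl : X.sub Z hZ → X) := isRegular_id (X.sub Z hZ)

/-- A map to a subvariety is regular if it is regular as a map to the variety. -/
theorem IsRegular.of_incl {T X : QPVar} {Z : Set X} {hZ : IsLocallyClosed Z}
    {φ : T → X.sub Z hZ} (h : IsRegular (fun t => incl (φ t))) : IsRegular φ := h

theorem isRegular_congr {X Y : QPVar} {φ ψ : X → Y} (h : ∀ x, φ x = ψ x) :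
    IsRegular φ ↔ IsRegular ψ := by rw [funext h]

/-- The locus where two regular maps coincide is closed. -/
theorem isClosed_eq {X Y : QPVar} {φ ψ : X → Y} (hφ : IsRegular φ) (hψ : IsRegular ψ) :
    IsClosed {x : X | φ x = ψ x} := by
  rw [← isOpen_compl_iff, isOpen_iff_mem_nhds]
  intro x hx
  obtain ⟨d, F, hF, hFx, hFy⟩ := hφ x
  obtain ⟨e, G, hG, hGx, hGy⟩ := hψ x
  have hne : ∃ i j, eval (coords x) (F i) * eval (coords x) (G j) -
      eval (coords x) (F j) * eval (coords x) (G i) ≠ 0 := by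
    by_contra! hall
    apply hx
    apply Subtype.ext
    rw [hFy x hFx, hGy x hGx, ProjSpace.point_eq_iff]
    obtain ⟨j, hj⟩ := Function.ne_iff.1 hGx
    have hj' : eval (coords x) (G j) ≠ 0 := hj
    refine ⟨eval (coords x) (F j) / eval (coords x) (G j), funext fun i => ?_⟩
    have := hall i j
    simp only [Pi.smul_apply, smul_eq_mul]
    field_simp
    linear_combination -this
  obtain ⟨i, j, hij⟩ := hne
  have hom : (F i * G j - F j * G i).IsHomogeneous (d + e) :=
    ((hF i).mul (hG j)).sub ((hF j).mul (hG i))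
  have hopen : IsOpen {y : X | eval (coords y) (F i * G j - F j * G i) ≠ 0} :=
    (ProjSpace.isOpen_basic hom).preimage continuous_subtype_val
  refine Filter.mem_of_superset (hopen.mem_nhds (by simpa using hij)) ?_
  intro y hy heq
  have hy' : eval (coords y) (F i) * eval (coords y) (G j) -
      eval (coords y) (F j) * eval (coords y) (G i) ≠ 0 := by simpa using hy
  have hF0 : (fun i => eval (coords y) (F i)) ≠ 0 := by
    intro h
    have h1 := congrFun h i
    have h2 := congrFun h j
    simp only [Pi.zero_apply] at h1 h2
    simp [h1, h2] at hy'
  have hG0 : (fun i => eval (coords y) (G i)) ≠ 0 := by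
    intro h
    have h1 := congrFun h i
    have h2 := congrFun h j
    simp only [Pi.zero_apply] at h1 h2
    simp [h1, h2] at hy'
  have h3 : (φ y).1 = (ψ y).1 := congrArg Subtype.val heq
  rw [hFy y hF0, hGy y hG0, ProjSpace.point_eq_iff] at h3
  obtain ⟨a, ha⟩ := h3
  have h1 := congrFun ha i
  have h2 := congrFun ha j
  simp only [Pi.smul_apply, smul_eq_mul] at h1 h2
  apply hy'
  rw [← h1, ← h2]
  ring

/-! ### Products

The product of finitely many varieties is embedded by the Segre map. -/

section Segre

variable {ι : Type} {σ : ι → Type}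

theorem exists_coords_ne_zero (x : ∀ i, ProjSpace (σ i)) :
    ∃ c : ∀ i, σ i, ∀ i, (x i).coords (c i) ≠ 0 := by
  choose c hc using fun i => Function.ne_iff.1 (x i).coords_ne_zero
  exact ⟨c, hc⟩

variable [Fintype ι]

/-- The monomial coordinates of the Segre map. -/
def segreVec (x : ∀ i, ProjSpace (σ i)) : (∀ i, σ i) → ℂ := fun c => ∏ i, (x i).coords (c i)

theorem segreVec_ne_zero (x : ∀ i, ProjSpace (σ i)) : segreVec x ≠ 0 := by
  obtain ⟨c, hc⟩ := exists_coords_ne_zero x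
  exact Function.ne_iff.2 ⟨c, Finset.prod_ne_zero_iff.2 fun i _ => hc i⟩

/-- The Segre map. -/
def segre (x : ∀ i, ProjSpace (σ i)) : ProjSpace (∀ i, σ i) :=
  ProjSpace.point (segreVec x) (segreVec_ne_zero x)

theorem segreVec_update [DecidableEq ι] (x : ∀ i, ProjSpace (σ i)) (c : ∀ i, σ i) (i : ι) (a : σ i) :
    segreVec x (Function.update c i a) =
      (∏ j ∈ Finset.univ.erase i, (x j).coords (c j)) * (x i).coords a := by
  rw [segreVec, ← Finset.prod_erase_mul _ _ (Finset.mem_univ i)]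
  congr 1
  · refine Finset.prod_congr rfl fun j hj => ?_
    rw [Function.update_of_ne (Finset.ne_of_mem_erase hj)]
  · rw [Function.update_self]

theorem segre_injective : Function.Injective (segre (σ := σ)) := by
  classical
  intro x y h
  obtain ⟨a, ha⟩ := (ProjSpace.point_eq_iff _ _ _ _).1 h
  funext i
  obtain ⟨c, hc⟩ := exists_coords_ne_zero x
  rw [← (x i).point_coords, ← (y i).point_coords, ProjSpace.point_eq_iff]
  have hP : (∏ j ∈ Finset.univ.erase i, (x j).coords (c j)) ≠ 0 :=
    Finset.prod_ne_zero_iff.2 fun j _ => hc j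
  refine ⟨a * (∏ j ∈ Finset.univ.erase i, (y j).coords (c j)) /
    (∏ j ∈ Finset.univ.erase i, (x j).coords (c j)), funext fun b => ?_⟩
  have := congrFun ha (Function.update c i b)
  simp only [Pi.smul_apply, smul_eq_mul, segreVec_update] at this ⊢
  field_simp
  linear_combination this

/-- The points in the image of the Segre map are those of "rank one". -/
theorem mem_range_segre_iff (z : ProjSpace (∀ i, σ i)) [DecidableEq ι] :
    z ∈ Set.range (segre (σ := σ)) ↔ ∀ (c d : ∀ i, σ i) (i : ι),
      z.coords c * z.coords d =
        z.coords (Function.update c i (d i)) * z.coords (Function.update d i (c i)) := by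
  constructor
  · rintro ⟨x, rfl⟩ c d i
    obtain ⟨a, -, ha⟩ := ProjSpace.coords_point _ (segreVec_ne_zero x)
    rw [segre, ha]
    have e1 := segreVec_update x c i (c i)
    have e2 := segreVec_update x d i (d i)
    have e3 := segreVec_update x c i (d i)
    have e4 := segreVec_update x d i (c i)
    rw [Function.update_eq_self] at e1 e2
    simp only [Pi.smul_apply, smul_eq_mul]
    rw [e1, e2, e3, e4]
    ring
  · intro hz
    obtain ⟨c, hc⟩ := Function.ne_iff.1 z.coords_ne_zero
    have hc' : z.coords c ≠ 0 := hc
    have hx : ∀ i, (fun a : σ i => z.coords (Function.update c i a)) ≠ 0 := fun i =>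
      Function.ne_iff.2 ⟨c i, by simpa using hc'⟩
    let x : ∀ i, ProjSpace (σ i) := fun i => ProjSpace.point _ (hx i)
    refine ⟨x, ?_⟩
    choose b hb hxb using fun i => ProjSpace.coords_point _ (hx i)
    have key : ∀ (d : ∀ i, σ i) (s : Finset ι),
        z.coords (fun i => if i ∈ s then d i else c i) * z.coords c ^ s.card =
          z.coords c * ∏ i ∈ s, z.coords (Function.update c i (d i)) := by
      intro d s
      induction s using Finset.induction_on with
      | empty => simp
      | insert i s his ih =>
        rw [Finset.card_insert_of_notMem his, Finset.prod_insert his, pow_succ]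
        have h := hz (fun j => if j ∈ s then d j else c j) (Function.update c i (d i)) i
        have u1 : Function.update (fun j => if j ∈ s then d j else c j) i
            (Function.update c i (d i) i) = fun j => if j ∈ insert i s then d j else c j := by
          funext j
          by_cases hj : j = i
          · subst hj; simp
          · simp [hj]
        have u2 : Function.update (Function.update c i (d i)) i
            ((fun j => if j ∈ s then d j else c j) i) = c := by
          simp [his]
        rw [u1, u2] at h
        linear_combination (-(z.coords c ^ s.card)) * h +
          (z.coords (Function.update c i (d i))) * ih
    rw [← z.point_coords, segre, ProjSpace.point_eq_iff]
    refine ⟨(∏ i, b i) * z.coords c ^ Fintype.card ι / z.coords c, funext fun d => ?_⟩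
    have h := key d Finset.univ
    simp only [Finset.mem_univ, if_true, Finset.card_univ] at h
    have hs : segreVec x d = (∏ i, b i) * ∏ i, z.coords (Function.update c i (d i)) := by
      rw [segreVec, ← Finset.prod_mul_distrib]
      refine Finset.prod_congr rfl fun i _ => ?_
      have := congrFun (hxb i) (d i)
      simpa using this
    rw [hs, Pi.smul_apply, smul_eq_mul]
    field_simp
    linear_combination (∏ i, b i) * h

theorem isClosed_range_segre : IsClosed (Set.range (segre (σ := σ))) := by
  classical
  have : Set.range (segre (σ := σ)) = ⋂ (c : ∀ i, σ i) (d : ∀ i, σ i) (i : ι),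
      {z : ProjSpace (∀ i, σ i) | eval z.coords (MvPolynomial.X c * MvPolynomial.X d -
        MvPolynomial.X (Function.update c i (d i)) * MvPolynomial.X (Function.update d i (c i)) :
          MvPolynomial (∀ i, σ i) ℂ) ≠ 0}ᶜ := by
    ext z
    simp only [mem_range_segre_iff, Set.mem_iInter, Set.mem_compl_iff, Set.mem_ofPred_eq, not_not,
      map_sub, map_mul, eval_X, sub_eq_zero]
  rw [this]
  exact isClosed_iInter fun c => isClosed_iInter fun d => isClosed_iInter fun i =>
    (ProjSpace.isOpen_basic (((isHomogeneous_X ℂ c).mul (isHomogeneous_X ℂ d)).sub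
      ((isHomogeneous_X ℂ _).mul (isHomogeneous_X ℂ _)))).isClosed_compl

/-- The coordinates of the factors can be read off, up to a common multiple, from those of the
image under the Segre map. -/
theorem segre_coords_update [DecidableEq ι] (x : ∀ i, ProjSpace (σ i)) (c : ∀ i, σ i) (i : ι) :
    ∃ b : ℂ, (fun a => (segre x).coords (Function.update c i a)) = b • (x i).coords ∧
      ((segre x).coords c ≠ 0 → b ≠ 0) := by
  obtain ⟨a, ha0, ha⟩ := ProjSpace.coords_point _ (segreVec_ne_zero x)
  refine ⟨a * ∏ j ∈ Finset.univ.erase i, (x j).coords (c j), ?_, ?_⟩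
  · funext t
    rw [segre, ha, Pi.smul_apply, segreVec_update]
    simp only [smul_eq_mul, Pi.smul_apply]
    ring
  · intro h
    rw [segre, ha, Pi.smul_apply, smul_eq_mul, segreVec,
      ← Finset.prod_erase_mul _ _ (Finset.mem_univ i), ← mul_assoc] at h
    exact left_ne_zero_of_mul h

theorem continuous_segre_symm (i : ι) : Continuous (fun z : Set.range (segre (σ := σ)) =>
    (Equiv.ofInjective _ segre_injective).symm z i) := by
  classical
  refine continuous_generateFrom_iff.2 ?_
  rintro _ ⟨d, F, hF, rfl⟩
  have : (fun z : Set.range (segre (σ := σ)) =>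
      (Equiv.ofInjective _ segre_injective).symm z i) ⁻¹' {p | eval p.coords F ≠ 0} =
      ⋃ c : ∀ i, σ i, Subtype.val ⁻¹' ({z : ProjSpace (∀ i, σ i) |
        eval z.coords (rename (Function.update c i) F) ≠ 0} ∩
        {z | eval z.coords (MvPolynomial.X c : MvPolynomial (∀ i, σ i) ℂ) ≠ 0}) := by
    ext z
    obtain ⟨x, rfl⟩ := (Equiv.ofInjective _ segre_injective).surjective z
    have hval : ((Equiv.ofInjective _ segre_injective) x).1 = segre x := rfl
    simp only [Set.mem_preimage, Equiv.symm_apply_apply, Set.mem_ofPred_eq, Set.mem_iUnion,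
      Set.mem_inter_iff, eval_X, eval_rename, hval]
    constructor
    · intro h
      obtain ⟨c, hc⟩ := Function.ne_iff.1 (segre x).coords_ne_zero
      obtain ⟨b, hb, hb0⟩ := segre_coords_update x c i
      refine ⟨c, ?_, hc⟩
      have hb' : (segre x).coords ∘ Function.update c i = b • (x i).coords := hb
      rw [hb', ProjSpace.eval_smul hF]
      exact mul_ne_zero (pow_ne_zero _ (hb0 hc)) h
    · rintro ⟨c, h, -⟩
      obtain ⟨b, hb, -⟩ := segre_coords_update x c i
      have hb' : (segre x).coords ∘ Function.update c i = b • (x i).coords := hb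
      rw [hb', ProjSpace.eval_smul hF] at h
      exact right_ne_zero_of_mul h
  rw [this]
  exact isOpen_iUnion fun c => ((ProjSpace.isOpen_basic hF.rename_isHomogeneous).inter
    (ProjSpace.isOpen_basic (isHomogeneous_X ℂ c))).preimage continuous_subtype_val

theorem isLocallyClosed_segre (S : ∀ i, Set (ProjSpace (σ i))) (hS : ∀ i, IsLocallyClosed (S i)) :
    IsLocallyClosed (segre '' {x : ∀ i, ProjSpace (σ i) | ∀ i, x i ∈ S i}) := by
  have h1 : IsLocallyClosed (⋂ i, (fun z : Set.range (segre (σ := σ)) =>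
      (Equiv.ofInjective _ segre_injective).symm z i) ⁻¹' S i) := by
    choose U Z hU hZ hUZ using hS
    refine ⟨⋂ i, (fun z : Set.range (segre (σ := σ)) =>
      (Equiv.ofInjective _ segre_injective).symm z i) ⁻¹' U i, ⋂ i, (fun z : Set.range
      (segre (σ := σ)) => (Equiv.ofInjective _ segre_injective).symm z i) ⁻¹' Z i,
      isOpen_iInter_of_finite fun i => (hU i).preimage (continuous_segre_symm i),
      isClosed_iInter fun i => (hZ i).preimage (continuous_segre_symm i), ?_⟩
    simp_rw [hUZ, Set.preimage_inter, Set.iInter_inter_distrib]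
  have h2 := h1.image IsInducing.subtypeVal (by
    rw [Subtype.range_coe]; exact isClosed_range_segre.isLocallyClosed)
  convert h2 using 1
  ext z
  constructor
  · rintro ⟨x, hx, rfl⟩
    refine ⟨Equiv.ofInjective _ segre_injective x, ?_, rfl⟩
    simpa using hx
  · rintro ⟨w, hw, rfl⟩
    obtain ⟨x, rfl⟩ := (Equiv.ofInjective _ segre_injective).surjective w
    exact ⟨x, by simpa using hw, rfl⟩

end Segre

section Pi

variable {ι : Type} [Fintype ι]

/-- The Cartesian product of a finite family of varieties. -/
abbrev pi (X : ι → QPVar) : QPVar where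
  σ := ∀ i, (X i).σ
  carrier := segre '' {x | ∀ i, x i ∈ (X i).carrier}
  isLocallyClosed := isLocallyClosed_segre _ fun i => (X i).isLocallyClosed

/-- The points of the product are the families of points. -/
def piEquiv (X : ι → QPVar) : pi X ≃ ∀ i, X i :=
  (Equiv.ofBijective (fun x : ∀ i, X i => (⟨segre fun i => (x i).1, ⟨_, fun i => (x i).2, rfl⟩⟩ :
    pi X)) ⟨fun x y h => by
      have h1 := segre_injective (congrArg Subtype.val h)
      funext i
      exact Subtype.ext (congrFun h1 i), by
      rintro ⟨_, ⟨x, hx, rfl⟩⟩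
      exact ⟨fun i => ⟨x i, hx i⟩, rfl⟩⟩).symm

theorem piEquiv_symm_val (X : ι → QPVar) (x : ∀ i, X i) :
    ((piEquiv X).symm x).1 = segre fun i => (x i).1 := rfl

theorem isRegular_piEquiv_apply (X : ι → QPVar) (i : ι) :
    IsRegular (fun z : pi X => piEquiv X z i) := by
  classical
  intro z
  obtain ⟨c, hc⟩ := Function.ne_iff.1 (coords_ne_zero z)
  refine ⟨1, fun a => MvPolynomial.X (σ := (pi X).σ) (Function.update c i a),
    fun a => isHomogeneous_X _ _, Function.ne_iff.2 ⟨c i, by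
      show eval (coords z) (MvPolynomial.X (Function.update c i (c i))) ≠ 0
      rw [eval_X, Function.update_eq_self]; exact hc⟩, ?_⟩
  intro y hy
  obtain ⟨x, rfl⟩ := (piEquiv X).symm.surjective y
  obtain ⟨b, hb, -⟩ := segre_coords_update (fun i => (x i).1) c i
  have hb' : (fun a => coords ((piEquiv X).symm x) (Function.update c i a)) =
    b • (x i).1.coords := hb
  simp only [Equiv.apply_symm_apply]
  rw [← (x i).1.point_coords, ProjSpace.point_eq_iff]
  have hy' : (fun a => coords ((piEquiv X).symm x) (Function.update c i a)) ≠ 0 := by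
    simp only [eval_X] at hy
    exact hy
  have hb0 : b ≠ 0 := by
    rintro rfl
    rw [hb'] at hy'
    simp at hy'
  refine ⟨b⁻¹, ?_⟩
  simp only [eval_X]
  rw [hb', smul_smul, inv_mul_cancel₀ hb0, one_smul]

/-- A map to a product is regular if its components are. -/
theorem isRegular_pi {T : QPVar} {X : ι → QPVar} {φ : T → pi X}
    (h : ∀ i, IsRegular (fun t => piEquiv X (φ t) i)) : IsRegular φ := by
  intro t
  choose d F hF hFt hFy using fun i => h i t
  refine ⟨∑ i, d i, fun c => ∏ i, F i (c i),
    fun c => IsHomogeneous.prod _ _ _ fun i _ => hF i (c i), ?_, ?_⟩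
  · choose c hc using fun i => Function.ne_iff.1 (hFt i)
    refine Function.ne_iff.2 ⟨c, ?_⟩
    show eval (coords t) (∏ i, F i (c i)) ≠ 0
    rw [map_prod]
    exact Finset.prod_ne_zero_iff.2 fun i _ => hc i
  · intro y hy
    obtain ⟨c, hc⟩ := Function.ne_iff.1 hy
    have hF0 : ∀ i, (fun j => eval (coords y) (F i j)) ≠ 0 := by
      intro i
      refine Function.ne_iff.2 ⟨c i, ?_⟩
      have hc' : eval (coords y) (∏ i, F i (c i)) ≠ 0 := hc
      rw [map_prod] at hc'
      exact Finset.prod_ne_zero_iff.1 hc' i (Finset.mem_univ i)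
    obtain ⟨x, hx⟩ := (piEquiv X).symm.surjective (φ y)
    have hxi : ∀ i, (x i).1 = ProjSpace.point _ (hF0 i) := fun i => by
      have := hFy i y (hF0 i)
      beta_reduce at this
      rwa [← hx, Equiv.apply_symm_apply] at this
    choose a ha0 ha using fun i => ProjSpace.coords_point _ (hF0 i)
    rw [← hx, piEquiv_symm_val, segre, ProjSpace.point_eq_iff]
    refine ⟨∏ i, a i, funext fun c => ?_⟩
    rw [segreVec, Pi.smul_apply, smul_eq_mul, map_prod, ← Finset.prod_mul_distrib]
    refine Finset.prod_congr rfl fun i _ => ?_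
    have h1 := hxi i
    rw [h1, ha i]
    rfl

end Pi

section Prod

/-- The Cartesian product of two varieties. -/
def prod (X Y : QPVar) : QPVar := pi (fun b : Bool => bif b then Y else X)

/-- The points of the product are the pairs of points. -/
def prodEquiv (X Y : QPVar) : X.prod Y ≃ X × Y where
  toFun z := (piEquiv (fun b : Bool => bif b then Y else X) z false,
    piEquiv (fun b : Bool => bif b then Y else X) z true)
  invFun p := (piEquiv (fun b : Bool => bif b then Y else X)).symm
    (fun b => match b with
      | false => p.1
      | true => p.2)
  left_inv z := by
    apply (piEquiv (fun b : Bool => bif b then Y else X)).injective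
    rw [Equiv.apply_symm_apply]
    funext b
    cases b <;> rfl
  right_inv p := by simp

theorem isRegular_fst (X Y : QPVar) : IsRegular (fun z : X.prod Y => (prodEquiv X Y z).1) :=
  isRegular_piEquiv_apply (fun b : Bool => bif b then Y else X) false

theorem isRegular_snd (X Y : QPVar) : IsRegular (fun z : X.prod Y => (prodEquiv X Y z).2) :=
  isRegular_piEquiv_apply (fun b : Bool => bif b then Y else X) true

/-- A map to a product is regular if both components are. -/
theorem isRegular_prod {T X Y : QPVar} {φ : T → X.prod Y}
    (h₁ : IsRegular (fun t => (prodEquiv X Y (φ t)).1))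
    (h₂ : IsRegular (fun t => (prodEquiv X Y (φ t)).2)) : IsRegular φ := by
  refine isRegular_pi (X := fun b : Bool => bif b then Y else X) fun b => ?_
  cases b
  · exact h₁
  · exact h₂

end Prod

theorem IsRegular.continuous {X Y : QPVar} {φ : X → Y} (hφ : IsRegular φ) : Continuous φ := by
  rw [continuous_induced_rng]
  refine continuous_generateFrom_iff.2 ?_
  rintro _ ⟨e, G, hG, rfl⟩
  rw [isOpen_iff_mem_nhds]
  intro x hx
  have hx' : eval (coords (φ x)) G ≠ 0 := hx
  obtain ⟨d, F, hF, hFx, hFy⟩ := hφ x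
  obtain ⟨i₀, hi₀⟩ := Function.ne_iff.1 hFx
  have key : ∀ (y : X), (fun i => eval (coords y) (F i)) ≠ 0 → ∃ a : ℂ, a ≠ 0 ∧
      eval (coords (φ y)) G = a * eval (coords y) (bind₁ F G) := by
    intro y hy
    have h1 := hFy y hy
    obtain ⟨a, ha, h2⟩ := ProjSpace.coords_point _ hy
    refine ⟨a ^ e, pow_ne_zero _ ha, ?_⟩
    have h3 : coords (φ y) = a • fun i => eval (coords y) (F i) := by
      rw [← h2, ← h1]; rfl
    rw [h3, ProjSpace.eval_smul hG]
    congr 1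
    exact (eval₂Hom_bind₁ (RingHom.id ℂ) _ _ _).symm
  have hopen : IsOpen {y : X | eval (coords y) (F i₀ * bind₁ F G) ≠ 0} :=
    (ProjSpace.isOpen_basic ((hF i₀).mul (hG.aeval F hF))).preimage continuous_subtype_val
  refine Filter.mem_of_superset (hopen.mem_nhds ?_) ?_
  · obtain ⟨a, ha, h⟩ := key x hFx
    rw [h] at hx'
    show eval (coords x) (F i₀ * bind₁ F G) ≠ 0
    rw [map_mul]
    exact mul_ne_zero hi₀ (right_ne_zero_of_mul hx')
  · intro y hy
    have hy' : eval (coords y) (F i₀ * bind₁ F G) ≠ 0 := hy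
    rw [map_mul] at hy'
    obtain ⟨a, ha, h⟩ := key y (Function.ne_iff.2 ⟨i₀, left_ne_zero_of_mul hy'⟩)
    show eval (coords (φ y)) G ≠ 0
    rw [h]
    exact mul_ne_zero ha (right_ne_zero_of_mul hy')

/-- The one-point variety. -/
def pt : QPVar where
  σ := Unit
  carrier := Set.univ
  isLocallyClosed := isOpen_univ.isLocallyClosed

instance : Unique pt where
  default := ⟨ProjSpace.point (fun _ => 1) (Function.ne_iff.2 ⟨(), one_ne_zero⟩), trivial⟩
  uniq x := by
    apply Subtype.ext
    rw [← x.1.point_coords, ProjSpace.point_eq_iff]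
    exact ⟨x.1.coords (), funext fun (_ : Unit) => mul_one _⟩

/-! ### The ring `K₀(Var_ℂ)` -/

theorem Iso.refl (X : QPVar) : Iso X X := ⟨Equiv.refl X, isRegular_id X, isRegular_id X⟩

theorem Iso.symm {X Y : QPVar} : Iso X Y → Iso Y X := fun ⟨e, h₁, h₂⟩ => ⟨e.symm, h₂, h₁⟩

theorem Iso.trans {X Y Z : QPVar} : Iso X Y → Iso Y Z → Iso X Z :=
  fun ⟨e, h₁, h₂⟩ ⟨f, h₃, h₄⟩ => ⟨e.trans f, h₃.comp h₁, h₂.comp h₄⟩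

theorem isRegular_prodMap {X Y X' Y' : QPVar} {φ : X → X'} {ψ : Y → Y'} (hφ : IsRegular φ)
    (hψ : IsRegular ψ) : IsRegular (fun z : X.prod Y =>
      (prodEquiv X' Y').symm (φ (prodEquiv X Y z).1, ψ (prodEquiv X Y z).2)) := by
  refine isRegular_prod ?_ ?_
  · simpa using hφ.comp (isRegular_fst X Y)
  · simpa using hψ.comp (isRegular_snd X Y)

/-- The product of two bijections. -/
def prodCongr {X Y X' Y' : QPVar} (e : X ≃ X') (f : Y ≃ Y') : X.prod Y ≃ X'.prod Y' :=
  (prodEquiv X Y).trans ((Equiv.prodCongr e f).trans (prodEquiv X' Y').symm)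

/-- The exchange of the factors. -/
def prodComm (X Y : QPVar) : X.prod Y ≃ Y.prod X :=
  (prodEquiv X Y).trans ((Equiv.prodComm X Y).trans (prodEquiv Y X).symm)

theorem isRegular_prodComm (X Y : QPVar) : IsRegular (prodComm X Y) :=
  isRegular_prod (by simpa [prodComm] using isRegular_snd X Y)
    (by simpa [prodComm] using isRegular_fst X Y)

/-- Associativity of the product. -/
def prodAssoc (X Y Z : QPVar) : (X.prod Y).prod Z ≃ X.prod (Y.prod Z) :=
  (prodEquiv _ _).trans (((Equiv.prodCongr (prodEquiv X Y) (Equiv.refl Z)).trans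
    (Equiv.prodAssoc X Y Z)).trans ((Equiv.prodCongr (Equiv.refl X) (prodEquiv Y Z).symm).trans
      (prodEquiv _ _).symm))

theorem isRegular_prodAssoc (X Y Z : QPVar) : IsRegular (prodAssoc X Y Z) := by
  refine isRegular_prod ?_ (isRegular_prod ?_ ?_)
  · simpa [prodAssoc] using (isRegular_fst X Y).comp (isRegular_fst (X.prod Y) Z)
  · simpa [prodAssoc] using (isRegular_snd X Y).comp (isRegular_fst (X.prod Y) Z)
  · simpa [prodAssoc] using isRegular_snd (X.prod Y) Z

theorem isRegular_prodAssoc_symm (X Y Z : QPVar) : IsRegular (prodAssoc X Y Z).symm := by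
  refine isRegular_prod (isRegular_prod ?_ ?_) ?_
  · simpa [prodAssoc] using isRegular_fst X (Y.prod Z)
  · simpa [prodAssoc] using (isRegular_fst Y Z).comp (isRegular_snd X (Y.prod Z))
  · simpa [prodAssoc] using (isRegular_snd Y Z).comp (isRegular_snd X (Y.prod Z))

/-- The one-point variety is a unit for the product. -/
def ptProd (X : QPVar) : pt.prod X ≃ X := (prodEquiv pt X).trans (Equiv.uniqueProd X pt)

theorem isRegular_ptProd (X : QPVar) : IsRegular (ptProd X) := isRegular_snd pt X

theorem isRegular_ptProd_symm (X : QPVar) : IsRegular (ptProd X).symm := by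
  refine isRegular_prod ?_ ?_
  · simpa [ptProd] using isRegular_const (X := X) (default : pt)
  · simpa [ptProd] using isRegular_id X

theorem fst_prodComm (X Y : QPVar) (z : X.prod Y) :
    (prodEquiv Y X (prodComm X Y z)).1 = (prodEquiv X Y z).2 := by simp [prodComm]

theorem snd_prodComm (X Y : QPVar) (z : X.prod Y) :
    (prodEquiv Y X (prodComm X Y z)).2 = (prodEquiv X Y z).1 := by simp [prodComm]

theorem fst_prodAssoc (X Y Z : QPVar) (z : (X.prod Y).prod Z) :
    (prodEquiv X (Y.prod Z) (prodAssoc X Y Z z)).1 =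
      (prodEquiv X Y (prodEquiv (X.prod Y) Z z).1).1 := by simp [prodAssoc]

theorem fst_snd_prodAssoc (X Y Z : QPVar) (z : (X.prod Y).prod Z) :
    (prodEquiv Y Z (prodEquiv X (Y.prod Z) (prodAssoc X Y Z z)).2).1 =
      (prodEquiv X Y (prodEquiv (X.prod Y) Z z).1).2 := by simp [prodAssoc]

theorem snd_snd_prodAssoc (X Y Z : QPVar) (z : (X.prod Y).prod Z) :
    (prodEquiv Y Z (prodEquiv X (Y.prod Z) (prodAssoc X Y Z z)).2).2 =
      (prodEquiv (X.prod Y) Z z).2 := by simp [prodAssoc]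

theorem fst_prodCongr {X Y X' Y' : QPVar} (e : X ≃ X') (f : Y ≃ Y') (z : X.prod Y) :
    (prodEquiv X' Y' (prodCongr e f z)).1 = e (prodEquiv X Y z).1 := by simp [prodCongr]

theorem snd_prodCongr {X Y X' Y' : QPVar} (e : X ≃ X') (f : Y ≃ Y') (z : X.prod Y) :
    (prodEquiv X' Y' (prodCongr e f z)).2 = f (prodEquiv X Y z).2 := by simp [prodCongr]

/-- Varieties up to isomorphism. -/
instance isoSetoid : Setoid QPVar := ⟨Iso, Iso.refl, Iso.symm, Iso.trans⟩

end QPVar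

/-- Isomorphism classes of varieties; they form a monoid under the Cartesian product. -/
def QPClass : Type 1 := Quotient QPVar.isoSetoid

namespace QPVar

instance : CommMonoid QPClass where
  mul := Quotient.map₂ prod (by
    rintro X X' ⟨e, he, he'⟩ Y Y' ⟨f, hf, hf'⟩
    exact ⟨prodCongr e f, isRegular_prodMap he hf, isRegular_prodMap he' hf'⟩)
  one := Quotient.mk _ pt
  mul_assoc := by
    rintro ⟨X⟩ ⟨Y⟩ ⟨Z⟩
    exact Quotient.sound ⟨prodAssoc X Y Z, isRegular_prodAssoc X Y Z,
      isRegular_prodAssoc_symm X Y Z⟩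
  mul_comm := by
    rintro ⟨X⟩ ⟨Y⟩
    exact Quotient.sound ⟨prodComm X Y, isRegular_prodComm X Y, isRegular_prodComm Y X⟩
  one_mul := by
    rintro ⟨X⟩
    exact Quotient.sound ⟨ptProd X, isRegular_ptProd X, isRegular_ptProd_symm X⟩
  mul_one := by
    rintro ⟨X⟩
    exact Quotient.sound ⟨(prodComm X pt).trans (ptProd X),
      (isRegular_ptProd X).comp (isRegular_prodComm X pt),
      (isRegular_prodComm pt X).comp (isRegular_ptProd_symm X)⟩

/-- The class of a variety in the free abelian group on isomorphism classes. -/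
def gen (X : QPVar) : FreeAbelianGroup QPClass := FreeAbelianGroup.of (Quotient.mk _ X)

theorem gen_mul (X Y : QPVar) : gen X * gen Y = gen (X.prod Y) :=
  FreeAbelianGroup.of_mul_of _ _

theorem gen_eq {X Y : QPVar} (h : Iso X Y) : gen X = gen Y :=
  congrArg FreeAbelianGroup.of (Quotient.sound h)

/-- The scissor relations `[X] = [Y] + [X \ Y]` for closed subvarieties `Y` of `X`. -/
inductive Relation : FreeAbelianGroup QPClass → Prop
  | scissor (X : QPVar) (Y : Set X) (hY : IsClosed Y) :
      Relation (gen X - (gen (X.sub Y hY.isLocallyClosed) +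
        gen (X.sub Yᶜ hY.isOpen_compl.isLocallyClosed)))

/-- The product with a subvariety, as a subvariety of the product. -/
def prodSubEquiv (Z X : QPVar) (Y : Set X) (hY : IsLocallyClosed Y)
    (hY' : IsLocallyClosed {t : Z.prod X | (prodEquiv Z X t).2 ∈ Y}) :
    Z.prod (X.sub Y hY) ≃ (Z.prod X).sub {t | (prodEquiv Z X t).2 ∈ Y} hY' where
  toFun t := toSub ((prodEquiv Z X).symm ((prodEquiv _ _ t).1, incl (prodEquiv _ _ t).2))
    (by simpa using incl_mem _)
  invFun w := (prodEquiv _ _).symm ((prodEquiv _ _ (incl w)).1,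
    toSub (prodEquiv _ _ (incl w)).2 (incl_mem w))
  left_inv t := by
    apply (prodEquiv _ _).injective
    refine Prod.ext ?_ (incl_injective ?_) <;> simp
  right_inv w := by
    apply incl_injective
    apply (prodEquiv _ _).injective
    simp

theorem prodEquiv_incl_prodSubEquiv (Z X : QPVar) (Y : Set X) (hY : IsLocallyClosed Y)
    (hY' : IsLocallyClosed {t : Z.prod X | (prodEquiv Z X t).2 ∈ Y}) (t : Z.prod (X.sub Y hY)) :
    prodEquiv Z X (incl (prodSubEquiv Z X Y hY hY' t)) =
      ((prodEquiv _ _ t).1, incl (prodEquiv _ _ t).2) := by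
  simp [prodSubEquiv]

theorem isRegular_prodSubEquiv (Z X : QPVar) (Y : Set X) (hY : IsLocallyClosed Y)
    (hY' : IsLocallyClosed {t : Z.prod X | (prodEquiv Z X t).2 ∈ Y}) :
    IsRegular (prodSubEquiv Z X Y hY hY') := by
  refine IsRegular.of_incl (isRegular_prod ?_ ?_)
  · simpa [prodSubEquiv] using isRegular_fst Z (X.sub Y hY)
  · simpa [prodSubEquiv] using isRegular_incl.comp (isRegular_snd Z (X.sub Y hY))

theorem isRegular_prodSubEquiv_symm (Z X : QPVar) (Y : Set X) (hY : IsLocallyClosed Y)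
    (hY' : IsLocallyClosed {t : Z.prod X | (prodEquiv Z X t).2 ∈ Y}) :
    IsRegular (prodSubEquiv Z X Y hY hY').symm := by
  refine isRegular_prod ?_ (IsRegular.of_incl ?_)
  · simpa [prodSubEquiv] using (isRegular_fst Z X).comp isRegular_incl
  · simpa [prodSubEquiv] using (isRegular_snd Z X).comp isRegular_incl

theorem iso_prod_sub (Z X : QPVar) (Y : Set X) (hY : IsLocallyClosed Y)
    (hY' : IsLocallyClosed {t : Z.prod X | (prodEquiv Z X t).2 ∈ Y}) :
    Iso (Z.prod (X.sub Y hY)) ((Z.prod X).sub {t | (prodEquiv Z X t).2 ∈ Y} hY') :=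
  ⟨prodSubEquiv Z X Y hY hY', isRegular_prodSubEquiv _ _ _ _ _,
    isRegular_prodSubEquiv_symm _ _ _ _ _⟩

theorem Relation.gen_mul (Z : QPVar) {r : FreeAbelianGroup QPClass} (hr : Relation r) :
    Relation (gen Z * r) := by
  obtain ⟨X, Y, hY⟩ := hr
  have hc : IsClosed {t : Z.prod X | (prodEquiv Z X t).2 ∈ Y} :=
    hY.preimage (isRegular_snd Z X).continuous
  rw [mul_sub, mul_add, QPVar.gen_mul, QPVar.gen_mul, QPVar.gen_mul,
    gen_eq (iso_prod_sub Z X Y _ hc.isLocallyClosed),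
    gen_eq (iso_prod_sub Z X Yᶜ _ hc.isOpen_compl.isLocallyClosed)]
  exact Relation.scissor (Z.prod X) _ hc

end QPVar

/-- If a set of relations in the free abelian group on a monoid is stable under multiplication by
the generators, then the subgroup generated by it is an ideal. -/
def relationIdeal {C : Type 1} [CommMonoid C] (R : FreeAbelianGroup C → Prop)
    (hR : ∀ (c : C) (r : FreeAbelianGroup C), R r → R (FreeAbelianGroup.of c * r)) :
    Ideal (FreeAbelianGroup C) where
  carrier := AddSubgroup.closure {r | R r}
  add_mem' := add_mem
  zero_mem' := zero_mem _
  smul_mem' a x hx := by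
    simp only [smul_eq_mul, SetLike.mem_coe] at hx ⊢
    induction a using FreeAbelianGroup.induction_on with
    | zero => rw [zero_mul]; exact zero_mem _
    | of c =>
      induction hx using AddSubgroup.closure_induction with
      | mem r hr => exact AddSubgroup.subset_closure (hR c r hr)
      | zero => rw [mul_zero]; exact zero_mem _
      | add x y _ _ hx hy => rw [mul_add]; exact add_mem hx hy
      | neg x _ hx => rw [mul_neg]; exact neg_mem hx
    | neg c hc => rw [neg_mul]; exact neg_mem hc
    | add a b ha hb => rw [add_mul]; exact add_mem ha hb

/-- The Grothendieck ring `K₀(Var_ℂ)`: the abelian group generated by the isomorphism classes of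
quasi-projective varieties modulo the scissor relations, with the Cartesian product. -/
abbrev K0Var : Type 1 :=
  FreeAbelianGroup QPClass ⧸ relationIdeal QPVar.Relation (by
    rintro ⟨Z⟩ r hr
    exact QPVar.Relation.gen_mul Z hr)

/-- The class `[X]` in `K₀(Var_ℂ)`. -/
def QPVar.cls (X : QPVar) : K0Var := Ideal.Quotient.mk _ X.gen

/-! ### Varieties with actions of finite groups -/

/-- A `G`-variety `(X, G)`: a quasi-projective variety with an action of a finite group by regular
maps. -/
structure GVar : Type 1 where
  /-- The variety. -/
  X : QPVar
  /-- The group. -/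
  G : Type
  [group : Group G]
  [finite : Finite G]
  [action : MulAction G X]
  isRegular_smul : ∀ g : G, QPVar.IsRegular (fun x : X => g • x)

attribute [instance] GVar.group GVar.finite GVar.action

namespace GVar

open QPVar

/-- Isomorphism of pairs `(X, G)`: an isomorphism of varieties which is equivariant with respect to
an isomorphism of groups. -/
def Iso (A B : GVar) : Prop :=
  ∃ (φ : A.G ≃* B.G) (ψ : A.X ≃ B.X), IsRegular ψ ∧ IsRegular ψ.symm ∧
    ∀ (g : A.G) (x : A.X), ψ (g • x) = φ g • ψ x

/-- A locally closed invariant subset, as a `G`-variety. -/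
def sub (A : GVar) (Z : Set A.X) (hZ : IsLocallyClosed Z)
    (hG : ∀ (g : A.G) (x : A.X), x ∈ Z → g • x ∈ Z) : GVar where
  X := A.X.sub Z hZ
  G := A.G
  action :=
    { smul := fun g z => toSub (g • incl z) (hG g _ (incl_mem z))
      one_smul := fun z => incl_injective (one_smul A.G (incl z))
      mul_smul := fun g h z => incl_injective (mul_smul g h (incl z)) }
  isRegular_smul g := IsRegular.of_incl ((A.isRegular_smul g).comp isRegular_incl)

/-- The variety `X` with the action of a group `H` through a homomorphism `H → G`. -/
def comap (A : GVar) {H : Type} [Group H] [Finite H] (f : H →* A.G) : GVar where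
  X := A.X
  G := H
  action := MulAction.compHom A.X f
  isRegular_smul h := A.isRegular_smul (f h)

/-- The set of fixed points of an element of the group. -/
def fixedLocus (A : GVar) (g : A.G) : Set A.X := {x | g • x = x}

theorem isClosed_fixedLocus (A : GVar) (g : A.G) : IsClosed (A.fixedLocus g) :=
  isClosed_eq (A.isRegular_smul g) (isRegular_id A.X)

theorem smul_mem_fixedLocus (A : GVar) {g : A.G} (h : Subgroup.centralizer {g}) (x : A.X)
    (hx : x ∈ A.fixedLocus g) : h.1 • x ∈ A.fixedLocus g := by
  have hx' : g • x = x := hx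
  have hh := Subgroup.mem_centralizer_singleton_iff.1 h.2
  show g • h.1 • x = h.1 • x
  rw [← mul_smul, ← hh, mul_smul, hx']

/-- The fixed point locus `X^⟨g⟩` with the action of the centralizer `C_G(g)`. -/
def fixed (A : GVar) (g : A.G) : GVar :=
  (A.comap (Subgroup.centralizer {g}).subtype).sub (A.fixedLocus g)
    (A.isClosed_fixedLocus g).isLocallyClosed
    (fun h x hx => A.smul_mem_fixedLocus h x hx)

/-- The Cartesian product `(X₁ × X₂, G₁ × G₂)`. -/
def prod (A B : GVar) : GVar where
  X := A.X.prod B.X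
  G := A.G × B.G
  action :=
    { smul := fun g z => (prodEquiv A.X B.X).symm
        (g.1 • (prodEquiv A.X B.X z).1, g.2 • (prodEquiv A.X B.X z).2)
      one_smul := fun z => by
        apply (prodEquiv A.X B.X).injective
        refine (Equiv.apply_symm_apply _ _).trans ?_
        simp
      mul_smul := fun g h z => by
        apply (prodEquiv A.X B.X).injective
        refine (Equiv.apply_symm_apply _ _).trans ((Equiv.apply_symm_apply _ _).trans ?_).symm
        refine Prod.ext ?_ ?_
        · refine (congrArg (g.1 • ·) (congrArg Prod.fst (Equiv.apply_symm_apply _ _))).trans ?_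
          exact (mul_smul _ _ _).symm
        · refine (congrArg (g.2 • ·) (congrArg Prod.snd (Equiv.apply_symm_apply _ _))).trans ?_
          exact (mul_smul _ _ _).symm }
  isRegular_smul g := isRegular_prodMap (A.isRegular_smul g.1) (B.isRegular_smul g.2)

theorem prodEquiv_smul (A B : GVar) (g : (A.prod B).G) (z : (A.prod B).X) :
    prodEquiv A.X B.X (g • z) =
      ((g.1 • (prodEquiv A.X B.X z).1, g.2 • (prodEquiv A.X B.X z).2) : A.X × B.X) :=
  Equiv.apply_symm_apply _ _

/-- The wreath product `G_n = Gⁿ ⋊ S_n`. -/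
abbrev Wreath (G : Type) [Group G] (n : ℕ) : Type :=
  (Fin n → G) ⋊[mulAutArrow] Equiv.Perm (Fin n)

instance (G : Type) [Group G] [Finite G] (n : ℕ) : Finite (Wreath G n) :=
  Finite.of_equiv _ SemidirectProduct.equivProd.symm

/-- The action of the wreath product `G_n` on `Xⁿ`: the group `Gⁿ` acts component-wise and `S_n`
permutes the components. -/
def wreathSmul (A : GVar) (n : ℕ) (w : Wreath A.G n) (z : pi (fun _ : Fin n => A.X)) :
    pi (fun _ : Fin n => A.X) :=
  (piEquiv (fun _ : Fin n => A.X)).symm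
    (fun i => w.left i • piEquiv (fun _ : Fin n => A.X) z (w.right⁻¹ i))

theorem piEquiv_wreathSmul (A : GVar) (n : ℕ) (w : Wreath A.G n)
    (z : pi (fun _ : Fin n => A.X)) (i : Fin n) :
    piEquiv (fun _ : Fin n => A.X) (A.wreathSmul n w z) i =
      w.left i • piEquiv (fun _ : Fin n => A.X) z (w.right⁻¹ i) :=
  congrFun (Equiv.apply_symm_apply _ _) i

/-- The Cartesian power `(Xⁿ, G_n)`. -/
def power (A : GVar) (n : ℕ) : GVar where
  X := pi (fun _ : Fin n => A.X)
  G := Wreath A.G n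
  action :=
    { smul := A.wreathSmul n
      one_smul := fun z => by
        apply (piEquiv (fun _ : Fin n => A.X)).injective
        funext i
        refine (piEquiv_wreathSmul A n 1 z i).trans ?_
        simp
      mul_smul := fun v w z => by
        apply (piEquiv (fun _ : Fin n => A.X)).injective
        funext i
        refine (piEquiv_wreathSmul A n (v * w) z i).trans ?_
        refine Eq.trans ?_ (piEquiv_wreathSmul A n v (A.wreathSmul n w z) i).symm
        rw [piEquiv_wreathSmul A n w z]
        simp only [SemidirectProduct.mul_left, SemidirectProduct.mul_right, Pi.mul_apply, mul_smul,
          mul_inv_rev, Equiv.Perm.mul_apply]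
        rfl }
  isRegular_smul w := by
    refine isRegular_pi (X := fun _ : Fin n => A.X) fun i => ?_
    have h : IsRegular fun z : pi (fun _ : Fin n => A.X) =>
        w.left i • piEquiv (fun _ : Fin n => A.X) z (w.right⁻¹ i) :=
      (A.isRegular_smul (w.left i)).comp
        (isRegular_piEquiv_apply (fun _ : Fin n => A.X) (w.right⁻¹ i))
    exact (isRegular_congr fun z => (piEquiv_wreathSmul A n w z i).symm).1 h

/-- The one-point variety with the action of the trivial group. -/
def pt : GVar where
  X := QPVar.pt
  G := Unit
  action :=
    { smul := fun _ x => x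
      one_smul := fun _ => rfl
      mul_smul := fun _ _ _ => rfl }
  isRegular_smul _ := isRegular_id _

/-- `(B, H)` is the induced variety `Ind_G^H X` of `(A, G) = (X, G)`, the group `G` being embedded
into `H` by `j`: there is a `G`-equivariant isomorphism `e` of `X` with an open and closed
subvariety `Z` of the variety of `B`, which is the disjoint union of the translates `h Z`,
`h ∈ H / G`.  (`e` is `x ↦ [1, x]`, and `h • e x` is the class `[h, x]` in `(H × X) / G`.) -/
def IsInduced (A B : GVar) : Prop :=
  ∃ (j : A.G →* B.G) (Z : Set B.X) (hZ : IsClopen Z)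
    (e : A.X ≃ B.X.sub Z hZ.isOpen.isLocallyClosed),
    Function.Injective j ∧ IsRegular e ∧ IsRegular e.symm ∧
    (∀ (g : A.G) (x : A.X), incl (e (g • x)) = j g • incl (e x)) ∧
    (∀ y : B.X, ∃ (h : B.G) (x : A.X), h • incl (e x) = y) ∧
    (∀ (h : B.G) (x x' : A.X), h • incl (e x) = incl (e x') → h ∈ j.range)

/-! ### The ring `K₀^fGr(Var_ℂ)` -/

theorem Iso.refl (A : GVar) : Iso A A :=
  ⟨MulEquiv.refl _, Equiv.refl _, isRegular_id _, isRegular_id _, fun _ _ => rfl⟩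

theorem Iso.symm {A B : GVar} : Iso A B → Iso B A := fun ⟨φ, ψ, h₁, h₂, h⟩ =>
  ⟨φ.symm, ψ.symm, h₂, h₁, fun g x => by
    apply ψ.injective
    rw [Equiv.apply_symm_apply, h, MulEquiv.apply_symm_apply, Equiv.apply_symm_apply]⟩

theorem Iso.trans {A B C : GVar} : Iso A B → Iso B C → Iso A C :=
  fun ⟨φ, ψ, h₁, h₂, h⟩ ⟨φ', ψ', h₁', h₂', h'⟩ =>
    ⟨φ.trans φ', ψ.trans ψ', h₁'.comp h₁, h₂.comp h₂', fun g x => by simp [h, h']⟩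

/-- `G`-varieties up to isomorphism. -/
instance isoSetoid : Setoid GVar := ⟨Iso, Iso.refl, Iso.symm, Iso.trans⟩

/-- The first component of a point of a product. -/
def pr₁ {A B : GVar} (z : (A.prod B).X) : A.X := (prodEquiv A.X B.X z).1

/-- The second component of a point of a product. -/
def pr₂ {A B : GVar} (z : (A.prod B).X) : B.X := (prodEquiv A.X B.X z).2

/-- Equality of points of a product can be checked on the components. -/
theorem prod_ext {A B : GVar} {z w : (A.prod B).X} (h₁ : pr₁ z = pr₁ w) (h₂ : pr₂ z = pr₂ w) :
    z = w :=
  (prodEquiv A.X B.X).injective (Prod.ext h₁ h₂)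

theorem fst_smul {A B : GVar} (g : (A.prod B).G) (z : (A.prod B).X) :
    pr₁ (g • z) = g.1 • pr₁ z := congrArg Prod.fst (prodEquiv_smul A B g z)

theorem snd_smul {A B : GVar} (g : (A.prod B).G) (z : (A.prod B).X) :
    pr₂ (g • z) = g.2 • pr₂ z := congrArg Prod.snd (prodEquiv_smul A B g z)

theorem iso_prodComm (A B : GVar) : Iso (A.prod B) (B.prod A) := by
  refine ⟨MulEquiv.prodComm, prodComm A.X B.X, isRegular_prodComm _ _, isRegular_prodComm _ _,
    fun g z => prod_ext ?_ ?_⟩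
  · exact (fst_prodComm _ _ _).trans ((snd_smul g z).trans
      ((congrArg (g.2 • ·) (fst_prodComm _ _ z).symm).trans
        (fst_smul (A := B) (B := A) (g.2, g.1) _).symm))
  · exact (snd_prodComm _ _ _).trans ((fst_smul g z).trans
      ((congrArg (g.1 • ·) (snd_prodComm _ _ z).symm).trans
        (snd_smul (A := B) (B := A) (g.2, g.1) _).symm))

theorem iso_prodAssoc (A B C : GVar) : Iso ((A.prod B).prod C) (A.prod (B.prod C)) := by
  refine ⟨MulEquiv.prodAssoc, prodAssoc A.X B.X C.X, isRegular_prodAssoc _ _ _,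
    isRegular_prodAssoc_symm _ _ _, fun ⟨⟨g, h⟩, k⟩ z => prod_ext ?_ (prod_ext ?_ ?_)⟩
  · refine (fst_prodAssoc _ _ _ _).trans ?_
    refine (congrArg (fun t => (prodEquiv A.X B.X t).1)
      (fst_smul (A := A.prod B) (B := C) ((g, h), k) z)).trans ?_
    refine (fst_smul (A := A) (B := B) (g, h) _).trans ?_
    refine ((congrArg (g • ·) (fst_prodAssoc _ _ _ z).symm).trans ?_)
    exact (fst_smul (A := A) (B := B.prod C) (g, (h, k)) _).symm
  · refine (fst_snd_prodAssoc _ _ _ _).trans ?_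
    refine (congrArg (fun t => (prodEquiv A.X B.X t).2)
      (fst_smul (A := A.prod B) (B := C) ((g, h), k) z)).trans ?_
    refine (snd_smul (A := A) (B := B) (g, h) _).trans ?_
    refine ((congrArg (h • ·) (fst_snd_prodAssoc _ _ _ z).symm).trans ?_)
    refine (fst_smul (A := B) (B := C) (h, k) _).symm.trans ?_
    exact (congrArg (fun t => (prodEquiv B.X C.X t).1)
      (snd_smul (A := A) (B := B.prod C) (g, (h, k)) _)).symm
  · refine (snd_snd_prodAssoc _ _ _ _).trans ?_
    refine (snd_smul (A := A.prod B) (B := C) ((g, h), k) z).trans ?_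
    refine ((congrArg (k • ·) (snd_snd_prodAssoc _ _ _ z).symm).trans ?_)
    refine (snd_smul (A := B) (B := C) (h, k) _).symm.trans ?_
    exact (congrArg (fun t => (prodEquiv B.X C.X t).2)
      (snd_smul (A := A) (B := B.prod C) (g, (h, k)) _)).symm

theorem iso_ptProd (A : GVar) : Iso (pt.prod A) A :=
  ⟨MulEquiv.uniqueProd (M := A.G) (N := Unit), ptProd A.X, isRegular_ptProd _,
    isRegular_ptProd_symm _, fun g z => snd_smul (A := pt) g z⟩

theorem iso_prodCongr {A A' B B' : GVar} (h : Iso A A') (h' : Iso B B') :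
    Iso (A.prod B) (A'.prod B') := by
  obtain ⟨φ, ψ, h₁, h₂, h₃⟩ := h
  obtain ⟨φ', ψ', h₁', h₂', h₃'⟩ := h'
  refine ⟨MulEquiv.prodCongr φ φ', prodCongr ψ ψ', isRegular_prodMap h₁ h₁',
    isRegular_prodMap h₂ h₂', fun g z => prod_ext ?_ ?_⟩
  · refine (fst_prodCongr _ _ _).trans ((congrArg ψ (fst_smul g z)).trans ?_)
    refine (h₃ _ _).trans ?_
    refine (congrArg (φ g.1 • ·) (fst_prodCongr ψ ψ' z).symm).trans ?_
    exact (fst_smul (A := A') (B := B') (φ g.1, φ' g.2) _).symm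
  · refine (snd_prodCongr _ _ _).trans ((congrArg ψ' (snd_smul g z)).trans ?_)
    refine (h₃' _ _).trans ?_
    refine (congrArg (φ' g.2 • ·) (snd_prodCongr ψ ψ' z).symm).trans ?_
    exact (snd_smul (A := A') (B := B') (φ g.1, φ' g.2) _).symm

end GVar

/-- Isomorphism classes of pairs `(X, G)`; they form a monoid under the Cartesian product. -/
def GClass : Type 1 := Quotient GVar.isoSetoid

namespace GVar

open QPVar

instance : CommMonoid GClass where
  mul := Quotient.map₂ prod (fun _ _ h _ _ h' => iso_prodCongr h h')
  one := Quotient.mk _ pt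
  mul_assoc := by
    rintro ⟨A⟩ ⟨B⟩ ⟨C⟩
    exact Quotient.sound (iso_prodAssoc A B C)
  mul_comm := by
    rintro ⟨A⟩ ⟨B⟩
    exact Quotient.sound (iso_prodComm A B)
  one_mul := by
    rintro ⟨A⟩
    exact Quotient.sound (iso_ptProd A)
  mul_one := by
    rintro ⟨A⟩
    exact Quotient.sound ((iso_prodComm A pt).trans (iso_ptProd A))

/-- The class of `(X, G)` in the free abelian group on isomorphism classes. -/
def gen (A : GVar) : FreeAbelianGroup GClass := FreeAbelianGroup.of (Quotient.mk _ A)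

theorem gen_mul (A B : GVar) : gen A * gen B = gen (A.prod B) :=
  FreeAbelianGroup.of_mul_of _ _

theorem gen_eq {A B : GVar} (h : Iso A B) : gen A = gen B :=
  congrArg FreeAbelianGroup.of (Quotient.sound h)

theorem smul_mem_compl {A : GVar} {Y : Set A.X}
    (hG : ∀ (g : A.G) (x : A.X), x ∈ Y → g • x ∈ Y) (g : A.G) (x : A.X) (hx : x ∈ Yᶜ) :
    g • x ∈ Yᶜ := fun h => hx (by simpa using hG g⁻¹ _ h)

/-- The defining relations: the scissor relations `[(X, G)] = [(Y, G)] + [(X \ Y, G)]` for closed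
invariant subvarieties `Y` of `X`, and the induction relations `[(Ind_G^H X, H)] = [(X, G)]`. -/
inductive Relation : FreeAbelianGroup GClass → Prop
  | scissor (A : GVar) (Y : Set A.X) (hY : IsClosed Y)
      (hG : ∀ (g : A.G) (x : A.X), x ∈ Y → g • x ∈ Y) :
      Relation (gen A - (gen (A.sub Y hY.isLocallyClosed hG) +
        gen (A.sub Yᶜ hY.isOpen_compl.isLocallyClosed (smul_mem_compl hG))))
  | induced (A B : GVar) (h : IsInduced A B) : Relation (gen B - gen A)

theorem iso_prod_sub (C A : GVar) (Y : Set A.X) (hY : IsLocallyClosed Y)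
    (hG : ∀ (g : A.G) (x : A.X), x ∈ Y → g • x ∈ Y)
    (hY' : IsLocallyClosed {t : (C.prod A).X | (prodEquiv C.X A.X t).2 ∈ Y})
    (hG' : ∀ (g : (C.prod A).G) (t : (C.prod A).X), t ∈ {t | (prodEquiv C.X A.X t).2 ∈ Y} →
      g • t ∈ {t : (C.prod A).X | (prodEquiv C.X A.X t).2 ∈ Y}) :
    Iso (C.prod (A.sub Y hY hG)) ((C.prod A).sub {t | (prodEquiv C.X A.X t).2 ∈ Y} hY' hG') := by
  refine ⟨MulEquiv.refl (C.G × A.G), prodSubEquiv C.X A.X Y hY hY', isRegular_prodSubEquiv _ _ _ _ _,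
    isRegular_prodSubEquiv_symm _ _ _ _ _, fun g z => incl_injective (hZ := hY') ?_⟩
  have h := prodEquiv_incl_prodSubEquiv C.X A.X Y hY hY'
  refine prod_ext (A := C) (B := A) ?_ ?_
  · refine (congrArg Prod.fst (h _)).trans ?_
    refine (fst_smul (A := C) (B := A.sub Y hY hG) g z).trans ?_
    refine (congrArg (g.1 • ·) (congrArg Prod.fst (h z)).symm).trans ?_
    exact (fst_smul (A := C) (B := A) g (incl (prodSubEquiv C.X A.X Y hY hY' z))).symm
  · refine (congrArg Prod.snd (h _)).trans ?_
    refine (congrArg incl (snd_smul (A := C) (B := A.sub Y hY hG) g z)).trans ?_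
    refine (congrArg (fun t : A.X => (show A.G from g.2) • t)
      (congrArg Prod.snd (h z)).symm).trans ?_
    exact (snd_smul (A := C) (B := A) g (incl (prodSubEquiv C.X A.X Y hY hY' z))).symm

theorem isInduced_prod (C : GVar) {A B : GVar} (h : IsInduced A B) :
    IsInduced (C.prod A) (C.prod B) := by
  obtain ⟨j, Z, hZ, e, hj, he, he', h₁, h₂, h₃⟩ := h
  have hZ' : IsClopen {t : (C.prod B).X | pr₂ t ∈ Z} :=
    hZ.preimage (isRegular_snd C.X B.X).continuous
  let f : (C.prod A).X ≃ (C.prod B).X.sub {t : (C.prod B).X | pr₂ t ∈ Z}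
      hZ'.isOpen.isLocallyClosed :=
    (prodCongr (Equiv.refl C.X) e).trans (prodSubEquiv C.X B.X Z _ hZ'.isOpen.isLocallyClosed)
  have hf₁ : ∀ t, pr₁ (A := C) (B := B) (incl (f t)) = pr₁ (A := C) (B := A) t := fun t =>
    (congrArg Prod.fst (prodEquiv_incl_prodSubEquiv _ _ _ _ _ _)).trans
      (fst_prodCongr (Equiv.refl C.X) e t)
  have hf₂ : ∀ t, pr₂ (A := C) (B := B) (incl (f t)) = incl (e (pr₂ (A := C) (B := A) t)) :=
    fun t => (congrArg Prod.snd (prodEquiv_incl_prodSubEquiv _ _ _ _ _ _)).trans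
      (congrArg incl (snd_prodCongr (Equiv.refl C.X) e t))
  refine ⟨(MonoidHom.id C.G).prodMap j, _, hZ', f, ?_, ?_, ?_, ?_, ?_, ?_⟩
  · exact Function.Injective.prodMap Function.injective_id hj
  · exact (isRegular_prodSubEquiv _ _ _ _ _).comp (isRegular_prodMap (isRegular_id _) he)
  · exact (isRegular_prodMap (isRegular_id _) he').comp (isRegular_prodSubEquiv_symm _ _ _ _ _)
  · intro g t
    refine prod_ext (A := C) (B := B) ?_ ?_
    · refine (hf₁ _).trans ((fst_smul g t).trans (Eq.trans ?_ (fst_smul _ _).symm))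
      rw [hf₁]
      rfl
    · refine (hf₂ _).trans ((congrArg (fun x => incl (e x)) (snd_smul g t)).trans
        (Eq.trans ?_ (snd_smul _ _).symm))
      rw [hf₂]
      exact h₁ _ _
  · intro y
    obtain ⟨h, x, hx⟩ := h₂ (pr₂ y)
    obtain ⟨t, ht₁, ht₂⟩ : ∃ t : (C.prod A).X, pr₁ t = pr₁ y ∧ pr₂ t = x :=
      ⟨(prodEquiv C.X A.X).symm (pr₁ y, x), congrArg Prod.fst (Equiv.apply_symm_apply _ _),
        congrArg Prod.snd (Equiv.apply_symm_apply _ _)⟩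
    refine ⟨((1 : C.G), h), t, prod_ext (A := C) (B := B) ?_ ?_⟩
    · refine (fst_smul _ _).trans ?_
      rw [hf₁, ht₁]
      exact one_smul _ _
    · refine (snd_smul _ _).trans ?_
      rw [hf₂, ht₂]
      exact hx
  · rintro ⟨c, h⟩ x x' hxx
    have h4 := (snd_smul (A := C) (B := B) (c, h) _).symm.trans
      (congrArg (pr₂ (A := C) (B := B)) hxx)
    rw [hf₂, hf₂] at h4
    obtain ⟨g, hg⟩ := h₃ h _ _ h4
    exact ⟨(c, g), Prod.ext rfl hg⟩

theorem Relation.gen_mul (C : GVar) {r : FreeAbelianGroup GClass} (hr : Relation r) :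
    Relation (gen C * r) := by
  obtain ⟨A, Y, hY, hG⟩ | ⟨A, B, h⟩ := hr
  · have hc : IsClosed {t : (C.prod A).X | (prodEquiv C.X A.X t).2 ∈ Y} :=
      hY.preimage (isRegular_snd C.X A.X).continuous
    have hG' : ∀ (g : (C.prod A).G) (t : (C.prod A).X), t ∈ {t | (prodEquiv C.X A.X t).2 ∈ Y} →
        g • t ∈ {t : (C.prod A).X | (prodEquiv C.X A.X t).2 ∈ Y} := by
      intro g t ht
      have h := snd_smul (A := C) (B := A) g t
      exact (show pr₂ (A := C) (B := A) (g • t) ∈ Y from h ▸ hG _ _ ht)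
    rw [mul_sub, mul_add, GVar.gen_mul, GVar.gen_mul, GVar.gen_mul,
      gen_eq (iso_prod_sub C A Y _ hG hc.isLocallyClosed hG'),
      gen_eq (iso_prod_sub C A Yᶜ _ (smul_mem_compl hG) hc.isOpen_compl.isLocallyClosed
        (smul_mem_compl hG'))]
    exact Relation.scissor (C.prod A) _ hc hG'
  · rw [mul_sub, GVar.gen_mul, GVar.gen_mul]
    exact Relation.induced _ _ (isInduced_prod C h)

end GVar

/-- The Grothendieck ring `K₀^fGr(Var_ℂ)` of quasi-projective varieties with actions of finite
groups: the abelian group generated by the isomorphism classes of pairs `(X, G)` modulo the scissor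
and the induction relations, with the Cartesian product. -/
abbrev K0fGr : Type 1 :=
  FreeAbelianGroup GClass ⧸ relationIdeal GVar.Relation (by
    rintro ⟨C⟩ r hr
    exact GVar.Relation.gen_mul C hr)

/-- The class `[(X, G)]` in `K₀^fGr(Var_ℂ)`. -/
def GVar.cls (A : GVar) : K0fGr := Ideal.Quotient.mk _ A.gen

namespace GVar

open QPVar

/-! ### Quotients and the generalized Euler characteristics -/

/-- `π : X → Y` is the quotient of `X` by `G`: its fibres are the orbits, `Y` carries the quotient
topology, and a function on `Y` is regular (at a point) if and only if its pull-back to `X` is. -/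
def IsQuotient (A : GVar) (Y : QPVar) (π : A.X → Y) : Prop :=
  IsQuotientMap π ∧ (∀ x x' : A.X, π x = π x' ↔ ∃ g : A.G, g • x = x') ∧
    ∀ (f : Y → ℂ) (x : A.X), RegularAt f (π x) ↔ RegularAt (fun y => f (π y)) x

instance : Nonempty QPVar := ⟨QPVar.pt⟩

/-- The quotient variety `X / G` (it is determined up to isomorphism). -/
def quotient (A : GVar) : QPVar :=
  Classical.epsilon fun Y : QPVar => ∃ π : A.X → Y, IsQuotient A Y π

/-- The generalized Euler characteristic `χ_g^{(k)}(X, G)` of order `k`: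
`χ_g^{(0)}(X, G) = [X / G]` and `χ_g^{(k)}(X, G) = ∑_{[g]} χ_g^{(k-1)}(X^⟨g⟩, C_G(g))`, the sum
being over the conjugacy classes of elements of `G`. -/
def eulerChar : ℕ → GVar → K0Var
  | 0, A => A.quotient.cls
  | k + 1, A => ∑ᶠ c : ConjClasses A.G, eulerChar k (A.fixed (Quotient.out c))

end GVar

/-! ### λ-structures and power structures -/

/-- The multiplicative monoid `1 + t R[[t]]`. -/
def oneSeries (R : Type*) [CommRing R] : Submonoid (PowerSeries R) where
  carrier := {A | PowerSeries.constantCoeff A = 1}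
  one_mem' := map_one _
  mul_mem' := fun {A B} hA hB => by
    simp only [Set.mem_ofPred_eq] at hA hB ⊢
    rw [map_mul, hA, hB, one_mul]

/-- The coefficient of `t^n`. -/
def coeffSeries {R : Type*} [CommRing R] (n : ℕ) (A : oneSeries R) : R :=
  PowerSeries.coeff n A.1

/-- The coefficientwise map `φ_* : 1 + t R[[t]] → 1 + t S[[t]]` defined by a ring homomorphism. -/
def mapSeries {R S : Type*} [CommRing R] [CommRing S] (φ : R →+* S) (A : oneSeries R) :
    oneSeries S :=
  ⟨PowerSeries.map φ A.1, by
    show PowerSeries.constantCoeff (PowerSeries.map φ A.1) = 1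
    have h : PowerSeries.constantCoeff A.1 = 1 := A.2
    rw [← PowerSeries.coeff_zero_eq_constantCoeff_apply, PowerSeries.coeff_map,
      PowerSeries.coeff_zero_eq_constantCoeff_apply, h, map_one]⟩

/-- A λ-structure on a ring `R`: a map `a ↦ λ_a(t) = 1 + a t + ⋯` with
`λ_{a + b}(t) = λ_a(t) λ_b(t)`. -/
structure LambdaStructure (R : Type*) [CommRing R] where
  /-- The series `λ_a(t)`. -/
  series : R → oneSeries R
  series_add : ∀ a b, series (a + b) = series a * series b
  coeff_one : ∀ a, coeffSeries 1 (series a) = a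

/-- A ring homomorphism `φ` is a λ-ring homomorphism if `λ_{φ(a)}(t) = φ_* λ_a(t)`. -/
def IsLambdaHom {R S : Type*} [CommRing R] [CommRing S] (l : LambdaStructure R)
    (m : LambdaStructure S) (φ : R →+* S) : Prop :=
  ∀ a, m.series (φ a) = mapSeries φ (l.series a)

/-- A power structure over a ring `R`. -/
structure PowerStructure (R : Type*) [CommRing R] where
  /-- The power `(A(t))^m`. -/
  pow : oneSeries R → R → oneSeries R
  pow_zero : ∀ A, pow A 0 = 1
  pow_one : ∀ A, pow A 1 = A
  mul_pow : ∀ A B m, pow (A * B) m = pow A m * pow B m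
  pow_add : ∀ A m n, pow A (m + n) = pow A m * pow A n
  pow_mul : ∀ A m n, pow A (m * n) = pow (pow A n) m
  coeff_one_pow : ∀ A m, coeffSeries 1 (pow A m) = m * coeffSeries 1 A
  /-- If `B(t) = A(t^k)`, then `(B(t))^m` is obtained from `(A(t))^m` by `t ↦ t^k`. -/
  pow_expand : ∀ (k : ℕ) (hk : k ≠ 0) (A B : oneSeries R),
    B.1 = PowerSeries.expand k hk A.1 → ∀ m, (pow B m).1 = PowerSeries.expand k hk (pow A m).1

/-! ### The geometric power structure over `K₀(Var_ℂ)` -/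

section Geometric

open QPVar GVar

/-- The action of `∏_i S_{k_i}` on `∏_i B_i^{k_i}` by permutations of the components. -/
def blockSmul {n : ℕ} (B : Fin n → QPVar) (k : Fin n → ℕ)
    (s : ∀ i : Fin n, Equiv.Perm (Fin (k i))) (z : pi (fun j : Σ i : Fin n, Fin (k i) => B j.1)) :
    pi (fun j : Σ i : Fin n, Fin (k i) => B j.1) :=
  (piEquiv (fun j : Σ i : Fin n, Fin (k i) => B j.1)).symm
    (fun j => piEquiv (fun j : Σ i : Fin n, Fin (k i) => B j.1) z ⟨j.1, (s j.1)⁻¹ j.2⟩)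

theorem piEquiv_blockSmul {n : ℕ} (B : Fin n → QPVar) (k : Fin n → ℕ)
    (s : ∀ i : Fin n, Equiv.Perm (Fin (k i))) (z : pi (fun j : Σ i : Fin n, Fin (k i) => B j.1))
    (j : Σ i : Fin n, Fin (k i)) :
    piEquiv (fun j : Σ i : Fin n, Fin (k i) => B j.1) (blockSmul B k s z) j =
      piEquiv (fun j : Σ i : Fin n, Fin (k i) => B j.1) z ⟨j.1, (s j.1)⁻¹ j.2⟩ :=
  congrFun (Equiv.apply_symm_apply _ _) j

/-- The product `∏_i B_i^{k_i}` with the action of `∏_i S_{k_i}`. -/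
def blockPower {n : ℕ} (B : Fin n → QPVar) (k : Fin n → ℕ) : GVar where
  X := pi (fun j : Σ i : Fin n, Fin (k i) => B j.1)
  G := ∀ i : Fin n, Equiv.Perm (Fin (k i))
  action :=
    { smul := blockSmul B k
      one_smul := fun z => Equiv.symm_apply_apply _ z
      mul_smul := fun s s' z => by
        apply (piEquiv (fun j : Σ i : Fin n, Fin (k i) => B j.1)).injective
        funext j
        refine (piEquiv_blockSmul B k (s * s') z j).trans ?_
        refine Eq.trans ?_ (piEquiv_blockSmul B k s (blockSmul B k s' z) j).symm
        rw [piEquiv_blockSmul B k s']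
        rfl }
  isRegular_smul s := by
    refine isRegular_pi (X := fun j : Σ i : Fin n, Fin (k i) => B j.1) fun j => ?_
    have h := isRegular_piEquiv_apply (fun j : Σ i : Fin n, Fin (k i) => B j.1)
      ⟨j.1, (s j.1)⁻¹ j.2⟩
    exact (isRegular_congr fun z => (piEquiv_blockSmul B k s z j).symm).1 h

/-- The complement of the big diagonal in a power of `M`: the components are pairwise distinct. -/
def offDiagonal {n : ℕ} (M : QPVar) (k : Fin n → ℕ) : Set (blockPower (fun _ => M) k).X :=
  {z | Function.Injective (piEquiv (fun _ : Σ i : Fin n, Fin (k i) => M) z)}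

theorem isOpen_offDiagonal {n : ℕ} (M : QPVar) (k : Fin n → ℕ) : IsOpen (offDiagonal M k) := by
  have : offDiagonal M k = ⋂ (a : Σ i : Fin n, Fin (k i)) (b : Σ i : Fin n, Fin (k i))
      (_ : a ≠ b), {z : (blockPower (fun _ => M) k).X |
        piEquiv (fun _ : Σ i : Fin n, Fin (k i) => M) z a =
          piEquiv (fun _ : Σ i : Fin n, Fin (k i) => M) z b}ᶜ := by
    ext z
    simp only [Set.mem_iInter, Set.mem_compl_iff]
    exact ⟨fun h a b hab e => hab (h e), fun h a b e => by_contra fun hab => h a b hab e⟩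
  rw [this]
  exact isOpen_iInter_of_finite fun a => isOpen_iInter_of_finite fun b =>
    isOpen_iInter_of_finite fun _ => (isClosed_eq
      (isRegular_piEquiv_apply (fun _ : Σ i : Fin n, Fin (k i) => M) a)
      (isRegular_piEquiv_apply (fun _ : Σ i : Fin n, Fin (k i) => M) b)).isOpen_compl

theorem smul_mem_offDiagonal {n : ℕ} (M : QPVar) (k : Fin n → ℕ)
    (s : (blockPower (fun _ => M) k).G) (z : (blockPower (fun _ => M) k).X)
    (hz : z ∈ offDiagonal M k) : s • z ∈ offDiagonal M k := by
  intro a b hab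
  have e : ∀ j, piEquiv (fun _ : Σ i : Fin n, Fin (k i) => M) (s • z) j =
      piEquiv (fun _ : Σ i : Fin n, Fin (k i) => M) z ⟨j.1, (s j.1)⁻¹ j.2⟩ :=
    piEquiv_blockSmul (fun _ => M) k s z
  have h := hz ((e a).symm.trans (hab.trans (e b)))
  obtain ⟨i, a⟩ := a
  obtain ⟨i', b⟩ := b
  obtain rfl : i = i' := congrArg Sigma.fst h
  simpa using h

/-- The variety `(M^{∑ k_i} \ Δ) × ∏_i A_i^{k_i}` with the simultaneous action of `∏_i S_{k_i}`;
here `i` runs over `1, …, n`. -/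
def labelledConf (A : ℕ → QPVar) (M : QPVar) {n : ℕ} (k : Fin n → ℕ) : GVar :=
  (((blockPower (fun _ => M) k).sub (offDiagonal M k) (isOpen_offDiagonal M k).isLocallyClosed
    (smul_mem_offDiagonal M k)).prod (blockPower (fun i : Fin n => A (i + 1)) k)).comap
    (H := ∀ i : Fin n, Equiv.Perm (Fin (k i))) (MonoidHom.prod (MonoidHom.id _) (MonoidHom.id _))

/-- A power structure over `K₀(Var_ℂ)` is the geometric one if the coefficient of `t^n` in
`(1 + [A₁] t + [A₂] t² + ⋯)^[M]` is the sum of the classes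
`[((M^{∑ k_i} \ Δ) × ∏_i A_i^{k_i}) / ∏_i S_{k_i}]` over all `(k_1, …, k_n)` with
`∑ i k_i = n`. -/
def IsGeometric (P : PowerStructure K0Var) : Prop :=
  ∀ (A : ℕ → QPVar) (M : QPVar) (B : oneSeries K0Var), (∀ n, 1 ≤ n → coeffSeries n B = (A n).cls) →
    ∀ n, coeffSeries n (P.pow B M.cls) =
      ∑ k : Fin n → Fin (n + 1) with ∑ i : Fin n, ((i : ℕ) + 1) * (k i : ℕ) = n,
        (labelledConf A M (fun i => (k i : ℕ))).quotient.cls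

end Geometric

/-- The series `∏_{r_1, …, r_k ≥ 1} (1 - t^{r_1 ⋯ r_k})^{r_2 r_3² ⋯ r_k^{k-1}}`.  Only the factors
with `r_1, …, r_k ≤ n` contribute to the coefficient of `t^n` (for `k = 0` the product consists of
the single factor `1 - t`). -/
def eulerProduct (R : Type*) [CommRing R] (k : ℕ) : oneSeries R :=
  ⟨PowerSeries.mk fun n => PowerSeries.coeff n
    (∏ r ∈ Fintype.piFinset (fun _ : Fin k => Finset.Icc 1 n),
      ((1 : PowerSeries R) - PowerSeries.X ^ (∏ i, r i)) ^ (∏ i, r i ^ (i : ℕ))), by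
    show PowerSeries.constantCoeff _ = 1
    rw [← PowerSeries.coeff_zero_eq_constantCoeff_apply, PowerSeries.coeff_mk,
      PowerSeries.coeff_zero_eq_constantCoeff_apply, map_prod]
    refine Finset.prod_eq_one fun r hr => ?_
    have h : 0 < ∏ i, r i := Finset.prod_pos fun i _ =>
      (Finset.mem_Icc.1 (Fintype.mem_piFinset.1 hr i)).1
    simp [h.ne']⟩

end Motivic

end

open Motivic

/-!
Quotients. A finite group acts on a locally closed subset of a projective space, and by a product
of embeddings the action becomes a permutation of the coordinates of a larger projective space.
There the invariants of a suitable degree `d` generate all invariants of degrees divisible by `d`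
(`exists_veronese`), so that the map they define is a quotient map
(`exists_isQuotient_permSpace`); quotient maps restrict to invariant locally closed subsets
(`GVar.exists_isQuotient`) and are compatible with products. Hence `p` is well defined
(`quotientRingHom`).

The homomorphism `α`. The sum over the conjugacy classes of `G` is the class of the *inertia
variety*, the variety of pairs `(g, x)` with `g x = x` on which `G` acts by conjugation and by the
given action: its part over a conjugacy class is induced from a fixed point locus
(`GVar.inertia_cls_eq_finsum`). In this form compatibility with the scissor relations, with
induction and with products is evident (`inertiaRingHom`).

The λ-structures. If `Y` is closed and invariant in `X`, the power `X^n` is cut into the parts of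
the points with a given number of components in `Y`; each is induced from a product of a power of
`Y` and a power of `X ∖ Y` (`GVar.cls_eq_sum_antidiagonal`, `GVar.power_scissor`). This gives `ζ`,
and its image under `p` is the λ-structure `symLambda` of the symmetric powers.

The power structure. For any λ-structure, every series `1 + a₁ t + ⋯` is a unique infinite product
of series `λ_b (t^i)`, and the power with exponent `m` multiplies the elements `b` by `m`. For
`symLambda` this power structure is geometric (`isGeometric_symLambda`): the generating series of
the configurations on `M` labelled by the `A_i` is multiplicative in the series of labels. Indeed
labelled configurations together with a further family of points with multiplicities, labelled
by points of a variety, are superposed to configurations of points of several types, a type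
recording a label and a number of points of the family (`GVar.quotientRingHom_super`,
`confSum_typeWeight`). So multiplying the series of labels by a series `λ_b (t^i)` multiplies the
generating series by the power of that series (`power_labelSeries`).

The product formula. A point of the inertia variety of `(X^n, G_n)` is an element of the wreath
product with a point fixed by it, and the cycles of the permutation cut it into independent parts.
Therefore `α(ζ_a(t))` is a product of series in `t^r` for `r ≥ 1` that belong to the cycles of
length `r` alone (`GVar.mapSeries_inertiaRingHom_zeta`), and the `r`-th series is `ζ` of the class
of the part of the inertia variety of `(X^r, G_r)` over the elements with a single cycle
(`GVar.cyclePart_singleton`). Up to conjugation such an element is a cyclic rotation followed by an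
element `g` at one place; its fixed points are the points of `X` fixed by `g`, and its centralizer
is the diagonally embedded `C_G(g)` extended by the element itself, an `r`-th root of `g`
(`GVar.cyclePart_self_cls`, `GVar.diagHom_bijective`). Adjoining an `r`-th root that acts trivially
multiplies the value of `p ∘ α^k` by `r^k`, since each of the `k` group elements that enter `α^k`
may be multiplied by `r` powers of the root (`GVar.quotientRingHom_inertia_pow_comap`). So the
`r`-th factor contributes `r^k χ^(k+1)(X, G)` (`GVar.quotientRingHom_cyclePart_self`). This matches
the factorization of the product of order `k + 1` by its last index (`eulerProduct_succ_eqMod`),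
and the theorem follows by induction on `k` (`isLambdaHom_eulerLambda`); it starts with
`λ_{-1}(t) = 1 - t` for the symmetric powers.
-/

noncomputable section

namespace Motivic

open MvPolynomial Topology QPVar
open Finset.HasAntidiagonal (antidiagonal mem_antidiagonal)
open Finset (sum_congr prod_congr)
open Function (Injective Surjective Bijective)
open Equiv (Perm)

/-! ### Regular functions -/

theorem ProjSpace.isTopologicalBasis {σ : Type} : TopologicalSpace.IsTopologicalBasis
    {U : Set (ProjSpace σ) | ∃ (d : ℕ) (F : MvPolynomial σ ℂ), F.IsHomogeneous d ∧
      U = {p : ProjSpace σ | eval p.coords F ≠ 0}} where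
  exists_subset_inter := by
    rintro _ ⟨d, F, hF, rfl⟩ _ ⟨e, G, hG, rfl⟩ x ⟨hx, hx'⟩
    refine ⟨_, ⟨d + e, F * G, hF.mul hG, rfl⟩, ?_, ?_⟩
    · show eval x.coords (F * G) ≠ 0
      rw [map_mul]; exact mul_ne_zero hx hx'
    · intro y hy
      have hy' : eval y.coords (F * G) ≠ 0 := hy
      rw [map_mul] at hy'
      exact ⟨left_ne_zero_of_mul hy', right_ne_zero_of_mul hy'⟩
  sUnion_eq := by
    refine Set.eq_univ_of_forall fun x => ⟨_, ⟨0, 1, isHomogeneous_one _ _, rfl⟩, ?_⟩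
    show eval x.coords 1 ≠ 0
    simp
  eq_generateFrom := rfl

namespace QPVar

variable {X Y Z : QPVar}

theorem exists_form_of_mem_nhds {x : X} {U : Set X} (hU : U ∈ 𝓝 x) :
    ∃ (d : ℕ) (F : MvPolynomial X.σ ℂ), F.IsHomogeneous d ∧ eval (coords x) F ≠ 0 ∧
      ∀ y : X, eval (coords y) F ≠ 0 → y ∈ U := by
  rw [nhds_subtype_eq_comap, Filter.mem_comap] at hU
  obtain ⟨V, hV, hVU⟩ := hU
  obtain ⟨_, ⟨d, F, hF, rfl⟩, hx, hs⟩ := ProjSpace.isTopologicalBasis.mem_nhds_iff.1 hV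
  exact ⟨d, F, hF, hx, fun y hy => hVU (hs hy)⟩

theorem isOpen_form_ne_zero {d : ℕ} {F : MvPolynomial X.σ ℂ} (hF : F.IsHomogeneous d) :
    IsOpen {y : X | eval (coords y) F ≠ 0} :=
  (ProjSpace.isOpen_basic hF).preimage continuous_subtype_val

theorem eventually_form_ne_zero {d : ℕ} {F : MvPolynomial X.σ ℂ} (hF : F.IsHomogeneous d) {x : X}
    (hx : eval (coords x) F ≠ 0) : ∀ᶠ y in 𝓝 x, eval (coords y) F ≠ 0 :=
  (isOpen_form_ne_zero hF).mem_nhds hx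

/-- Regularity at a point depends on the germ of the function only. -/
theorem regularAt_iff_eventually {f : X → ℂ} {x : X} : RegularAt f x ↔
    ∃ (d : ℕ) (P Q : MvPolynomial X.σ ℂ), P.IsHomogeneous d ∧ Q.IsHomogeneous d ∧
      eval (coords x) Q ≠ 0 ∧
      ∀ᶠ y in 𝓝 x, f y = eval (coords y) P / eval (coords y) Q := by
  constructor
  · rintro ⟨d, P, Q, hP, hQ, hx, h⟩
    exact ⟨d, P, Q, hP, hQ, hx, (eventually_form_ne_zero hQ hx).mono fun y hy => h y hy⟩
  · rintro ⟨d, P, Q, hP, hQ, hx, h⟩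
    obtain ⟨e, F, hF, hFx, hFy⟩ := exists_form_of_mem_nhds h
    refine ⟨d + e, P * F, Q * F, hP.mul hF, hQ.mul hF, ?_, fun y hy => ?_⟩
    · rw [map_mul]; exact mul_ne_zero hx hFx
    · rw [map_mul] at hy
      have h1 := right_ne_zero_of_mul hy
      rw [hFy y h1, map_mul, map_mul, mul_div_mul_right _ _ h1]

theorem RegularAt.congr {f g : X → ℂ} {x : X} (hf : RegularAt f x) (h : f =ᶠ[𝓝 x] g) :
    RegularAt g x := by
  obtain ⟨d, P, Q, hP, hQ, hx, hy⟩ := regularAt_iff_eventually.1 hf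
  refine regularAt_iff_eventually.2 ⟨d, P, Q, hP, hQ, hx, ?_⟩
  filter_upwards [h, hy] with y h1 h2
  rw [← h1, h2]

theorem regularAt_form_div {d : ℕ} {P Q : MvPolynomial X.σ ℂ} (hP : P.IsHomogeneous d)
    (hQ : Q.IsHomogeneous d) {x : X} (hx : eval (coords x) Q ≠ 0) :
    RegularAt (fun y : X => eval (coords y) P / eval (coords y) Q) x :=
  ⟨d, P, Q, hP, hQ, hx, fun _ _ => rfl⟩

theorem regularAt_const (c : ℂ) (x : X) : RegularAt (fun _ : X => c) x :=
  ⟨0, C c, 1, isHomogeneous_C _ _, isHomogeneous_one _ _, by simp, fun y _ => by simp⟩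

theorem RegularAt.add {f g : X → ℂ} {x : X} (hf : RegularAt f x) (hg : RegularAt g x) :
    RegularAt (fun y => f y + g y) x := by
  obtain ⟨d, P, Q, hP, hQ, hx, h⟩ := hf
  obtain ⟨e, P', Q', hP', hQ', hx', h'⟩ := hg
  refine ⟨d + e, P * Q' + Q * P', Q * Q', (hP.mul hQ').add (hQ.mul hP'), hQ.mul hQ', ?_,
    fun y hy => ?_⟩
  · rw [map_mul]; exact mul_ne_zero hx hx'
  · rw [map_mul] at hy
    have h1 := left_ne_zero_of_mul hy
    have h2 := right_ne_zero_of_mul hy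
    beta_reduce
    rw [h y h1, h' y h2, div_add_div _ _ h1 h2]
    simp only [map_add, map_mul]

theorem RegularAt.mul {f g : X → ℂ} {x : X} (hf : RegularAt f x) (hg : RegularAt g x) :
    RegularAt (fun y => f y * g y) x := by
  obtain ⟨d, P, Q, hP, hQ, hx, h⟩ := hf
  obtain ⟨e, P', Q', hP', hQ', hx', h'⟩ := hg
  refine ⟨d + e, P * P', Q * Q', hP.mul hP', hQ.mul hQ', ?_, fun y hy => ?_⟩
  · rw [map_mul]; exact mul_ne_zero hx hx'
  · rw [map_mul] at hy
    beta_reduce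
    rw [h y (left_ne_zero_of_mul hy), h' y (right_ne_zero_of_mul hy), div_mul_div_comm]
    simp only [map_mul]

theorem RegularAt.eventually_ne_zero {f : X → ℂ} {x : X} (hf : RegularAt f x) (hx : f x ≠ 0) :
    ∀ᶠ y in 𝓝 x, f y ≠ 0 := by
  obtain ⟨d, P, Q, hP, hQ, hQx, h⟩ := hf
  have hPx : eval (coords x) P ≠ 0 := by
    rw [h x hQx] at hx
    exact fun h0 => hx (by rw [h0, zero_div])
  filter_upwards [eventually_form_ne_zero hP hPx, eventually_form_ne_zero hQ hQx] with y h1 h2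
  rw [h y h2]
  exact div_ne_zero h1 h2

theorem RegularAt.inv {f : X → ℂ} {x : X} (hf : RegularAt f x) (hx : f x ≠ 0) :
    RegularAt (fun y => (f y)⁻¹) x := by
  obtain ⟨d, P, Q, hP, hQ, hQx, h⟩ := hf
  have hPx : eval (coords x) P ≠ 0 := by
    rw [h x hQx] at hx
    exact fun h0 => hx (by rw [h0, zero_div])
  refine regularAt_iff_eventually.2 ⟨d, Q, P, hQ, hP, hPx, ?_⟩
  filter_upwards [eventually_form_ne_zero hQ hQx] with y h2
  rw [h y h2, inv_div]

theorem RegularAt.div {f g : X → ℂ} {x : X} (hf : RegularAt f x) (hg : RegularAt g x)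
    (hx : g x ≠ 0) : RegularAt (fun y => f y / g y) x := by
  simpa only [div_eq_mul_inv] using hf.mul (hg.inv hx)

theorem RegularAt.sum {ι : Type*} (s : Finset ι) {f : ι → X → ℂ} {x : X}
    (hf : ∀ i ∈ s, RegularAt (f i) x) : RegularAt (fun y => ∑ i ∈ s, f i y) x := by
  classical
  induction s using Finset.induction_on with
  | empty => simpa using regularAt_const (0 : ℂ) x
  | insert i s hi ih =>
    simp only [Finset.sum_insert hi]
    exact (hf i (Finset.mem_insert_self _ _)).add
      (ih fun j hj => hf j (Finset.mem_insert_of_mem hj))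

theorem RegularAt.prod {ι : Type*} (s : Finset ι) {f : ι → X → ℂ} {x : X}
    (hf : ∀ i ∈ s, RegularAt (f i) x) : RegularAt (fun y => ∏ i ∈ s, f i y) x := by
  classical
  induction s using Finset.induction_on with
  | empty => simpa using regularAt_const (1 : ℂ) x
  | insert i s hi ih =>
    simp only [Finset.prod_insert hi]
    exact (hf i (Finset.mem_insert_self _ _)).mul
      (ih fun j hj => hf j (Finset.mem_insert_of_mem hj))

/-! ### Criteria for the regularity of maps -/

/-- A regular map pulls back regular functions to regular functions. -/
theorem IsRegular.regularAt_comp {φ : X → Y} (hφ : IsRegular φ) {f : Y → ℂ} {x : X}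
    (hf : RegularAt f (φ x)) : RegularAt (fun y => f (φ y)) x := by
  obtain ⟨e, P, Q, hP, hQ, hQx, h⟩ := hf
  obtain ⟨d, F, hF, hFx, hFy⟩ := hφ x
  obtain ⟨i₀, hi₀⟩ := Function.ne_iff.1 hFx
  have key : ∀ (y : X), (fun i => eval (coords y) (F i)) ≠ 0 → ∃ a : ℂ, a ≠ 0 ∧
      ∀ G : MvPolynomial Y.σ ℂ, G.IsHomogeneous e →
        eval (coords (φ y)) G = a * eval (coords y) (bind₁ F G) := by
    intro y hy
    have h1 := hFy y hy
    obtain ⟨a, ha, h2⟩ := ProjSpace.coords_point _ hy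
    refine ⟨a ^ e, pow_ne_zero _ ha, fun G hG => ?_⟩
    have h3 : coords (φ y) = a • fun i => eval (coords y) (F i) := by
      rw [← h2, ← h1]; rfl
    rw [h3, ProjSpace.eval_smul hG]
    congr 1
    exact (eval₂Hom_bind₁ (RingHom.id ℂ) _ _ _).symm
  refine regularAt_iff_eventually.2 ⟨d * e, bind₁ F P, bind₁ F Q, hP.aeval F hF, hQ.aeval F hF,
    ?_, ?_⟩
  · obtain ⟨a, ha, h3⟩ := key x hFx
    rw [h3 Q hQ] at hQx
    exact right_ne_zero_of_mul hQx
  · filter_upwards [eventually_form_ne_zero (hF i₀) hi₀,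
      hφ.continuous.continuousAt.eventually (eventually_form_ne_zero hQ hQx)] with y h1 h2
    obtain ⟨a, ha, h3⟩ := key y (Function.ne_iff.2 ⟨i₀, h1⟩)
    rw [h _ h2, h3 P hP, h3 Q hQ, mul_div_mul_left _ _ ha]

/-- A map is regular if locally the ratios of its homogeneous coordinates are regular. -/
theorem isRegular_of_coords {φ : X → Y} (h : ∀ x : X, ∃ a : Y.σ → X → ℂ,
    (∀ i, RegularAt (a i) x) ∧ (∃ i, a i x ≠ 0) ∧
    ∀ᶠ y in 𝓝 x, ∃ c : ℂ, (fun i => a i y) = c • coords (φ y)) : IsRegular φ := by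
  classical
  let _ := Fintype.ofFinite Y.σ
  intro x
  obtain ⟨a, ha, ⟨i₀, hi₀⟩, hc⟩ := h x
  choose d P Q hP hQ hQx hay using ha
  obtain ⟨e, H, hH, hHx, hHy⟩ := exists_form_of_mem_nhds hc
  have hval : ∀ y, (∀ j, eval (coords y) (Q j) ≠ 0) → ∀ i,
      eval (coords y) (P i) * ∏ j ∈ Finset.univ.erase i, eval (coords y) (Q j) =
        a i y * ∏ j, eval (coords y) (Q j) := by
    intro y hy i
    rw [hay i y (hy i), ← Finset.mul_prod_erase Finset.univ _ (Finset.mem_univ i)]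
    field_simp [hy i]
  have hev : ∀ y i, eval (coords y) (H * (∏ j, Q j) * (P i * ∏ j ∈ Finset.univ.erase i, Q j)) =
      eval (coords y) H * (∏ j, eval (coords y) (Q j)) *
        (eval (coords y) (P i) * ∏ j ∈ Finset.univ.erase i, eval (coords y) (Q j)) := by
    intro y i
    simp only [map_mul, map_prod]
  refine ⟨e + (∑ j, d j) + ∑ j, d j,
    fun i => H * (∏ j, Q j) * (P i * ∏ j ∈ Finset.univ.erase i, Q j), fun i => ?_, ?_, ?_⟩
  · refine (hH.mul (IsHomogeneous.prod _ _ _ fun j _ => hQ j)).mul ?_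
    rw [← Finset.add_sum_erase Finset.univ d (Finset.mem_univ i)]
    exact (hP i).mul (IsHomogeneous.prod _ _ _ fun j _ => hQ j)
  · refine Function.ne_iff.2 ⟨i₀, ?_⟩
    show eval (coords x) _ ≠ 0
    rw [hev, hval x hQx]
    have := Finset.prod_ne_zero_iff.2 fun j (_ : j ∈ Finset.univ) => hQx j
    exact mul_ne_zero (mul_ne_zero hHx this) (mul_ne_zero hi₀ this)
  · intro y hy
    obtain ⟨i, hi⟩ := Function.ne_iff.1 hy
    have hi' : eval (coords y) (H * (∏ j, Q j) * (P i * ∏ j ∈ Finset.univ.erase i, Q j)) ≠ 0 := hi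
    rw [hev] at hi'
    have h1 := left_ne_zero_of_mul hi'
    have h2 := left_ne_zero_of_mul h1
    have h3 := right_ne_zero_of_mul h1
    have h4 : ∀ j, eval (coords y) (Q j) ≠ 0 := fun j =>
      Finset.prod_ne_zero_iff.1 h3 j (Finset.mem_univ j)
    obtain ⟨c, hc'⟩ := hHy y h2
    have h5 : ∀ i, eval (coords y) (H * (∏ j, Q j) * (P i * ∏ j ∈ Finset.univ.erase i, Q j)) =
        (eval (coords y) H * (∏ j, eval (coords y) (Q j)) * (∏ j, eval (coords y) (Q j)) * c) *
          coords (φ y) i := by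
      intro i
      rw [hev, hval y h4]
      have := congrFun hc' i
      simp only [Pi.smul_apply, smul_eq_mul] at this
      rw [this]; ring
    have hne : (eval (coords y) H * (∏ j, eval (coords y) (Q j)) *
        (∏ j, eval (coords y) (Q j)) * c) ≠ 0 := by
      have h7 := h5 i
      rw [hev] at h7
      rw [h7] at hi'
      exact left_ne_zero_of_mul hi'
    rw [← (φ y).1.point_coords, ProjSpace.point_eq_iff]
    refine ⟨(eval (coords y) H * (∏ j, eval (coords y) (Q j)) *
        (∏ j, eval (coords y) (Q j)) * c)⁻¹, funext fun k => ?_⟩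
    simp only [Pi.smul_apply, smul_eq_mul]
    rw [h5 k, inv_mul_cancel_left₀ hne]
    rfl

/-- A map that pulls back regular functions to regular functions is regular. -/
theorem isRegular_of_regularAt {φ : X → Y}
    (h : ∀ (f : Y → ℂ) (x : X), RegularAt f (φ x) → RegularAt (fun y => f (φ y)) x) :
    IsRegular φ := by
  refine isRegular_of_coords fun x => ?_
  obtain ⟨i₀, hi₀⟩ := Function.ne_iff.1 (coords_ne_zero (φ x))
  have hi₀' : coords (φ x) i₀ ≠ 0 := hi₀
  refine ⟨fun i y => coords (φ y) i / coords (φ y) i₀, fun i => ?_, ⟨i₀, ?_⟩, ?_⟩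
  · refine h (fun z => coords z i / coords z i₀) x ?_
    have := regularAt_form_div (X := Y) (isHomogeneous_X ℂ i) (isHomogeneous_X ℂ i₀) (x := φ x)
      (by simpa using hi₀)
    simpa using this
  · simp [hi₀']
  · refine Filter.Eventually.of_forall fun y => ⟨(coords (φ y) i₀)⁻¹, funext fun i => ?_⟩
    simp [div_eq_inv_mul]

theorem isInducing_incl {S : Set X} {hS : IsLocallyClosed S} :
    IsInducing (incl : X.sub S hS → X) := by
  refine ⟨?_⟩
  show instTopologicalSpaceSubtype = _
  rw [instTopologicalSpaceSubtype, instTopologicalSpaceSubtype, induced_compose]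
  rfl

theorem continuous_incl {S : Set X} {hS : IsLocallyClosed S} :
    Continuous (incl : X.sub S hS → X) := isInducing_incl.continuous

theorem range_incl {S : Set X} {hS : IsLocallyClosed S} :
    Set.range (incl : X.sub S hS → X) = S :=
  Set.Subset.antisymm (by rintro _ ⟨z, rfl⟩; exact incl_mem z)
    fun x hx => ⟨toSub x hx, rfl⟩

theorem isOpenEmbedding_incl {S : Set X} (hS : IsOpen S) :
    IsOpenEmbedding (incl : X.sub S hS.isLocallyClosed → X) :=
  ⟨⟨isInducing_incl, incl_injective⟩, by rw [range_incl]; exact hS⟩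

theorem RegularAt.incl {S : Set X} {hS : IsLocallyClosed S} {f : X → ℂ} {z : X.sub S hS}
    (hf : RegularAt f (incl z)) : RegularAt (fun y : X.sub S hS => f (QPVar.incl y)) z :=
  isRegular_incl.regularAt_comp hf

/-- Regularity at a point of an open subvariety. -/
theorem RegularAt.of_incl {S : Set X} (hS : IsOpen S) {f : X → ℂ}
    {z : X.sub S hS.isLocallyClosed}
    (hf : RegularAt (fun y : X.sub S hS.isLocallyClosed => f (QPVar.incl y)) z) :
    RegularAt f (QPVar.incl z) := by
  obtain ⟨d, P, Q, hP, hQ, hQx, h⟩ := hf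
  refine regularAt_iff_eventually.2 ⟨d, P, Q, hP, hQ, hQx, ?_⟩
  filter_upwards [eventually_form_ne_zero (X := X) hQ hQx, hS.mem_nhds (incl_mem z)] with y h1 h2
  exact h (toSub y h2) h1

/-- Regularity of a map is local on the source. -/
theorem isRegular_of_open_cover {φ : X → Y}
    (h : ∀ x, ∃ (U : Set X) (hU : IsOpen U), x ∈ U ∧
      IsRegular (fun u : X.sub U hU.isLocallyClosed => φ (incl u))) : IsRegular φ := by
  refine isRegular_of_regularAt fun f x hf => ?_
  obtain ⟨U, hU, hx, hφ⟩ := h x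
  exact RegularAt.of_incl hU (z := toSub x hx) (f := fun y => f (φ y))
    (hφ.regularAt_comp (x := toSub x hx) hf)

theorem isRegular_toSub {T : QPVar} {S : Set X} {hS : IsLocallyClosed S} {φ : T → X}
    (hφ : IsRegular φ) (h : ∀ t, φ t ∈ S) :
    IsRegular (fun t => (toSub (φ t) (h t) : X.sub S hS)) :=
  IsRegular.of_incl hφ

/-! ### Forms separating points -/


variable {X Y Z : QPVar}

theorem exists_linear_ne_zero (x : X) :
    ∃ F : MvPolynomial X.σ ℂ, F.IsHomogeneous 1 ∧ eval (coords x) F ≠ 0 := by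
  obtain ⟨i, hi⟩ := Function.ne_iff.1 (coords_ne_zero x)
  exact ⟨MvPolynomial.X i, isHomogeneous_X _ _, by simpa using hi⟩

theorem exists_linear_separating {x y : X} (h : y ≠ x) :
    ∃ F : MvPolynomial X.σ ℂ, F.IsHomogeneous 1 ∧ eval (coords x) F ≠ 0 ∧
      eval (coords y) F = 0 := by
  by_contra! hall
  apply h
  apply Subtype.ext
  rw [← x.1.point_coords, ← y.1.point_coords, ProjSpace.point_eq_iff]
  have key : ∀ i j, coords x i * coords y j = coords x j * coords y i := by
    intro i j
    by_contra hne
    refine hall (C (coords y j) * MvPolynomial.X i - C (coords y i) * MvPolynomial.X j)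
      ((isHomogeneous_C_mul_X _ _).sub (isHomogeneous_C_mul_X _ _)) ?_ ?_
    · simp only [map_sub, map_mul, eval_C, eval_X]
      intro h0
      exact hne (by linear_combination h0)
    · simp only [map_sub, map_mul, eval_C, eval_X]
      ring
  obtain ⟨j, hj⟩ := Function.ne_iff.1 (coords_ne_zero x)
  have hj' : coords x j ≠ 0 := hj
  refine ⟨coords y j / coords x j, funext fun i => ?_⟩
  have := key i j
  simp only [Pi.smul_apply, smul_eq_mul]
  show coords y j / coords x j * coords x i = coords y i
  field_simp
  linear_combination this

theorem exists_separating_form (x : X) (S : Finset X) :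
    ∃ H : MvPolynomial X.σ ℂ, H.IsHomogeneous S.card ∧ eval (coords x) H ≠ 0 ∧
      ∀ y ∈ S, y ≠ x → eval (coords y) H = 0 := by
  classical
  have h : ∀ y : X, ∃ F : MvPolynomial X.σ ℂ, F.IsHomogeneous 1 ∧ eval (coords x) F ≠ 0 ∧
      (y ≠ x → eval (coords y) F = 0) := by
    intro y
    by_cases hy : y = x
    · obtain ⟨F, hF, hx⟩ := exists_linear_ne_zero x
      exact ⟨F, hF, hx, fun h => absurd hy h⟩
    · obtain ⟨F, hF, hx, h⟩ := exists_linear_separating hy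
      exact ⟨F, hF, hx, fun _ => h⟩
  choose F hF hx hy using h
  refine ⟨∏ y ∈ S, F y, ?_, ?_, fun y hyS hyx => ?_⟩
  · simpa using IsHomogeneous.prod S F (fun _ => 1) fun y _ => hF y
  · rw [map_prod]
    exact Finset.prod_ne_zero_iff.2 fun y _ => hx y
  · rw [map_prod]
    exact Finset.prod_eq_zero hyS (hy y hyx)

/-- A linear form that does not vanish at finitely many given points. -/
theorem exists_linear_ne_zero_of_finite {ι : Type} [Finite ι] [Fintype X.σ] (x : ι → X) :
    ∃ a : X.σ → ℂ, ∀ i, ∑ j, a j * coords (x i) j ≠ 0 := by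
  classical
  obtain ⟨f, hf⟩ := Module.exists_dual_forall_apply_ne_zero (K := ℂ) (fun i => coords (x i))
    fun i => coords_ne_zero (x i)
  refine ⟨fun j => f (Pi.single j 1), fun i => ?_⟩
  have h := hf i
  rw [LinearMap.pi_apply_eq_sum_univ f (coords (x i))] at h
  convert h using 2 with j
  rw [smul_eq_mul, mul_comm]
  show _ * f _ = _ * f _
  congr 2
  funext k
  simp [Pi.single_apply, eq_comm]

theorem isHomogeneous_linear {σ : Type} [Fintype σ] (a : σ → ℂ) :
    (∑ j, C (a j) * MvPolynomial.X j : MvPolynomial σ ℂ).IsHomogeneous 1 :=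
  IsHomogeneous.sum _ _ _ fun _ _ => isHomogeneous_C_mul_X _ _

theorem eval_linear {σ : Type} [Fintype σ] (a v : σ → ℂ) :
    eval v (∑ j, C (a j) * MvPolynomial.X j : MvPolynomial σ ℂ) = ∑ j, a j * v j := by
  simp

/-- The restriction of a map to subvarieties. -/
def mapSub (φ : X → Y) {T : Set X} (hT : IsLocallyClosed T) {S : Set Y} (hS : IsLocallyClosed S)
    (h : ∀ x ∈ T, φ x ∈ S) (z : X.sub T hT) : Y.sub S hS :=
  toSub (φ (incl z)) (h _ (incl_mem z))

theorem isRegular_mapSub {φ : X → Y} (hφ : IsRegular φ) {T : Set X} {hT : IsLocallyClosed T}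
    {S : Set Y} {hS : IsLocallyClosed S} (h : ∀ x ∈ T, φ x ∈ S) :
    IsRegular (mapSub φ hT hS h) :=
  isRegular_toSub (hφ.comp isRegular_incl) fun z => h _ (incl_mem z)

/-! ### Quotient maps of varieties -/

/-- A map of varieties such that the target has the quotient topology and its regular functions are
the functions with a regular pull-back. -/
def IsQuotMap (φ : X → Y) : Prop :=
  IsQuotientMap φ ∧ ∀ (f : Y → ℂ) (x : X), RegularAt f (φ x) ↔ RegularAt (fun y => f (φ y)) x

theorem IsQuotMap.isRegular {φ : X → Y} (h : IsQuotMap φ) : IsRegular φ :=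
  isRegular_of_regularAt fun f x hf => (h.2 f x).1 hf

theorem IsQuotMap.surjective {φ : X → Y} (h : IsQuotMap φ) : Surjective φ :=
  h.1.surjective

theorem IsQuotMap.comp {φ : X → Y} {ψ : Y → Z} (hψ : IsQuotMap ψ) (hφ : IsQuotMap φ) :
    IsQuotMap (fun x => ψ (φ x)) :=
  ⟨hψ.1.comp hφ.1, fun f x => (hψ.2 f (φ x)).trans (hφ.2 _ x)⟩

theorem isQuotMap_of_inverse {φ : X → Y} {ψ : Y → X} (hφ : IsRegular φ) (hψ : IsRegular ψ)
    (h₁ : ∀ x, ψ (φ x) = x) (h₂ : ∀ y, φ (ψ y) = y) : IsQuotMap φ := by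
  refine ⟨(Homeomorph.mk ⟨φ, ψ, h₁, h₂⟩ hφ.continuous hψ.continuous).isQuotientMap,
    fun f x => ⟨fun h => hφ.regularAt_comp h, fun h => ?_⟩⟩
  have h3 : RegularAt (fun y => f (φ y)) (ψ (φ x)) := by rw [h₁]; exact h
  have := hψ.regularAt_comp h3
  simpa only [h₂] using this

/-- A map out of a quotient is regular if its composition with the quotient map is. -/
theorem IsQuotMap.isRegular_of_comp {φ : X → Y} (h : IsQuotMap φ) {ψ : Y → Z}
    (hψ : IsRegular (fun x => ψ (φ x))) : IsRegular ψ := by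
  refine isRegular_of_regularAt fun f y hf => ?_
  obtain ⟨x, rfl⟩ := h.surjective y
  exact (h.2 _ x).2 (hψ.regularAt_comp hf)

end QPVar

namespace GVar

variable {A B : GVar} {Y : QPVar}

theorem isQuotient_iff {π : A.X → Y} : A.IsQuotient Y π ↔
    IsQuotMap π ∧ ∀ x x' : A.X, π x = π x' ↔ ∃ g : A.G, g • x = x' :=
  ⟨fun h => ⟨⟨h.1, h.2.2⟩, h.2.1⟩, fun h => ⟨h.1.1, h.2, h.1.2⟩⟩

theorem IsQuotient.quotMap {π : A.X → Y} (h : A.IsQuotient Y π) : IsQuotMap π :=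
  (isQuotient_iff.1 h).1

theorem IsQuotient.eq_iff {π : A.X → Y} (h : A.IsQuotient Y π) {x x' : A.X} :
    π x = π x' ↔ ∃ g : A.G, g • x = x' := h.2.1 x x'

theorem IsQuotient.map_smul {π : A.X → Y} (h : A.IsQuotient Y π) (g : A.G) (x : A.X) :
    π (g • x) = π x := (h.eq_iff.2 ⟨g, rfl⟩).symm

/-- A regular map that is constant on the orbits factors through the quotient. -/
theorem IsQuotient.exists_lift {π : A.X → Y} (h : A.IsQuotient Y π) {Z : QPVar} {φ : A.X → Z}
    (hφ : IsRegular φ) (hinv : ∀ (g : A.G) (x : A.X), φ (g • x) = φ x) :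
    ∃ ψ : Y → Z, IsRegular ψ ∧ ∀ x, ψ (π x) = φ x := by
  have hs := h.quotMap.surjective
  have hψ : ∀ x, φ (Function.surjInv hs (π x)) = φ x := by
    intro x
    obtain ⟨g, hg⟩ := h.eq_iff.1 (Function.surjInv_eq hs (π x))
    exact (hinv g _).symm.trans (congrArg φ hg)
  refine ⟨fun y => φ (Function.surjInv hs y), h.quotMap.isRegular_of_comp ?_, hψ⟩
  exact (isRegular_congr fun x => (hψ x)).2 hφ

/-- The quotient is unique up to isomorphism. -/
theorem IsQuotient.iso {π : A.X → Y} (h : A.IsQuotient Y π) {Y' : QPVar} {π' : A.X → Y'}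
    (h' : A.IsQuotient Y' π') : QPVar.Iso Y Y' := by
  obtain ⟨ψ, hψ, h1⟩ := h.exists_lift h'.quotMap.isRegular h'.map_smul
  obtain ⟨ψ', hψ', h2⟩ := h'.exists_lift h.quotMap.isRegular h.map_smul
  refine ⟨⟨ψ, ψ', fun y => ?_, fun y => ?_⟩, hψ, hψ'⟩
  · obtain ⟨x, rfl⟩ := h.quotMap.surjective y
    rw [h1, h2]
  · obtain ⟨x, rfl⟩ := h'.quotMap.surjective y
    rw [h2, h1]

theorem continuous_smul (g : A.G) : Continuous (fun x : A.X => g • x) :=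
  (A.isRegular_smul g).continuous

theorem IsQuotient.isOpenMap {π : A.X → Y} (h : A.IsQuotient Y π) : IsOpenMap π := by
  intro U hU
  rw [← h.1.isOpen_preimage]
  have : π ⁻¹' (π '' U) = ⋃ g : A.G, (fun x : A.X => g • x) ⁻¹' U := by
    ext x
    simp only [Set.mem_preimage, Set.mem_image, Set.mem_iUnion]
    constructor
    · rintro ⟨y, hy, hyx⟩
      obtain ⟨g, hg⟩ := h.eq_iff.1 hyx.symm
      exact ⟨g, by rwa [hg]⟩
    · rintro ⟨g, hg⟩
      exact ⟨_, hg, h.map_smul g x⟩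
  rw [this]
  exact isOpen_iUnion fun g => hU.preimage (continuous_smul g)

theorem IsQuotient.isLocallyClosed_preimage {π : A.X → Y} (h : A.IsQuotient Y π) {S : Set Y} :
    IsLocallyClosed (π ⁻¹' S) ↔ IsLocallyClosed S := by
  rw [isLocallyClosed_iff_isOpen_coborder, isLocallyClosed_iff_isOpen_coborder,
    coborder_preimage h.isOpenMap h.1.continuous, h.1.isOpen_preimage]

/-! ### Averages over the group -/

/-- The average (up to a factor) of the quotient `P / L ^ k` of two forms over the group. -/
def avg (A : GVar) (P L : MvPolynomial A.X.σ ℂ) (k : ℕ) (y : A.X) : ℂ :=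
  ∑ᶠ g : A.G, eval (coords (g • y)) P / eval (coords (g • y)) L ^ k

theorem avg_smul (P L : MvPolynomial A.X.σ ℂ) (k : ℕ) (h : A.G) (y : A.X) :
    A.avg P L k (h • y) = A.avg P L k y := by
  unfold avg
  simp_rw [← mul_smul]
  exact finsum_comp_equiv (Equiv.mulRight h)
    (f := fun g : A.G => eval (coords (g • y)) P / eval (coords (g • y)) L ^ k)

theorem avg_sub {T : Set A.X} (hT : IsLocallyClosed T)
    (hG : ∀ (g : A.G) (x : A.X), x ∈ T → g • x ∈ T) (P L : MvPolynomial A.X.σ ℂ) (k : ℕ)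
    (z : A.X.sub T hT) : (A.sub T hT hG).avg P L k z = A.avg P L k (incl z) :=
  finsum_congr (α := A.G) fun _ => rfl

theorem regularAt_avg {d k : ℕ} {P L : MvPolynomial A.X.σ ℂ} (hP : P.IsHomogeneous (d * k))
    (hL : L.IsHomogeneous d) {x : A.X} (hx : ∀ g : A.G, eval (coords (g • x)) L ≠ 0) :
    RegularAt (A.avg P L k) x := by
  let _ := Fintype.ofFinite A.G
  have : A.avg P L k = fun y => ∑ g : A.G, eval (coords (g • y)) P /
      eval (coords (g • y)) (L ^ k) := by
    funext y
    simp only [avg, finsum_eq_sum_of_fintype, map_pow]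
  rw [this]
  refine RegularAt.sum _ fun g _ => ?_
  refine (A.isRegular_smul g).regularAt_comp
    (f := fun y : A.X => eval (coords y) P / eval (coords y) (L ^ k)) ?_
  refine regularAt_form_div hP (hL.pow k) ?_
  rw [map_pow]
  exact pow_ne_zero _ (hx g)

/-- Given a quotient `P / Q` of forms with `Q` not vanishing at `x`, it can be rewritten as
`P' / Q'` with forms of a degree divisible by a given number `d`, such that in addition the average
of `Q'` does not vanish at `x`: multiply by a form that vanishes at the points of the orbit of `x`
other than `x`. -/
theorem exists_avg_ne_zero (x : A.X) {d : ℕ} (hd : 0 < d) {L : MvPolynomial A.X.σ ℂ}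
    (hL : eval (coords x) L ≠ 0) {e : ℕ} {P Q : MvPolynomial A.X.σ ℂ} (hP : P.IsHomogeneous e)
    (hQ : Q.IsHomogeneous e) (hx : eval (coords x) Q ≠ 0) :
    ∃ (k : ℕ) (P' Q' : MvPolynomial A.X.σ ℂ), P'.IsHomogeneous (d * k) ∧
      Q'.IsHomogeneous (d * k) ∧ A.avg Q' L k x ≠ 0 ∧
      ∀ y : A.X, (eval (coords y) Q = 0 → eval (coords y) P' = 0 ∧ eval (coords y) Q' = 0) ∧
        eval (coords y) P' * eval (coords y) Q = eval (coords y) Q' * eval (coords y) P := by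
  classical
  let _ := Fintype.ofFinite A.G
  obtain ⟨H, hH, hHx, hHy⟩ := exists_separating_form x (Finset.univ.image fun g : A.G => g • x)
  obtain ⟨E, hE, hEx⟩ := exists_linear_ne_zero x
  set h := (Finset.univ.image fun g : A.G => g • x).card
  set k := 2 * e + h
  have hdeg : e + e + h + 1 * ((d - 1) * k) = d * k := by
    obtain ⟨d, rfl⟩ := Nat.exists_eq_add_of_le' hd
    simp only [Nat.add_sub_cancel, k]
    ring
  refine ⟨k, P * Q * H * E ^ ((d - 1) * k), Q * Q * H * E ^ ((d - 1) * k), ?_, ?_, ?_, ?_⟩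
  · exact hdeg ▸ (((hP.mul hQ).mul hH).mul (hE.pow _))
  · exact hdeg ▸ (((hQ.mul hQ).mul hH).mul (hE.pow _))
  · rw [avg, finsum_eq_sum_of_fintype]
    set Q' := Q * Q * H * E ^ ((d - 1) * k)
    have hterm : ∀ g : A.G, eval (coords (g • x)) Q' / eval (coords (g • x)) L ^ k =
        if g • x = x then eval (coords x) Q' / eval (coords x) L ^ k else 0 := by
      intro g
      split_ifs with hg
      · rw [hg]
      · have := hHy (g • x) (Finset.mem_image_of_mem _ (Finset.mem_univ g)) hg
        simp [Q', this]
    simp_rw [hterm]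
    rw [← Finset.sum_filter, Finset.sum_const, nsmul_eq_mul]
    refine mul_ne_zero ?_ (div_ne_zero ?_ (pow_ne_zero _ hL))
    · rw [Nat.cast_ne_zero, ← Nat.pos_iff_ne_zero, Finset.card_pos]
      exact ⟨1, by simp⟩
    · simp only [Q', map_mul, map_pow]
      exact mul_ne_zero (mul_ne_zero (mul_ne_zero hx hx) hHx) (pow_ne_zero _ hEx)
  · intro y
    simp only [map_mul, map_pow]
    refine ⟨fun h0 => by simp [h0], by ring⟩

/-- A criterion for quotients: every average of a quotient of forms descends to a regular
function. -/
theorem isQuotient_of_avg {π : A.X → Y} (hπ : IsRegular π) (hs : Surjective π)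
    (hfib : ∀ x x' : A.X, π x = π x' ↔ ∃ g : A.G, g • x = x')
    (h : ∀ x : A.X, ∃ (d : ℕ) (L : MvPolynomial A.X.σ ℂ), 0 < d ∧
      (∀ g : A.G, eval (coords (g • x)) L ≠ 0) ∧
      ∀ (k : ℕ) (P : MvPolynomial A.X.σ ℂ), P.IsHomogeneous (d * k) →
        ∀ u : Y → ℂ, (∀ y, u (π y) = A.avg P L k y) → RegularAt u (π x)) :
    A.IsQuotient Y π := by
  have hdesc : ∀ (P L : MvPolynomial A.X.σ ℂ) (k : ℕ), ∃ u : Y → ℂ,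
      ∀ y, u (π y) = A.avg P L k y := by
    intro P L k
    refine ⟨fun y => A.avg P L k (Function.surjInv hs y), fun y => ?_⟩
    obtain ⟨g, hg⟩ := (hfib _ _).1 (Function.surjInv_eq hs (π y))
    exact (avg_smul P L k g _).symm.trans (congrArg (A.avg P L k) hg)
  refine ⟨(isQuotientMap_iff π).2 ⟨isCoinducing_iff.2 fun V => ⟨fun hV => ?_, fun hV => hV.preimage hπ.continuous⟩, hs⟩, hfib, fun f x => ⟨fun hf => hπ.regularAt_comp hf, fun hf => ?_⟩⟩
  · rw [isOpen_iff_mem_nhds]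
    intro y hy
    obtain ⟨x, rfl⟩ := hs y
    obtain ⟨d, L, hd, hLx, hu⟩ := h x
    obtain ⟨e, Q, hQ, hQx, hQy⟩ := exists_form_of_mem_nhds (hV.mem_nhds hy)
    have hLx1 := hLx 1
    rw [one_smul] at hLx1
    obtain ⟨k, P', Q', hP', hQ', hne, hy'⟩ := exists_avg_ne_zero x hd hLx1 hQ hQ hQx
    obtain ⟨u, hu'⟩ := hdesc Q' L k
    have hreg := hu k Q' hQ' u hu'
    have hux : u (π x) ≠ 0 := by rwa [hu']
    filter_upwards [hreg.eventually_ne_zero hux] with z hz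
    obtain ⟨y, rfl⟩ := hs z
    rw [hu', avg] at hz
    obtain ⟨g, hg⟩ : ∃ g : A.G, eval (coords (g • y)) Q' ≠ 0 := by
      by_contra! hall
      exact hz (by simp [hall])
    have h1 : g • y ∈ π ⁻¹' V := hQy _ fun h0 => hg ((hy' _).1 h0).2
    have h2 : π y = π (g • y) := (hfib _ _).2 ⟨g, rfl⟩
    rw [h2]
    exact h1
  · obtain ⟨d, L, hd, hLx, hu⟩ := h x
    obtain ⟨e, P, Q, hP, hQ, hQx, hPQ⟩ := hf
    have hLx1 := hLx 1
    rw [one_smul] at hLx1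
    obtain ⟨k, P', Q', hP', hQ', hne, hy'⟩ := exists_avg_ne_zero x hd hLx1 hP hQ hQx
    obtain ⟨u, hu'⟩ := hdesc Q' L k
    obtain ⟨v, hv'⟩ := hdesc P' L k
    have hux : u (π x) ≠ 0 := by rwa [hu']
    have hru := hu k Q' hQ' u hu'
    have hrv := hu k P' hP' v hv'
    refine (hrv.div hru hux).congr ?_
    filter_upwards [hru.eventually_ne_zero hux] with z hz
    obtain ⟨y, rfl⟩ := hs z
    rw [div_eq_iff hz, hu', hv', avg, avg]
    let _ := Fintype.ofFinite A.G
    rw [finsum_eq_sum_of_fintype, finsum_eq_sum_of_fintype, Finset.mul_sum]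
    refine sum_congr rfl fun g _ => ?_
    rw [← mul_div_assoc]
    congr 1
    have h2 : π y = π (g • y) := (hfib _ _).2 ⟨g, rfl⟩
    rw [h2]
    by_cases h0 : eval (coords (g • y)) Q = 0
    · rw [((hy' _).1 h0).1, ((hy' _).1 h0).2, mul_zero]
    · have h3 : f (π (g • y)) = _ := hPQ _ h0
      rw [h3, div_mul_eq_mul_div, eq_div_iff h0, (hy' _).2, mul_comm]

theorem IsQuotient.exists_avg_eq {π : A.X → Y} (h : A.IsQuotient Y π)
    (P L : MvPolynomial A.X.σ ℂ) (k : ℕ) : ∃ u : Y → ℂ, ∀ y, u (π y) = A.avg P L k y := by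
  have hs := h.quotMap.surjective
  refine ⟨fun y => A.avg P L k (Function.surjInv hs y), fun y => ?_⟩
  obtain ⟨g, hg⟩ := h.eq_iff.1 (Function.surjInv_eq hs (π y))
  exact (avg_smul P L k g _).symm.trans (congrArg (A.avg P L k) hg)

/-- The quotient of an invariant locally closed subset. -/
theorem IsQuotient.sub {π : A.X → Y} (h : A.IsQuotient Y π) {S : Set Y} (hS : IsLocallyClosed S)
    {T : Set A.X} (hT : IsLocallyClosed T) (hG : ∀ (g : A.G) (x : A.X), x ∈ T → g • x ∈ T)
    (hTS : ∀ x, x ∈ T ↔ π x ∈ S) :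
    (A.sub T hT hG).IsQuotient (Y.sub S hS)
      (mapSub π hT hS fun x hx => (hTS x).1 hx) := by
  have hs := h.quotMap.surjective
  refine isQuotient_of_avg ?_ ?_ ?_ ?_
  · exact isRegular_mapSub h.quotMap.isRegular _
  · intro y
    obtain ⟨x, hx⟩ := hs (incl y)
    have hxT : x ∈ T := (hTS x).2 (hx ▸ incl_mem y)
    exact ⟨(toSub x hxT : A.X.sub T hT), incl_injective (X := Y) (hZ := hS) hx⟩
  · intro x x'
    constructor
    · intro hxx
      obtain ⟨g, hg⟩ := h.eq_iff.1 (congrArg incl hxx)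
      exact ⟨g, incl_injective hg⟩
    · rintro ⟨g, rfl⟩
      exact incl_injective (h.map_smul g _).symm
  · intro (x : A.X.sub T hT)
    let _ := Fintype.ofFinite A.X.σ
    obtain ⟨L, hL, hLx⟩ : ∃ L : MvPolynomial A.X.σ ℂ, L.IsHomogeneous 1 ∧
        ∀ g : A.G, eval (coords (g • incl x)) L ≠ 0 := by
      obtain ⟨a, ha⟩ := exists_linear_ne_zero_of_finite (fun g : A.G => g • incl x)
      exact ⟨_, isHomogeneous_linear a, fun g => by rw [eval_linear]; exact ha g⟩
    refine ⟨1, L, one_pos, ?_, ?_⟩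
    · exact fun g => hLx g
    intro k P hP u hu
    obtain ⟨v, hv⟩ := h.exists_avg_eq P L k
    have hvr : RegularAt v (π (incl x)) := by
      rw [h.quotMap.2]
      simp only [hv]
      exact regularAt_avg (A := A) hP hL hLx
    have huv : u = fun y => v (incl y) := by
      funext y
      obtain ⟨z, hz⟩ := hs (incl y)
      have hzT : z ∈ T := (hTS z).2 (hz ▸ incl_mem y)
      have h1 : y = mapSub π hT hS (fun x hx => (hTS x).1 hx) (toSub z hzT) :=
        incl_injective hz.symm
      have h2 := hu (toSub z hzT : A.X.sub T hT)
      rw [← h1] at h2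
      rw [h2, ← hz, hv]
      exact avg_sub hT hG P L k _
    rw [huv]
    exact RegularAt.incl hvr

/-! ### Products of quotients -/


section Pi

variable {ι : Type} [Fintype ι]

/-- The product of a finite family of varieties with group actions. -/
def pi (A : ι → GVar) : GVar where
  X := QPVar.pi fun i => (A i).X
  G := ∀ i, (A i).G
  action :=
    { smul := fun g z => (piEquiv fun i => (A i).X).symm
        fun i => g i • piEquiv (fun i => (A i).X) z i
      one_smul := fun z => by
        apply (piEquiv fun i => (A i).X).injective
        refine (Equiv.apply_symm_apply _ _).trans ?_
        funext i
        exact one_smul _ _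
      mul_smul := fun g h z => by
        apply (piEquiv fun i => (A i).X).injective
        refine (Equiv.apply_symm_apply _ _).trans ((Equiv.apply_symm_apply _ _).trans ?_).symm
        funext i
        refine (congrArg (g i • ·) (congrFun (Equiv.apply_symm_apply (piEquiv fun i => (A i).X) _) i)).trans ?_
        exact (mul_smul _ _ _).symm }
  isRegular_smul g := by
    refine isRegular_pi (X := fun i => (A i).X) fun i => ?_
    have h := ((A i).isRegular_smul (g i)).comp (isRegular_piEquiv_apply (fun i => (A i).X) i)
    exact (isRegular_congr fun z =>
      (congrFun (Equiv.apply_symm_apply (piEquiv fun i => (A i).X) _) i).symm).1 h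

/-- The components of a point of a product. -/
def proj {A : ι → GVar} (z : (pi A).X) (i : ι) : (A i).X := piEquiv (fun i => (A i).X) z i

theorem proj_smul {A : ι → GVar} (g : (pi A).G) (z : (pi A).X) (i : ι) :
    proj (g • z) i = g i • proj z i :=
  congrFun (Equiv.apply_symm_apply (piEquiv fun i => (A i).X) _) i

theorem proj_ext {A : ι → GVar} {z w : (pi A).X} (h : ∀ i, proj z i = proj w i) : z = w :=
  (piEquiv fun i => (A i).X).injective (funext h)

end Pi

end GVar

namespace QPVar

variable {ι : Type} [Fintype ι]

theorem exists_coords_eq_smul_segreVec {X : ι → QPVar} (z : QPVar.pi X) :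
    ∃ a : ℂ, a ≠ 0 ∧ coords z = a • segreVec (fun i => (piEquiv X z i).1) := by
  obtain ⟨x, rfl⟩ := (piEquiv X).symm.surjective z
  rw [Equiv.apply_symm_apply]
  exact ProjSpace.coords_point _ (segreVec_ne_zero _)

theorem segreVec_coords {X : ι → QPVar} (z : QPVar.pi X) (c : ∀ i, (X i).σ) :
    segreVec (fun i => (piEquiv X z i).1) c = ∏ i, coords (piEquiv X z i) (c i) := rfl

/-- A form on a product is a sum of products of forms on the factors. -/
theorem eval_segreVec {X : ι → QPVar} (z : QPVar.pi X)
    (P : MvPolynomial (∀ i, (X i).σ) ℂ) :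
    eval (segreVec (fun i => (piEquiv X z i).1)) P =
      ∑ m ∈ P.support, P.coeff m * ∏ i, eval (coords (piEquiv X z i))
        (m.prod fun c e => (MvPolynomial.X (c i) : MvPolynomial (X i).σ ℂ) ^ e) := by
  rw [eval_eq]
  refine sum_congr rfl fun m _ => ?_
  congr 1
  simp only [segreVec_coords, Finsupp.prod, map_prod, map_pow, eval_X, ← Finset.prod_pow]
  exact Finset.prod_comm

/-- The product of maps. -/
def piMap {X Y : ι → QPVar} (φ : ∀ i, X i → Y i) (z : QPVar.pi X) : QPVar.pi Y :=
  (piEquiv Y).symm fun i => φ i (piEquiv X z i)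

theorem piEquiv_piMap {X Y : ι → QPVar} (φ : ∀ i, X i → Y i) (z : QPVar.pi X) (i : ι) :
    piEquiv Y (piMap φ z) i = φ i (piEquiv X z i) :=
  congrFun (Equiv.apply_symm_apply (piEquiv Y) _) i

theorem isRegular_piMap {X Y : ι → QPVar} {φ : ∀ i, X i → Y i} (h : ∀ i, IsRegular (φ i)) :
    IsRegular (piMap φ) := by
  refine isRegular_pi fun i => ?_
  exact (isRegular_congr fun z => (piEquiv_piMap φ z i).symm).1
    ((h i).comp (isRegular_piEquiv_apply X i))

end QPVar

namespace GVar

section Pi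

variable {ι : Type} [Fintype ι] {A : ι → GVar} {Y : ι → QPVar}

/-- The product of maps from varieties with group actions. -/
def piProj (π : ∀ i, (A i).X → Y i) (z : (GVar.pi A).X) : QPVar.pi Y := piMap π z

theorem piEquiv_piProj (π : ∀ i, (A i).X → Y i) (z : (GVar.pi A).X) (i : ι) :
    piEquiv Y (piProj π z) i = π i (proj z i) := piEquiv_piMap π z i

theorem exists_proj_eq (x : ∀ i, (A i).X) : ∃ z : (GVar.pi A).X, ∀ i, proj z i = x i :=
  ⟨(piEquiv fun i => (A i).X).symm x, fun i => congrFun (Equiv.apply_symm_apply _ x) i⟩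

theorem surjective_piProj {π : ∀ i, (A i).X → Y i} (h : ∀ i, Surjective (π i)) :
    Surjective (piProj π) := by
  intro y
  choose x hx using fun i => h i (piEquiv Y y i)
  obtain ⟨z, hz⟩ := exists_proj_eq x
  exact ⟨z, (piEquiv Y).injective (funext fun i => by rw [piEquiv_piProj, hz, hx])⟩

/-- The product of quotients is the quotient of the product by the product of the groups. -/
theorem IsQuotient.pi {π : ∀ i, (A i).X → Y i} (h : ∀ i, (A i).IsQuotient (Y i) (π i)) :
    (GVar.pi A).IsQuotient (QPVar.pi Y) (piProj π) := by
  classical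
  have hs := surjective_piProj fun i => (h i).quotMap.surjective
  refine isQuotient_of_avg (isRegular_piMap fun i => (h i).quotMap.isRegular) hs ?_ ?_
  · intro x x'
    constructor
    · intro hxx
      have h1 : ∀ i, ∃ g : (A i).G, g • proj x i = proj x' i := fun i => by
        rw [← (h i).eq_iff]
        rw [← piEquiv_piProj π, ← piEquiv_piProj π, hxx]
      choose g hg using h1
      exact ⟨g, proj_ext fun i => (proj_smul _ _ _).trans (hg i)⟩
    · rintro ⟨g, rfl⟩
      refine (piEquiv Y).injective (funext fun i => ?_)
      rw [piEquiv_piProj, piEquiv_piProj, proj_smul, (h i).map_smul]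
  · intro x
    let _ := fun i => Fintype.ofFinite (A i).X.σ
    let _ := fun i => Fintype.ofFinite (A i).G
    choose a ha using fun i => exists_linear_ne_zero_of_finite (fun g : (A i).G => g • proj x i)
    set l : ∀ i, MvPolynomial (A i).X.σ ℂ := fun i => ∑ j, C (a i j) * MvPolynomial.X j with hl
    have hl1 : ∀ i, (l i).IsHomogeneous 1 := fun i => isHomogeneous_linear (a i)
    have hlx : ∀ i (g : (A i).G), eval (coords (g • proj x i)) (l i) ≠ 0 := fun i g => by
      rw [hl, eval_linear]; exact ha i g
    -- the form on the product that is the product of the linear forms `l i`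
    set L : MvPolynomial (∀ i, (A i).X.σ) ℂ :=
      ∑ c : ∀ i, (A i).X.σ, C (∏ i, a i (c i)) * MvPolynomial.X c with hLdef
    have hL : L.IsHomogeneous 1 := isHomogeneous_linear _
    have hLev : ∀ z : QPVar.pi fun i => (A i).X,
        eval (segreVec (fun i => (piEquiv (fun i => (A i).X) z i).1)) L =
          ∏ i, eval (coords (piEquiv (fun i => (A i).X) z i)) (l i) := by
      intro z
      rw [hLdef, eval_linear]
      simp only [hl, eval_linear, segreVec_coords]
      rw [Finset.prod_univ_sum, Fintype.piFinset_univ]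
      exact sum_congr rfl fun c _ => Finset.prod_mul_distrib.symm
    have hratio : ∀ (k : ℕ) (P : MvPolynomial (∀ i, (A i).X.σ) ℂ), P.IsHomogeneous (1 * k) →
        ∀ z : QPVar.pi fun i => (A i).X, eval (coords z) P / eval (coords z) L ^ k =
        ∑ m ∈ P.support, P.coeff m * ∏ i, (eval (coords (piEquiv (fun i => (A i).X) z i))
          (m.prod fun c e => (MvPolynomial.X (c i) : MvPolynomial (A i).X.σ ℂ) ^ e) /
            eval (coords (piEquiv (fun i => (A i).X) z i)) (l i) ^ k) := by
      intro k P hP z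
      obtain ⟨b, hb, hz⟩ := exists_coords_eq_smul_segreVec z
      rw [hz, ProjSpace.eval_smul hP, ProjSpace.eval_smul hL, mul_pow, ← pow_mul,
        mul_div_mul_left _ _ (pow_ne_zero _ hb), hLev, eval_segreVec, Finset.sum_div]
      refine sum_congr rfl fun m _ => ?_
      rw [mul_div_assoc, Finset.prod_div_distrib, Finset.prod_pow]
    -- averages on the product are sums of products of averages on the factors
    have havg : ∀ (k : ℕ) (P : MvPolynomial (∀ i, (A i).X.σ) ℂ), P.IsHomogeneous (1 * k) →
        ∀ z : (GVar.pi A).X, (GVar.pi A).avg P L k z =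
        ∑ m ∈ P.support, P.coeff m * ∏ i, (A i).avg
          (m.prod fun c e => (MvPolynomial.X (c i) : MvPolynomial (A i).X.σ ℂ) ^ e) (l i) k
            (proj z i) := by
      intro k P hP z
      have h1 : (GVar.pi A).avg P L k z = ∑ᶠ g : ∀ i, (A i).G,
          ∑ m ∈ P.support, P.coeff m * ∏ i, (eval (coords (g i • proj z i))
          (m.prod fun c e => (MvPolynomial.X (c i) : MvPolynomial (A i).X.σ ℂ) ^ e) /
            eval (coords (g i • proj z i)) (l i) ^ k) := by
        refine finsum_congr (α := ∀ i, (A i).G) fun g => ?_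
        refine (hratio k P hP _).trans ?_
        refine sum_congr rfl fun m _ => ?_
        congr 1
        refine prod_congr rfl fun i _ => ?_
        rw [show piEquiv (fun i => (A i).X) ((show (GVar.pi A).G from g) • z) i = g i • proj z i from
          proj_smul g z i]
      rw [h1, finsum_eq_sum_of_fintype, Finset.sum_comm]
      refine sum_congr rfl fun m _ => ?_
      rw [← Finset.mul_sum]
      congr 1
      simp only [avg, finsum_eq_sum_of_fintype]
      rw [Finset.prod_univ_sum, Fintype.piFinset_univ]
    have hL0 : ∀ z : QPVar.pi fun i => (A i).X,
        (∀ i, eval (coords (piEquiv (fun i => (A i).X) z i)) (l i) ≠ 0) →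
          eval (coords z) L ≠ 0 := by
      intro z hz
      obtain ⟨b, hb, hz'⟩ := exists_coords_eq_smul_segreVec z
      rw [hz', ProjSpace.eval_smul hL, hLev]
      exact mul_ne_zero (pow_ne_zero _ hb) (Finset.prod_ne_zero_iff.2 fun i _ => hz i)
    refine ⟨1, L, one_pos, ?_, ?_⟩
    · intro g
      refine hL0 (g • x) fun i => ?_
      rw [show piEquiv (fun i => (A i).X) (g • x) i = g i • proj x i from proj_smul g x i]
      exact hlx i (g i)
    · intro k (P : MvPolynomial (∀ i, (A i).X.σ) ℂ) hP u hu
      choose v hv using fun (m : (∀ i, (A i).X.σ) →₀ ℕ) i => (h i).exists_avg_eq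
        (m.prod fun c e => (MvPolynomial.X (c i) : MvPolynomial (A i).X.σ ℂ) ^ e) (l i) k
      have huv : u = fun y => ∑ m ∈ P.support, P.coeff m * ∏ i, v m i (piEquiv Y y i) := by
        funext y
        obtain ⟨z, rfl⟩ := hs y
        rw [hu]
        refine (havg k P hP z).trans ?_
        refine sum_congr rfl fun m _ => ?_
        congr 1
        refine prod_congr rfl fun i _ => ?_
        rw [piEquiv_piProj, hv]
      rw [huv]
      refine RegularAt.sum _ fun m hm => (regularAt_const _ _).mul (RegularAt.prod _ fun i _ => ?_)
      refine (isRegular_piEquiv_apply Y i).regularAt_comp (f := v m i) ?_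
      rw [piEquiv_piProj, (h i).quotMap.2]
      simp only [hv]
      refine regularAt_avg ?_ (hl1 i) (hlx i)
      have h3 := hP.degree_eq_sum_deg_support hm
      rw [h3]
      refine IsHomogeneous.prod _ _ _ fun c _ => ?_
      have h4 := (isHomogeneous_X ℂ (c i)).pow (m c)
      rw [one_mul] at h4
      exact h4

end Pi

section Prod

/-- The product of two quotients is the quotient of the product. -/
theorem IsQuotient.prod {A B : GVar} {Y Z : QPVar} {π : A.X → Y} {ρ : B.X → Z}
    (h : A.IsQuotient Y π) (h' : B.IsQuotient Z ρ) : (A.prod B).IsQuotient (Y.prod Z)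
      (fun z => (prodEquiv Y Z).symm (π (pr₁ z), ρ (pr₂ z))) := by
  let F : Bool → GVar := fun b => bif b then B else A
  let W : Bool → QPVar := fun b => bif b then Z else Y
  let τ : ∀ b, (F b).X → W b := fun b => match b with
    | true => ρ
    | false => π
  have hτ : (GVar.pi F).IsQuotient (QPVar.pi W) (piProj τ) := IsQuotient.pi fun b => by
    cases b
    · exact h
    · exact h'
  let e : (A.prod B).X → (GVar.pi F).X := fun z => (piEquiv fun b => (F b).X).symm fun b =>
    match b with
    | true => pr₂ z
    | false => pr₁ z
  have he : ∀ z b, piEquiv (fun b => (F b).X) (e z) b = match b with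
    | true => pr₂ z
    | false => pr₁ z := fun z b => congrFun (Equiv.apply_symm_apply _ _) b
  let e' : (GVar.pi F).X → (A.prod B).X := fun z => (prodEquiv A.X B.X).symm
    (proj z false, proj z true)
  have hpr : ∀ z, prodEquiv A.X B.X (e' z) = (proj z false, proj z true) := fun z =>
    Equiv.apply_symm_apply _ _
  have heq : IsQuotMap e := by
    refine isQuotMap_of_inverse (ψ := e') ?_ ?_ ?_ ?_
    · refine isRegular_pi (X := fun b => (F b).X) fun b => ?_
      simp only [he]
      cases b
      · exact isRegular_fst A.X B.X
      · exact isRegular_snd A.X B.X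
    · refine isRegular_prod ?_ ?_
      · simp only [hpr]
        exact isRegular_piEquiv_apply (fun b => (F b).X) false
      · simp only [hpr]
        exact isRegular_piEquiv_apply (fun b => (F b).X) true
    · intro z
      exact prod_ext ((congrArg Prod.fst (hpr _)).trans (he z false))
        ((congrArg Prod.snd (hpr _)).trans (he z true))
    · intro z
      refine proj_ext fun b => ?_
      refine (he _ b).trans ?_
      cases b
      · exact congrArg Prod.fst (hpr _)
      · exact congrArg Prod.snd (hpr _)
  have hq : IsQuotMap (X := QPVar.pi W) (Y := Y.prod Z) fun z => z :=
    isQuotMap_of_inverse (ψ := fun z => z) (isRegular_id _) (isRegular_id _) (fun _ => rfl)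
      fun _ => rfl
  refine isQuotient_iff.2 ⟨?_, ?_⟩
  · have h1 := hq.comp (hτ.quotMap.comp heq)
    refine (congrArg IsQuotMap (funext fun z => ?_)).mpr h1
    apply (prodEquiv Y Z).injective
    refine (Equiv.apply_symm_apply _ _).trans (Prod.ext ?_ ?_)
    · refine Eq.trans ?_ (piEquiv_piProj τ (e z) false).symm
      exact congrArg π (he z false).symm
    · refine Eq.trans ?_ (piEquiv_piProj τ (e z) true).symm
      exact congrArg ρ (he z true).symm
  · intro x x'
    rw [Equiv.apply_eq_iff_eq, Prod.mk.injEq, h.eq_iff, h'.eq_iff]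
    constructor
    · rintro ⟨⟨g, hg⟩, ⟨g', hg'⟩⟩
      exact ⟨(g, g'), prod_ext ((fst_smul _ _).trans hg) ((snd_smul _ _).trans hg')⟩
    · rintro ⟨g, rfl⟩
      exact ⟨⟨g.1, (fst_smul _ _).symm⟩, ⟨g.2, (snd_smul _ _).symm⟩⟩

end Prod

end GVar

/-! ### Invariants of a group permuting the variables -/

section Invariants

variable {τ G : Type} [Group G] [MulAction G τ]

/-- The algebra of the polynomials invariant under a group that permutes the variables. -/
def invariants (τ G : Type) [Group G] [MulAction G τ] : Subalgebra ℂ (MvPolynomial τ ℂ) where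
  carrier := {F | ∀ g : G, rename (g • ·) F = F}
  mul_mem' hF hF' g := by rw [map_mul, hF, hF']
  add_mem' hF hF' g := by rw [map_add, hF, hF']
  algebraMap_mem' c g := by rw [algebraMap_eq, rename_C]

/-- The action on polynomials by permutations of the variables. -/
abbrev renameAction (τ G : Type) [Group G] [MulAction G τ] :
    MulSemiringAction G (MvPolynomial τ ℂ) where
  smul g F := rename (g • ·) F
  one_smul F := by
    show rename (fun t : τ => (1 : G) • t) F = F
    simp only [one_smul]
    exact rename_id_apply F
  mul_smul g h F := by
    show rename (fun t : τ => (g * h) • t) F = rename (g • ·) (rename (h • ·) F)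
    rw [rename_rename]
    congr 2
    funext t
    exact mul_smul g h t
  smul_zero g := map_zero _
  smul_add g := map_add _
  smul_one g := map_one _
  smul_mul g := map_mul _

theorem isIntegral_invariants [Finite G] :
    Algebra.IsIntegral (invariants τ G) (MvPolynomial τ ℂ) := by
  let _ := renameAction τ G
  have : Algebra.IsInvariant (invariants τ G) (MvPolynomial τ ℂ) G := ⟨fun b hb => ⟨⟨b, hb⟩, rfl⟩⟩
  exact Algebra.IsInvariant.isIntegral _ _ G

theorem fg_invariants [Finite τ] [Finite G] : (⊤ : Subalgebra ℂ (invariants τ G)).FG := by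
  have := isIntegral_invariants (τ := τ) (G := G)
  have : Algebra.FiniteType (invariants τ G) (MvPolynomial τ ℂ) :=
    Algebra.FiniteType.of_restrictScalars_finiteType ℂ _ _
  have hf : Module.Finite (invariants τ G) (MvPolynomial τ ℂ) := Algebra.IsIntegral.finite
  exact fg_of_fg_of_fg ℂ (invariants τ G) (MvPolynomial τ ℂ) Algebra.FiniteType.out hf.fg_top
    Subtype.val_injective

theorem homogeneousComponent_mem_invariants {F : MvPolynomial τ ℂ} (hF : F ∈ invariants τ G)
    (n : ℕ) : homogeneousComponent n F ∈ invariants τ G := by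
  intro g
  have h1 : ∀ m, (rename (g • ·) (homogeneousComponent m F)).IsHomogeneous m := fun m =>
    (homogeneousComponent_isHomogeneous m F).rename_isHomogeneous
  have h2 : homogeneousComponent n (rename (g • ·) F) =
      rename (g • ·) (homogeneousComponent n F) := by
    conv_lhs => rw [← sum_homogeneousComponent F]
    rw [map_sum, map_sum]
    simp_rw [homogeneousComponent_of_mem (h1 _)]
    rw [Finset.sum_ite_eq]
    split_ifs with h
    · rfl
    · rw [homogeneousComponent_eq_zero, map_zero]
      simpa using h
  rw [← h2, hF g]

/-- The positive-degree components of generators of the algebra of invariants generate it. -/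
theorem exists_homogeneous_generators [Finite τ] [Finite G] :
    ∃ (ι : Type) (_ : Fintype ι) (f : ι → MvPolynomial τ ℂ) (n : ι → ℕ),
      (∀ i, 0 < n i) ∧ (∀ i, (f i).IsHomogeneous (n i)) ∧ (∀ i, f i ∈ invariants τ G) ∧
      ∀ F ∈ invariants τ G, F ∈ Algebra.adjoin ℂ (Set.range f) := by
  classical
  obtain ⟨t, ht⟩ := fg_invariants (τ := τ) (G := G)
  let S : Finset ((invariants τ G) × ℕ) :=
    t.biUnion fun a => (Finset.range (a.1.totalDegree + 1)).image fun m => (a, m)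
  let ι := {p : (invariants τ G) × ℕ // p ∈ S ∧ 0 < p.2}
  have : Finite ι := Finite.of_injective (fun p : ι => (⟨p.1, p.2.1⟩ : S))
    fun p q h => Subtype.ext (congrArg (fun x : S => x.1) h)
  let f : ι → MvPolynomial τ ℂ := fun p => homogeneousComponent p.1.2 p.1.1.1
  refine ⟨ι, Fintype.ofFinite ι, f, fun p => p.1.2, fun p => p.2.2,
    fun p => homogeneousComponent_isHomogeneous _ _,
    fun p => homogeneousComponent_mem_invariants p.1.1.2 _, fun F hF => ?_⟩
  have h1 : ∀ a ∈ t, a.1 ∈ Algebra.adjoin ℂ (Set.range f) := by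
    intro a ha
    rw [← sum_homogeneousComponent a.1]
    refine Subalgebra.sum_mem _ fun m hm => ?_
    rcases Nat.eq_zero_or_pos m with rfl | hm0
    · rw [homogeneousComponent_zero]
      exact Subalgebra.algebraMap_mem _ _
    · exact Algebra.subset_adjoin ⟨⟨(a, m), Finset.mem_biUnion.2 ⟨a, ha,
        Finset.mem_image_of_mem _ hm⟩, hm0⟩, rfl⟩
  have h2 : (⟨F, hF⟩ : invariants τ G) ∈ Algebra.adjoin ℂ (t : Set (invariants τ G)) := by
    rw [ht]; trivial
  have h3 : Algebra.adjoin ℂ (t : Set (invariants τ G)) ≤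
      (Algebra.adjoin ℂ (Set.range f)).comap (invariants τ G).val :=
    Algebra.adjoin_le fun a ha => h1 a ha
  exact h3 h2

theorem le_of_sum_mul_eq {ι : Type*} [Fintype ι] {k n : ι → ℕ} {d : ℕ} (hn : ∀ i, 0 < n i)
    (h : ∑ i, k i * n i = d) (i : ι) : k i ≤ d :=
  h ▸ (Nat.le_mul_of_pos_right _ (hn i)).trans (Finset.single_le_sum (f := fun i => k i * n i)
    (fun _ _ => Nat.zero_le _) (Finset.mem_univ i))

theorem sum_sub_mul_add {ι : Type*} [Fintype ι] {a b : ι → ℕ} (h : ∀ i, b i ≤ a i) (n : ι → ℕ) :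
    ∑ i, (a i - b i) * n i + ∑ i, b i * n i = ∑ i, a i * n i := by
  rw [← Finset.sum_add_distrib]
  exact sum_congr rfl fun i _ => by rw [← add_mul, Nat.sub_add_cancel (h i)]

/-- An exponent vector whose weighted degree is large contains one of weighted degree `m * L`. -/
theorem exists_le_weight_eq {ι : Type} [Fintype ι] (n : ι → ℕ) (hn : ∀ i, 0 < n i) {L : ℕ}
    (hL : ∀ i, n i ∣ L) (m : ℕ) (a : ι → ℕ)
    (ha : (Fintype.card ι + 1) * L + m * L ≤ ∑ i, a i * n i + L) :
    ∃ b : ι → ℕ, (∀ i, b i ≤ a i) ∧ ∑ i, b i * n i = m * L := by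
  classical
  induction m with
  | zero => exact ⟨fun _ => 0, fun i => Nat.zero_le _, by simp⟩
  | succ m ih =>
    obtain ⟨b, hb, hbm⟩ := ih (le_trans (by nlinarith) ha)
    have hsplit := sum_sub_mul_add hb n
    rcases Nat.eq_zero_or_pos L with rfl | hLpos
    · exact ⟨b, hb, by simpa using hbm⟩
    obtain ⟨i, hi⟩ : ∃ i, L ≤ (a i - b i) * n i := by
      by_contra! hall
      have h1 : ∑ i, (a i - b i) * n i ≤ ∑ _i : ι, L := Finset.sum_le_sum fun i _ => (hall i).le
      rw [Finset.sum_const, Finset.card_univ, smul_eq_mul] at h1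
      rcases isEmpty_or_nonempty ι with h | ⟨⟨i⟩⟩
      · simp at ha
        nlinarith
      · have h2 : ∑ i, (a i - b i) * n i < ∑ _i : ι, L :=
          Finset.sum_lt_sum (fun i _ => (hall i).le) ⟨i, Finset.mem_univ i, hall i⟩
        rw [Finset.sum_const, Finset.card_univ, smul_eq_mul] at h2
        nlinarith
    obtain ⟨q, hq⟩ := hL i
    have hqa : q ≤ a i - b i := by
      rw [hq, mul_comm] at hi
      exact Nat.le_of_mul_le_mul_right hi (hn i)
    refine ⟨Function.update b i (b i + q), fun j => ?_, ?_⟩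
    · by_cases hj : j = i
      · subst hj; rw [Function.update_self]; have := hb j; omega
      · rw [Function.update_of_ne hj]; exact hb j
    · have h3 : ∀ j, Function.update b i (b i + q) j * n j = b j * n j + if j = i then L else 0 := by
        intro j
        by_cases hj : j = i
        · subst hj; rw [Function.update_self, if_pos rfl, hq]; ring
        · rw [Function.update_of_ne hj, if_neg hj, add_zero]
      simp_rw [h3]
      rw [Finset.sum_add_distrib, hbm, Finset.sum_ite_eq', if_pos (Finset.mem_univ i)]
      ring

/-- In a suitable degree `d` the invariant forms generate all invariant forms of degrees divisible
by `d`. -/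
theorem exists_veronese (τ G : Type) [Finite τ] [Group G] [Finite G] [MulAction G τ] :
    ∃ (d : ℕ) (ρ : Type) (_ : Finite ρ) (Φ : ρ → MvPolynomial τ ℂ), 0 < d ∧
      (∀ j, (Φ j).IsHomogeneous d) ∧ (∀ j, Φ j ∈ invariants τ G) ∧
      ∀ (k : ℕ) (F : MvPolynomial τ ℂ), F.IsHomogeneous (d * k) → F ∈ invariants τ G →
        ∃ W : MvPolynomial ρ ℂ, W.IsHomogeneous k ∧ bind₁ Φ W = F := by
  classical
  obtain ⟨ι, _, f, n, hn, hfh, hfi, hgen⟩ := exists_homogeneous_generators (τ := τ) (G := G)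
  set L := ∏ i, n i with hLdef
  have hL : ∀ i, n i ∣ L := fun i => Finset.dvd_prod_of_mem n (Finset.mem_univ i)
  have hLpos : 0 < L := Finset.prod_pos fun i _ => hn i
  -- a monomial of degree at least `2 * d` in the generators has a factor of degree exactly `d`: some
  -- `f i` occurs with a power of degree at least `L`, and factors of degree `L` are collected
  set d := (Fintype.card ι + 1) * L with hd
  have hdpos : 0 < d := Nat.mul_pos (Nat.succ_pos _) hLpos
  let mon : (ι → ℕ) → MvPolynomial τ ℂ := fun a => ∏ i, f i ^ a i
  have hmonh : ∀ a, (mon a).IsHomogeneous (∑ i, a i * n i) := fun a =>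
    IsHomogeneous.prod _ _ _ fun i _ => by rw [mul_comm]; exact (hfh i).pow (a i)
  let ρ := {a : ι → Fin (d + 1) // ∑ i, (a i : ℕ) * n i = d}
  let Φ : ρ → MvPolynomial τ ℂ := fun a => mon fun i => a.1 i
  have hΦ : ∀ b : ι → ℕ, ∑ i, b i * n i = d → ∃ j, Φ j = mon b := by
    intro b hb
    have hbd : ∀ i, b i < d + 1 := fun i => Nat.lt_succ_of_le (le_of_sum_mul_eq hn hb i)
    exact ⟨⟨fun i => ⟨b i, hbd i⟩, hb⟩, rfl⟩
  have hmon : ∀ (k : ℕ) (a : ι → ℕ), ∑ i, a i * n i = d * k →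
      ∃ W : MvPolynomial ρ ℂ, W.IsHomogeneous k ∧ bind₁ Φ W = mon a := by
    intro k
    induction k with
    | zero =>
      intro a ha
      refine ⟨1, isHomogeneous_one _ _, ?_⟩
      rw [map_one]
      refine (Finset.prod_eq_one fun i _ => ?_).symm
      have h1 := (Finset.sum_eq_zero_iff.1 (ha.trans (mul_zero d))) i (Finset.mem_univ i)
      rw [(mul_eq_zero.1 h1).resolve_right (hn i).ne', pow_zero]
    | succ k ih =>
      intro a ha
      obtain ⟨b, hba, hbd⟩ : ∃ b : ι → ℕ, (∀ i, b i ≤ a i) ∧ ∑ i, b i * n i = d := by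
        rcases Nat.eq_zero_or_pos k with rfl | hk
        · exact ⟨a, fun i => le_rfl, by simpa using ha⟩
        · obtain ⟨b, hb, hb'⟩ := exists_le_weight_eq n hn hL (Fintype.card ι + 1) a (by
            rw [ha, ← hd]; nlinarith)
          exact ⟨b, hb, hb'⟩
      have hsplit := sum_sub_mul_add hba n
      obtain ⟨W, hW, hWm⟩ := ih (fun i => a i - b i) (by
        rw [hbd, ha] at hsplit; rw [mul_add, mul_one] at hsplit; exact Nat.add_right_cancel hsplit)
      obtain ⟨j, hj⟩ := hΦ b hbd
      refine ⟨W * MvPolynomial.X j, hW.mul (isHomogeneous_X _ _), ?_⟩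
      rw [map_mul, bind₁_X_right, hWm, hj]
      show (∏ i, f i ^ (a i - b i)) * (∏ i, f i ^ b i) = ∏ i, f i ^ a i
      rw [← Finset.prod_mul_distrib]
      exact prod_congr rfl fun i _ => by rw [← pow_add, Nat.sub_add_cancel (hba i)]
  refine ⟨d, ρ, inferInstance, Φ, hdpos, fun j => ?_, fun j => ?_, fun k F hF hFi => ?_⟩
  · have := hmonh fun i => j.1 i
    rw [j.2] at this
    exact this
  · exact Subalgebra.prod_mem _ fun i _ => Subalgebra.pow_mem _ (hfi i) _
  · have h1 := hgen F hFi
    rw [Algebra.adjoin_range_eq_range_aeval] at h1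
    obtain ⟨V, hV⟩ := h1
    have hV' : F = ∑ a ∈ V.support, C (V.coeff a) * mon a := by
      rw [← hV]
      show aeval f V = _
      rw [aeval_def, eval₂_eq']
      rfl
    have hcomp : F = ∑ a ∈ V.support, if ∑ i, a i * n i = d * k then C (V.coeff a) * mon a else 0 := by
      have h2 : homogeneousComponent (d * k) F = F := by
        rw [homogeneousComponent_of_mem hF, if_pos rfl]
      rw [← h2]
      conv_lhs => rw [hV']
      rw [map_sum]
      refine sum_congr rfl fun a _ => ?_
      rw [homogeneousComponent_C_mul, homogeneousComponent_of_mem (hmonh a)]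
      by_cases h : ∑ i, a i * n i = d * k
      · rw [if_pos h, if_pos h.symm]
      · rw [if_neg h, if_neg fun h' => h h'.symm, mul_zero]
    choose W hW hWm using hmon k
    refine ⟨∑ a ∈ V.support, if h : ∑ i, a i * n i = d * k then C (V.coeff a) * W a h else 0,
      IsHomogeneous.sum _ _ _ fun a _ => ?_, ?_⟩
    · split_ifs with h
      · simpa using (isHomogeneous_C ρ (V.coeff a)).mul (hW a h)
      · exact isHomogeneous_zero _ _ _
    · rw [hcomp, map_sum]
      refine sum_congr rfl fun a _ => ?_
      split_ifs with h
      · rw [map_mul, bind₁_C_right, hWm]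
      · exact map_zero _

/-- The image of the map given by forms generating the invariants in the degrees divisible by `d`
is the zero locus of the relations between these forms. -/
theorem exists_eval_eq_of_relations {τ G ρ : Type} [Finite τ] [Group G] [Finite G] [Finite ρ]
    [MulAction G τ] {d : ℕ} (hd : 0 < d) {Φ : ρ → MvPolynomial τ ℂ}
    (hΦ : ∀ j, (Φ j).IsHomogeneous d)
    (hgen : ∀ (k : ℕ) (F : MvPolynomial τ ℂ), F.IsHomogeneous (d * k) → F ∈ invariants τ G →
        ∃ W : MvPolynomial ρ ℂ, W.IsHomogeneous k ∧ bind₁ Φ W = F)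
    (z : ρ → ℂ) (hz : ∀ (k : ℕ) (W : MvPolynomial ρ ℂ), W.IsHomogeneous k → bind₁ Φ W = 0 →
      eval z W = 0) :
    ∃ v : τ → ℂ, ∀ j, eval v (Φ j) = z j := by
  let θ : MvPolynomial ρ ℂ →+* MvPolynomial τ ℂ := (bind₁ Φ).toRingHom
  let _ : Algebra (MvPolynomial ρ ℂ) (MvPolynomial τ ℂ) := θ.toAlgebra
  have hθ : ∀ W, algebraMap (MvPolynomial ρ ℂ) (MvPolynomial τ ℂ) W = bind₁ Φ W := fun _ => rfl
  have hinv : ∀ F ∈ invariants τ G, IsIntegral (MvPolynomial ρ ℂ) F := by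
    intro F hF
    rw [← sum_homogeneousComponent F]
    refine IsIntegral.sum _ fun m _ => ?_
    obtain ⟨W, -, hW⟩ := hgen m (homogeneousComponent m F ^ d)
      (by rw [mul_comm]; exact (homogeneousComponent_isHomogeneous m F).pow d)
      (Subalgebra.pow_mem _ (homogeneousComponent_mem_invariants hF m) d)
    refine IsIntegral.of_pow hd ?_
    rw [← hW, ← hθ]
    exact isIntegral_algebraMap
  -- lying over turns the point `z` into a maximal ideal of `ℂ[τ]`, that is, into a point
  have hint : Algebra.IsIntegral (MvPolynomial ρ ℂ) (MvPolynomial τ ℂ) := by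
    refine ⟨fun F => ?_⟩
    obtain ⟨p, hp, hpF⟩ := (isIntegral_invariants (τ := τ) (G := G)).isIntegral F
    let ic := integralClosure (MvPolynomial ρ ℂ) (MvPolynomial τ ℂ)
    let j : invariants τ G →+* ic := (invariants τ G).val.toRingHom.codRestrict ic
      fun a => hinv a.1 a.2
    have h2 : IsIntegral ic F := ⟨p.map j, hp.map j, by rw [Polynomial.eval₂_map]; exact hpF⟩
    exact isIntegral_trans F h2
  have hmax : (vanishingIdeal ℂ {z} : Ideal (MvPolynomial ρ ℂ)).IsMaximal := inferInstance
  obtain ⟨M, hM, hMz⟩ := Ideal.exists_ideal_over_maximal_of_isIntegral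
    (S := MvPolynomial τ ℂ) (vanishingIdeal ℂ {z} : Ideal (MvPolynomial ρ ℂ)) (by
      intro W hW
      rw [mem_vanishingIdeal_singleton_iff]
      have hW' : bind₁ Φ W = 0 := hW
      have hcomp : ∀ m, bind₁ Φ (homogeneousComponent m W) = 0 := by
        intro m
        have h1 : ∀ i, (bind₁ Φ (homogeneousComponent i W)).IsHomogeneous (d * i) := fun i =>
          (homogeneousComponent_isHomogeneous i W).aeval Φ hΦ
        have h2 := congrArg (homogeneousComponent (d * m)) hW'
        conv_lhs at h2 => rw [← sum_homogeneousComponent W]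
        rw [map_sum, map_sum, map_zero] at h2
        simp_rw [homogeneousComponent_of_mem (h1 _), Nat.mul_right_inj hd.ne'] at h2
        rw [Finset.sum_ite_eq] at h2
        split_ifs at h2 with h
        · exact h2
        · rw [homogeneousComponent_eq_zero, map_zero]
          simpa using h
      rw [← sum_homogeneousComponent W, map_sum]
      exact Finset.sum_eq_zero fun m _ =>
        hz m _ (homogeneousComponent_isHomogeneous m W) (hcomp m))
  obtain ⟨v, rfl⟩ := isMaximal_iff_eq_vanishingIdeal_singleton.1 hM
  refine ⟨v, fun j => ?_⟩
  have h1 : (MvPolynomial.X j - C (z j) : MvPolynomial ρ ℂ) ∈ vanishingIdeal ℂ {z} := by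
    rw [mem_vanishingIdeal_singleton_iff]
    simp
  rw [← hMz, Ideal.mem_comap, hθ, mem_vanishingIdeal_singleton_iff, map_sub, bind₁_X_right,
    bind₁_C_right] at h1
  simpa [sub_eq_zero] using h1

end Invariants

/-! ### Quotients of projective space by permutations of the coordinates -/

/-- The projective space as a variety. -/
abbrev projVar (τ : Type) [Finite τ] : QPVar where
  σ := τ
  carrier := Set.univ
  isLocallyClosed := isOpen_univ.isLocallyClosed

theorem comp_smul_ne_zero {τ G : Type} [Group G] [MulAction G τ] {v : τ → ℂ} (hv : v ≠ 0) (g : G) :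
    (fun t => v (g⁻¹ • t)) ≠ 0 := by
  obtain ⟨t, ht⟩ := Function.ne_iff.1 hv
  exact Function.ne_iff.2 ⟨g • t, by simpa using ht⟩

/-- The projective space with the action of a group by permutations of the coordinates. -/
def permSpace (τ G : Type) [Finite τ] [Group G] [Finite G] [MulAction G τ] : GVar where
  X := projVar τ
  G := G
  action :=
    { smul := fun g p => ⟨ProjSpace.point _ (comp_smul_ne_zero (coords_ne_zero p) g), trivial⟩
      one_smul := fun p => by
        apply Subtype.ext
        show ProjSpace.point (fun t => coords p ((1 : G)⁻¹ • (t : τ))) _ = p.1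
        rw [← p.1.point_coords, ProjSpace.point_eq_iff]
        refine ⟨1, ?_⟩
        simp only [inv_one, one_smul]
        rfl
      mul_smul := fun g h p => by
        apply Subtype.ext
        refine (ProjSpace.point_eq_iff _ _ _ _).2 ?_
        obtain ⟨a, ha, hc⟩ := ProjSpace.coords_point _ (comp_smul_ne_zero (coords_ne_zero p) h)
        refine ⟨a⁻¹, funext fun t => ?_⟩
        have h1 := congrFun hc (g⁻¹ • (t : τ))
        refine (congrArg (a⁻¹ * ·) h1).trans ?_
        show a⁻¹ * (a * coords p (h⁻¹ • g⁻¹ • t)) = coords p ((g * h)⁻¹ • t)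
        rw [inv_mul_cancel_left₀ ha, mul_inv_rev, mul_smul] }
  isRegular_smul g := by
    intro p
    refine ⟨1, fun t => MvPolynomial.X (g⁻¹ • t), fun t => isHomogeneous_X _ _, ?_, fun q hq => ?_⟩
    · simpa only [eval_X] using comp_smul_ne_zero (coords_ne_zero p) g
    · simp only [eval_X]
      rfl

section

variable {τ G : Type} [Group G] [Finite G] [MulAction G τ]

theorem sum_rename_mem_invariants (P : MvPolynomial τ ℂ) :
    ∑ᶠ g : G, rename (g • ·) P ∈ invariants τ G := by
  let _ := Fintype.ofFinite G
  intro h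
  rw [finsum_eq_sum_of_fintype, map_sum]
  refine Fintype.sum_equiv (Equiv.mulLeft h) _ _ fun g => ?_
  rw [rename_rename]
  congr 2
  funext t
  exact (mul_smul h g t).symm

theorem isHomogeneous_sum_rename {P : MvPolynomial τ ℂ} {d : ℕ} (hP : P.IsHomogeneous d) :
    (∑ᶠ g : G, rename (g • ·) P).IsHomogeneous d := by
  let _ := Fintype.ofFinite G
  rw [finsum_eq_sum_of_fintype]
  exact IsHomogeneous.sum _ _ _ fun g _ => hP.rename_isHomogeneous

theorem eval_bind₁_smul {τ ρ : Type} (Φ : ρ → MvPolynomial τ ℂ) (W : MvPolynomial ρ ℂ) (v : τ → ℂ) :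
    eval v (bind₁ Φ W) = eval (fun j => eval v (Φ j)) W :=
  eval₂Hom_bind₁ (RingHom.id ℂ) _ _ _

end

section PermSpace

variable {τ G : Type} [Finite τ] [Group G] [Finite G] [MulAction G τ]

/-- The homogeneous coordinates of a point of `permSpace τ G`. -/
def permVec (p : (permSpace τ G).X) : τ → ℂ := coords p

/-- The action of `G` on `permSpace τ G`. -/
def permAct (g : G) (p : (permSpace τ G).X) : (permSpace τ G).X :=
  (show (permSpace τ G).G from g) • p

theorem permVec_permAct (g : G) (p : (permSpace τ G).X) : ∃ a : ℂ, a ≠ 0 ∧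
    permVec (permAct g p) = a • fun t => permVec p (g⁻¹ • t) :=
  ProjSpace.coords_point (σ := τ) _ (comp_smul_ne_zero (τ := τ) (coords_ne_zero p) g)

theorem eval_permAct {e : ℕ} {P : MvPolynomial τ ℂ} (hP : P.IsHomogeneous e) {g : G}
    {p : (permSpace τ G).X} {a : ℂ} (ha : permVec (permAct g p) = a • fun t => permVec p (g⁻¹ • t)) :
    eval (permVec (permAct g p)) P = a ^ e * eval (permVec p) (rename (g⁻¹ • · : τ → τ) P) := by
  rw [ha, ProjSpace.eval_smul hP, eval_rename (σ := τ) (τ := τ)]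
  rfl

theorem avg_permSpace {d k : ℕ} {P F : MvPolynomial τ ℂ} (hP : P.IsHomogeneous (d * k))
    (hF : F.IsHomogeneous d) (hFi : F ∈ invariants τ G) (y : (permSpace τ G).X) :
    (permSpace τ G).avg P F k y =
      eval (permVec y) (∑ᶠ g : G, rename (g • ·) P) / eval (permVec y) F ^ k := by
  let _ := Fintype.ofFinite G
  have h1 : (permSpace τ G).avg P F k y = ∑ᶠ g : G,
      eval (permVec y) (rename (g⁻¹ • ·) P) / eval (permVec y) F ^ k := by
    refine finsum_congr (α := G) fun g => ?_
    obtain ⟨a, ha, hc⟩ := permVec_permAct g y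
    refine (congrArg₂ (fun u v => u / v ^ k) (eval_permAct hP hc) (eval_permAct hF hc)).trans ?_
    rw [hFi g⁻¹, mul_pow, ← pow_mul, mul_div_mul_left _ _ (pow_ne_zero _ ha)]
  rw [h1, finsum_eq_sum_of_fintype, finsum_eq_sum_of_fintype, ← Finset.sum_div, map_sum]
  congr 1
  exact Fintype.sum_equiv (Equiv.inv G) _ _ fun g => rfl

/-- The quotient of the projective space by a group permuting the coordinates: the map given by
the invariant forms of a suitable degree. -/
theorem exists_isQuotient_permSpace (τ G : Type) [Finite τ] [Group G] [Finite G] [MulAction G τ] :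
    ∃ (Y : QPVar) (π : (permSpace τ G).X → Y), (permSpace τ G).IsQuotient Y π := by
  classical
  obtain ⟨d, ρ, _, Φ, hd, hΦ, hΦi, hgen⟩ := exists_veronese τ G
  let _ := Fintype.ofFinite G
  have hpow : ∀ (k : ℕ) (P : MvPolynomial τ ℂ), P.IsHomogeneous (d * k) →
      ∃ W : MvPolynomial ρ ℂ, W.IsHomogeneous k ∧ bind₁ Φ W = ∑ᶠ g : G, rename (g • ·) P :=
    fun k P hP => hgen k _ (isHomogeneous_sum_rename hP) (sum_rename_mem_invariants P)
  -- the generating forms have no common zero: the norm of a linear form is an invariant form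
  have hne : ∀ p : (permSpace τ G).X, (fun j => eval (permVec p) (Φ j)) ≠ 0 := by
    intro p h0
    let _ : Fintype (projVar τ).σ := Fintype.ofFinite τ
    obtain ⟨a, ha⟩ := exists_linear_ne_zero_of_finite (X := projVar τ)
      (fun g : G => permAct g p)
    set l : MvPolynomial τ ℂ := ∑ t : (projVar τ).σ, C (a t) * MvPolynomial.X t with hl
    have hl1 : l.IsHomogeneous 1 := isHomogeneous_linear a
    set N : MvPolynomial τ ℂ := ∏ g : G, rename (g • ·) l with hN
    have hNi : N ∈ invariants τ G := by
      intro h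
      rw [hN, map_prod]
      refine Fintype.prod_equiv (Equiv.mulLeft h) _ _ fun g => ?_
      rw [rename_rename]
      congr 2
      funext t
      exact (mul_smul h g t).symm
    have hNh : N.IsHomogeneous (Fintype.card G) := by
      have := IsHomogeneous.prod Finset.univ (fun g : G => rename (g • ·) l) (fun _ => 1)
        fun g _ => hl1.rename_isHomogeneous
      simpa using this
    have hN0 : eval (permVec p) N ≠ 0 := by
      rw [hN, map_prod]
      refine Finset.prod_ne_zero_iff.2 fun g _ h1 => ha g⁻¹ ?_
      obtain ⟨c, hc, hcc⟩ := permVec_permAct g⁻¹ p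
      refine (eval_linear a _).symm.trans ?_
      refine (eval_permAct hl1 hcc).trans ?_
      rw [inv_inv, h1, mul_zero]
    obtain ⟨W, hW, hWN⟩ := hgen (Fintype.card G) (N ^ d)
      (by rw [mul_comm]; exact hNh.pow d) (Subalgebra.pow_mem _ hNi d)
    have h1 := congrArg (eval (permVec p)) hWN
    rw [eval_bind₁_smul, h0, map_pow] at h1
    have h2 : eval ((0 : ℂ) • (0 : ρ → ℂ)) W = 0 := by
      rw [ProjSpace.eval_smul hW, zero_pow Fintype.card_ne_zero, zero_mul]
    rw [zero_smul] at h2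
    exact pow_ne_zero d hN0 (h1.symm.trans h2)
  let φ : (permSpace τ G).X → ProjSpace ρ := fun p => ProjSpace.point _ (hne p)
  have hφc : ∀ p, ∃ c : ℂ, c ≠ 0 ∧ (φ p).coords = c • fun j => eval (permVec p) (Φ j) := fun p =>
    ProjSpace.coords_point _ (hne p)
  have hclosed : IsClosed (Set.range φ) := by
    have : Set.range φ = ⋂ (k : ℕ) (W : MvPolynomial ρ ℂ) (_ : W.IsHomogeneous k)
        (_ : bind₁ Φ W = 0), {z : ProjSpace ρ | eval z.coords W ≠ 0}ᶜ := by
      ext z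
      simp only [Set.mem_iInter, Set.mem_compl_iff, Set.mem_ofPred_eq, not_not]
      constructor
      · rintro ⟨p, rfl⟩ k W hW hW0
        obtain ⟨c, hc, hcc⟩ := hφc p
        rw [hcc, ProjSpace.eval_smul hW, ← eval_bind₁_smul, hW0, map_zero, mul_zero]
      · intro hz
        obtain ⟨v, hv⟩ := exists_eval_eq_of_relations hd hΦ hgen z.coords hz
        have hv' : (fun j => eval v (Φ j)) = z.coords := funext hv
        have hv0 : v ≠ 0 := by
          rintro rfl
          refine z.coords_ne_zero (hv' ▸ funext fun j => ?_)
          have := ProjSpace.eval_smul (hΦ j) 0 0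
          rwa [zero_smul, zero_pow hd.ne', zero_mul] at this
        refine ⟨⟨ProjSpace.point v hv0, trivial⟩, ?_⟩
        rw [← z.point_coords]
        refine (ProjSpace.point_eq_iff _ _ _ _).2 ?_
        obtain ⟨c, hc, hcc⟩ := ProjSpace.coords_point v hv0
        refine ⟨c ^ d, funext fun j => ?_⟩
        refine Eq.trans ?_ (congrArg (fun w => eval w (Φ j)) hcc).symm
        rw [ProjSpace.eval_smul (hΦ j), hv j]
        rfl
    rw [this]
    exact isClosed_iInter fun k => isClosed_iInter fun W => isClosed_iInter fun hW =>
      isClosed_iInter fun _ => (ProjSpace.isOpen_basic hW).isClosed_compl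
  let Y : QPVar := ⟨ρ, Set.range φ, hclosed.isLocallyClosed⟩
  let π : (permSpace τ G).X → Y := fun p => ⟨φ p, p, rfl⟩
  have hπreg : IsRegular π := fun p => ⟨d, Φ, hΦ, hne p, fun q _ => rfl⟩
  have hπc : ∀ p, ∃ c : ℂ, c ≠ 0 ∧ coords (π p) = c • fun j => eval (permVec p) (Φ j) := hφc
  have hsurj : Surjective π := by
    rintro ⟨_, p, rfl⟩
    exact ⟨p, rfl⟩
  have hΦ0 : ∀ p, ∃ j, eval (permVec p) (Φ j) ≠ 0 := fun p => Function.ne_iff.1 (hne p)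
  have hΦsmul : ∀ (j : ρ) (g : G) (p : (permSpace τ G).X),
      eval (permVec p) (Φ j) ≠ 0 → eval (permVec (permAct g p)) (Φ j) ≠ 0 := by
    intro j g p hp
    obtain ⟨c, hc, hcc⟩ := permVec_permAct g p
    rw [eval_permAct (hΦ j) hcc, hΦi j]
    exact mul_ne_zero (pow_ne_zero _ hc) hp
  refine ⟨Y, π, GVar.isQuotient_of_avg hπreg hsurj (fun x x' => ⟨fun hxx => ?_, ?_⟩) fun x => ?_⟩
  · -- otherwise a form separates `x` from the orbit of `x'`, and then an average separates them
    by_contra! hno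
    obtain ⟨j, hj⟩ := hΦ0 x
    obtain ⟨H, hH, hHx, hHy⟩ := exists_separating_form x
      (Finset.univ.image fun g : G => permAct g x')
    obtain ⟨k, P', (Q' : MvPolynomial τ ℂ), -, hQ', hav, hQ0⟩ :=
      GVar.exists_avg_ne_zero (A := permSpace τ G) x hd hj hH hH hHx
    obtain ⟨W, hW, hWQ⟩ := hpow k Q' hQ'
    obtain ⟨c, hcc⟩ := (ProjSpace.point_eq_iff _ _ _ _).1 (congrArg Subtype.val hxx)
    have hc : c ≠ 0 := by
      rintro rfl
      exact hne x (by rw [← hcc, zero_smul])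
    have e1 := avg_permSpace (τ := τ) (G := G) hQ' (hΦ j) (hΦi j) x
    have e2 := avg_permSpace (τ := τ) (G := G) hQ' (hΦ j) (hΦi j) x'
    rw [← hWQ, eval_bind₁_smul, ← congrFun hcc j, ← hcc, ProjSpace.eval_smul hW] at e1
    have e3 : (permSpace τ G).avg Q' (Φ j) k x' = 0 := by
      unfold GVar.avg
      refine finsum_eq_zero_of_forall_eq_zero fun g => ?_
      rw [((hQ0 (g • x')).1 (hHy (g • x') (Finset.mem_image_of_mem _ (Finset.mem_univ (α := G) g))
        fun h => hno g⁻¹ (by rw [← h, inv_smul_smul]))).2, zero_div]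
    refine hav (e1.trans ?_)
    rw [← hWQ, eval_bind₁_smul] at e2
    have e4 := (div_eq_zero_iff.1 (e2.symm.trans e3)).resolve_right (pow_ne_zero _ fun h0 => hj (by
      rw [← congrFun hcc j]; exact mul_eq_zero_of_right _ h0))
    rw [e4, mul_zero, zero_div]
  · rintro ⟨g, rfl⟩
    apply Subtype.ext
    refine (ProjSpace.point_eq_iff _ _ _ _).2 ?_
    obtain ⟨c, hc, hcc⟩ := permVec_permAct (show G from g) x
    refine ⟨(c ^ d)⁻¹, funext fun j => ?_⟩
    have h1 := eval_permAct (hΦ j) hcc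
    rw [hΦi j] at h1
    refine (congrArg ((c ^ d)⁻¹ * ·) h1).trans ?_
    rw [inv_mul_cancel_left₀ (pow_ne_zero _ hc)]
  · obtain ⟨j, hj⟩ := hΦ0 x
    refine ⟨d, Φ j, hd, fun g => hΦsmul j g x hj, fun k (P : MvPolynomial τ ℂ) hP u hu => ?_⟩
    obtain ⟨W, hW, hWP⟩ := hpow k P hP
    obtain ⟨c, hc, hcc⟩ := hπc x
    refine ⟨k, W, MvPolynomial.X j ^ k, hW, by simpa using (isHomogeneous_X ℂ j).pow k, ?_, ?_⟩
    · rw [map_pow]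
      refine pow_ne_zero _ ?_
      rw [hcc, eval_X]
      exact mul_ne_zero hc hj
    · intro y _
      obtain ⟨z, rfl⟩ := hsurj y
      obtain ⟨c, hc, hcc⟩ := hπc z
      have e1 := avg_permSpace (τ := τ) (G := G) hP (hΦ j) (hΦi j) z
      refine (hu z).trans (e1.trans ?_)
      rw [hcc, ← hWP, ProjSpace.eval_smul hW, eval_bind₁_smul, map_pow, eval_X,
        Pi.smul_apply, smul_eq_mul, mul_pow, mul_div_mul_left _ _ (pow_ne_zero _ hc)]

end PermSpace

/-! ### Existence of quotients -/

namespace GVar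

/-- Two varieties with group actions that are isomorphic as varieties and have the same orbits have
the same quotient. -/
theorem IsQuotient.of_inverse {A B : GVar} {Y : QPVar} {π : B.X → Y} (h : B.IsQuotient Y π)
    {φ : A.X → B.X} {ψ : B.X → A.X} (hφ : IsRegular φ) (hψ : IsRegular ψ)
    (h₁ : ∀ x, ψ (φ x) = x) (h₂ : ∀ y, φ (ψ y) = y)
    (horb : ∀ x x', (∃ g : A.G, g • x = x') ↔ ∃ g : B.G, g • φ x = φ x') :
    A.IsQuotient Y (fun x => π (φ x)) :=
  isQuotient_iff.2 ⟨h.quotMap.comp (isQuotMap_of_inverse hφ hψ h₁ h₂),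
    fun x x' => h.eq_iff.trans (horb x x').symm⟩

/-- The quotient of a quasi-projective variety by a finite group exists: the map
`x ↦ (h⁻¹ x)_h` embeds the variety into a projective space on which the group permutes the
coordinates. -/
theorem exists_isQuotient (A : GVar) : ∃ (Y : QPVar) (π : A.X → Y), A.IsQuotient Y π := by
  classical
  let _ : Fintype A.G := Fintype.ofFinite A.G
  let _ : MulAction A.G (A.G → A.X.σ) := arrowAction
  let W : QPVar := QPVar.pi fun _ : A.G => A.X
  let T : GVar := permSpace (A.G → A.X.σ) A.G
  let c : W → A.G → A.X := piEquiv fun _ : A.G => A.X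
  have hc : ∀ h, IsRegular fun w => c w h := isRegular_piEquiv_apply fun _ : A.G => A.X
  let E : A.X → W := fun x => (piEquiv fun _ : A.G => A.X).symm fun h => h⁻¹ • x
  have hEc : ∀ x h, c (E x) h = h⁻¹ • x := fun x h => congrFun (Equiv.apply_symm_apply _ _) h
  have hEreg : IsRegular E := isRegular_pi fun h =>
    (isRegular_congr fun x => hEc x h).2 (A.isRegular_smul h⁻¹)
  let R : Set W := {w | ∀ h, c w h = h⁻¹ • c w 1}
  have hR : IsClosed R := by
    have : R = ⋂ h, {w | c w h = h⁻¹ • c w 1} := by ext; simp [R]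
    rw [this]
    exact isClosed_iInter fun h => isClosed_eq (hc h) ((A.isRegular_smul h⁻¹).comp (hc 1))
  have hER : ∀ x, E x ∈ R := fun x h => by rw [hEc, hEc, inv_one, one_smul]
  have hRE : ∀ w ∈ R, E (c w 1) = w := fun w hw => (piEquiv fun _ : A.G => A.X).injective
    (funext fun h => (hEc _ h).trans (hw h).symm)
  let Z : Set T.X := {p | p.1 ∈ Subtype.val '' R}
  have hZ : IsLocallyClosed Z := by
    have h1 : IsLocallyClosed (Subtype.val '' R : Set (ProjSpace (A.G → A.X.σ))) :=
      (W.sub R hR.isLocallyClosed).isLocallyClosed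
    exact h1.preimage continuous_subtype_val
  let φ : A.X → T.X := fun x => ⟨(E x).1, trivial⟩
  have hφreg : IsRegular φ := hEreg
  have hφZ : ∀ x, φ x ∈ Z := fun x => ⟨E x, hER x, rfl⟩
  have hZφ : ∀ p ∈ Z, ∃ x, φ x = p := by
    rintro p ⟨w, hw, hwp⟩
    refine ⟨c w 1, Subtype.ext ?_⟩
    exact (congrArg Subtype.val (hRE w hw)).trans hwp
  have hφinj : Injective φ := by
    intro x x' h
    have h1 : E x = E x' := Subtype.ext (congrArg (fun p : T.X => p.1) h)
    have h2 := hEc x 1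
    rw [h1, hEc] at h2
    simpa using h2.symm
  have hφsmul : ∀ (g : A.G) (x : A.X), φ (g • x) = permAct g (φ x) := by
    intro g x
    have hcoord : ∀ y : A.X, ∃ a : ℂ, a ≠ 0 ∧ coords (E y) = a • fun t : A.G → A.X.σ =>
        ∏ h, coords (h⁻¹ • y) (t h) := by
      intro y
      obtain ⟨a, ha, h1⟩ := exists_coords_eq_smul_segreVec (E y)
      refine ⟨a, ha, h1.trans ?_⟩
      congr 1
      funext t
      refine (segreVec_coords _ _).trans (prod_congr rfl fun h _ => ?_)
      exact congrArg (fun z : A.X => coords z (t h)) (hEc y h)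
    obtain ⟨a, ha, h1⟩ := hcoord x
    obtain ⟨b, hb, h2⟩ := hcoord (g • x)
    apply Subtype.ext
    rw [← (φ (g • x)).1.point_coords]
    refine (ProjSpace.point_eq_iff _ _ _ _).2 ⟨b * a⁻¹, ?_⟩
    refine Eq.trans ?_ h2.symm
    funext t
    have h3 := congrFun h1 (g⁻¹ • (show A.G → A.X.σ from t))
    refine (congrArg (b * a⁻¹ * ·) h3).trans ?_
    simp only [Pi.smul_apply, smul_eq_mul]
    rw [mul_assoc, inv_mul_cancel_left₀ ha]
    congr 1
    refine Fintype.prod_equiv (Equiv.mulLeft g) _ _ fun h => ?_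
    show coords (h⁻¹ • x) (t (g⁻¹⁻¹ * h)) = coords ((g * h)⁻¹ • g • x) (t (g * h))
    rw [inv_inv, mul_inv_rev, mul_smul, inv_smul_smul]
  have hZG : ∀ (g : T.G) (p : T.X), p ∈ Z → g • p ∈ Z := by
    intro g p hp
    obtain ⟨x, rfl⟩ := hZφ p hp
    have h1 := hφZ ((show A.G from g) • x)
    rw [hφsmul] at h1
    exact h1
  obtain ⟨Y, π, hπ⟩ := exists_isQuotient_permSpace (A.G → A.X.σ) A.G
  have hpre : π ⁻¹' (π '' Z) = Z := by
    ext p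
    constructor
    · rintro ⟨q, hq, hqp⟩
      obtain ⟨g, rfl⟩ := hπ.eq_iff.1 hqp
      exact hZG g q hq
    · exact fun hp => ⟨p, hp, rfl⟩
  have hS : IsLocallyClosed (π '' Z) := by
    rw [← hπ.isLocallyClosed_preimage, hpre]
    exact hZ
  have hsub := hπ.sub hS hZ hZG fun p => ⟨fun hp => ⟨p, hp, rfl⟩, fun hp => hpre ▸ hp⟩
  let toW : T.X.sub Z hZ → W := fun p => ⟨p.1, by
    obtain ⟨w, _, hw⟩ := incl_mem p
    exact hw ▸ w.2⟩
  have htoW : IsRegular toW := isRegular_id (T.X.sub Z hZ)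
  let φ' : A.X → (T.sub Z hZ hZG).X := fun x => (toSub (φ x) (hφZ x) : T.X.sub Z hZ)
  have hleft : ∀ x, c (toW (φ' x)) 1 = x := fun x => (hEc x 1).trans (by rw [inv_one, one_smul])
  refine ⟨_, _, hsub.of_inverse (A := A) (φ := φ') (ψ := fun p => c (toW p) 1) hφreg
    ((hc 1).comp htoW) hleft (fun p => ?_) fun x x' => ?_⟩
  · obtain ⟨x, hx⟩ := hZφ (incl p) (incl_mem p)
    have h1 : φ' x = p := incl_injective (hZ := hZ) hx
    rw [← h1, hleft]
  · constructor
    · rintro ⟨g, rfl⟩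
      exact ⟨g, incl_injective (hZ := hZ) (hφsmul g x).symm⟩
    · rintro ⟨g, hg⟩
      exact ⟨g, hφinj ((hφsmul _ x).trans (congrArg (incl (hZ := hZ)) hg))⟩

theorem exists_isQuotient_quotient (A : GVar) : ∃ π : A.X → A.quotient, A.IsQuotient A.quotient π :=
  Classical.epsilon_spec (exists_isQuotient A)

/-- The quotient map. -/
def quotMk (A : GVar) : A.X → A.quotient := A.exists_isQuotient_quotient.choose

theorem isQuotient_quotMk (A : GVar) : A.IsQuotient A.quotient A.quotMk :=
  A.exists_isQuotient_quotient.choose_spec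

end GVar

theorem QPVar.cls_eq {X Y : QPVar} (h : QPVar.Iso X Y) : X.cls = Y.cls :=
  congrArg (Ideal.Quotient.mk _) (QPVar.gen_eq h)

namespace GVar

theorem IsQuotient.cls_eq {A : GVar} {Y : QPVar} {π : A.X → Y} (h : A.IsQuotient Y π) :
    A.quotient.cls = Y.cls :=
  QPVar.cls_eq (A.isQuotient_quotMk.iso h)

theorem cls_eq {A B : GVar} (h : GVar.Iso A B) : A.cls = B.cls :=
  congrArg (Ideal.Quotient.mk _) (gen_eq h)

end GVar

/-! ### Homomorphisms from the Grothendieck rings -/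

section RelationIdeal

variable {C : Type 1} [CommMonoid C] {R : FreeAbelianGroup C → Prop}
  {hR : ∀ (c : C) (r : FreeAbelianGroup C), R r → R (FreeAbelianGroup.of c * r)}

theorem eq_zero_of_mem_relationIdeal {M : Type*} [AddGroup M] (φ : FreeAbelianGroup C →+ M)
    (h : ∀ r, R r → φ r = 0) (a : FreeAbelianGroup C) (ha : a ∈ relationIdeal R hR) : φ a = 0 := by
  have h1 : AddSubgroup.closure {r | R r} ≤ φ.ker := by
    rw [AddSubgroup.closure_le]
    exact fun r hr => h r hr
  exact h1 ha

theorem relation_induction {P : (FreeAbelianGroup C ⧸ relationIdeal R hR) → Prop}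
    (h0 : P 0) (h1 : ∀ c, P (Ideal.Quotient.mk _ (FreeAbelianGroup.of c))) (hneg : ∀ a, P a → P (-a))
    (hadd : ∀ a b, P a → P b → P (a + b)) (a) : P a := by
  obtain ⟨a, rfl⟩ := Ideal.Quotient.mk_surjective a
  induction a using FreeAbelianGroup.induction_on with
  | zero => rwa [map_zero]
  | of c => exact h1 c
  | neg c hc => rw [map_neg]; exact hneg _ hc
  | add a b ha hb => rw [map_add]; exact hadd _ _ ha hb

/-- The additive map on the Grothendieck group defined by an invariant that respects the
relations. -/
def relationLift {M : Type*} [AddCommGroup M] (φ : C → M)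
    (h : ∀ r, R r → FreeAbelianGroup.lift φ r = 0) :
    (FreeAbelianGroup C ⧸ relationIdeal R hR) →+ M :=
  QuotientAddGroup.lift (relationIdeal R hR).toAddSubgroup (FreeAbelianGroup.lift φ)
    (eq_zero_of_mem_relationIdeal (hR := hR) _ h)

theorem relationLift_of {M : Type*} [AddCommGroup M] (φ : C → M)
    (h : ∀ r, R r → FreeAbelianGroup.lift φ r = 0) (c : C) :
    relationLift (hR := hR) φ h (Ideal.Quotient.mk _ (FreeAbelianGroup.of c)) = φ c :=
  (QuotientAddGroup.lift_mk' (relationIdeal R hR).toAddSubgroup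
    (eq_zero_of_mem_relationIdeal (hR := hR) _ h) _).trans (FreeAbelianGroup.lift_apply_of φ c)

/-- The ring homomorphism on the Grothendieck ring defined by a multiplicative invariant that
respects the relations. -/
def relationLiftRing {S : Type*} [CommRing S] (φ : C →* S)
    (h : ∀ r, R r → FreeAbelianGroup.lift φ r = 0) :
    (FreeAbelianGroup C ⧸ relationIdeal R hR) →+* S :=
  Ideal.Quotient.lift _ (FreeAbelianGroup.liftMonoid φ) fun a ha =>
    eq_zero_of_mem_relationIdeal (hR := hR) (FreeAbelianGroup.liftMonoid φ).toAddMonoidHom h a ha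

theorem relationLiftRing_of {S : Type*} [CommRing S] (φ : C →* S)
    (h : ∀ r, R r → FreeAbelianGroup.lift φ r = 0) (c : C) :
    relationLiftRing (hR := hR) φ h (Ideal.Quotient.mk _ (FreeAbelianGroup.of c)) = φ c :=
  (Ideal.Quotient.lift_mk _ _ _).trans (FreeAbelianGroup.lift_apply_of φ c)

theorem mk_eq_mk_of_relation {a b : FreeAbelianGroup C} (h : R (a - b)) :
    Ideal.Quotient.mk (relationIdeal R hR) a = Ideal.Quotient.mk (relationIdeal R hR) b :=
  Ideal.Quotient.eq.2 (AddSubgroup.subset_closure h)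

end RelationIdeal

theorem K0Var.induction {P : K0Var → Prop} (h0 : P 0) (h1 : ∀ X : QPVar, P X.cls)
    (hneg : ∀ a, P a → P (-a)) (hadd : ∀ a b, P a → P b → P (a + b)) (a : K0Var) : P a :=
  relation_induction h0 (by rintro ⟨X⟩; exact h1 X) hneg hadd a

theorem K0fGr.induction {P : K0fGr → Prop} (h0 : P 0) (h1 : ∀ A : GVar, P A.cls)
    (hneg : ∀ a, P a → P (-a)) (hadd : ∀ a b, P a → P b → P (a + b)) (a : K0fGr) : P a :=
  relation_induction h0 (by rintro ⟨A⟩; exact h1 A) hneg hadd a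

theorem QPVar.cls_prod (X Y : QPVar) : (X.prod Y).cls = X.cls * Y.cls := by
  unfold QPVar.cls
  rw [← QPVar.gen_mul, map_mul]

theorem QPVar.cls_scissor (X : QPVar) (Y : Set X) (hY : IsClosed Y) :
    X.cls = (X.sub Y hY.isLocallyClosed).cls + (X.sub Yᶜ hY.isOpen_compl.isLocallyClosed).cls := by
  exact (mk_eq_mk_of_relation (QPVar.Relation.scissor X Y hY)).trans (map_add _ _ _)

namespace GVar

theorem cls_prod (A B : GVar) : (A.prod B).cls = A.cls * B.cls := by
  unfold GVar.cls
  rw [← GVar.gen_mul, map_mul]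

theorem cls_scissor (A : GVar) (Y : Set A.X) (hY : IsClosed Y)
    (hG : ∀ (g : A.G) (x : A.X), x ∈ Y → g • x ∈ Y) :
    A.cls = (A.sub Y hY.isLocallyClosed hG).cls +
      (A.sub Yᶜ hY.isOpen_compl.isLocallyClosed (smul_mem_compl hG)).cls := by
  exact (mk_eq_mk_of_relation (Relation.scissor A Y hY hG)).trans (map_add _ _ _)

theorem cls_induced {A B : GVar} (h : IsInduced A B) : B.cls = A.cls :=
  mk_eq_mk_of_relation (Relation.induced A B h)

theorem lift_gen {M : Type*} [AddCommGroup M] (φ : GClass → M) (A : GVar) :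
    FreeAbelianGroup.lift φ A.gen = φ (Quotient.mk _ A) := FreeAbelianGroup.lift_apply_of _ _

/-- The quotient of an induced variety is the quotient of the original one. -/
theorem IsInduced.exists_isQuotient {A B : GVar} (h : IsInduced A B) {Y : QPVar} {π : B.X → Y}
    (hπ : B.IsQuotient Y π) : ∃ ρ : A.X → Y, A.IsQuotient Y ρ := by
  obtain ⟨j, Z, hZ, e, hj, he, he', h₁, h₂, h₃⟩ := h
  have hZe : ∀ y ∈ Z, ∃ x, incl (e x) = y := fun y hy =>
    ⟨e.symm (toSub y hy), by rw [Equiv.apply_symm_apply]; rfl⟩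
  have hreg : IsRegular fun x => π (incl (e x)) :=
    hπ.quotMap.isRegular.comp (isRegular_incl.comp he)
  have hquot : IsQuotMap fun x => π (incl (e x)) := by
    refine ⟨(isQuotientMap_iff _).2 ⟨isCoinducing_iff.2 fun U => ⟨fun hU => ?_, fun hU =>
      hU.preimage hreg.continuous⟩, fun y => ?_⟩, fun f x => ⟨fun hf => hreg.regularAt_comp hf,
        fun hf => ?_⟩⟩
    · have h4 : IsOpen {z : B.X.sub Z hZ.isOpen.isLocallyClosed | π (incl z) ∈ U} := by
        have := hU.preimage he'.continuous
        simpa [Set.preimage] using this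
      have h5 := hπ.isOpenMap _ ((isOpenEmbedding_incl hZ.isOpen).isOpenMap _ h4)
      convert h5 using 1
      ext y
      constructor
      · intro hy
        obtain ⟨b, rfl⟩ := hπ.quotMap.surjective y
        obtain ⟨g, x, rfl⟩ := h₂ b
        rw [hπ.map_smul] at hy ⊢
        exact ⟨_, ⟨e x, hy, rfl⟩, rfl⟩
      · rintro ⟨_, ⟨z, hz, rfl⟩, rfl⟩
        exact hz
    · obtain ⟨b, rfl⟩ := hπ.quotMap.surjective y
      obtain ⟨g, x, rfl⟩ := h₂ b
      exact ⟨x, (hπ.map_smul _ _).symm⟩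
    · refine (hπ.quotMap.2 f _).2 (RegularAt.of_incl hZ.isOpen ?_)
      have h6 : RegularAt (fun x => f (π (incl (e x)))) (e.symm (e x)) := by
        rw [Equiv.symm_apply_apply]; exact hf
      have := he'.regularAt_comp h6
      simpa only [Equiv.apply_symm_apply] using this
  refine ⟨_, isQuotient_iff.2 ⟨hquot, fun x x' => ?_⟩⟩
  rw [hπ.eq_iff]
  constructor
  · rintro ⟨g, hg⟩
    obtain ⟨a, rfl⟩ := h₃ g x x' hg
    refine ⟨a, e.injective (incl_injective ?_)⟩
    rw [h₁, hg]
  · rintro ⟨g, rfl⟩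
    exact ⟨j g, (h₁ g x).symm⟩

end GVar

/-- The multiplicative map `[(X, G)] ↦ [X / G]`. -/
def quotientHom : GClass →* K0Var where
  toFun := Quotient.lift (fun A : GVar => A.quotient.cls) (by
    rintro A B ⟨φ, ψ, hψ, hψ', h⟩
    refine ((B.isQuotient_quotMk.of_inverse hψ hψ' ψ.symm_apply_apply ψ.apply_symm_apply
      fun x x' => ?_).cls_eq)
    constructor
    · rintro ⟨g, rfl⟩
      exact ⟨φ g, (h g x).symm⟩
    · rintro ⟨g, hg⟩
      exact ⟨φ.symm g, ψ.injective (by rw [h, MulEquiv.apply_symm_apply, hg])⟩)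
  map_one' := by
    have h : GVar.pt.IsQuotient QPVar.pt (fun x => x) := GVar.isQuotient_iff.2
      ⟨isQuotMap_of_inverse (isRegular_id _) (isRegular_id _) (fun _ => rfl) fun _ => rfl,
        fun x x' => ⟨fun h => ⟨(), h⟩, fun ⟨_, h⟩ => h⟩⟩
    exact h.cls_eq
  map_mul' := by
    rintro ⟨A⟩ ⟨B⟩
    exact (A.isQuotient_quotMk.prod B.isQuotient_quotMk).cls_eq.trans (QPVar.cls_prod _ _)

/-- The ring homomorphism `p : [(X, G)] ↦ [X / G]`. -/
def quotientRingHom : K0fGr →+* K0Var :=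
  relationLiftRing quotientHom (by
    rintro r (⟨A, Y, hY, hG⟩ | ⟨A, B, h⟩)
    · rw [map_sub, map_add]
      rw [GVar.lift_gen, GVar.lift_gen, GVar.lift_gen]
      have hπ := A.isQuotient_quotMk
      have hpre : A.quotMk ⁻¹' (A.quotMk '' Y) = Y := by
        ext p
        constructor
        · rintro ⟨q, hq, hqp⟩
          obtain ⟨g, rfl⟩ := hπ.eq_iff.1 hqp
          exact hG g q hq
        · exact fun hp => ⟨p, hp, rfl⟩
      have hS : IsClosed (A.quotMk '' Y) := by
        rw [← hπ.1.isClosed_preimage, hpre]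
        exact hY
      have hmem : ∀ x, x ∈ Y ↔ A.quotMk x ∈ A.quotMk '' Y := fun x =>
        ⟨fun hx => ⟨x, hx, rfl⟩, fun hx => hpre ▸ hx⟩
      have e1 := (hπ.sub hS.isLocallyClosed hY.isLocallyClosed hG hmem).cls_eq
      have e2 := (hπ.sub hS.isOpen_compl.isLocallyClosed hY.isOpen_compl.isLocallyClosed
        (GVar.smul_mem_compl hG) fun x => not_congr (hmem x)).cls_eq
      have e3 := QPVar.cls_scissor A.quotient _ hS
      rw [← e1, ← e2] at e3
      exact sub_eq_zero.2 e3
    · rw [map_sub]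
      rw [GVar.lift_gen, GVar.lift_gen]
      obtain ⟨ρ, hρ⟩ := h.exists_isQuotient B.isQuotient_quotMk
      exact sub_eq_zero.2 hρ.cls_eq.symm)

theorem quotientRingHom_cls (A : GVar) : quotientRingHom A.cls = A.quotient.cls :=
  relationLiftRing_of _ _ _

theorem QPVar.lift_gen {M : Type*} [AddCommGroup M] (φ : QPClass → M) (X : QPVar) :
    FreeAbelianGroup.lift φ X.gen = φ (Quotient.mk _ X) := FreeAbelianGroup.lift_apply_of _ _

/-- A variety with the action of the trivial group. -/
def QPVar.triv (X : QPVar) : GVar where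
  X := X
  G := Unit
  action :=
    { smul := fun _ x => x
      one_smul := fun _ => rfl
      mul_smul := fun _ _ _ => rfl }
  isRegular_smul _ := isRegular_id _

theorem QPVar.isQuotient_triv (X : QPVar) : X.triv.IsQuotient X (fun x => x) :=
  GVar.isQuotient_iff.2
    ⟨isQuotMap_of_inverse (isRegular_id _) (isRegular_id _) (fun _ => rfl) fun _ => rfl,
      fun _ _ => ⟨fun h => ⟨(), h⟩, fun ⟨_, h⟩ => h⟩⟩

/-- The class in `K₀^fGr(Var_ℂ)` of a variety with the trivial group. -/
def trivClass : QPClass → K0fGr :=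
  Quotient.lift (fun X : QPVar => X.triv.cls) fun _ _ ⟨e, he, he'⟩ =>
    GVar.cls_eq ⟨MulEquiv.refl Unit, e, he, he', fun _ _ => rfl⟩

/-- The homomorphism `K₀(Var_ℂ) → K₀^fGr(Var_ℂ)` defined by the actions of the trivial group. -/
def trivHom : K0Var →+ K0fGr :=
  relationLift trivClass (by
    rintro r ⟨X, Y, hY⟩
    rw [map_sub, map_add, QPVar.lift_gen, QPVar.lift_gen, QPVar.lift_gen]
    exact sub_eq_zero.2 (GVar.cls_scissor X.triv Y hY fun _ _ h => h))

theorem trivHom_cls (X : QPVar) : trivHom X.cls = X.triv.cls := relationLift_of _ _ _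

theorem quotientRingHom_trivHom (a : K0Var) : quotientRingHom (trivHom a) = a := by
  induction a using K0Var.induction with
  | h0 => rw [map_zero, map_zero]
  | h1 X => rw [trivHom_cls, quotientRingHom_cls, X.isQuotient_triv.cls_eq]
  | hneg a ha => rw [map_neg, map_neg, ha]
  | hadd a b ha hb => rw [map_add, map_add, ha, hb]

namespace GVar

/-! ### Stratifications -/

/-- Two varieties with group actions are isomorphic if there are mutually inverse equivariant
regular maps. -/
theorem iso_of_inverse {A B : GVar} (φ : A.G ≃* B.G) {f : A.X → B.X} {g : B.X → A.X}
    (hf : IsRegular f) (hg : IsRegular g) (h₁ : ∀ x, g (f x) = x) (h₂ : ∀ y, f (g y) = y)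
    (h : ∀ (a : A.G) (x : A.X), f (a • x) = φ a • f x) : GVar.Iso A B :=
  ⟨φ, ⟨f, g, h₁, h₂⟩, hf, hg, h⟩

variable {A : GVar}

section Sub

variable {Z : Set A.X} {hZ : IsLocallyClosed Z} {hG : ∀ (g : A.G) (x : A.X), x ∈ Z → g • x ∈ Z}

/-- The inclusion of an invariant subvariety. -/
def val (z : (A.sub Z hZ hG).X) : A.X := incl (hZ := hZ) z

/-- The point of an invariant subvariety defined by a point of the variety. -/
def mkSub (hZ : IsLocallyClosed Z) (hG : ∀ (g : A.G) (x : A.X), x ∈ Z → g • x ∈ Z) (x : A.X)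
    (hx : x ∈ Z) : (A.sub Z hZ hG).X := toSub (hZ := hZ) x hx

theorem val_mem (z : (A.sub Z hZ hG).X) : val z ∈ Z := incl_mem (hZ := hZ) z

theorem val_mkSub (x : A.X) (hx : x ∈ Z) : val (mkSub hZ hG x hx) = x := rfl

theorem mkSub_val (z : (A.sub Z hZ hG).X) : mkSub hZ hG (val z) (val_mem z) = z := rfl

theorem val_injective : Injective (val : (A.sub Z hZ hG).X → A.X) :=
  incl_injective (hZ := hZ)

theorem isRegular_val : IsRegular (val : (A.sub Z hZ hG).X → A.X) := isRegular_incl (hZ := hZ)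

theorem isRegular_mkSub {T : QPVar} {φ : T → A.X} (hφ : IsRegular φ) (h : ∀ t, φ t ∈ Z) :
    IsRegular (fun t => mkSub hZ hG (φ t) (h t)) := isRegular_toSub (hS := hZ) hφ h

end Sub

open Classical in
/-- The class of an invariant locally closed subset. -/
def clsOn (A : GVar) (Z : Set A.X) : K0fGr :=
  if h : IsLocallyClosed Z ∧ ∀ (g : A.G) (x : A.X), x ∈ Z → g • x ∈ Z then
    (A.sub Z h.1 h.2).cls else 0

theorem clsOn_eq {Z : Set A.X} (hZ : IsLocallyClosed Z)
    (hG : ∀ (g : A.G) (x : A.X), x ∈ Z → g • x ∈ Z) : A.clsOn Z = (A.sub Z hZ hG).cls :=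
  dif_pos ⟨hZ, hG⟩

theorem clsOn_univ : A.clsOn Set.univ = A.cls := by
  rw [clsOn_eq isOpen_univ.isLocallyClosed fun _ _ _ => trivial]
  exact cls_eq (iso_of_inverse (MulEquiv.refl A.G) (isRegular_val (A := A))
    (isRegular_mkSub (isRegular_id A.X) fun _ => trivial) mkSub_val
    (fun x => val_mkSub (Z := Set.univ) x trivial) fun _ _ => rfl)

theorem cls_eq_zero_of_isEmpty [h : IsEmpty A.X] : A.cls = 0 := by
  have h1 : ∀ (Z : Set A.X) (hZ : IsLocallyClosed Z)
      (hG : ∀ (g : A.G) (x : A.X), x ∈ Z → g • x ∈ Z), (A.sub Z hZ hG).cls = A.cls :=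
    fun Z hZ hG => cls_eq (iso_of_inverse (MulEquiv.refl A.G) (isRegular_val (A := A))
      (g := fun x => h.elim x) (fun x => h.elim x) (fun x => h.elim (val x)) (fun x => h.elim x)
      fun _ _ => rfl)
  have h2 := cls_scissor A Set.univ isClosed_univ fun _ _ _ => trivial
  exact left_eq_add.1 (h2.trans (congrArg₂ (· + ·) (h1 _ _ _) (h1 _ _ _)))

theorem clsOn_empty : A.clsOn ∅ = 0 := by
  rw [clsOn_eq isOpen_empty.isLocallyClosed fun _ _ h => h.elim]
  have : IsEmpty (A.sub ∅ isOpen_empty.isLocallyClosed fun _ _ h => h.elim).X :=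
    ⟨fun z => val_mem z⟩
  exact cls_eq_zero_of_isEmpty

/-- A subvariety of a subvariety. -/
theorem cls_sub_sub {Z : Set A.X} (hZ : IsLocallyClosed Z)
    (hG : ∀ (g : A.G) (x : A.X), x ∈ Z → g • x ∈ Z) {T : Set (A.sub Z hZ hG).X}
    (hT : IsLocallyClosed T)
    (hTG : ∀ (g : (A.sub Z hZ hG).G) (x : (A.sub Z hZ hG).X), x ∈ T → g • x ∈ T)
    {W : Set A.X} (hW : IsLocallyClosed W) (hWG : ∀ (g : A.G) (x : A.X), x ∈ W → g • x ∈ W)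
    (hWZ : W ⊆ Z) (hTW : ∀ z, z ∈ T ↔ val z ∈ W) :
    ((A.sub Z hZ hG).sub T hT hTG).cls = (A.sub W hW hWG).cls :=
  cls_eq (iso_of_inverse (A := (A.sub Z hZ hG).sub T hT hTG) (B := A.sub W hW hWG)
    (MulEquiv.refl A.G)
    (f := fun z => mkSub hW hWG (val (val z)) ((hTW _).1 (val_mem z)))
    (g := fun w => mkSub hT hTG (mkSub hZ hG (val w) (hWZ (val_mem w))) ((hTW _).2 (val_mem w)))
    (isRegular_mkSub (isRegular_val.comp isRegular_val) _)
    (isRegular_mkSub (isRegular_mkSub isRegular_val _) _) (fun _ => val_injective rfl)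
    (fun _ => val_injective rfl) fun _ _ => rfl)

theorem clsOn_scissor {Z C : Set A.X} (hZ : IsLocallyClosed Z)
    (hG : ∀ (g : A.G) (x : A.X), x ∈ Z → g • x ∈ Z) (hC : IsClosed C)
    (hCG : ∀ (g : A.G) (x : A.X), x ∈ C → g • x ∈ C) :
    A.clsOn Z = A.clsOn (Z ∩ C) + A.clsOn (Z ∩ Cᶜ) := by
  have h1 : ∀ (g : A.G) (x : A.X), x ∈ Z ∩ C → g • x ∈ Z ∩ C :=
    fun g x hx => ⟨hG g x hx.1, hCG g x hx.2⟩
  have h2 : ∀ (g : A.G) (x : A.X), x ∈ Z ∩ Cᶜ → g • x ∈ Z ∩ Cᶜ :=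
    fun g x hx => ⟨hG g x hx.1, smul_mem_compl hCG g x hx.2⟩
  have h3 : IsClosed (incl (hZ := hZ) ⁻¹' C) := hC.preimage continuous_incl
  rw [clsOn_eq hZ hG, clsOn_eq (hZ.inter hC.isLocallyClosed) h1,
    clsOn_eq (hZ.inter hC.isOpen_compl.isLocallyClosed) h2,
    cls_scissor (A.sub Z hZ hG) (incl (hZ := hZ) ⁻¹' C) h3 fun g x hx => hCG g _ hx]
  congr 1
  · exact cls_sub_sub _ _ _ _ _ _ Set.inter_subset_left fun z => ⟨fun h => ⟨incl_mem z, h⟩, fun h => h.2⟩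
  · exact cls_sub_sub _ _ _ _ _ _ Set.inter_subset_left fun z => ⟨fun h => ⟨incl_mem z, h⟩, fun h => h.2⟩

/-- Additivity over the fibres of `f`, if `f` is constant on the atoms of a finite family of closed
invariant sets; by induction on the family. -/
theorem clsOn_eq_sum_aux {I : Type} [Fintype I] [DecidableEq I] (f : A.X → I) :
    ∀ (L : List (Set A.X)), (∀ C ∈ L, IsClosed C ∧ ∀ (g : A.G) (x : A.X), x ∈ C → g • x ∈ C) →
    ∀ Z : Set A.X, IsLocallyClosed Z → (∀ (g : A.G) (x : A.X), x ∈ Z → g • x ∈ Z) →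
    (∀ i, IsLocallyClosed {x | f x = i} ∧ ∀ (g : A.G) (x : A.X), f (g • x) = f x) →
    (∀ x ∈ Z, ∀ y ∈ Z, (∀ C ∈ L, x ∈ C ↔ y ∈ C) → f x = f y) →
    A.clsOn Z = ∑ i, A.clsOn (Z ∩ {x | f x = i}) := by
  intro L
  induction L with
  | nil =>
    intro _ Z hZ hG hf hsep
    rcases Z.eq_empty_or_nonempty with rfl | ⟨x, hx⟩
    · simp [clsOn_empty]
    · rw [Finset.sum_eq_single (f x)]
      · congr 1
        ext y
        exact ⟨fun hy => ⟨hy, hsep y hy x hx (by simp)⟩, fun hy => hy.1⟩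
      · intro i _ hi
        convert clsOn_empty
        ext y
        simp only [Set.mem_inter_iff, Set.mem_ofPred_eq, Set.mem_empty_iff_false, iff_false, not_and]
        intro hy hyi
        exact hi (hyi.symm.trans (hsep y hy x hx (by simp)))
      · intro h; exact absurd (Finset.mem_univ _) h
  | cons C L ih =>
    intro hL Z hZ hG hf hsep
    obtain ⟨hC, hCG⟩ := hL C List.mem_cons_self
    have hL' := fun D hD => hL D (List.mem_cons_of_mem _ hD)
    rw [clsOn_scissor hZ hG hC hCG,
      ih hL' (Z ∩ C) (hZ.inter hC.isLocallyClosed) (fun g x hx => ⟨hG g x hx.1, hCG g x hx.2⟩) hf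
        (fun x hx y hy h => hsep x hx.1 y hy.1 fun D hD => by
          rcases List.mem_cons.1 hD with rfl | hD
          · exact ⟨fun _ => hy.2, fun _ => hx.2⟩
          · exact h D hD),
      ih hL' (Z ∩ Cᶜ) (hZ.inter hC.isOpen_compl.isLocallyClosed)
        (fun g x hx => ⟨hG g x hx.1, smul_mem_compl hCG g x hx.2⟩) hf
        (fun x hx y hy h => hsep x hx.1 y hy.1 fun D hD => by
          rcases List.mem_cons.1 hD with rfl | hD
          · exact ⟨fun h => absurd h hx.2, fun h => absurd h hy.2⟩
          · exact h D hD), ← Finset.sum_add_distrib]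
    refine sum_congr rfl fun i _ => ?_
    rw [clsOn_scissor (hZ.inter (hf i).1) (fun g x hx => ⟨hG g x hx.1, ((hf i).2 g x).trans hx.2⟩)
      hC hCG, Set.inter_right_comm, Set.inter_right_comm Z _ Cᶜ]

theorem smul_mem_closure {Z : Set A.X} (hG : ∀ (g : A.G) (x : A.X), x ∈ Z → g • x ∈ Z) (g : A.G)
    (x : A.X) (hx : x ∈ closure Z) : g • x ∈ closure Z :=
  map_mem_closure (continuous_smul g) hx fun y hy => hG g y hy

/-- The class is additive with respect to a finite partition into locally closed invariant
subsets. -/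
theorem cls_eq_sum_fibres {I : Type} [Fintype I] (f : A.X → I)
    (hf : ∀ i, IsLocallyClosed {x | f x = i}) (hinv : ∀ (g : A.G) (x : A.X), f (g • x) = f x) :
    A.cls = ∑ i, (A.sub {x | f x = i} (hf i) fun g x hx => (hinv g x).trans hx).cls := by
  classical
  let Z : I → Set A.X := fun i => {x | f x = i}
  have hZG : ∀ i (g : A.G) (x : A.X), x ∈ Z i → g • x ∈ Z i := fun i g x hx => (hinv g x).trans hx
  let L : List (Set A.X) := (Finset.univ : Finset I).toList.flatMap fun i =>
    [closure (Z i), closure (Z i) \ Z i]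
  have h := clsOn_eq_sum_aux f L (fun C hC => ?_) Set.univ isOpen_univ.isLocallyClosed
    (fun _ _ _ => trivial) (fun i => ⟨hf i, hinv⟩) (fun x _ y _ hxy => ?_)
  · rw [clsOn_univ] at h
    rw [h]
    refine sum_congr rfl fun i _ => ?_
    rw [Set.univ_inter, clsOn_eq (hf i) (hZG i)]
  · simp only [L, List.mem_flatMap, Finset.mem_toList, Finset.mem_univ, true_and, List.mem_cons,
      List.not_mem_nil, or_false] at hC
    obtain ⟨i, rfl | rfl⟩ := hC
    · exact ⟨isClosed_closure, smul_mem_closure (hZG i)⟩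
    · refine ⟨?_, fun g x hx => ⟨smul_mem_closure (hZG i) g x hx.1, smul_mem_compl (hZG i) g x hx.2⟩⟩
      have := isLocallyClosed_iff_isOpen_coborder.1 (hf i)
      rw [coborder] at this
      exact isOpen_compl_iff.1 this
  · have h1 : x ∈ Z (f x) := rfl
    have h2 := hxy (closure (Z (f x))) (by
      simp only [L, List.mem_flatMap, Finset.mem_toList]
      exact ⟨f x, Finset.mem_univ _, by simp⟩)
    have h3 := hxy (closure (Z (f x)) \ Z (f x)) (by
      simp only [L, List.mem_flatMap, Finset.mem_toList]
      exact ⟨f x, Finset.mem_univ _, by simp⟩)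
    by_contra hne
    have h4 : y ∉ Z (f x) := fun h => hne h.symm
    exact (h3.2 ⟨h2.1 (subset_closure h1), h4⟩).2 h1

end GVar

/-- If a finite group acts monotonically on a partially ordered set, then its orbits are
antichains. -/
theorem smul_eq_of_le_smul {G I : Type*} [Group G] [Finite G] [PartialOrder I] [MulAction G I]
    (hmono : ∀ (g : G) (i j : I), i ≤ j → g • i ≤ g • j) {g : G} {i : I} (h : i ≤ g • i) :
    g • i = i := by
  have h1 : ∀ n : ℕ, g • i ≤ g ^ (n + 1) • i := by
    intro n
    induction n with
    | zero => rw [zero_add, pow_one]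
    | succ n ih =>
      refine ih.trans ?_
      rw [pow_succ g (n + 1), mul_smul]
      exact hmono _ _ _ h
  have h2 := h1 (orderOf g - 1)
  rw [Nat.sub_add_cancel (orderOf_pos g), pow_orderOf_eq_one, one_smul] at h2
  exact le_antisymm h2 h

namespace GVar

theorem isLocallyClosed_stratum {X : QPVar} {I : Type} [Finite I] [PartialOrder I] {f : X → I}
    (hclosed : ∀ i, IsClosed {x | i ≤ f x}) (i : I) : IsLocallyClosed {x | f x = i} := by
  have h : {x | f x = i} = {x | i ≤ f x} ∩ (⋃ (j : I) (_ : i < j), {x | j ≤ f x})ᶜ := by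
    ext x
    simp only [Set.mem_inter_iff, Set.mem_iUnion, Set.mem_compl_iff, Set.mem_ofPred_eq, not_exists,
      exists_prop, not_and]
    constructor
    · rintro rfl
      exact ⟨le_rfl, fun j hj hj' => absurd hj' hj.not_ge⟩
    · rintro ⟨h1, h2⟩
      exact (h1.eq_of_not_lt fun hlt => h2 _ hlt le_rfl).symm
  rw [h]
  exact (hclosed i).isLocallyClosed.inter (isClosed_iUnion_of_finite fun j =>
    isClosed_iUnion_of_finite fun _ => hclosed _).isOpen_compl.isLocallyClosed

section Strata

variable {A : GVar} {I : Type} [Finite I] [PartialOrder I] [MulAction A.G I]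
  (hmono : ∀ (g : A.G) (i j : I), i ≤ j → g • i ≤ g • j) {f : A.X → I}
  (hf : ∀ (g : A.G) (x : A.X), f (g • x) = g • f x) (hclosed : ∀ i, IsClosed {x | i ≤ f x})

include hmono hclosed in
theorem isLocallyClosed_orbit_stratum (i : I) : IsLocallyClosed {x | ∃ g : A.G, g • i = f x} := by
  have h : {x | ∃ g : A.G, g • i = f x} = (⋃ g : A.G, {x | g • i ≤ f x}) ∩
      (⋃ (j : I) (_ : ∃ g : A.G, g • i < j), {x | j ≤ f x})ᶜ := by
    ext x
    simp only [Set.mem_inter_iff, Set.mem_iUnion, Set.mem_compl_iff, Set.mem_ofPred_eq, not_exists,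
      exists_prop, not_and]
    constructor
    · rintro ⟨g, hg⟩
      refine ⟨⟨g, hg.le⟩, fun j ⟨g', hj⟩ hjx => ?_⟩
      have h1 : g' • i < (g * g'⁻¹) • g' • i := by
        rw [mul_smul, inv_smul_smul, hg]
        exact hj.trans_le hjx
      exact h1.ne (smul_eq_of_le_smul hmono h1.le).symm
    · rintro ⟨⟨g, hg⟩, hno⟩
      refine ⟨g, hg.eq_of_not_lt fun hlt => ?_⟩
      exact hno _ ⟨g, hlt⟩ le_rfl
  rw [h]
  exact (isClosed_iUnion_of_finite fun g => hclosed _).isLocallyClosed.inter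
    (isClosed_iUnion_of_finite fun j => isClosed_iUnion_of_finite fun _ =>
      hclosed _).isOpen_compl.isLocallyClosed

include hmono hf hclosed in
/-- Let the points of a variety be labelled by the elements of a finite set with an action of the
group (the labelling being equivariant and, for a suitable order, semicontinuous).  Then the class
is the sum, over the orbits of labels, of the classes of the strata with one representing label,
with the actions of the stabilizers. -/
theorem cls_eq_sum_strata {O : Type} [Fintype O] (rep : O → I)
    (hrep : ∀ x : A.X, ∃ (o : O) (g : A.G), g • rep o = f x)
    (huniq : ∀ (o o' : O) (g : A.G), g • rep o = rep o' → o = o')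
    (B : O → GVar) (j : ∀ o, (B o).G →* A.G) (hj : ∀ o, Injective (j o))
    (hstab : ∀ o (g : A.G), g • rep o = rep o → g ∈ (j o).range)
    (φ : ∀ o, (B o).X → A.X) (hφ : ∀ o, IsRegular (φ o)) (hφi : ∀ o, Injective (φ o))
    (hφj : ∀ o (g : (B o).G) (x : (B o).X), φ o (g • x) = j o g • φ o x)
    (hφf : ∀ o (x : (B o).X), f (φ o x) = rep o)
    (hψ : ∀ o (h : IsLocallyClosed {x | f x = rep o}), ∃ ψ : A.X.sub _ h → (B o).X,
      IsRegular ψ ∧ ∀ z, φ o (ψ z) = incl z) :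
    A.cls = ∑ o, (B o).cls := by
  choose oi hoi using hrep
  have hoieq : ∀ o, {x | oi x = o} = {x | ∃ g : A.G, g • rep o = f x} := by
    intro o
    ext x
    constructor
    · rintro rfl
      exact hoi x
    · rintro ⟨g, hg⟩
      obtain ⟨g', hg'⟩ := hoi x
      refine huniq _ _ (g⁻¹ * g') ?_
      rw [mul_smul, hg', ← hg, inv_smul_smul]
  have hlc : ∀ o, IsLocallyClosed {x | oi x = o} := fun o => by
    rw [hoieq]; exact isLocallyClosed_orbit_stratum hmono hclosed (rep o)
  have hinv : ∀ (g : A.G) (x : A.X), oi (g • x) = oi x := by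
    intro g x
    have h1 : g • x ∈ {y | ∃ g : A.G, g • rep (oi x) = f y} := by
      obtain ⟨g', hg'⟩ := hoi x
      exact ⟨g * g', by rw [mul_smul, hg', hf]⟩
    rw [← hoieq] at h1
    exact h1
  rw [cls_eq_sum_fibres oi hlc hinv]
  refine sum_congr rfl fun o _ => ?_
  set C := A.sub {x | oi x = o} (hlc o) fun g x hx => (hinv g x).trans hx with hC
  have hCf : ∀ z : C.X, ∃ g : A.G, g • rep o = f (val z) := fun z =>
    (Set.ext_iff.1 (hoieq o) (val z)).1 (val_mem z)
  have hclosedC : ∀ g : A.G, IsClosed {z : C.X | f (val z) = g • rep o} := by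
    intro g
    have h1 : {z : C.X | f (val z) = g • rep o} = val ⁻¹' {x | g • rep o ≤ f x} := by
      ext z
      constructor
      · intro h
        exact h.ge
      · intro h
        obtain ⟨g', hg'⟩ := hCf z
        have h2 : g • rep o ≤ (g' * g⁻¹) • g • rep o := by
          rw [mul_smul, inv_smul_smul, hg']; exact h
        have h3 := smul_eq_of_le_smul hmono h2
        rw [mul_smul, inv_smul_smul, hg'] at h3
        exact h3
    rw [h1]
    exact (hclosed _).preimage isRegular_val.continuous
  have hclopen : IsClopen {z : C.X | f (val z) = rep o} := by
    refine ⟨by simpa using hclosedC 1, ?_⟩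
    rw [← isClosed_compl_iff]
    have h1 : {z : C.X | f (val z) = rep o}ᶜ =
        ⋃ (g : A.G) (_ : g • rep o ≠ rep o), {z : C.X | f (val z) = g • rep o} := by
      ext z
      simp only [Set.mem_compl_iff, Set.mem_iUnion, Set.mem_ofPred_eq, exists_prop]
      constructor
      · intro h
        obtain ⟨g, hg⟩ := hCf z
        exact ⟨g, fun h2 => h (hg.symm.trans h2), hg.symm⟩
      · rintro ⟨g, hg, hz⟩ h
        exact hg (hz.symm.trans h)
    rw [h1]
    exact isClosed_iUnion_of_finite fun g => isClosed_iUnion_of_finite fun _ => hclosedC g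
  have hlc' : IsLocallyClosed {x | f x = rep o} := isLocallyClosed_stratum hclosed (rep o)
  obtain ⟨ψ, hψr, hψφ⟩ := hψ o hlc'
  have hφC : ∀ b : (B o).X, φ o b ∈ {x | oi x = o} := fun b => by
    rw [hoieq]; exact ⟨1, by rw [one_smul, hφf]⟩
  let e₁ : (B o).X → C.X := fun b => mkSub (hlc o) (fun g x hx => (hinv g x).trans hx) (φ o b) (hφC b)
  have he₁ : IsRegular e₁ := isRegular_mkSub (hφ o) _
  let e : (B o).X ≃ C.X.sub {z : C.X | f (val z) = rep o} hclopen.isOpen.isLocallyClosed :=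
    { toFun := fun b => toSub (e₁ b) (hφf o b)
      invFun := fun z => ψ (toSub (val (incl (X := C.X) z)) (incl_mem (X := C.X) z))
      left_inv := fun b => hφi o (hψφ _)
      right_inv := fun z => incl_injective (val_injective (hψφ _)) }
  refine cls_induced ⟨j o, _, hclopen, e, hj o, isRegular_toSub he₁ (hφf o),
    hψr.comp (isRegular_toSub (isRegular_val.comp isRegular_incl)
      fun z => incl_mem (X := C.X) z), fun g b => ?_, fun y => ?_,
    fun h b b' hb => ?_⟩
  · exact val_injective (hφj o g b)
  · obtain ⟨g, hg⟩ := hCf y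
    have h1 : f (g⁻¹ • val y) = rep o := by rw [hf, ← hg, inv_smul_smul]
    refine ⟨g, ψ (toSub _ h1), val_injective ?_⟩
    have h2 := hψφ (toSub _ h1)
    refine (congrArg (fun x : A.X => (show A.G from g) • x) h2).trans ?_
    exact smul_inv_smul (show A.G from g) (val y)
  · refine hstab o h ?_
    have h1 : (show A.G from h) • φ o b = φ o b' := congrArg val hb
    have h2 := congrArg f h1
    rw [hf, hφf, hφf] at h2
    exact h2

end Strata

/-- The case of a locally constant labelling. -/
theorem cls_eq_sum_strata_of_isClosed {A : GVar} {I : Type} [Finite I] [MulAction A.G I]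
    {f : A.X → I} (hf : ∀ (g : A.G) (x : A.X), f (g • x) = g • f x)
    (hclosed : ∀ i, IsClosed {x | f x = i}) {O : Type} [Fintype O] (rep : O → I)
    (hrep : ∀ x : A.X, ∃ (o : O) (g : A.G), g • rep o = f x)
    (huniq : ∀ (o o' : O) (g : A.G), g • rep o = rep o' → o = o')
    (B : O → GVar) (j : ∀ o, (B o).G →* A.G) (hj : ∀ o, Injective (j o))
    (hstab : ∀ o (g : A.G), g • rep o = rep o → g ∈ (j o).range)
    (φ : ∀ o, (B o).X → A.X) (hφ : ∀ o, IsRegular (φ o)) (hφi : ∀ o, Injective (φ o))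
    (hφj : ∀ o (g : (B o).G) (x : (B o).X), φ o (g • x) = j o g • φ o x)
    (hφf : ∀ o (x : (B o).X), f (φ o x) = rep o)
    (hψ : ∀ o (h : IsLocallyClosed {x | f x = rep o}), ∃ ψ : A.X.sub _ h → (B o).X,
      IsRegular ψ ∧ ∀ z, φ o (ψ z) = incl z) :
    A.cls = ∑ o, (B o).cls := by
  let _ : PartialOrder I :=
    { le := Eq, le_refl := fun _ => rfl, le_trans := fun _ _ _ => Eq.trans,
      le_antisymm := fun _ _ h _ => h }
  refine cls_eq_sum_strata (I := I) (fun g i j h => congrArg (g • ·) h) hf (fun i => ?_) rep hrep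
    huniq B j hj hstab φ hφ hφi hφj hφf hψ
  have : {x | i ≤ f x} = {x | f x = i} := by ext x; exact eq_comm
  rw [this]
  exact hclosed i

end GVar

/-! ### Discrete varieties -/

namespace ProjSpace

variable {I : Type}

open Classical in
theorem single_ne_zero (i : I) : (Pi.single i 1 : I → ℂ) ≠ 0 := Function.ne_iff.2 ⟨i, by simp⟩

/-- A coordinate point of a projective space. -/
def coordPoint (i : I) : ProjSpace I := point _ (single_ne_zero i)

theorem coords_coordPoint_self (i : I) : (coordPoint i).coords i ≠ 0 := by
  obtain ⟨c, hc0, hc⟩ := coords_point _ (single_ne_zero i)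
  rw [coordPoint, hc]
  simpa using hc0

theorem coords_coordPoint_of_ne {i j : I} (h : j ≠ i) : (coordPoint i).coords j = 0 := by
  classical
  obtain ⟨c, -, hc⟩ := coords_point _ (single_ne_zero i)
  rw [coordPoint, hc]
  simp [Pi.single_eq_of_ne h]

theorem coordPoint_eq {p : ProjSpace I} {i : I} (h : ∀ j, j ≠ i → p.coords j = 0) :
    coordPoint i = p := by
  classical
  refine (((point_eq_iff _ _ p.coords_ne_zero _).2 ⟨p.coords i, funext fun j => ?_⟩).symm).trans
    p.point_coords
  by_cases hj : j = i
  · rw [hj]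
    simp
  · rw [h j hj]
    simp [Pi.single_eq_of_ne hj]

end ProjSpace

namespace QPVar

section Disc

variable {I : Type} [Finite I]

variable (I) in
/-- A finite set as a variety of dimension zero: the coordinate points of a projective space. -/
def disc : QPVar where
  σ := I
  carrier := {p | ∀ i j, i ≠ j → p.coords i * p.coords j = 0}
  isLocallyClosed := by
    have : {p : ProjSpace I | ∀ i j, i ≠ j → p.coords i * p.coords j = 0} =
        ⋂ (i : I) (j : I) (_ : i ≠ j),
          {p : ProjSpace I | eval p.coords (MvPolynomial.X i * MvPolynomial.X j) ≠ 0}ᶜ := by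
      ext p
      simp only [Set.mem_ofPred_eq, Set.mem_iInter, Set.mem_compl_iff, not_not, map_mul, eval_X]
    rw [this]
    exact (isClosed_iInter fun i => isClosed_iInter fun j => isClosed_iInter fun _ =>
      (ProjSpace.isOpen_basic ((isHomogeneous_X ℂ i).mul
        (isHomogeneous_X ℂ j))).isClosed_compl).isLocallyClosed

/-- The element of the set corresponding to a point of a discrete variety. -/
def discIdx (z : disc I) : I := (Function.ne_iff.1 z.1.coords_ne_zero).choose

theorem discIdx_eq_iff {z : disc I} {i : I} : discIdx z = i ↔ z.1.coords i ≠ 0 := by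
  have h := (Function.ne_iff.1 z.1.coords_ne_zero).choose_spec
  refine ⟨fun hi => hi ▸ h, fun hi => ?_⟩
  by_contra hne
  exact mul_ne_zero h hi (z.2 _ _ hne)

theorem isClopen_discIdx_mem (S : Set I) : IsClopen {z : disc I | discIdx z ∈ S} := by
  have h : ∀ S : Set I, IsOpen {z : disc I | discIdx z ∈ S} := fun S => by
    have : {z : disc I | discIdx z ∈ S} = ⋃ i ∈ S, {z : disc I | eval (coords z)
        (MvPolynomial.X (σ := (disc I).σ) (i : I)) ≠ 0} := by
      ext z
      have h1 : ∀ i : I, eval (coords z) (MvPolynomial.X (σ := (disc I).σ) i) = z.1.coords i :=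
        fun i => eval_X i
      simp only [Set.mem_ofPred_eq, Set.mem_iUnion, h1, exists_prop, ← discIdx_eq_iff]
      exact exists_eq_right'.symm
    rw [this]
    exact isOpen_biUnion fun i _ => isOpen_form_ne_zero (isHomogeneous_X ℂ _)
  exact ⟨⟨h Sᶜ⟩, h S⟩

/-- The point of a discrete variety defined by an element of the set. -/
def discMk (i : I) : disc I := ⟨ProjSpace.coordPoint i, fun j k hjk => by
  by_cases h : j = i
  · exact mul_eq_zero_of_right _ (ProjSpace.coords_coordPoint_of_ne fun hk => hjk (h.trans hk.symm))
  · exact mul_eq_zero_of_left (ProjSpace.coords_coordPoint_of_ne h) _⟩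

theorem discIdx_mk (i : I) : discIdx (discMk i) = i :=
  discIdx_eq_iff.2 (ProjSpace.coords_coordPoint_self i)

theorem discMk_idx (z : disc I) : discMk (discIdx z) = z :=
  Subtype.ext (ProjSpace.coordPoint_eq fun _ hj =>
    not_not.1 fun h => hj (discIdx_eq_iff.2 h).symm)

theorem isRegular_discMk {T : QPVar} {f : T → I} (hf : ∀ i, IsOpen {t | f t = i}) :
    IsRegular fun t => discMk (f t) :=
  isRegular_of_open_cover fun t => ⟨_, hf (f t), rfl,
    (isRegular_congr fun z => congrArg discMk (incl_mem z)).2 (isRegular_const (discMk (f t)))⟩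

end Disc

end QPVar

namespace GVar

section Comap

variable {Y : GVar} {H : Type} [Group H] [Finite H] {j : H →* Y.G}

/-- The group acting through a homomorphism. -/
def comapG : (Y.comap j).G ≃* H := MulEquiv.refl H

/-- A point of a variety as a point of the variety with the action of another group. -/
def comapMk (x : Y.X) : (Y.comap j).X := x

/-- A point of a variety with the action of another group as a point of the variety. -/
def comapVal (x : (Y.comap j).X) : Y.X := x

theorem comapVal_mk (x : Y.X) : comapVal (comapMk (j := j) x) = x := rfl

theorem comapVal_injective : Injective (comapVal (j := j)) := fun _ _ h => h

theorem comapVal_smul (h : (Y.comap j).G) (x : (Y.comap j).X) :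
    comapVal (h • x) = j (comapG h) • comapVal x := rfl

theorem isRegular_comapMk : IsRegular (comapMk (j := j)) := isRegular_id Y.X

theorem isRegular_comapVal : IsRegular (comapVal (j := j)) := isRegular_id Y.X

end Comap

/-! ### Inertia varieties -/

variable {A : GVar}

/-- The group of an invariant subvariety. -/
def subG {Z : Set A.X} {hZ : IsLocallyClosed Z}
    {hG : ∀ (g : A.G) (x : A.X), x ∈ Z → g • x ∈ Z} : (A.sub Z hZ hG).G ≃* A.G :=
  MulEquiv.refl A.G

/-- The group of a product. -/
def prodG {A B : GVar} : (A.prod B).G ≃* A.G × B.G := MulEquiv.refl (A.G × B.G)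

theorem val_smul_eq {Z : Set A.X} {hZ : IsLocallyClosed Z}
    {hG : ∀ (g : A.G) (x : A.X), x ∈ Z → g • x ∈ Z} (g : (A.sub Z hZ hG).G)
    (z : (A.sub Z hZ hG).X) : val (g • z) = subG g • val z := rfl

theorem pr₁_smul {A B : GVar} (g : (A.prod B).G) (z : (A.prod B).X) :
    pr₁ (g • z) = (prodG g).1 • pr₁ z := fst_smul g z

theorem pr₂_smul {A B : GVar} (g : (A.prod B).G) (z : (A.prod B).X) :
    pr₂ (g • z) = (prodG g).2 • pr₂ z := snd_smul g z

/-- The point of a product with given components. -/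
def pair {A B : GVar} (x : A.X) (y : B.X) : (A.prod B).X := (prodEquiv A.X B.X).symm (x, y)

theorem pr₁_pair {A B : GVar} (x : A.X) (y : B.X) : pr₁ (pair x y) = x :=
  congrArg Prod.fst (Equiv.apply_symm_apply _ _)

theorem pr₂_pair {A B : GVar} (x : A.X) (y : B.X) : pr₂ (pair x y) = y :=
  congrArg Prod.snd (Equiv.apply_symm_apply _ _)

theorem isRegular_pr₁ {A B : GVar} : IsRegular (pr₁ (A := A) (B := B)) := isRegular_fst A.X B.X

theorem isRegular_pr₂ {A B : GVar} : IsRegular (pr₂ (A := A) (B := B)) := isRegular_snd A.X B.X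

theorem isRegular_pair {A B : GVar} {T : QPVar} {φ : T → A.X} {ψ : T → B.X} (hφ : IsRegular φ)
    (hψ : IsRegular ψ) : IsRegular fun t => (pair (φ t) (ψ t) : (A.prod B).X) :=
  isRegular_prod (X := A.X) (Y := B.X) ((isRegular_congr fun t => pr₁_pair (φ t) (ψ t)).2 hφ)
    ((isRegular_congr fun t => pr₂_pair (φ t) (ψ t)).2 hψ)

/-- A finite group as a variety, with the action by conjugation. -/
def conjVar (G : Type) [Group G] [Finite G] : GVar where
  X := disc G
  G := G
  action :=
    { smul := fun h z => discMk (h * discIdx z * h⁻¹)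
      one_smul := fun z => by
        refine Eq.trans (congrArg discMk ?_) (discMk_idx z)
        rw [one_mul, inv_one, mul_one]
      mul_smul := fun h k z => congrArg discMk (by
        refine Eq.trans ?_ (congrArg (fun t => h * t * h⁻¹) (discIdx_mk _).symm)
        rw [mul_inv_rev]
        simp only [mul_assoc]) }
  isRegular_smul h := isRegular_discMk fun g =>
    (isClopen_discIdx_mem {t | h * t * h⁻¹ = g}).isOpen

/-- The group acting by conjugation. -/
def conjVarG {G : Type} [Group G] [Finite G] : (conjVar G).G ≃* G := MulEquiv.refl G

/-- The product of the group and the variety, the group acting by conjugation on the first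
factor. -/
def conjProd (A : GVar) : GVar := ((conjVar A.G).prod A).comap (prodG.symm.toMonoidHom.comp
  (conjVarG.symm.toMonoidHom.prod (MonoidHom.id A.G)))

/-- The group element of a point `(g, x)` of the product. -/
def conjElt (z : A.conjProd.X) : A.G := discIdx (I := A.G) (pr₁ (comapVal z))

/-- The point `x` of a point `(g, x)` of the product. -/
def conjPos (z : A.conjProd.X) : A.X := pr₂ (comapVal z)

/-- The group of the product. -/
def conjG : A.conjProd.G ≃* A.G := MulEquiv.refl A.G

theorem conjElt_smul (h : A.conjProd.G) (z : A.conjProd.X) :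
    conjElt (h • z) = conjG h * conjElt z * (conjG h)⁻¹ :=
  (congrArg (discIdx (I := A.G)) (pr₁_smul (A := conjVar A.G) (B := A)
    (prodG.symm (conjVarG.symm (conjG h), conjG h)) (comapVal z))).trans (discIdx_mk _)

theorem conjPos_smul (h : A.conjProd.G) (z : A.conjProd.X) :
    conjPos (h • z) = conjG h • conjPos z :=
  pr₂_smul (A := conjVar A.G) (prodG.symm (conjVarG.symm (conjG h), conjG h)) (comapVal z)

theorem isClopen_conjElt_mem (S : Set A.G) : IsClopen {z : A.conjProd.X | conjElt z ∈ S} :=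
  (isClopen_discIdx_mem S).preimage (isRegular_pr₁.comp isRegular_comapVal).continuous

theorem isRegular_conjPos : IsRegular (conjPos (A := A)) := isRegular_pr₂.comp isRegular_comapVal

theorem isClosed_inertia : IsClosed {z : A.conjProd.X | conjElt z • conjPos z = conjPos z} := by
  have : {z : A.conjProd.X | conjElt z • conjPos z = conjPos z} =
      ⋃ g : A.G, {z | conjElt z ∈ ({g} : Set A.G)} ∩ conjPos ⁻¹' A.fixedLocus g := by
    ext z
    simp [fixedLocus]
  rw [this]
  exact isClosed_iUnion_of_finite fun g => (isClopen_conjElt_mem {g}).isClosed.inter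
    ((A.isClosed_fixedLocus g).preimage isRegular_conjPos.continuous)

variable (A) in
/-- The inertia variety of a `G`-variety `X`: the variety of pairs `(g, x)` with `g x = x`, the
group acting by conjugation on the first component. -/
def inertia : GVar := A.conjProd.sub {z | conjElt z • conjPos z = conjPos z}
  isClosed_inertia.isLocallyClosed fun h z (hz : conjElt z • conjPos z = conjPos z) => by
    show conjElt (h • z) • conjPos (h • z) = conjPos (h • z)
    rw [conjElt_smul, conjPos_smul, smul_smul, inv_mul_cancel_right, mul_smul, hz]

/-- The group element of a point `(g, x)` of the inertia variety. -/
def elt (z : A.inertia.X) : A.G := conjElt (val z)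

/-- The point `x` of a point `(g, x)` of the inertia variety. -/
def pos (z : A.inertia.X) : A.X := conjPos (val z)

theorem elt_smul_pos (z : A.inertia.X) : elt z • pos z = pos z := val_mem z

/-- The point `(g, x)` of the product. -/
def conjMk (g : A.G) (x : A.X) : A.conjProd.X :=
  comapMk (pair (show (conjVar A.G).X from discMk g) x)

theorem conjElt_mk (g : A.G) (x : A.X) : conjElt (conjMk g x) = g :=
  (congrArg (discIdx (I := A.G)) (pr₁_pair (A := conjVar A.G) _ _)).trans (discIdx_mk g)

theorem conjPos_mk (g : A.G) (x : A.X) : conjPos (conjMk g x) = x := pr₂_pair _ _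

/-- The point `(g, x)` of the inertia variety. -/
def inertiaMk (g : A.G) (x : A.X) (h : g • x = x) : A.inertia.X :=
  mkSub _ _ (conjMk g x) (by
    show conjElt _ • conjPos _ = conjPos _
    rwa [conjElt_mk, conjPos_mk])

theorem elt_mk (g : A.G) (x : A.X) (h : g • x = x) : elt (inertiaMk g x h) = g := conjElt_mk g x

theorem pos_mk (g : A.G) (x : A.X) (h : g • x = x) : pos (inertiaMk g x h) = x := conjPos_mk g x

theorem inertia_ext {z w : A.inertia.X} (h : elt z = elt w) (h' : pos z = pos w) : z = w := by
  refine val_injective (comapVal_injective (prod_ext ?_ h'))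
  exact (discMk_idx _).symm.trans ((congrArg discMk h).trans (discMk_idx _))

theorem isClopen_elt_mem (S : Set A.G) : IsClopen {z : A.inertia.X | elt z ∈ S} :=
  (isClopen_conjElt_mem S).preimage isRegular_val.continuous

theorem isRegular_pos : IsRegular (pos (A := A)) := isRegular_conjPos.comp isRegular_val

theorem isRegular_inertiaMk {T : QPVar} {f : T → A.G} {φ : T → A.X}
    (hf : ∀ g, IsOpen {t | f t = g}) (hφ : IsRegular φ) (h : ∀ t, f t • φ t = φ t) :
    IsRegular fun t => inertiaMk (f t) (φ t) (h t) :=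
  isRegular_mkSub (isRegular_comapMk.comp (isRegular_pair (isRegular_discMk hf) hφ)) _

/-- The group of an inertia variety. -/
def inertiaG : A.inertia.G ≃* A.G := MulEquiv.refl A.G

theorem elt_smul (h : A.inertia.G) (z : A.inertia.X) :
    elt (h • z) = inertiaG h * elt z * (inertiaG h)⁻¹ := conjElt_smul _ _

theorem pos_smul (h : A.inertia.G) (z : A.inertia.X) : pos (h • z) = inertiaG h • pos z :=
  conjPos_smul _ _

/-- A map between inertia varieties defined by a map of the groups and a map of the varieties. -/
theorem isRegular_inertiaMk_comp {B : GVar} (j : A.G → B.G) {φ : A.X → B.X} (hφ : IsRegular φ)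
    (h : ∀ z : A.inertia.X, j (elt z) • φ (pos z) = φ (pos z)) :
    IsRegular fun z : A.inertia.X => inertiaMk (j (elt z)) (φ (pos z)) (h z) :=
  isRegular_inertiaMk (fun g => (isClopen_elt_mem {t | j t = g}).isOpen) (hφ.comp isRegular_pos) _

theorem inertia_iso {B : GVar} (h : GVar.Iso A B) : GVar.Iso A.inertia B.inertia := by
  obtain ⟨φ, ψ, hψ, hψ', hs⟩ := h
  have h1 : ∀ z : A.inertia.X, φ (elt z) • ψ (pos z) = ψ (pos z) := fun z => by
    rw [← hs, elt_smul_pos]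
  have hs' : ∀ (g : B.G) (y : B.X), ψ.symm (g • y) = φ.symm g • ψ.symm y := fun g y => by
    apply ψ.injective
    rw [hs, MulEquiv.apply_symm_apply, Equiv.apply_symm_apply, Equiv.apply_symm_apply]
  have h2 : ∀ z : B.inertia.X, φ.symm (elt z) • ψ.symm (pos z) = ψ.symm (pos z) := fun z => by
    rw [← hs', elt_smul_pos]
  refine iso_of_inverse ((inertiaG.trans φ).trans inertiaG.symm)
    (isRegular_inertiaMk_comp φ hψ h1)
    (isRegular_inertiaMk_comp φ.symm hψ' h2) (fun z => inertia_ext ?_ ?_)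
    (fun z => inertia_ext ?_ ?_) fun g z => inertia_ext ?_ ?_
  · rw [elt_mk, elt_mk, MulEquiv.symm_apply_apply]
  · rw [pos_mk, pos_mk, Equiv.symm_apply_apply]
  · rw [elt_mk, elt_mk, MulEquiv.apply_symm_apply]
  · rw [pos_mk, pos_mk, Equiv.apply_symm_apply]
  · rw [elt_mk, elt_smul, elt_smul, elt_mk]
    simp
  · rw [pos_mk, pos_smul, pos_smul, pos_mk, hs]
    simp

theorem smul_mem_inertia {Z : Set A.X} (hG : ∀ (g : A.G) (x : A.X), x ∈ Z → g • x ∈ Z)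
    (g : A.inertia.G) (z : A.inertia.X) (hz : pos z ∈ Z) : pos (g • z) ∈ Z := by
  rw [pos_smul]
  exact hG _ _ hz

theorem inertia_sub_iso {Z : Set A.X} (hZ : IsLocallyClosed Z)
    (hG : ∀ (g : A.G) (x : A.X), x ∈ Z → g • x ∈ Z)
    (hZ' : IsLocallyClosed {z : A.inertia.X | pos z ∈ Z}) :
    GVar.Iso (A.sub Z hZ hG).inertia
      (A.inertia.sub {z : A.inertia.X | pos z ∈ Z} hZ' (smul_mem_inertia (Z := Z) hG)) := by
  have h1 : ∀ z : (A.sub Z hZ hG).inertia.X, subG (elt z) • val (pos z) = val (pos z) := fun z => by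
    rw [← val_smul_eq, elt_smul_pos]
  have h2 : ∀ w : (A.inertia.sub {z : A.inertia.X | pos z ∈ Z} hZ' (smul_mem_inertia (Z := Z) hG)).X,
      (subG.symm (elt (val (A := A.inertia) w)) : (A.sub Z hZ hG).G) •
        mkSub hZ hG (pos (val (A := A.inertia) w)) (val_mem (A := A.inertia) w) =
      mkSub hZ hG (pos (val (A := A.inertia) w)) (val_mem (A := A.inertia) w) := fun w => by
    apply val_injective
    rw [val_smul_eq, val_mkSub, MulEquiv.apply_symm_apply, elt_smul_pos]
  have h3 : ∀ z, inertiaMk _ _ (h1 z) ∈ {z : A.inertia.X | pos z ∈ Z} := fun z => by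
    show pos _ ∈ Z
    rw [pos_mk]
    exact val_mem _
  refine iso_of_inverse (((inertiaG (A := A.sub Z hZ hG)).trans subG).trans
    ((inertiaG (A := A)).symm.trans subG.symm))
    (isRegular_mkSub (hZ := hZ') (hG := smul_mem_inertia (Z := Z) hG)
      (isRegular_inertiaMk_comp (A := A.sub Z hZ hG) subG isRegular_val h1) h3)
    (isRegular_inertiaMk (A := A.sub Z hZ hG)
      (f := fun w => subG.symm (elt (val (A := A.inertia) w))) (fun g => (isClopen_elt_mem (A := A) {subG g}).isOpen.preimage
      isRegular_val.continuous) (isRegular_mkSub (isRegular_pos.comp isRegular_val) _) h2)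
    (fun z => inertia_ext ?_ ?_)
    (fun z => val_injective (inertia_ext ?_ ?_)) fun g z => val_injective (inertia_ext ?_ ?_)
  · rw [elt_mk, val_mkSub, elt_mk, MulEquiv.symm_apply_apply]
  · apply val_injective
    rw [pos_mk, val_mkSub, val_mkSub, pos_mk]
  · rw [val_mkSub, elt_mk, elt_mk, MulEquiv.apply_symm_apply]
  · rw [val_mkSub, pos_mk, pos_mk, val_mkSub]
  · rw [val_mkSub, elt_mk, elt_smul, val_smul_eq, val_mkSub, elt_smul, elt_mk]
    simp
  · rw [val_mkSub, pos_mk, pos_smul, val_smul_eq, val_smul_eq, val_mkSub, pos_smul, pos_mk]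
    simp

theorem inertia_prod_iso (A B : GVar) : GVar.Iso (A.prod B).inertia (A.inertia.prod B.inertia) := by
  have h1 : ∀ z : (A.prod B).inertia.X, (prodG (elt z)).1 • pr₁ (pos z) = pr₁ (pos z) := fun z => by
    rw [← pr₁_smul, elt_smul_pos]
  have h2 : ∀ z : (A.prod B).inertia.X, (prodG (elt z)).2 • pr₂ (pos z) = pr₂ (pos z) := fun z => by
    rw [← pr₂_smul, elt_smul_pos]
  have h3 : ∀ w : (A.inertia.prod B.inertia).X,
      (prodG.symm (elt (pr₁ w), elt (pr₂ w)) : (A.prod B).G) •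
        (pair (pos (pr₁ w)) (pos (pr₂ w)) : (A.prod B).X) = pair (pos (pr₁ w)) (pos (pr₂ w)) :=
    fun w => prod_ext (by rw [pr₁_smul, pr₁_pair, MulEquiv.apply_symm_apply, elt_smul_pos])
      (by rw [pr₂_smul, pr₂_pair, MulEquiv.apply_symm_apply, elt_smul_pos])
  have hf : IsRegular fun z => (pair (inertiaMk _ _ (h1 z)) (inertiaMk _ _ (h2 z)) :
      (A.inertia.prod B.inertia).X) := isRegular_pair
    (isRegular_inertiaMk
      (fun g => (isClopen_elt_mem (A := A.prod B) {t | (prodG t).1 = g}).isOpen)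
      (isRegular_pr₁.comp isRegular_pos) _)
    (isRegular_inertiaMk
      (fun g => (isClopen_elt_mem (A := A.prod B) {t | (prodG t).2 = g}).isOpen)
      (isRegular_pr₂.comp isRegular_pos) _)
  refine iso_of_inverse ((inertiaG.trans prodG).trans
    ((inertiaG.symm.prodCongr inertiaG.symm).trans prodG.symm)) hf
    (isRegular_inertiaMk (fun g => ?_) (isRegular_pair (isRegular_pos.comp isRegular_pr₁)
      (isRegular_pos.comp isRegular_pr₂)) h3)
    (fun z => inertia_ext ?_ ?_)
    (fun w => prod_ext (inertia_ext ?_ ?_) (inertia_ext ?_ ?_)) fun g z =>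
      prod_ext (inertia_ext ?_ ?_) (inertia_ext ?_ ?_)
  · have h4 := ((isClopen_elt_mem (A := A) {(prodG g).1}).isOpen.preimage
        (isRegular_pr₁ (A := A.inertia) (B := B.inertia)).continuous).inter
      ((isClopen_elt_mem (A := B) {(prodG g).2}).isOpen.preimage
        (isRegular_pr₂ (A := A.inertia) (B := B.inertia)).continuous)
    convert h4 using 1
    refine Set.ext fun w => ?_
    show prodG.symm (elt (pr₁ w), elt (pr₂ w)) = g ↔ _
    rw [MulEquiv.symm_apply_eq]
    exact Prod.ext_iff
  · rw [elt_mk, pr₁_pair, pr₂_pair, elt_mk, elt_mk, MulEquiv.symm_apply_eq]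
  · refine prod_ext ?_ ?_
    · rw [pos_mk, pr₁_pair, pr₁_pair, pos_mk]
    · rw [pos_mk, pr₂_pair, pr₂_pair, pos_mk]
  · rw [pr₁_pair, elt_mk, elt_mk, MulEquiv.apply_symm_apply]
  · rw [pr₁_pair, pos_mk, pos_mk, pr₁_pair]
  · rw [pr₂_pair, elt_mk, elt_mk, MulEquiv.apply_symm_apply]
  · rw [pr₂_pair, pos_mk, pos_mk, pr₂_pair]
  · rw [pr₁_pair, elt_mk, elt_smul, pr₁_smul, elt_smul, pr₁_pair, elt_mk]
    rfl
  · rw [pr₁_pair, pos_mk, pos_smul, pr₁_smul, pr₁_smul, pos_smul, pr₁_pair, pos_mk]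
    rfl
  · rw [pr₂_pair, elt_mk, elt_smul, pr₂_smul, elt_smul, pr₂_pair, elt_mk]
    rfl
  · rw [pr₂_pair, pos_mk, pos_smul, pr₂_smul, pr₂_smul, pos_smul, pr₂_pair, pos_mk]
    rfl

theorem isInduced_of_maps {A B : GVar} (j : A.G →* B.G) (hj : Injective j) {Z : Set B.X}
    (hZ : IsClopen Z) {φ : A.X → B.X} (hφ : IsRegular φ) (hφZ : ∀ x, φ x ∈ Z)
    {ψ : B.X.sub Z hZ.isOpen.isLocallyClosed → A.X} (hψ : IsRegular ψ)
    (hφi : Injective φ) (hφψ : ∀ w, φ (ψ w) = incl w)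
    (h₁ : ∀ (g : A.G) (x : A.X), φ (g • x) = j g • φ x)
    (h₂ : ∀ y : B.X, ∃ (h : B.G) (x : A.X), h • φ x = y)
    (h₃ : ∀ (h : B.G) (x x' : A.X), h • φ x = φ x' → h ∈ j.range) : IsInduced A B :=
  ⟨j, Z, hZ, ⟨fun x => toSub (φ x) (hφZ x), ψ, fun _ => hφi (hφψ _), fun w =>
    incl_injective (hφψ w)⟩, hj, isRegular_toSub hφ hφZ, hψ, h₁, h₂, h₃⟩

theorem IsInduced.exists_maps {A B : GVar} (h : IsInduced A B) :
    ∃ (j : A.G →* B.G) (Z : Set B.X) (hZ : IsClopen Z) (φ : A.X → B.X)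
      (ψ : B.X.sub Z hZ.isOpen.isLocallyClosed → A.X), Injective j ∧ IsRegular φ ∧
      (∀ x, φ x ∈ Z) ∧ IsRegular ψ ∧ Injective φ ∧ (∀ w, φ (ψ w) = incl w) ∧
      (∀ (g : A.G) (x : A.X), φ (g • x) = j g • φ x) ∧
      (∀ y : B.X, ∃ (h : B.G) (x : A.X), h • φ x = y) ∧
      ∀ (h : B.G) (x x' : A.X), h • φ x = φ x' → h ∈ j.range := by
  obtain ⟨j, Z, hZ, e, hj, he, he', h₁, h₂, h₃⟩ := h
  exact ⟨j, Z, hZ, fun x => incl (e x), e.symm, hj, isRegular_incl.comp he, fun x => incl_mem _,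
    he', fun x y h => e.injective (incl_injective h),
    fun w => congrArg incl (e.apply_symm_apply w), h₁, h₂, h₃⟩

theorem IsInduced.inertia {A B : GVar} (h : IsInduced A B) : IsInduced A.inertia B.inertia := by
  obtain ⟨j, Z, hZ, φ, ψ, hj, hφ, hφZ, hψ, hφi, hφψ, h₁, h₂, h₃⟩ := h.exists_maps
  have hZ' : IsClopen {z : B.inertia.X | pos z ∈ Z} := hZ.preimage isRegular_pos.continuous
  have hfix : ∀ z : A.inertia.X, j (elt z) • φ (pos z) = φ (pos z) := fun z => by
    rw [← h₁, elt_smul_pos]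
  let Y := B.inertia.X.sub {z : B.inertia.X | pos z ∈ Z} hZ'.isOpen.isLocallyClosed
  let y : Y → A.X := fun w => ψ (toSub (pos (incl w)) (incl_mem w))
  have hy : ∀ w : Y, φ (y w) = pos (incl w) := fun w => hφψ _
  have hyr : IsRegular y := hψ.comp (isRegular_toSub (isRegular_pos.comp isRegular_incl)
    fun w => incl_mem w)
  have hk : ∀ w : Y, ∃ g : A.G, j g = elt (incl w) := fun w => by
    refine h₃ _ (y w) (y w) ?_
    rw [hy, elt_smul_pos]
  choose k hk using hk
  have hkf : ∀ w : Y, k w • y w = y w := fun w => by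
    apply hφi
    rw [h₁, hk, hy, elt_smul_pos]
  have hψ' : IsRegular fun w : Y => inertiaMk (k w) (y w) (hkf w) := isRegular_inertiaMk (fun g => by
    have : {w | k w = g} = incl ⁻¹' {z : B.inertia.X | elt z ∈ ({j g} : Set B.G)} := by
      ext w
      exact ⟨fun h => (hk w).symm.trans (congrArg j h), fun h => hj ((hk w).trans h)⟩
    rw [this]
    exact (isClopen_elt_mem (A := B) {j g}).isOpen.preimage continuous_incl) hyr hkf
  refine isInduced_of_maps ((inertiaG.symm.toMonoidHom.comp j).comp inertiaG.toMonoidHom)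
    (inertiaG.symm.injective.comp (hj.comp inertiaG.injective)) hZ'
    (isRegular_inertiaMk_comp (A := A) (B := B) j hφ hfix) (fun z => ?_) hψ'
    (fun z z' h => inertia_ext ?_ ?_) (fun w => inertia_ext ?_ ?_)
    (fun g z => inertia_ext ?_ ?_) (fun w => ?_) (fun g z z' hzz => ?_)
  · show pos _ ∈ Z
    rw [pos_mk]
    exact hφZ _
  · have h' := congrArg elt h
    rw [elt_mk, elt_mk] at h'
    exact hj h'
  · have h' := congrArg pos h
    rw [pos_mk, pos_mk] at h'
    exact hφi h'
  · rw [elt_mk, elt_mk, hk]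
  · rw [pos_mk, pos_mk, hy]
  · rw [elt_mk, elt_smul, elt_smul, elt_mk]
    simp
  · rw [pos_mk, pos_smul, pos_smul, pos_mk, h₁]
    simp
  · obtain ⟨h, x, hx⟩ := h₂ (pos w)
    have h5 : (h⁻¹ * elt w * h) • φ x = φ x := by
      rw [mul_smul, mul_smul, hx, elt_smul_pos, ← hx, inv_smul_smul]
    obtain ⟨g, hg⟩ := h₃ _ _ _ h5
    have h6 : g • x = x := by
      apply hφi
      rw [h₁, hg, h5]
    refine ⟨inertiaG.symm h, inertiaMk g x h6, inertia_ext ?_ ?_⟩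
    · rw [elt_smul, elt_mk, elt_mk, hg, MulEquiv.apply_symm_apply]
      group
    · rw [pos_smul, pos_mk, pos_mk, hx.symm, MulEquiv.apply_symm_apply]
  · have h5 := congrArg pos hzz
    rw [pos_smul, pos_mk, pos_mk] at h5
    obtain ⟨a, ha⟩ := h₃ _ _ _ h5
    exact ⟨inertiaG.symm a, inertiaG.injective (by simpa using ha)⟩


theorem inertia_pt_iso : GVar.Iso pt.inertia pt := by
  have h : ∀ x : pt.X, (1 : pt.G) • x = x := fun x => one_smul _ x
  refine iso_of_inverse (A := pt.inertia) (B := pt) (inertiaG (A := pt)) isRegular_pos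
    (isRegular_inertiaMk (f := fun _ => 1) (fun g => ?_) (isRegular_id _) h) (fun z => inertia_ext ?_ ?_)
    (fun x => pos_mk _ _ _) fun g z => pos_smul _ _
  · have : {t : pt.X | (1 : pt.G) = g} = Set.univ :=
      Set.eq_univ_of_forall fun _ => Subsingleton.elim (α := Unit) _ _
    rw [this]
    exact isOpen_univ
  · exact Subsingleton.elim (α := Unit) _ _
  · exact pos_mk _ _ _

end GVar

/-- The class of the inertia variety as a function on isomorphism classes. -/
def inertiaHom : GClass →* K0fGr where
  toFun := Quotient.lift (fun A : GVar => A.inertia.cls) fun _ _ h =>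
    GVar.cls_eq (GVar.inertia_iso h)
  map_one' := GVar.cls_eq GVar.inertia_pt_iso
  map_mul' := by
    rintro ⟨A⟩ ⟨B⟩
    exact (GVar.cls_eq (GVar.inertia_prod_iso A B)).trans (GVar.cls_prod _ _)

/-- The endomorphism of `K₀^fGr(Var_ℂ)` that sends the class of a `G`-variety to the class of its
inertia variety. -/
def inertiaRingHom : K0fGr →+* K0fGr :=
  relationLiftRing inertiaHom (by
    rintro r (⟨A, Y, hY, hG⟩ | ⟨A, B, h⟩)
    · rw [map_sub, map_add, GVar.lift_gen, GVar.lift_gen, GVar.lift_gen]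
      have hc : IsClosed {z : A.inertia.X | GVar.pos z ∈ Y} :=
        hY.preimage GVar.isRegular_pos.continuous
      refine sub_eq_zero.2 ((GVar.cls_scissor A.inertia _ hc
        (GVar.smul_mem_inertia (Z := Y) hG)).trans ?_)
      refine congrArg₂ (· + ·) ?_ ?_
      · exact (GVar.cls_eq (GVar.inertia_sub_iso hY.isLocallyClosed hG hc.isLocallyClosed)).symm
      · exact (GVar.cls_eq (GVar.inertia_sub_iso hY.isOpen_compl.isLocallyClosed
          (GVar.smul_mem_compl hG) hc.isOpen_compl.isLocallyClosed)).symm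
    · rw [map_sub, GVar.lift_gen, GVar.lift_gen]
      exact sub_eq_zero.2 (GVar.cls_induced h.inertia))

theorem inertiaRingHom_cls (A : GVar) : inertiaRingHom A.cls = A.inertia.cls :=
  relationLiftRing_of _ _ _

namespace GVar

variable {A : GVar}

/-- The group of a fixed point locus. -/
def fixedG {g : A.G} : (A.fixed g).G ≃* Subgroup.centralizer {g} := MulEquiv.refl _

/-- The inclusion of a fixed point locus. -/
def fixedVal {g : A.G} (z : (A.fixed g).X) : A.X :=
  incl (hZ := (A.isClosed_fixedLocus g).isLocallyClosed) z

/-- The point of a fixed point locus defined by a point of the variety. -/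
def fixedMk {g : A.G} (x : A.X) (h : g • x = x) : (A.fixed g).X :=
  toSub (hZ := (A.isClosed_fixedLocus g).isLocallyClosed) x h

theorem smul_fixedVal {g : A.G} (z : (A.fixed g).X) : g • fixedVal z = fixedVal z :=
  incl_mem (hZ := (A.isClosed_fixedLocus g).isLocallyClosed) z

theorem fixedVal_mk {g : A.G} (x : A.X) (h : g • x = x) : fixedVal (fixedMk x h) = x := rfl

theorem fixedVal_injective {g : A.G} : Injective (fixedVal (A := A) (g := g)) :=
  incl_injective (hZ := (A.isClosed_fixedLocus g).isLocallyClosed)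

theorem fixedVal_smul {g : A.G} (h : (A.fixed g).G) (z : (A.fixed g).X) :
    fixedVal (h • z) = (fixedG h).1 • fixedVal z := rfl

theorem isRegular_fixedVal {g : A.G} : IsRegular (fixedVal (A := A) (g := g)) :=
  isRegular_incl (hZ := (A.isClosed_fixedLocus g).isLocallyClosed)

theorem isRegular_fixedMk {g : A.G} {T : QPVar} {φ : T → A.X} (hφ : IsRegular φ)
    (h : ∀ t, g • φ t = φ t) : IsRegular fun t => fixedMk (φ t) (h t) :=
  isRegular_toSub (hS := (A.isClosed_fixedLocus g).isLocallyClosed) hφ h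

theorem smul_mem_elt {K : Set A.G} (hK : ∀ g k, k ∈ K → g * k * g⁻¹ ∈ K) (g : A.inertia.G)
    (z : A.inertia.X) (hz : elt z ∈ K) : elt (g • z) ∈ K := by
  rw [elt_smul]
  exact hK _ _ hz

/-- The part of the inertia variety over an invariant set of group elements. -/
def inertiaOn (A : GVar) (K : Set A.G) (hK : ∀ g k, k ∈ K → g * k * g⁻¹ ∈ K) : GVar :=
  A.inertia.sub {z | elt z ∈ K} (isClopen_elt_mem K).isOpen.isLocallyClosed
    (smul_mem_elt (K := K) hK)

section InertiaOn

variable {K : Set A.G} {hK : ∀ g k, k ∈ K → g * k * g⁻¹ ∈ K}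

/-- The group of a part of an inertia variety. -/
def onG : (A.inertiaOn K hK).G ≃* A.G := MulEquiv.refl _

/-- The group element of a point `(g, x)`. -/
def onElt (z : (A.inertiaOn K hK).X) : A.G := elt (val (A := A.inertia) z)

/-- The point `x` of a point `(g, x)`. -/
def onPos (z : (A.inertiaOn K hK).X) : A.X := pos (val (A := A.inertia) z)

/-- The point `(g, x)`. -/
def onMk (g : A.G) (x : A.X) (h : g • x = x) (hg : g ∈ K) : (A.inertiaOn K hK).X :=
  mkSub _ _ (inertiaMk g x h) (by
    show elt _ ∈ K
    rwa [elt_mk])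

theorem onElt_mk (g : A.G) (x : A.X) (h : g • x = x) (hg : g ∈ K) :
    onElt (onMk (hK := hK) g x h hg) = g := elt_mk g x h

theorem onPos_mk (g : A.G) (x : A.X) (h : g • x = x) (hg : g ∈ K) :
    onPos (onMk (hK := hK) g x h hg) = x := pos_mk g x h

theorem onElt_mem (z : (A.inertiaOn K hK).X) : onElt z ∈ K := val_mem (A := A.inertia) z

theorem onElt_smul_pos (z : (A.inertiaOn K hK).X) : onElt z • onPos z = onPos z := elt_smul_pos _

theorem onElt_smul (g : (A.inertiaOn K hK).G) (z : (A.inertiaOn K hK).X) :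
    onElt (g • z) = onG g * onElt z * (onG g)⁻¹ := elt_smul (A := A) _ _

theorem onPos_smul (g : (A.inertiaOn K hK).G) (z : (A.inertiaOn K hK).X) :
    onPos (g • z) = onG g • onPos z := pos_smul (A := A) _ _

theorem on_ext {z w : (A.inertiaOn K hK).X} (h : onElt z = onElt w) (h' : onPos z = onPos w) :
    z = w := val_injective (inertia_ext h h')

theorem isClopen_onElt_mem (S : Set A.G) : IsClopen {z : (A.inertiaOn K hK).X | onElt z ∈ S} :=
  (isClopen_elt_mem S).preimage (isRegular_val (A := A.inertia)).continuous

theorem isLocallyConstant_onElt : IsLocallyConstant (onElt (A := A) (K := K) (hK := hK)) :=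
  fun S => (isClopen_onElt_mem S).isOpen

theorem isRegular_onPos : IsRegular (onPos (A := A) (K := K) (hK := hK)) :=
  isRegular_pos.comp (isRegular_val (A := A.inertia))

theorem isRegular_onMk {T : QPVar} {f : T → A.G} {φ : T → A.X}
    (hf : ∀ g, IsOpen {t | f t = g}) (hφ : IsRegular φ) (h : ∀ t, f t • φ t = φ t)
    (hfK : ∀ t, f t ∈ K) : IsRegular fun t => onMk (hK := hK) (f t) (φ t) (h t) (hfK t) :=
  isRegular_mkSub (A := A.inertia) (isRegular_inertiaMk hf hφ h) _

theorem inertia_cls_eq_inertiaOn_univ :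
    A.inertia.cls = (A.inertiaOn Set.univ fun _ _ _ => trivial).cls := by
  rw [← clsOn_univ]
  exact clsOn_eq (A := A.inertia) _ _

open Classical in
/-- The inertia variety is a union of varieties induced by fixed point loci. -/
theorem inertiaOn_cls {O : Type} [Fintype O] (rep : O → A.G) (hrepK : ∀ o, rep o ∈ K)
    (hrep : ∀ k ∈ K, ∃ (o : O) (g : A.G), g * rep o * g⁻¹ = k)
    (huniq : ∀ (o o' : O) (g : A.G), g * rep o * g⁻¹ = rep o' → o = o') :
    (A.inertiaOn K hK).cls = ∑ o, (A.fixed (rep o)).cls := by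
  let _ : MulAction (A.inertiaOn K hK).G A.G :=
    MulAction.compHom A.G (MulAut.conj.comp (onG (A := A) (K := K) (hK := hK)).toMonoidHom)
  have hs : ∀ (g : (A.inertiaOn K hK).G) (h : A.G), g • h = onG g * h * (onG g)⁻¹ :=
    fun _ _ => rfl
  have hx : ∀ o (x : (A.fixed (rep o)).X), rep o • fixedVal x = fixedVal x :=
    fun o => smul_fixedVal
  refine cls_eq_sum_strata_of_isClosed (A := A.inertiaOn K hK) (I := A.G) (f := onElt)
    (fun g x => (onElt_smul g x).trans (hs g _).symm) (fun i => (isClopen_onElt_mem {i}).isClosed)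
    rep (fun x => ?_) (fun o o' g h => huniq o o' (onG g) h) (fun o => A.fixed (rep o))
    (fun o => (onG (A := A) (K := K) (hK := hK)).symm.toMonoidHom.comp
      ((Subgroup.subtype _).comp (fixedG (A := A) (g := rep o)).toMonoidHom))
    (fun o => (onG (A := A) (K := K) (hK := hK)).symm.injective.comp
      (Subtype.val_injective.comp (fixedG (A := A) (g := rep o)).injective))
    (fun o g h => ?_) (fun o x => onMk (rep o) (fixedVal x) (hx o x) (hrepK o))
    (fun o => isRegular_onMk (f := fun _ => rep o) (fun g => ?_) isRegular_fixedVal _ _)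
    (fun o x y h => fixedVal_injective ?_) (fun o g x => on_ext ?_ ?_)
    (fun o x => onElt_mk _ _ _ _) fun o h => ?_
  · obtain ⟨o, g, h⟩ := hrep _ (onElt_mem x)
    exact ⟨o, onG.symm g, h⟩
  · have h1 : onG g * rep o = rep o * onG g := by
      have h2 : onG g * rep o * (onG g)⁻¹ = rep o := h
      exact mul_inv_eq_iff_eq_mul.1 h2
    exact ⟨fixedG.symm ⟨onG g, Subgroup.mem_centralizer_singleton_iff.2 h1⟩, rfl⟩
  · by_cases h : rep o = g
    · simp [h]
    · simp [h]
  · have h1 := congrArg onPos h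
    rwa [onPos_mk, onPos_mk] at h1
  · rw [onElt_mk, onElt_smul, onElt_mk]
    exact (mul_inv_eq_iff_eq_mul.2 (Subgroup.mem_centralizer_singleton_iff.1 (fixedG g).2)).symm
  · rw [onPos_mk, onPos_smul, onPos_mk]
    rfl
  · have h1 : ∀ z : (A.inertiaOn K hK).X.sub _ h, rep o • onPos (incl z) = onPos (incl z) :=
      fun z => by
        have h2 : onElt (incl z) = rep o := incl_mem z
        exact (congrArg (· • onPos (incl z)) h2.symm).trans (onElt_smul_pos _)
    refine ⟨fun z => fixedMk (onPos (incl z)) (h1 z),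
      isRegular_fixedMk (isRegular_onPos.comp isRegular_incl) h1, fun z => on_ext ?_ ?_⟩
    · rw [onElt_mk]
      exact (incl_mem z).symm
    · rw [onPos_mk, fixedVal_mk]

end InertiaOn

theorem inertia_cls_eq_finsum (A : GVar) :
    A.inertia.cls = ∑ᶠ c : ConjClasses A.G, (A.fixed (Quotient.out c)).cls := by
  let _ : Fintype (ConjClasses A.G) := Fintype.ofFinite _
  rw [finsum_eq_sum_of_fintype, inertia_cls_eq_inertiaOn_univ]
  refine inertiaOn_cls _ (fun _ => trivial) (fun k _ => ?_) fun c c' g h => ?_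
  · have h1 : IsConj (Quotient.out (ConjClasses.mk k)) k :=
      ConjClasses.mk_eq_mk_iff_isConj.1 (Quotient.out_eq _)
    obtain ⟨g, hg⟩ := isConj_iff.1 h1
    exact ⟨_, g, hg⟩
  · have h1 : ConjClasses.mk (Quotient.out c) = ConjClasses.mk (Quotient.out c') :=
      ConjClasses.mk_eq_mk_iff_isConj.2 (isConj_iff.2 ⟨g, h⟩)
    exact (Quotient.out_eq c).symm.trans (h1.trans (Quotient.out_eq c'))

end GVar

/-! ### Cartesian powers and wreath products -/

section Wreath

variable {G : Type} [Group G] {n : ℕ}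

theorem wreath_mul_left (v w : GVar.Wreath G n) (a : Fin n) :
    (v * w).left a = v.left a * w.left (v.right⁻¹ a) := rfl

theorem wreath_mul_right (v w : GVar.Wreath G n) : (v * w).right = v.right * w.right := rfl

theorem wreath_ext {v w : GVar.Wreath G n} (h : ∀ a, v.left a = w.left a)
    (h' : ∀ a, v.right a = w.right a) : v = w :=
  SemidirectProduct.ext (funext h) (Equiv.ext h')

/-- A homomorphism to a wreath product is given by a homomorphism to the symmetric group and a
cocycle. -/
def wreathHom {H : Type} [Group H] (r : H →* Perm (Fin n)) (l : H → Fin n → G)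
    (hl : ∀ h h' a, l (h * h') a = l h a * l h' ((r h)⁻¹ a)) : H →* GVar.Wreath G n :=
  MonoidHom.mk' (fun h => ⟨l h, r h⟩) fun h h' =>
    wreath_ext (fun a => hl h h' a) fun a => by
      show r (h * h') a = (r h * r h') a
      rw [map_mul]

/-- The permutations of two blocks as permutations of the union. -/
def sumPerm {i j : ℕ} (e : Fin i ⊕ Fin j ≃ Fin n) :
    Perm (Fin i) × Perm (Fin j) →* Perm (Fin n) :=
  (e.permCongrHom.toMonoidHom).comp (Equiv.Perm.sumCongrHom (Fin i) (Fin j))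

theorem sumPerm_inl {i j : ℕ} (e : Fin i ⊕ Fin j ≃ Fin n)
    (s : Perm (Fin i) × Perm (Fin j)) (a : Fin i) :
    sumPerm e s (e (Sum.inl a)) = e (Sum.inl (s.1 a)) := by
  simp [sumPerm]

theorem sumPerm_inr {i j : ℕ} (e : Fin i ⊕ Fin j ≃ Fin n)
    (s : Perm (Fin i) × Perm (Fin j)) (b : Fin j) :
    sumPerm e s (e (Sum.inr b)) = e (Sum.inr (s.2 b)) := by
  simp [sumPerm]

theorem sumPerm_inv_inl {i j : ℕ} (e : Fin i ⊕ Fin j ≃ Fin n)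
    (s : Perm (Fin i) × Perm (Fin j)) (a : Fin i) :
    (sumPerm e s)⁻¹ (e (Sum.inl a)) = e (Sum.inl (s.1⁻¹ a)) := by
  rw [← map_inv, sumPerm_inl, Prod.fst_inv]

theorem sumPerm_inv_inr {i j : ℕ} (e : Fin i ⊕ Fin j ≃ Fin n)
    (s : Perm (Fin i) × Perm (Fin j)) (b : Fin j) :
    (sumPerm e s)⁻¹ (e (Sum.inr b)) = e (Sum.inr (s.2⁻¹ b)) := by
  rw [← map_inv, sumPerm_inr, Prod.snd_inv]

theorem forall_sum_block {i j : ℕ} (e : Fin i ⊕ Fin j ≃ Fin n) {P : Fin n → Prop}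
    (hl : ∀ a, P (e (Sum.inl a))) (hr : ∀ b, P (e (Sum.inr b))) (c : Fin n) : P c := by
  obtain ⟨s, rfl⟩ := e.surjective c
  cases s with
  | inl a => exact hl a
  | inr b => exact hr b

/-- The homomorphism `G_i × G_j → G_n` defined by a decomposition of the set of `n` elements into
two blocks. -/
def wreathSum {i j : ℕ} (e : Fin i ⊕ Fin j ≃ Fin n) :
    GVar.Wreath G i × GVar.Wreath G j →* GVar.Wreath G n :=
  wreathHom ((sumPerm e).comp (SemidirectProduct.rightHom.prodMap SemidirectProduct.rightHom))
    (fun p c => Sum.elim p.1.left p.2.left (e.symm c)) (fun p q => by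
      refine forall_sum_block e (fun a => ?_) fun b => ?_
      · refine Eq.trans ?_ (congrArg (fun c => _ * Sum.elim q.1.left q.2.left (e.symm c))
          (sumPerm_inv_inl e _ a).symm)
        simp
        rfl
      · refine Eq.trans ?_ (congrArg (fun c => _ * Sum.elim q.1.left q.2.left (e.symm c))
          (sumPerm_inv_inr e _ b).symm)
        simp
        rfl)

variable {i j : ℕ} (e : Fin i ⊕ Fin j ≃ Fin n) (p : GVar.Wreath G i × GVar.Wreath G j)

theorem wreathSum_right : (wreathSum e p).right = sumPerm e (p.1.right, p.2.right) := rfl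

theorem wreathSum_left_inl (a : Fin i) : (wreathSum e p).left (e (Sum.inl a)) = p.1.left a := by
  refine (congrArg (Sum.elim p.1.left p.2.left) (e.symm_apply_apply _)).trans ?_
  rfl

theorem wreathSum_left_inr (b : Fin j) : (wreathSum e p).left (e (Sum.inr b)) = p.2.left b := by
  refine (congrArg (Sum.elim p.1.left p.2.left) (e.symm_apply_apply _)).trans ?_
  rfl

theorem wreathSum_injective : Injective (wreathSum (G := G) e) := by
  intro p q h
  refine Prod.ext (wreath_ext (fun a => ?_) fun a => ?_) (wreath_ext (fun b => ?_) fun b => ?_)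
  · rw [← wreathSum_left_inl e p, ← wreathSum_left_inl e q, h]
  · have h1 := congrArg (fun w => w.right (e (Sum.inl a))) h
    simp only [wreathSum_right, sumPerm_inl] at h1
    exact Sum.inl_injective (e.injective h1)
  · rw [← wreathSum_left_inr e p, ← wreathSum_left_inr e q, h]
  · have h1 := congrArg (fun w => w.right (e (Sum.inr b))) h
    simp only [wreathSum_right, sumPerm_inr] at h1
    exact Sum.inr_injective (e.injective h1)

theorem mem_range_wreathSum {w : GVar.Wreath G n}
    (h : ∀ a, ∃ a', w.right (e (Sum.inl a)) = e (Sum.inl a')) :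
    w ∈ (wreathSum (G := G) e).range := by
  have h1 : e.symm.permCongr w.right ∈ (Equiv.Perm.sumCongrHom (Fin i) (Fin j)).range := by
    refine Equiv.Perm.mem_sumCongrHom_range_of_perm_mapsTo_inl ?_
    rintro _ ⟨a, rfl⟩
    obtain ⟨a', ha'⟩ := h a
    exact ⟨a', by simp [ha']⟩
  obtain ⟨⟨s, t⟩, hst⟩ := h1
  have h2 : ∀ c, e (Equiv.sumCongr s t c) = w.right (e c) := fun c => by
    have h3 := congrArg (fun σ => e (σ c)) hst
    simpa using h3
  refine ⟨(⟨fun a => w.left (e (Sum.inl a)), s⟩, ⟨fun b => w.left (e (Sum.inr b)), t⟩),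
    wreath_ext (forall_sum_block e (fun a => ?_) fun b => ?_)
      (forall_sum_block e (fun a => ?_) fun b => ?_)⟩
  · exact wreathSum_left_inl e _ a
  · exact wreathSum_left_inr e _ b
  · exact (sumPerm_inl e _ a).trans (h2 (Sum.inl a))
  · exact (sumPerm_inr e _ b).trans (h2 (Sum.inr b))

/-- The homomorphism of wreath products defined by a homomorphism of groups. -/
def wreathMap {H : Type} [Group H] (f : G →* H) (n : ℕ) : GVar.Wreath G n →* GVar.Wreath H n :=
  wreathHom SemidirectProduct.rightHom (fun w a => f (w.left a)) fun v w a => by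
    rw [wreath_mul_left, map_mul]
    rfl

end Wreath

namespace GVar

variable {A : GVar} {n : ℕ}

/-- The group of a Cartesian power. -/
def powG : (A.power n).G ≃* Wreath A.G n := MulEquiv.refl _

/-- A component of a point of a Cartesian power. -/
def entry (z : (A.power n).X) (i : Fin n) : A.X := piEquiv (fun _ : Fin n => A.X) z i

/-- The point of a Cartesian power with given components. -/
def powMk (x : Fin n → A.X) : (A.power n).X := (piEquiv (fun _ : Fin n => A.X)).symm x

theorem entry_mk (x : Fin n → A.X) (i : Fin n) : entry (powMk x) i = x i :=
  congrFun (Equiv.apply_symm_apply (piEquiv (fun _ : Fin n => A.X)) x) i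

theorem pow_ext {z w : (A.power n).X} (h : ∀ i, entry z i = entry w i) : z = w :=
  (piEquiv (fun _ : Fin n => A.X)).injective (funext h)

theorem entry_smul (w : (A.power n).G) (z : (A.power n).X) (i : Fin n) :
    entry (w • z) i = (powG w).left i • entry z ((powG w).right⁻¹ i) :=
  piEquiv_wreathSmul A n w z i

theorem isRegular_entry (i : Fin n) : IsRegular fun z : (A.power n).X => entry z i :=
  isRegular_piEquiv_apply (fun _ : Fin n => A.X) i

theorem isRegular_powMk {T : QPVar} {φ : T → Fin n → A.X} (h : ∀ i, IsRegular fun t => φ t i) :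
    IsRegular fun t => powMk (φ t) :=
  isRegular_pi (X := fun _ : Fin n => A.X) fun i =>
    (isRegular_congr fun t => entry_mk (φ t) i).2 (h i)

section Sum

open scoped Pointwise

/-- The decomposition of the set of `i + j = n` elements into blocks of `i` and `j` elements. -/
def blockEquiv (o : {p // p ∈ antidiagonal n}) : Fin o.1.1 ⊕ Fin o.1.2 ≃ Fin n :=
  finSumFinEquiv.trans (finCongr (mem_antidiagonal.1 o.2))

/-- The first block. -/
def blockSet (o : {p // p ∈ antidiagonal n}) : Set (Fin n) :=
  Set.range fun a => blockEquiv o (Sum.inl a)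

theorem ncard_blockSet (o : {p // p ∈ antidiagonal n}) : (blockSet o).ncard = o.1.1 := by
  rw [← Nat.card_coe_set_eq]
  refine (Nat.card_range_of_injective ((blockEquiv o).injective.comp Sum.inl_injective)).trans ?_
  rw [Nat.card_eq_fintype_card, Fintype.card_fin]

theorem exists_smul_blockSet (S : Set (Fin n)) :
    ∃ (o : {p // p ∈ antidiagonal n}) (s : Perm (Fin n)), s '' blockSet o = S := by
  classical
  have hc : S.ncard + Sᶜ.ncard = n := by
    rw [Set.ncard_add_ncard_compl, Nat.card_eq_fintype_card, Fintype.card_fin]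
  let o : {p // p ∈ antidiagonal n} := ⟨(S.ncard, Sᶜ.ncard), mem_antidiagonal.2 hc⟩
  let e₁ : Fin S.ncard ≃ S := (Finite.equivFinOfCardEq (Nat.card_coe_set_eq S)).symm
  let e₂ : Fin Sᶜ.ncard ≃ (Sᶜ : Set (Fin n)) :=
    (Finite.equivFinOfCardEq (Nat.card_coe_set_eq Sᶜ)).symm
  refine ⟨o, (blockEquiv o).symm.trans ((Equiv.sumCongr e₁ e₂).trans (Equiv.Set.sumCompl S)), ?_⟩
  ext c
  simp only [blockSet, Set.mem_image, Set.mem_range, exists_exists_eq_and, Equiv.trans_apply,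
    Equiv.symm_apply_apply, Equiv.sumCongr_apply, Sum.map_inl, Equiv.Set.sumCompl_apply_inl]
  exact ⟨fun ⟨a, ha⟩ => ha ▸ (e₁ a).2, fun hcS => ⟨e₁.symm ⟨c, hcS⟩, by simp⟩⟩

variable {P : GVar} {G : Type} [Group G] (γ : P.G ≃* Wreath G n) {f : P.X → Set (Fin n)}
  (hf : ∀ (g : P.G) (x : P.X), f (g • x) = (γ g).right '' f x)
  (hclosed : ∀ S, IsClosed {x | S ⊆ f x})
  (B C : ℕ → GVar) (β : ∀ i, (B i).G ≃* Wreath G i) (δ : ∀ i, (C i).G ≃* Wreath G i)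
  (φ : ∀ o : {p // p ∈ antidiagonal n}, ((B o.1.1).prod (C o.1.2)).X → P.X)
  (hφ : ∀ o, IsRegular (φ o)) (hφi : ∀ o, Injective (φ o))
  (hφj : ∀ o (g : ((B o.1.1).prod (C o.1.2)).G) (x : ((B o.1.1).prod (C o.1.2)).X),
    φ o (g • x) = γ.symm (wreathSum (blockEquiv o) (β _ (prodG g).1, δ _ (prodG g).2)) • φ o x)
  (hφf : ∀ o x, f (φ o x) = blockSet o)
  (hψ : ∀ o (h : IsLocallyClosed {x | f x = blockSet o}),
    ∃ ψ : P.X.sub _ h → ((B o.1.1).prod (C o.1.2)).X, IsRegular ψ ∧ ∀ z, φ o (ψ z) = incl z)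

include γ hf hclosed β δ hφ hφi hφj hφf hψ in
/-- A variety with an action of `G_n` and an equivariant map to the set of subsets of the set of
`n` elements decomposes into varieties induced from the subgroups `G_i × G_j`, `i + j = n`. -/
theorem cls_eq_sum_antidiagonal :
    P.cls = ∑ p ∈ antidiagonal n, (B p.1).cls * (C p.2).cls := by
  let ρ : P.G →* Perm (Fin n) := SemidirectProduct.rightHom.comp γ.toMonoidHom
  let _ : MulAction P.G (Set (Fin n)) := MulAction.compHom _ ρ
  have hs : ∀ (g : P.G) (S : Set (Fin n)), g • S = (γ g).right '' S := fun _ _ => rfl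
  rw [cls_eq_sum_strata (A := P) (I := Set (Fin n)) (f := f)
    (fun g S T h => Set.image_mono h) (fun g x => hf g x) hclosed (fun o => blockSet o) ?_ ?_
    (fun o => (B o.1.1).prod (C o.1.2))
    (fun o => γ.symm.toMonoidHom.comp ((wreathSum (blockEquiv o)).comp
      (((β _).prodCongr (δ _)).toMonoidHom.comp
        (prodG (A := B o.1.1) (B := C o.1.2)).toMonoidHom))) ?_ ?_ φ hφ hφi hφj hφf hψ]
  · rw [← Finset.sum_coe_sort (antidiagonal n)
      fun p => (B p.1).cls * (C p.2).cls]
    exact sum_congr rfl fun o _ => cls_prod _ _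
  · intro x
    obtain ⟨o, s, h⟩ := exists_smul_blockSet (f x)
    exact ⟨o, γ.symm ⟨1, s⟩, by rw [hs, MulEquiv.apply_symm_apply]; exact h⟩
  · intro o o' g h
    have h1 := congrArg Set.ncard h
    rw [hs, Set.ncard_image_of_injective _ (Equiv.injective _), ncard_blockSet,
      ncard_blockSet] at h1
    have h2 := mem_antidiagonal.1 o.2
    have h3 := mem_antidiagonal.1 o'.2
    exact Subtype.ext (Prod.ext h1 (by omega))
  · intro o
    exact γ.symm.injective.comp ((wreathSum_injective _).comp
      (((β _).prodCongr (δ _)).injective.comp prodG.injective))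
  · intro o g h
    rw [hs] at h
    obtain ⟨p, hp⟩ := mem_range_wreathSum (blockEquiv o) (w := γ g) (fun a => by
      have h1 : (γ g).right (blockEquiv o (Sum.inl a)) ∈ blockSet o := by
        rw [← h]
        exact Set.mem_image_of_mem _ ⟨a, rfl⟩
      obtain ⟨a', ha'⟩ := h1
      exact ⟨a', ha'.symm⟩)
    refine ⟨prodG.symm ((β _).symm p.1, (δ _).symm p.2), ?_⟩
    apply γ.injective
    refine (MulEquiv.apply_symm_apply γ _).trans (Eq.trans ?_ hp)
    refine congrArg (wreathSum (blockEquiv o)) (Prod.ext ?_ ?_)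
    · exact (β _).apply_symm_apply _
    · exact (δ _).apply_symm_apply _

end Sum

end GVar

/-! ### The λ-structure given by the Cartesian powers -/

instance {R : Type*} [CommRing R] : CommGroup (oneSeries R) :=
  { (inferInstance : CommMonoid (oneSeries R)) with
    inv := fun A => ⟨PowerSeries.invOfUnit A.1 1, by
      show PowerSeries.constantCoeff _ = 1
      simp⟩
    inv_mul_cancel := fun A => Subtype.ext (by
      refine (mul_comm _ _).trans (PowerSeries.mul_invOfUnit A.1 1 ?_)
      exact A.2) }

theorem oneSeries_ext {R : Type*} [CommRing R] {A B : oneSeries R}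
    (h : ∀ n, coeffSeries n A = coeffSeries n B) : A = B :=
  Subtype.ext (PowerSeries.ext h)

theorem coeffSeries_zero {R : Type*} [CommRing R] (A : oneSeries R) : coeffSeries 0 A = 1 :=
  (PowerSeries.coeff_zero_eq_constantCoeff_apply A.1).trans A.2

theorem coeffSeries_mul {R : Type*} [CommRing R] (n : ℕ) (A B : oneSeries R) :
    coeffSeries n (A * B) = ∑ p ∈ antidiagonal n,
      coeffSeries p.1 A * coeffSeries p.2 B :=
  PowerSeries.coeff_mul n A.1 B.1

theorem coeffSeries_one {R : Type*} [CommRing R] {n : ℕ} (hn : n ≠ 0) :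
    coeffSeries n (1 : oneSeries R) = 0 :=
  (PowerSeries.coeff_one n).trans (if_neg hn)

theorem coeffSeries_mapSeries {R S : Type*} [CommRing R] [CommRing S] (φ : R →+* S) (n : ℕ)
    (A : oneSeries R) : coeffSeries n (mapSeries φ A) = φ (coeffSeries n A) :=
  PowerSeries.coeff_map φ n A.1

/-- The homomorphism of groups of series defined by a homomorphism of rings. -/
def mapSeriesHom {R S : Type*} [CommRing R] [CommRing S] (φ : R →+* S) :
    oneSeries R →* oneSeries S :=
  MonoidHom.mk' (mapSeries φ) fun A B => Subtype.ext (map_mul (PowerSeries.map φ) A.1 B.1)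

/-- The coefficient of `t` as a homomorphism. -/
def coeffOneHom {R : Type*} [CommRing R] : Additive (oneSeries R) →+ R :=
  AddMonoidHom.mk' (fun A => coeffSeries 1 A.toMul) fun A B => by
    refine (coeffSeries_mul 1 A.toMul B.toMul).trans ?_
    refine (Finset.Nat.sum_antidiagonal_eq_sum_range_succ
      (fun i j => coeffSeries i A.toMul * coeffSeries j B.toMul) 1).trans ?_
    simp [Finset.sum_range_succ, coeffSeries_zero, add_comm]

/-- The series `1 + a₁ t + a₂ t² + ⋯`, given its coefficients. -/
def mkSeries {R : Type*} [CommRing R] (a : ℕ → R) (h : a 0 = 1) : oneSeries R :=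
  ⟨PowerSeries.mk a, by
    show PowerSeries.constantCoeff _ = 1
    rw [← PowerSeries.coeff_zero_eq_constantCoeff_apply, PowerSeries.coeff_mk, h]⟩

theorem coeffSeries_mkSeries {R : Type*} [CommRing R] (a : ℕ → R) (h : a 0 = 1) (n : ℕ) :
    coeffSeries n (mkSeries a h) = a n := PowerSeries.coeff_mk n a

theorem GVar.cls_pt : GVar.pt.cls = 1 := rfl

namespace GVar

variable {A B : GVar}

theorem power_zero_iso (A : GVar) : GVar.Iso (A.power 0) pt := by
  have h : ∀ v w : Wreath A.G 0, v = w := fun v w => wreath_ext (fun a => a.elim0) fun a => a.elim0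
  let e : (A.power 0).G ≃* pt.G :=
    { toFun := fun _ => (1 : pt.G)
      invFun := fun _ => 1
      left_inv := fun _ => powG.injective (h _ _)
      right_inv := fun _ => Subsingleton.elim (α := Unit) _ _
      map_mul' := fun _ _ => (one_mul _).symm }
  exact iso_of_inverse (A := A.power 0) (B := pt) e (f := fun _ => (default : QPVar.pt))
    (g := fun _ => powMk Fin.elim0) (isRegular_const _) (isRegular_const _)
    (fun z => pow_ext fun i => i.elim0) (fun y => Subsingleton.elim (α := QPVar.pt) _ _)
    fun _ _ => Subsingleton.elim (α := QPVar.pt) _ _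

theorem power_zero_cls (A : GVar) : (A.power 0).cls = 1 := cls_eq A.power_zero_iso

theorem power_one_iso (A : GVar) : GVar.Iso (A.power 1) A := by
  let e : (A.power 1).G ≃* A.G :=
    { toFun := fun w => (powG w).left 0
      invFun := fun g => powG.symm ⟨fun _ => g, 1⟩
      left_inv := fun w => powG.injective (wreath_ext (fun a => by
        rw [MulEquiv.apply_symm_apply, Subsingleton.elim a 0]) fun a => Subsingleton.elim _ _)
      right_inv := fun g => congrArg (fun w : Wreath A.G 1 => w.left 0) (powG.apply_symm_apply _)
      map_mul' := fun v w => by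
        rw [map_mul, wreath_mul_left, Subsingleton.elim ((powG v).right⁻¹ 0) 0] }
  refine iso_of_inverse (A := A.power 1) e (isRegular_entry 0)
    (isRegular_powMk (φ := fun x _ => x) fun _ => isRegular_id _) (fun z => pow_ext fun i => ?_)
    (fun y => entry_mk _ _) fun w z => ?_
  · rw [entry_mk, Subsingleton.elim i 0]
  · rw [entry_smul, Subsingleton.elim ((powG w).right⁻¹ 0) 0]
    rfl

theorem power_one_cls (A : GVar) : (A.power 1).cls = A.cls := cls_eq A.power_one_iso

/-- The power of a map. -/
def powMap (φ : A.X → B.X) (n : ℕ) (z : (A.power n).X) : (B.power n).X :=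
  powMk fun i => φ (entry z i)

theorem entry_powMap (φ : A.X → B.X) (n : ℕ) (z : (A.power n).X) (i : Fin n) :
    entry (powMap φ n z) i = φ (entry z i) := entry_mk _ _

theorem isRegular_powMap {φ : A.X → B.X} (hφ : IsRegular φ) (n : ℕ) : IsRegular (powMap φ n) :=
  isRegular_powMk fun i => hφ.comp (isRegular_entry i)

theorem powMap_smul {φ : A.X → B.X} (j : A.G →* B.G) (h : ∀ g x, φ (g • x) = j g • φ x) {n : ℕ}
    (w : (A.power n).G) (z : (A.power n).X) :
    powMap φ n (w • z) = powG.symm (wreathMap j n (powG w)) • powMap φ n z :=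
  pow_ext fun i => by
    rw [entry_powMap, entry_smul, entry_smul, entry_powMap, h, MulEquiv.apply_symm_apply]
    rfl

theorem wreathMap_injective {G H : Type} [Group G] [Group H] {f : G →* H}
    (hf : Injective f) (n : ℕ) : Injective (wreathMap f n) := fun _ _ h =>
  wreath_ext (fun a => hf (congrArg (fun t : Wreath H n => t.left a) h))
    fun a => congrArg (fun t : Wreath H n => t.right a) h

theorem Iso.power (h : GVar.Iso A B) (n : ℕ) : GVar.Iso (A.power n) (B.power n) := by
  obtain ⟨j, ψ, hψ, hψ', hs⟩ := h
  have hs' : ∀ g x, ψ.symm (g • x) = j.symm g • ψ.symm x := fun g x => by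
    rw [Equiv.symm_apply_eq, hs, MulEquiv.apply_symm_apply, Equiv.apply_symm_apply]
  let e : (A.power n).G ≃* (B.power n).G :=
    { toFun := fun w => powG.symm (wreathMap j.toMonoidHom n (powG w))
      invFun := fun w => powG.symm (wreathMap j.symm.toMonoidHom n (powG w))
      left_inv := fun w => powG.injective (wreath_ext (fun a => j.symm_apply_apply _) fun a => rfl)
      right_inv := fun w => powG.injective (wreath_ext (fun a => j.apply_symm_apply _) fun a => rfl)
      map_mul' := fun v w => by rw [map_mul, map_mul, map_mul] }
  refine iso_of_inverse e (isRegular_powMap hψ n) (isRegular_powMap hψ' n)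
    (fun z => pow_ext fun i => ?_) (fun z => pow_ext fun i => ?_)
    (fun w z => powMap_smul j.toMonoidHom hs w z)
  · rw [entry_powMap, entry_powMap, Equiv.symm_apply_apply]
  · rw [entry_powMap, entry_powMap, Equiv.apply_symm_apply]

theorem IsInduced.power (h : IsInduced A B) (n : ℕ) : IsInduced (A.power n) (B.power n) := by
  obtain ⟨j, Z, hZ, φ, ψ, hj, hφ, hφZ, hψ, hφi, hφψ, h₁, h₂, h₃⟩ := h.exists_maps
  have hZ' : IsClopen {z : (B.power n).X | ∀ i, entry z i ∈ Z} := by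
    have : {z : (B.power n).X | ∀ i, entry z i ∈ Z} = ⋂ i, (fun z => entry z i) ⁻¹' Z := by
      ext z; simp
    rw [this]
    exact isClopen_iInter_of_finite fun i => hZ.preimage (isRegular_entry i).continuous
  refine isInduced_of_maps ((powG.symm.toMonoidHom.comp (wreathMap j n)).comp powG.toMonoidHom)
    (powG.symm.injective.comp ((wreathMap_injective hj n).comp powG.injective)) hZ'
    (isRegular_powMap hφ n) (fun z i => ?_)
    (ψ := fun w => powMk fun i => ψ (toSub (entry (incl w) i)
      ((incl_mem w : ∀ i, entry (incl w) i ∈ Z) i)))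
    (isRegular_powMk fun i => hψ.comp
      (isRegular_toSub ((isRegular_entry i).comp isRegular_incl) fun w =>
        (incl_mem w : ∀ i, entry (incl w) i ∈ Z) i))
    (fun z z' h => pow_ext fun i => hφi ?_) (fun w => pow_ext fun i => ?_)
    (fun w z => powMap_smul j h₁ w z) (fun y => ?_) fun w z z' h => ?_
  · rw [entry_powMap]
    exact hφZ _
  · rw [← entry_powMap φ, ← entry_powMap φ, h]
  · rw [entry_powMap, entry_mk, hφψ]
    rfl
  · choose g x hx using fun i => h₂ (entry y i)
    refine ⟨powG.symm ⟨g, 1⟩, powMk x, pow_ext fun i => ?_⟩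
    rw [entry_smul, entry_powMap, entry_mk, MulEquiv.apply_symm_apply]
    exact hx i
  · have h5 : ∀ i, (powG w).left i ∈ j.range := fun i => by
      refine h₃ _ (entry z ((powG w).right⁻¹ i)) (entry z' i) ?_
      rw [← entry_powMap φ, ← entry_powMap φ, ← h, entry_smul]
    choose g hg using h5
    exact ⟨powG.symm ⟨g, (powG w).right⟩, powG.injective (wreath_ext hg fun _ => rfl)⟩

theorem Iso.isInduced (h : GVar.Iso A B) : IsInduced A B := by
  obtain ⟨φ, ψ, hψ, hψ', hs⟩ := h
  exact isInduced_of_maps φ.toMonoidHom φ.injective isClopen_univ hψ (fun _ => trivial)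
    (hψ'.comp isRegular_incl) ψ.injective (fun w => ψ.apply_symm_apply _) hs
    (fun y => ⟨1, ψ.symm y, by rw [one_smul, Equiv.apply_symm_apply]⟩)
    fun g _ _ _ => ⟨φ.symm g, φ.apply_symm_apply g⟩

theorem IsInduced.power_cls (h : IsInduced A B) (n : ℕ) : (B.power n).cls = (A.power n).cls :=
  cls_induced (h.power n)

/-- The strata are given by the sets of indices `i` with `z_i ∈ Y`. -/
theorem power_scissor (A : GVar) (Y : Set A.X) (hY : IsClosed Y)
    (hG : ∀ (g : A.G) (x : A.X), x ∈ Y → g • x ∈ Y) (n : ℕ) :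
    (A.power n).cls = ∑ p ∈ antidiagonal n,
      ((A.sub Y hY.isLocallyClosed hG).power p.1).cls *
      ((A.sub Yᶜ hY.isOpen_compl.isLocallyClosed (smul_mem_compl hG)).power p.2).cls := by
  let B := A.sub Y hY.isLocallyClosed hG
  let C := A.sub Yᶜ hY.isOpen_compl.isLocallyClosed (smul_mem_compl hG)
  have hG' : ∀ (g : A.G) (x : A.X), g • x ∈ Y ↔ x ∈ Y := fun g x =>
    ⟨fun h => by simpa using hG g⁻¹ _ h, hG g x⟩
  let f : (A.power n).X → Set (Fin n) := fun z => {i | entry z i ∈ Y}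
  let vB : B.X → A.X := val (A := A)
  let vC : C.X → A.X := val (A := A)
  have hvB : IsRegular vB := isRegular_val (A := A)
  have hvC : IsRegular vC := isRegular_val (A := A)
  have sB : ∀ (g : B.G) (x : B.X), vB (g • x) = subG (A := A) g • vB x := val_smul_eq (A := A)
  have sC : ∀ (g : C.G) (x : C.X), vC (g • x) = subG (A := A) g • vC x := val_smul_eq (A := A)
  let φ : ∀ o : {p // p ∈ antidiagonal n},
      ((B.power o.1.1).prod (C.power o.1.2)).X → (A.power n).X := fun o x =>
    powMk fun c => Sum.elim (fun a => vB (entry (pr₁ x) a)) (fun b => vC (entry (pr₂ x) b))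
      ((blockEquiv o).symm c)
  have φl : ∀ o x a, entry (φ o x) (blockEquiv o (Sum.inl a)) = vB (entry (pr₁ x) a) :=
    fun o x a => (entry_mk _ _).trans (by rw [Equiv.symm_apply_apply]; rfl)
  have φr : ∀ o x b, entry (φ o x) (blockEquiv o (Sum.inr b)) = vC (entry (pr₂ x) b) :=
    fun o x b => (entry_mk _ _).trans (by rw [Equiv.symm_apply_apply]; rfl)
  have hfφ : ∀ o x, f (φ o x) = blockSet o := fun o x => by
    ext c
    refine forall_sum_block (blockEquiv o) (P := fun c => c ∈ f (φ o x) ↔ c ∈ blockSet o)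
      (fun a => ?_) (fun b => ?_) c
    · refine iff_of_true ?_ ⟨a, rfl⟩
      show entry _ _ ∈ Y
      rw [φl]
      exact val_mem (A := A) _
    · refine iff_of_false ?_ ?_
      · show entry _ _ ∉ Y
        rw [φr]
        exact val_mem (A := A) (Z := Yᶜ) _
      · rintro ⟨a, ha⟩
        exact Sum.inl_ne_inr ((blockEquiv o).injective ha)
  refine cls_eq_sum_antidiagonal (P := A.power n) powG (f := f) (fun w z => ?_) (fun S => ?_)
    (fun i => B.power i) (fun i => C.power i)
    (fun i => powG.trans (MulEquiv.refl (Wreath A.G i)))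
    (fun i => powG.trans (MulEquiv.refl (Wreath A.G i)))
    φ (fun o => ?_) (fun o x y h => ?_) (fun o g x => ?_) hfφ (fun o h => ?_)
  · ext c
    constructor
    · intro hc
      refine ⟨(powG w).right⁻¹ c, ?_, by simp⟩
      have h1 : entry (w • z) c ∈ Y := hc
      rw [entry_smul, hG'] at h1
      exact h1
    · rintro ⟨c, hc, rfl⟩
      show entry (w • z) _ ∈ Y
      rw [entry_smul, hG', Equiv.Perm.inv_def, Equiv.symm_apply_apply]
      exact hc
  · have : {z : (A.power n).X | S ⊆ f z} = ⋂ i ∈ S, (fun z => entry z i) ⁻¹' Y := by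
      ext z
      simp only [Set.mem_iInter]
      rfl
    rw [this]
    exact isClosed_biInter fun i _ => hY.preimage (isRegular_entry i).continuous
  · refine isRegular_powMk (forall_sum_block (blockEquiv o) (fun a => ?_) fun b => ?_)
    · simp only [Equiv.symm_apply_apply, Sum.elim_inl]
      exact hvB.comp ((isRegular_entry a).comp isRegular_pr₁)
    · simp only [Equiv.symm_apply_apply, Sum.elim_inr]
      exact hvC.comp ((isRegular_entry b).comp isRegular_pr₂)
  · refine prod_ext (pow_ext fun a => ?_) (pow_ext fun b => ?_)
    · exact val_injective (A := A)
        ((φl o x a).symm.trans ((congrArg (entry · _) h).trans (φl o y a)))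
    · exact val_injective (A := A)
        ((φr o x b).symm.trans ((congrArg (entry · _) h).trans (φr o y b)))
  · refine pow_ext (forall_sum_block (blockEquiv o) (fun a => ?_) fun b => ?_)
    · rw [φl, pr₁_smul, entry_smul, sB, entry_smul, MulEquiv.apply_symm_apply, wreathSum_left_inl,
        wreathSum_right, sumPerm_inv_inl, φl]
      rfl
    · rw [φr, pr₂_smul, entry_smul, sC, entry_smul, MulEquiv.apply_symm_apply, wreathSum_left_inr,
        wreathSum_right, sumPerm_inv_inr, φr]
      rfl
  · have h1 : ∀ (z : (A.power n).X.sub _ h) a, entry (incl z) (blockEquiv o (Sum.inl a)) ∈ Y :=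
      fun z a => by
        have h2 : blockEquiv o (Sum.inl a) ∈ f (incl z) := by
          rw [show f (incl z) = blockSet o from incl_mem z]
          exact ⟨a, rfl⟩
        exact h2
    have h2 : ∀ (z : (A.power n).X.sub _ h) b, entry (incl z) (blockEquiv o (Sum.inr b)) ∈ Yᶜ :=
      fun z b h3 => by
        have h4 : blockEquiv o (Sum.inr b) ∈ f (incl z) := h3
        rw [show f (incl z) = blockSet o from incl_mem z] at h4
        obtain ⟨a, ha⟩ := h4
        exact Sum.inl_ne_inr ((blockEquiv o).injective ha)
    refine ⟨fun z => pair (powMk (A := B) fun a => mkSub _ _ _ (h1 z a))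
      (powMk (A := C) fun b => mkSub _ _ _ (h2 z b)), isRegular_pair
      (isRegular_powMk fun a => isRegular_mkSub ((isRegular_entry _).comp isRegular_incl) _)
      (isRegular_powMk fun b => isRegular_mkSub ((isRegular_entry _).comp isRegular_incl) _),
      fun z => pow_ext (forall_sum_block (blockEquiv o) (fun a => ?_) fun b => ?_)⟩
    · rw [φl, pr₁_pair, entry_mk]
      rfl
    · rw [φr, pr₂_pair, entry_mk]
      rfl

/-- The series `1 + ∑ [(Xⁿ, G_n)] tⁿ`. -/
def zetaSeries (A : GVar) : oneSeries K0fGr :=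
  mkSeries (fun n => (A.power n).cls) (power_zero_cls A)

theorem coeffSeries_zetaSeries (A : GVar) (n : ℕ) : coeffSeries n A.zetaSeries = (A.power n).cls :=
  coeffSeries_mkSeries _ _ _

theorem IsInduced.zetaSeries_eq (h : IsInduced A B) : B.zetaSeries = A.zetaSeries :=
  oneSeries_ext fun n => by
    rw [coeffSeries_zetaSeries, coeffSeries_zetaSeries, h.power_cls]

end GVar

/-- The series `ζ` as a function on isomorphism classes. -/
def zetaClass : GClass → Additive (oneSeries K0fGr) :=
  Quotient.lift (fun A : GVar => Additive.ofMul A.zetaSeries) fun _ _ h =>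
    congrArg Additive.ofMul (GVar.Iso.isInduced h).zetaSeries_eq.symm

/-- The homomorphism from the additive group of `K₀^fGr(Var_ℂ)` to the group of series that sends
`[(X, G)]` to `1 + ∑ [(Xⁿ, G_n)] tⁿ`. -/
def zetaHom : K0fGr →+ Additive (oneSeries K0fGr) :=
  relationLift zetaClass (by
    rintro r (⟨A, Y, hY, hG⟩ | ⟨A, B, h⟩)
    · rw [map_sub, map_add, GVar.lift_gen, GVar.lift_gen, GVar.lift_gen]
      refine sub_eq_zero.2 (congrArg Additive.ofMul (oneSeries_ext (A := A.zetaSeries) fun n => ?_))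
      rw [GVar.coeffSeries_zetaSeries]
      refine Eq.trans ?_ (coeffSeries_mul n (GVar.zetaSeries _) (GVar.zetaSeries _)).symm
      simp only [GVar.coeffSeries_zetaSeries]
      exact GVar.power_scissor A Y hY hG n
    · rw [map_sub, GVar.lift_gen, GVar.lift_gen]
      exact sub_eq_zero.2 (congrArg Additive.ofMul h.zetaSeries_eq))

/-- The λ-structure on `K₀^fGr(Var_ℂ)` given by the Cartesian powers. -/
def zeta : LambdaStructure K0fGr where
  series a := (zetaHom a).toMul
  series_add a b := congrArg Additive.toMul (map_add zetaHom a b)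
  coeff_one a := by
    show coeffOneHom (zetaHom a) = a
    induction a using K0fGr.induction with
    | h0 => rw [map_zero, map_zero]
    | h1 A =>
      refine (congrArg coeffOneHom (relationLift_of _ _ _)).trans ?_
      exact (GVar.coeffSeries_zetaSeries A 1).trans (GVar.power_one_cls A)
    | hneg a ha => rw [map_neg, map_neg, ha]
    | hadd a b ha hb => rw [map_add, map_add, ha, hb]

theorem zeta_series_cls (A : GVar) : zeta.series A.cls = A.zetaSeries :=
  congrArg Additive.toMul (relationLift_of zetaClass _ _)

/-! ### The λ-structure on `K₀(Var_ℂ)` given by the symmetric powers -/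

namespace GVar

variable {A : GVar} {Y : QPVar} {n : ℕ}

/-- The quotient of a power by the wreath product is the quotient by the symmetric group of the
power of the quotient. -/
theorem IsQuotient.power {π : A.X → Y} (hπ : A.IsQuotient Y π) {Q : QPVar}
    {ρ : (Y.triv.power n).X → Q} (hρ : (Y.triv.power n).IsQuotient Q ρ) :
    (A.power n).IsQuotient Q fun z => ρ (powMap (B := Y.triv) π n z) := by
  have h1 := IsQuotient.pi fun _ : Fin n => hπ
  have h2 : ∀ z : (A.power n).X, powMap (B := Y.triv) π n z =
      piProj (A := fun _ : Fin n => A) (fun _ => π) z := fun z =>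
    pow_ext fun i => (entry_powMap _ _ _ _).trans
      (piEquiv_piProj (A := fun _ : Fin n => A) (fun _ => π) z i).symm
  have h3 : IsQuotMap (powMap (A := A) (B := Y.triv) π n) := by
    have h4 := h1.quotMap
    have h5 : (powMap (A := A) (B := Y.triv) π n) = piProj (A := fun _ : Fin n => A) fun _ => π :=
      funext h2
    rw [h5]
    exact h4
  refine isQuotient_iff.2 ⟨hρ.quotMap.comp h3, fun z z' => hρ.eq_iff.trans ⟨?_, ?_⟩⟩
  · rintro ⟨w, hw⟩
    have h4 : ∀ i, ∃ g : A.G, g • entry z ((powG w).right⁻¹ i) = entry z' i := fun i => by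
      rw [← hπ.eq_iff, ← entry_powMap (B := Y.triv) π, ← entry_powMap (B := Y.triv) π, ← hw,
        entry_smul]
      rfl
    choose g hg using h4
    refine ⟨powG.symm ⟨g, (powG w).right⟩, pow_ext fun i => ?_⟩
    rw [entry_smul, MulEquiv.apply_symm_apply]
    exact hg i
  · rintro ⟨w, rfl⟩
    refine ⟨powG.symm ⟨(1 : Fin n → Y.triv.G), (powG w).right⟩, pow_ext fun i => ?_⟩
    have e := fun z i => entry_powMap (B := Y.triv) π n z i
    rw [entry_smul, MulEquiv.apply_symm_apply]
    refine (e z _).trans (Eq.trans ?_ (e (w • z) i).symm)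
    rw [entry_smul, hπ.map_smul]

theorem quotientRingHom_power_cls (A : GVar) (n : ℕ) : quotientRingHom (A.power n).cls =
    quotientRingHom (A.quotient.triv.power n).cls := by
  rw [quotientRingHom_cls, quotientRingHom_cls]
  exact (A.isQuotient_quotMk.power (isQuotient_quotMk _)).cls_eq

end GVar

/-- The λ-structure on `K₀(Var_ℂ)` with `λ_X(t) = 1 + ∑ [Xⁿ / S_n] tⁿ`. -/
def symLambda : LambdaStructure K0Var where
  series a := mapSeries quotientRingHom (zeta.series (trivHom a))
  series_add a b := by
    rw [map_add, zeta.series_add]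
    exact map_mul (mapSeriesHom quotientRingHom) _ _
  coeff_one a := by
    rw [coeffSeries_mapSeries, zeta.coeff_one, quotientRingHom_trivHom]

theorem coeffSeries_symLambda (X : QPVar) (n : ℕ) :
    coeffSeries n (symLambda.series X.cls) = quotientRingHom (X.triv.power n).cls := by
  refine (coeffSeries_mapSeries _ _ _).trans ?_
  rw [trivHom_cls, zeta_series_cls, GVar.coeffSeries_zetaSeries]

namespace LambdaStructure

variable {R S : Type*} [CommRing R] [CommRing S] (l : LambdaStructure R)

/-- A λ-structure as a homomorphism. -/
def hom : R →+ Additive (oneSeries R) :=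
  AddMonoidHom.mk' (fun a => Additive.ofMul (l.series a)) fun a b =>
    congrArg Additive.ofMul (l.series_add a b)

theorem series_zero : l.series 0 = 1 := congrArg Additive.toMul (map_zero l.hom)

theorem series_neg (a : R) : l.series (-a) = (l.series a)⁻¹ :=
  congrArg Additive.toMul (map_neg l.hom a)

end LambdaStructure

theorem isLambdaHom_of_cls {S : Type*} [CommRing S] {l : LambdaStructure S} {φ : K0fGr →+* S}
    (h : ∀ A : GVar, l.series (φ A.cls) = mapSeries φ (zeta.series A.cls)) :
    IsLambdaHom zeta l φ := fun a => by
  induction a using K0fGr.induction with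
  | h0 =>
    rw [map_zero, LambdaStructure.series_zero, LambdaStructure.series_zero]
    exact (map_one (mapSeriesHom φ)).symm
  | h1 A => exact h A
  | hneg a ha =>
    rw [map_neg, LambdaStructure.series_neg, LambdaStructure.series_neg, ha]
    exact (map_inv (mapSeriesHom φ) _).symm
  | hadd a b ha hb =>
    rw [map_add, LambdaStructure.series_add, LambdaStructure.series_add, ha, hb]
    exact (map_mul (mapSeriesHom φ) _ _).symm

theorem isLambdaHom_quotientRingHom : IsLambdaHom zeta symLambda quotientRingHom :=
  isLambdaHom_of_cls fun A => oneSeries_ext fun n => by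
    rw [coeffSeries_mapSeries, zeta_series_cls, GVar.coeffSeries_zetaSeries, quotientRingHom_cls A,
      coeffSeries_symLambda, ← GVar.quotientRingHom_power_cls A]

/-! ### Series modulo powers of `t` -/

section EqMod

variable {R : Type*} [CommRing R] {n : ℕ} {A B C D : oneSeries R}

/-- Congruence of series modulo `t^(n+1)`. -/
def EqMod (n : ℕ) (A B : oneSeries R) : Prop := ∀ m ≤ n, coeffSeries m A = coeffSeries m B

theorem EqMod.refl (n : ℕ) (A : oneSeries R) : EqMod n A A := fun _ _ => rfl

theorem EqMod.symm (h : EqMod n A B) : EqMod n B A := fun m hm => (h m hm).symm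

theorem EqMod.trans (h : EqMod n A B) (h' : EqMod n B C) : EqMod n A C :=
  fun m hm => (h m hm).trans (h' m hm)

theorem EqMod.mono {m : ℕ} (h : EqMod n A B) (hm : m ≤ n) : EqMod m A B :=
  fun k hk => h k (hk.trans hm)

theorem EqMod.mul (h : EqMod n A B) (h' : EqMod n C D) : EqMod n (A * C) (B * D) := by
  intro m hm
  rw [coeffSeries_mul, coeffSeries_mul]
  refine sum_congr rfl fun p hp => ?_
  have h1 := mem_antidiagonal.1 hp
  rw [h p.1 (by omega), h' p.2 (by omega)]

theorem EqMod.of_mul_right (h : EqMod n (A * C) (B * C)) : EqMod n A B := by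
  have h1 := h.mul (EqMod.refl n C⁻¹)
  rwa [mul_inv_cancel_right, mul_inv_cancel_right] at h1

theorem EqMod.prod {ι : Type*} (s : Finset ι) {f g : ι → oneSeries R}
    (h : ∀ i ∈ s, EqMod n (f i) (g i)) : EqMod n (∏ i ∈ s, f i) (∏ i ∈ s, g i) := by
  classical
  induction s using Finset.induction_on with
  | empty => exact EqMod.refl n _
  | insert a s ha ih =>
    rw [Finset.prod_insert ha, Finset.prod_insert ha]
    exact (h a (Finset.mem_insert_self a s)).mul
      (ih fun i hi => h i (Finset.mem_insert_of_mem hi))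

theorem eqMod_zero (A B : oneSeries R) : EqMod 0 A B := by
  intro m hm
  obtain rfl : m = 0 := by omega
  rw [coeffSeries_zero, coeffSeries_zero]

theorem eq_of_eqMod (h : ∀ n, EqMod n A B) : A = B := oneSeries_ext fun n => h n n le_rfl

/-- The substitution `t ↦ t^(k+1)`. -/
def expandHom (k : ℕ) : oneSeries R →* oneSeries R :=
  MonoidHom.mk' (fun A => ⟨PowerSeries.expand (k + 1) k.succ_ne_zero A.1, by
    show PowerSeries.constantCoeff _ = 1
    rw [PowerSeries.constantCoeff_expand]
    exact A.2⟩) fun A B => Subtype.ext (map_mul _ A.1 B.1)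

theorem expandHom_val (k : ℕ) (A : oneSeries R) :
    (expandHom k A).1 = PowerSeries.expand (k + 1) k.succ_ne_zero A.1 := rfl

theorem coeffSeries_expandHom_mul (k : ℕ) (A : oneSeries R) (m : ℕ) :
    coeffSeries ((k + 1) * m) (expandHom k A) = coeffSeries m A :=
  PowerSeries.coeff_expand_mul (k + 1) k.succ_ne_zero A.1 m

theorem coeffSeries_expandHom_of_not_dvd (k : ℕ) (A : oneSeries R) {m : ℕ} (h : ¬ (k + 1) ∣ m) :
    coeffSeries m (expandHom k A) = 0 :=
  PowerSeries.coeff_expand_of_not_dvd (k + 1) k.succ_ne_zero A.1 h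

theorem EqMod.expandHom (k : ℕ) (h : EqMod n A B) : EqMod n (expandHom k A) (expandHom k B) := by
  intro m hm
  by_cases hd : (k + 1) ∣ m
  · obtain ⟨c, rfl⟩ := hd
    rw [coeffSeries_expandHom_mul, coeffSeries_expandHom_mul]
    exact h c ((Nat.le_mul_of_pos_left c k.succ_pos).trans hm)
  · rw [coeffSeries_expandHom_of_not_dvd k A hd, coeffSeries_expandHom_of_not_dvd k B hd]

theorem expandHom_expandHom (j k : ℕ) (A : oneSeries R) :
    Motivic.expandHom j (Motivic.expandHom k A) = Motivic.expandHom ((j + 1) * (k + 1) - 1) A := by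
  refine oneSeries_ext fun m => ?_
  obtain ⟨q, hq⟩ : ∃ q, (j + 1) * (k + 1) = q + 1 :=
    Nat.exists_eq_succ_of_ne_zero (Nat.mul_pos j.succ_pos k.succ_pos).ne'
  rw [hq, Nat.add_sub_cancel]
  by_cases hd : q + 1 ∣ m
  · obtain ⟨c, rfl⟩ := hd
    rw [coeffSeries_expandHom_mul, ← hq, mul_assoc, coeffSeries_expandHom_mul,
      coeffSeries_expandHom_mul]
  · rw [coeffSeries_expandHom_of_not_dvd q A hd]
    by_cases hj : (j + 1) ∣ m
    · obtain ⟨c, rfl⟩ := hj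
      rw [coeffSeries_expandHom_mul, coeffSeries_expandHom_of_not_dvd]
      exact fun h => hd (hq ▸ mul_dvd_mul_left _ h)
    · exact coeffSeries_expandHom_of_not_dvd _ _ hj

theorem expandHom_zero (A : oneSeries R) : Motivic.expandHom 0 A = A := oneSeries_ext fun m => by
  conv_lhs => rw [← one_mul m]
  exact coeffSeries_expandHom_mul 0 A m

theorem expandHom_eqMod_one (k : ℕ) (A : oneSeries R) : EqMod k (Motivic.expandHom k A) 1 := by
  intro m hm
  rcases Nat.eq_zero_or_pos m with rfl | h
  · rw [coeffSeries_zero, coeffSeries_zero]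
  · rw [coeffSeries_expandHom_of_not_dvd k A fun h1 => by have := Nat.le_of_dvd h h1; omega,
      coeffSeries_one h.ne']

theorem mapSeries_expandHom {R S : Type*} [CommRing R] [CommRing S] (φ : R →+* S) (i : ℕ)
    (A : oneSeries R) : mapSeriesHom φ (expandHom i A) = expandHom i (mapSeries φ A) :=
  oneSeries_ext fun m => by
    refine (coeffSeries_mapSeries _ _ _).trans ?_
    by_cases hd : (i + 1) ∣ m
    · obtain ⟨q, rfl⟩ := hd
      rw [coeffSeries_expandHom_mul, coeffSeries_expandHom_mul, coeffSeries_mapSeries]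
    · rw [coeffSeries_expandHom_of_not_dvd _ _ hd, coeffSeries_expandHom_of_not_dvd _ _ hd,
        map_zero]

end EqMod

/-! ### The power structure defined by a λ-structure -/

namespace LambdaStructure

variable {R : Type*} [CommRing R] (l : LambdaStructure R)

/-- The product of the series `λ_{b_i}(t^i)`, `1 ≤ i ≤ N`; here `b_i` is the value of `b` at
`i - 1`. -/
def partialProd (N : ℕ) (b : ℕ → R) : oneSeries R :=
  ∏ i ∈ Finset.range N, expandHom i (l.series (b i))

theorem partialProd_succ (N : ℕ) (b : ℕ → R) : l.partialProd (N + 1) b =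
    l.partialProd N b * expandHom N (l.series (b N)) := Finset.prod_range_succ _ _

theorem partialProd_add (N : ℕ) (b c : ℕ → R) : l.partialProd N (b + c) =
    l.partialProd N b * l.partialProd N c := by
  unfold partialProd
  rw [← Finset.prod_mul_distrib]
  refine prod_congr rfl fun i _ => ?_
  rw [Pi.add_apply, l.series_add, map_mul]

theorem partialProd_eqMod {n N : ℕ} (h : n ≤ N) (b : ℕ → R) :
    EqMod n (l.partialProd N b) (l.partialProd n b) := by
  induction N, h using Nat.le_induction with
  | base => exact EqMod.refl _ _
  | succ N hN ih =>
    rw [partialProd_succ]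
    have h1 := ih.mul ((expandHom_eqMod_one N (l.series (b N))).mono hN)
    rwa [mul_one] at h1

/-- The infinite product of the series `λ_{b_i}(t^i)`. -/
def infProd (b : ℕ → R) : oneSeries R :=
  mkSeries (fun n => coeffSeries n (l.partialProd n b)) (coeffSeries_zero _)

theorem infProd_eqMod {n N : ℕ} (h : n ≤ N) (b : ℕ → R) :
    EqMod n (l.infProd b) (l.partialProd N b) := by
  intro m hm
  refine (coeffSeries_mkSeries _ _ _).trans ?_
  exact (l.partialProd_eqMod (hm.trans h) b m le_rfl).symm

theorem infProd_add (b c : ℕ → R) : l.infProd (b + c) = l.infProd b * l.infProd c :=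
  eq_of_eqMod fun n => by
    refine (l.infProd_eqMod le_rfl _).trans ?_
    rw [partialProd_add]
    exact ((l.infProd_eqMod le_rfl b).mul (l.infProd_eqMod le_rfl c)).symm

/-- The infinite product as a homomorphism. -/
def infProdHom : (ℕ → R) →+ Additive (oneSeries R) :=
  AddMonoidHom.mk' (fun b => Additive.ofMul (l.infProd b)) fun b c =>
    congrArg Additive.ofMul (l.infProd_add b c)

theorem infProd_eqMod_one_iff {n : ℕ} {b : ℕ → R} :
    EqMod n (l.infProd b) 1 ↔ ∀ i < n, b i = 0 := by
  constructor
  · intro h i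
    induction i using Nat.strong_induction_on with
    | _ i ih =>
      intro hi
      have h1 := ((l.infProd_eqMod (le_refl (i + 1)) b).symm.trans (h.mono hi)) (i + 1) le_rfl
      have h2 : l.partialProd i b = 1 := Finset.prod_eq_one fun j hj => by
        have hj' := Finset.mem_range.1 hj
        rw [ih j hj' (hj'.trans hi), l.series_zero, map_one]
      rw [partialProd_succ, h2, one_mul, coeffSeries_one i.succ_ne_zero] at h1
      have h3 := coeffSeries_expandHom_mul i (l.series (b i)) 1
      rw [mul_one, h1, l.coeff_one] at h3
      exact h3.symm
  · intro h
    refine (l.infProd_eqMod le_rfl b).trans ?_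
    have h2 : l.partialProd n b = 1 := Finset.prod_eq_one fun j hj => by
      rw [h j (Finset.mem_range.1 hj), l.series_zero, map_one]
    rw [h2]
    exact EqMod.refl _ _

theorem infProd_injective : Injective l.infProd := by
  have h : Injective l.infProdHom := (injective_iff_map_eq_zero _).2 fun b hb =>
    funext fun i => (l.infProd_eqMod_one_iff (n := i + 1)).1
      (by rw [show l.infProd b = 1 from congrArg Additive.toMul hb]; exact EqMod.refl _ _) i
      (Nat.lt_succ_self i)
  exact fun b c hbc => h (congrArg Additive.ofMul hbc)

/-- The partial products that approximate a given series. -/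
def approx (A : oneSeries R) : ℕ → oneSeries R
  | 0 => 1
  | n + 1 => approx A n * expandHom n (l.series (coeffSeries (n + 1) (A * (approx A n)⁻¹)))

theorem approx_eqMod (A : oneSeries R) (n : ℕ) : EqMod n A (l.approx A n) := by
  induction n with
  | zero => exact eqMod_zero _ _
  | succ n ih =>
    set S := l.approx A n with hS
    have hC : EqMod n (A * S⁻¹) 1 := by
      have h1 := ih.mul (EqMod.refl n S⁻¹)
      rwa [mul_inv_cancel] at h1
    have h2 : EqMod (n + 1) (A * S⁻¹)
        (expandHom n (l.series (coeffSeries (n + 1) (A * S⁻¹)))) := by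
      intro m hm
      rcases Nat.lt_or_ge n m with h | h
      · obtain rfl : m = n + 1 := by omega
        have h3 := coeffSeries_expandHom_mul n (l.series (coeffSeries (n + 1) (A * S⁻¹))) 1
        rw [mul_one, l.coeff_one] at h3
        exact h3.symm
      · rw [hC m h, expandHom_eqMod_one n _ m h]
    have h4 := (EqMod.refl (n + 1) S).mul h2
    have e : S * (A * S⁻¹) = A := by rw [mul_comm, inv_mul_cancel_right]
    rw [e] at h4
    exact h4

theorem infProd_surjective : Surjective l.infProd := by
  intro A
  let b : ℕ → R := fun n => coeffSeries (n + 1) (A * (l.approx A n)⁻¹)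
  have h : ∀ n, l.partialProd n b = l.approx A n := by
    intro n
    induction n with
    | zero => rfl
    | succ n ih => rw [partialProd_succ, ih]; rfl
  refine ⟨b, eq_of_eqMod fun n => (l.infProd_eqMod le_rfl b).trans ?_⟩
  rw [h]
  exact (l.approx_eqMod A n).symm

/-- Every series is in a unique way an infinite product of series `λ_{b_i}(t^i)`. -/
def infProdEquiv : (ℕ → R) ≃+ Additive (oneSeries R) :=
  AddEquiv.ofBijective l.infProdHom ⟨fun _ _ h => l.infProd_injective (congrArg Additive.toMul h),
    fun A => (l.infProd_surjective A.toMul).imp fun _ h => congrArg Additive.ofMul h⟩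

/-- The elements `b_i` with `A(t) = ∏ λ_{b_i}(t^i)`. -/
def logCoord (A : oneSeries R) : ℕ → R := l.infProdEquiv.symm (Additive.ofMul A)

theorem infProd_logCoord (A : oneSeries R) : l.infProd (l.logCoord A) = A :=
  congrArg Additive.toMul (l.infProdEquiv.apply_symm_apply (Additive.ofMul A))

theorem logCoord_infProd (b : ℕ → R) : l.logCoord (l.infProd b) = b :=
  l.infProdEquiv.symm_apply_apply b

theorem logCoord_mul (A B : oneSeries R) : l.logCoord (A * B) = l.logCoord A + l.logCoord B :=
  map_add l.infProdEquiv.symm (Additive.ofMul A) (Additive.ofMul B)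

theorem expandHom_partialProd (k N : ℕ) (b : ℕ → R) : expandHom k (l.partialProd N b) =
    l.partialProd ((k + 1) * N)
      (fun j => if (k + 1) ∣ j + 1 then b ((j + 1) / (k + 1) - 1) else 0) := by
  induction N with
  | zero => exact map_one _
  | succ N ih =>
    rw [partialProd_succ, map_mul, ih, partialProd, partialProd, Nat.mul_succ,
      Finset.prod_range_add]
    congr 1
    rw [Finset.prod_range_succ, Finset.prod_eq_one, one_mul, expandHom_expandHom]
    · have h1 : (k + 1) * N + k + 1 = (k + 1) * (N + 1) := by ring
      rw [h1, if_pos (dvd_mul_right _ _), Nat.mul_div_cancel_left _ k.succ_pos, Nat.add_sub_cancel]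
      congr 1
    · intro c hc
      rw [if_neg, l.series_zero, map_one]
      intro hd
      have h1 : (k + 1) ∣ c + 1 := (Nat.dvd_add_right (dvd_mul_right (k + 1) N)).1 hd
      have h2 := Nat.le_of_dvd c.succ_pos h1
      have h3 := Finset.mem_range.1 hc
      omega

theorem expandHom_infProd (k : ℕ) (b : ℕ → R) : expandHom k (l.infProd b) =
    l.infProd (fun j => if (k + 1) ∣ j + 1 then b ((j + 1) / (k + 1) - 1) else 0) :=
  eq_of_eqMod fun n => by
    refine ((l.infProd_eqMod le_rfl b).expandHom k).trans ?_
    rw [expandHom_partialProd]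
    exact (l.infProd_eqMod (Nat.le_mul_of_pos_left n k.succ_pos) _).symm

/-- The power `A(t)^m = ∏ λ_{m b_i}(t^i)` of the series `A(t) = ∏ λ_{b_i}(t^i)`. -/
def power (A : oneSeries R) (m : R) : oneSeries R := l.infProd (m • l.logCoord A)

theorem power_infProd (b : ℕ → R) (m : R) : l.power (l.infProd b) m = l.infProd (m • b) := by
  rw [power, logCoord_infProd]

theorem power_mul (A B : oneSeries R) (m : R) :
    l.power (A * B) m = l.power A m * l.power B m := by
  rw [power, logCoord_mul, smul_add, infProd_add]
  rfl

theorem power_expandHom (k : ℕ) (A : oneSeries R) (m : R) :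
    l.power (expandHom k A) m = expandHom k (l.power A m) := by
  rw [← l.infProd_logCoord A, expandHom_infProd, power_infProd, power_infProd, expandHom_infProd]
  congr 1
  funext j
  rw [Pi.smul_apply]
  split_ifs
  · rfl
  · exact smul_zero _

/-- The power structure defined by a λ-structure. -/
def powerStructure : PowerStructure R where
  pow := l.power
  pow_zero A := by
    rw [power, zero_smul]
    exact congrArg Additive.toMul (map_zero l.infProdHom)
  pow_one A := by rw [power, one_smul, infProd_logCoord]
  mul_pow := l.power_mul
  pow_add A m n := by
    rw [power, add_smul, infProd_add]
    rfl
  pow_mul A m n := by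
    rw [power, mul_smul, ← power_infProd]
    rfl
  coeff_one_pow A m := by
    have h : ∀ b : ℕ → R, coeffSeries 1 (l.infProd b) = b 0 := fun b => by
      refine (l.infProd_eqMod le_rfl b 1 le_rfl).trans ?_
      rw [partialProd_succ, partialProd, Finset.prod_range_zero, one_mul, expandHom_zero,
        l.coeff_one]
    conv_rhs => rw [← l.infProd_logCoord A]
    rw [power, h, h]
    rfl
  pow_expand k hk A B h m := by
    obtain ⟨k, rfl⟩ := Nat.exists_eq_succ_of_ne_zero hk
    obtain rfl : B = expandHom k A := Subtype.ext h
    rw [power_expandHom]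
    rfl

theorem power_series (a m : R) : l.power (l.series a) m = l.series (m * a) := by
  have h : ∀ a, l.infProd (Pi.single 0 a) = l.series a := fun a => eq_of_eqMod fun n => by
    refine (l.infProd_eqMod (Nat.le_succ n) _).trans ?_
    rw [partialProd, Finset.prod_range_succ', Finset.prod_eq_one, one_mul, expandHom_zero,
      Pi.single_eq_same]
    · exact EqMod.refl _ _
    · intro i _
      rw [Pi.single_eq_of_ne i.succ_ne_zero, l.series_zero, map_one]
  rw [← h, power_infProd, ← h]
  congr 1
  rw [← Pi.single_smul]
  rfl

theorem EqMod.power {l : LambdaStructure R} {n : ℕ} {A B : oneSeries R} (h : EqMod n A B) (m : R) :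
    EqMod n (l.power A m) (l.power B m) := by
  have h1 : EqMod n (A * B⁻¹) 1 := by
    have h2 := h.mul (EqMod.refl n B⁻¹)
    rwa [mul_inv_cancel] at h2
  have h3 : EqMod n (l.power (A * B⁻¹) m) 1 := by
    refine l.infProd_eqMod_one_iff.2 fun i hi => ?_
    have h5 := (l.infProd_eqMod_one_iff (n := n)).1
      ((congrArg (EqMod n · 1) (l.infProd_logCoord _)).mpr h1) i hi
    rw [Pi.smul_apply, h5, smul_zero]
  have h4 := h3.mul (EqMod.refl n (l.power B m))
  rwa [← power_mul, inv_mul_cancel_right, one_mul] at h4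

end LambdaStructure

namespace GVar

/-! ### Orbits and the classes of quotients -/

/-- Two points lie in the same orbit. -/
def Orb (A : GVar) (x x' : A.X) : Prop := ∃ g : A.G, g • x = x'

theorem Orb.refl {A : GVar} (x : A.X) : A.Orb x x := ⟨1, one_smul _ _⟩

theorem orb_triv {Y : QPVar} {y y' : Y.triv.X} : Y.triv.Orb y y' ↔ y = y' :=
  ⟨fun ⟨_, h⟩ => h, fun h => ⟨(), h⟩⟩

theorem orb_sub {A : GVar} {Z : Set A.X} {hZ : IsLocallyClosed Z}
    {hG : ∀ (g : A.G) (x : A.X), x ∈ Z → g • x ∈ Z} {z z' : (A.sub Z hZ hG).X} :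
    (A.sub Z hZ hG).Orb z z' ↔ A.Orb (val z) (val z') :=
  ⟨fun ⟨g, h⟩ => ⟨subG g, congrArg val h⟩, fun ⟨g, h⟩ => ⟨subG.symm g, val_injective h⟩⟩

theorem orb_prod {A B : GVar} {z z' : (A.prod B).X} :
    (A.prod B).Orb z z' ↔ A.Orb (pr₁ z) (pr₁ z') ∧ B.Orb (pr₂ z) (pr₂ z') := by
  constructor
  · rintro ⟨g, rfl⟩
    exact ⟨⟨_, (pr₁_smul g z).symm⟩, ⟨_, (pr₂_smul g z).symm⟩⟩
  · rintro ⟨⟨g, hg⟩, ⟨h, hh⟩⟩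
    exact ⟨prodG.symm (g, h), prod_ext ((pr₁_smul _ z).trans hg) ((pr₂_smul _ z).trans hh)⟩

theorem orb_pi {ι : Type} [Fintype ι] {A : ι → GVar} {z z' : (pi A).X} :
    (pi A).Orb z z' ↔ ∀ i, (A i).Orb (proj z i) (proj z' i) := by
  constructor
  · rintro ⟨g, rfl⟩ i
    exact ⟨_, (proj_smul g z i).symm⟩
  · intro h
    choose g hg using h
    exact ⟨g, proj_ext fun i => (proj_smul (A := A) g z i).trans (hg i)⟩

theorem orb_power {A : GVar} {n : ℕ} {z z' : (A.power n).X} :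
    (A.power n).Orb z z' ↔
      ∃ σ : Perm (Fin n), ∀ i, A.Orb (entry z (σ i)) (entry z' i) := by
  constructor
  · rintro ⟨g, rfl⟩
    exact ⟨(powG g).right⁻¹, fun i => ⟨_, (entry_smul g z i).symm⟩⟩
  · rintro ⟨σ, h⟩
    choose g hg using h
    refine ⟨powG.symm ⟨g, σ⁻¹⟩, pow_ext fun i => (entry_smul _ z i).trans ?_⟩
    rw [MulEquiv.apply_symm_apply]
    exact hg i

/-- Mutually inverse regular maps that respect the orbits induce an isomorphism of the
quotients. -/
theorem quotientRingHom_cls_eq {A B : GVar} {φ : A.X → B.X} {ψ : B.X → A.X} (hφ : IsRegular φ)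
    (hψ : IsRegular ψ) (h₁ : ∀ x, ψ (φ x) = x) (h₂ : ∀ y, φ (ψ y) = y)
    (horb : ∀ x x', A.Orb x x' ↔ B.Orb (φ x) (φ x')) :
    quotientRingHom A.cls = quotientRingHom B.cls := by
  rw [quotientRingHom_cls, quotientRingHom_cls]
  exact (B.isQuotient_quotMk.of_inverse hφ hψ h₁ h₂ horb).cls_eq

/-- The stratification of a quotient by the values of an equivariant map to a finite partially
ordered set: each stratum is described by its points and by the orbits on it. -/
theorem quotientRingHom_cls_eq_sum_strata {A : GVar} {I : Type} [Finite I] [PartialOrder I]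
    [MulAction A.G I] (hmono : ∀ (g : A.G) (i j : I), i ≤ j → g • i ≤ g • j) {f : A.X → I}
    (hf : ∀ (g : A.G) (x : A.X), f (g • x) = g • f x) (hclosed : ∀ i, IsClosed {x | i ≤ f x})
    {O : Type} [Fintype O] (rep : O → I)
    (hrep : ∀ x : A.X, ∃ (o : O) (g : A.G), g • rep o = f x)
    (huniq : ∀ (o o' : O) (g : A.G), g • rep o = rep o' → o = o')
    (B : O → GVar) (φ : ∀ o, (B o).X → A.X) (hφ : ∀ o, IsRegular (φ o))
    (hφi : ∀ o, Injective (φ o)) (hφf : ∀ o (x : (B o).X), f (φ o x) = rep o)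
    (hψ : ∀ o (h : IsLocallyClosed {x | f x = rep o}), ∃ ψ : A.X.sub _ h → (B o).X,
      IsRegular ψ ∧ ∀ z, φ o (ψ z) = incl z)
    (horb : ∀ o (x x' : (B o).X), (B o).Orb x x' ↔ A.Orb (φ o x) (φ o x')) :
    quotientRingHom A.cls = ∑ o, quotientRingHom (B o).cls := by
  have hlc : ∀ o, IsLocallyClosed {x | f x = rep o} := fun o => isLocallyClosed_stratum hclosed _
  let S : ∀ o, GVar := fun o => A.comap (MulAction.stabilizer A.G (rep o)).subtype
  have hG : ∀ o (g : (S o).G) (x : (S o).X), x ∈ {x : A.X | f x = rep o} →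
      g • x ∈ {x : A.X | f x = rep o} := fun o g x hx =>
    (hf g.1 x).trans ((congrArg (g.1 • ·) hx).trans g.2)
  let C : ∀ o, GVar := fun o => (S o).sub {x : A.X | f x = rep o} (hlc o) (hG o)
  rw [cls_eq_sum_strata hmono hf hclosed rep hrep huniq C
    (fun o => (MulAction.stabilizer A.G (rep o)).subtype.comp
      (subG (A := S o) (hZ := hlc o) (hG := hG o)).toMonoidHom)
    (fun o => Subtype.val_injective.comp subG.injective)
    (fun o g hg => ⟨subG.symm ⟨g, hg⟩, rfl⟩)
    (fun o => val (A := S o)) (fun o => isRegular_val (A := S o))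
    (fun o => val_injective (A := S o)) (fun o g x => rfl) (fun o x => val_mem (A := S o) x)
    (fun o h => ⟨fun z => z, isRegular_id _, fun _ => rfl⟩), map_sum]
  refine sum_congr rfl fun o _ => ?_
  obtain ⟨ψ, hψr, hψφ⟩ := hψ o (hlc o)
  refine (quotientRingHom_cls_eq (A := B o) (B := C o)
    (φ := fun x => mkSub (A := S o) (hlc o) (hG o) (φ o x) (hφf o x)) (ψ := ψ)
    (isRegular_mkSub (A := S o) (hφ o) _) hψr (fun x => hφi o (hψφ _))
    (fun z => val_injective (A := S o) (hψφ z)) fun x x' => (horb o x x').trans ?_).symm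
  constructor
  · rintro ⟨g, hg⟩
    have h1 : g • rep o = rep o := by
      have h2 := hf g (φ o x)
      rwa [hg, hφf, hφf, eq_comm] at h2
    exact ⟨subG.symm ⟨g, h1⟩, val_injective (A := S o) hg⟩
  · rintro ⟨g, hg⟩
    exact ⟨(subG g).1, congrArg (val (A := S o)) hg⟩

/-! ### Labelled configuration spaces -/

section Conf

variable {E : Type} [Fintype E] {M : QPVar} {W : E → GVar} {k : E → ℕ}

/-- The families of points `m_{e,i}` of `M` with labels `w_{e,i}` in `W_e`, `1 ≤ i ≤ k_e`. -/
abbrev labelled (M : QPVar) (W : E → GVar) (k : E → ℕ) : GVar :=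
  GVar.pi fun e => (M.triv.prod (W e)).power (k e)

/-- The points of `M` in a family of labelled points. -/
def lpos (x : (labelled M W k).X) (s : Σ e, Fin (k e)) : M :=
  pr₁ (A := M.triv) (B := W s.1) (entry (proj x s.1) s.2)

theorem isRegular_lpos (s : Σ e, Fin (k e)) : IsRegular fun x : (labelled M W k).X => lpos x s :=
  (isRegular_pr₁ (A := M.triv)).comp ((isRegular_entry s.2).comp
    (isRegular_piEquiv_apply (fun e => ((M.triv.prod (W e)).power (k e)).X) s.1))

theorem isOpen_injective_lpos :
    IsOpen {x : (labelled M W k).X | Injective (lpos x)} := by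
  have : {x : (labelled M W k).X | Injective (lpos x)} =
      ⋂ (a : Σ e, Fin (k e)) (b : Σ e, Fin (k e)) (_ : a ≠ b),
        {x : (labelled M W k).X | lpos x a = lpos x b}ᶜ := by
    ext z
    simp only [Set.mem_iInter, Set.mem_compl_iff]
    exact ⟨fun h a b hab e => hab (h e), fun h a b e => by_contra fun hab => h a b hab e⟩
  rw [this]
  exact isOpen_iInter_of_finite fun a => isOpen_iInter_of_finite fun b =>
    isOpen_iInter_of_finite fun _ =>
      (isClosed_eq (isRegular_lpos a) (isRegular_lpos b)).isOpen_compl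

theorem lpos_smul (g : (labelled M W k).G) (x : (labelled M W k).X) (s : Σ e, Fin (k e)) :
    lpos (g • x) s = lpos x ⟨s.1, (powG (g s.1)).right⁻¹ s.2⟩ := by
  unfold lpos
  refine (congrArg (fun z => pr₁ (A := M.triv) (B := W s.1) (entry z s.2))
    (proj_smul (A := fun e => (M.triv.prod (W e)).power (k e)) g x s.1)).trans ?_
  refine (congrArg (pr₁ (A := M.triv) (B := W s.1)) (entry_smul (g s.1) _ s.2)).trans ?_
  exact pr₁_smul _ _

theorem injective_lpos_smul (g : (labelled M W k).G) (x : (labelled M W k).X)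
    (hx : Injective (lpos x)) : Injective (lpos (g • x)) := by
  rintro ⟨e, i⟩ ⟨e', i'⟩ h
  rw [lpos_smul, lpos_smul] at h
  have h' := hx h
  obtain rfl : e = e' := congrArg Sigma.fst h'
  simpa using h'

/-- The configurations of distinct points of `M` with labels: for each `e` there are `k_e` points
labelled by points of `W_e`.  The group permutes the points with labels in `W_e` and acts on the
labels. -/
def conf (M : QPVar) (W : E → GVar) (k : E → ℕ) : GVar :=
  (labelled M W k).sub {x | Injective (lpos x)} isOpen_injective_lpos.isLocallyClosed
    injective_lpos_smul

/-- The points of a configuration. -/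
def cpos (x : (conf M W k).X) (s : Σ e, Fin (k e)) : M := lpos (val x) s

/-- The labels of a configuration. -/
def clab (x : (conf M W k).X) (e : E) (i : Fin (k e)) : (W e).X :=
  pr₂ (A := M.triv) (B := W e) (entry (proj (val x) e) i)

theorem cpos_injective (x : (conf M W k).X) : Injective (cpos x) := val_mem x

theorem isRegular_cpos (s : Σ e, Fin (k e)) : IsRegular fun x : (conf M W k).X => cpos x s :=
  (isRegular_lpos s).comp isRegular_val

theorem isRegular_clab (e : E) (i : Fin (k e)) : IsRegular fun x : (conf M W k).X => clab x e i :=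
  (isRegular_pr₂ (A := M.triv)).comp ((isRegular_entry i).comp
    ((isRegular_piEquiv_apply (fun e => ((M.triv.prod (W e)).power (k e)).X) e).comp
      isRegular_val))

/-- The family of points of `M` with given points and labels. -/
def labelledMk (p : (Σ e, Fin (k e)) → M) (w : ∀ e, Fin (k e) → (W e).X) : (labelled M W k).X :=
  (piEquiv fun e => ((M.triv.prod (W e)).power (k e)).X).symm fun e =>
    powMk fun i => pair (A := M.triv) (p ⟨e, i⟩) (w e i)

theorem entry_labelledMk (p : (Σ e, Fin (k e)) → M) (w : ∀ e, Fin (k e) → (W e).X) (e : E)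
    (i : Fin (k e)) : entry (proj (labelledMk p w) e) i =
      pair (A := M.triv) (B := W e) (p ⟨e, i⟩) (w e i) :=
  (congrArg (entry (A := M.triv.prod (W e)) · i) (congrFun (Equiv.apply_symm_apply
    (piEquiv fun e => ((M.triv.prod (W e)).power (k e)).X) _) e)).trans (entry_mk _ _)

theorem lpos_labelledMk (p : (Σ e, Fin (k e)) → M) (w : ∀ e, Fin (k e) → (W e).X) :
    lpos (labelledMk p w) = p :=
  funext fun s => (congrArg (pr₁ (A := M.triv)) (entry_labelledMk p w s.1 s.2)).trans
    (pr₁_pair (A := M.triv) _ _)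

theorem isRegular_labelledMk {T : QPVar} {p : T → (Σ e, Fin (k e)) → M}
    {w : T → ∀ e, Fin (k e) → (W e).X} (hp : ∀ s, IsRegular fun t => p t s)
    (hw : ∀ e i, IsRegular fun t => w t e i) : IsRegular fun t => labelledMk (p t) (w t) :=
  isRegular_pi (X := fun e => ((M.triv.prod (W e)).power (k e)).X) fun e =>
    (isRegular_congr fun _ => congrFun (Equiv.apply_symm_apply
      (piEquiv fun e => ((M.triv.prod (W e)).power (k e)).X) _) e).2
      (isRegular_powMk fun i => isRegular_pair (A := M.triv) (hp ⟨e, i⟩) (hw e i))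

/-- The configuration with given points and labels. -/
def confMk (p : (Σ e, Fin (k e)) → M) (w : ∀ e, Fin (k e) → (W e).X)
    (h : Injective p) : (conf M W k).X :=
  mkSub _ _ (labelledMk p w) (show Injective _ by rwa [lpos_labelledMk])

theorem cpos_mk (p : (Σ e, Fin (k e)) → M) (w : ∀ e, Fin (k e) → (W e).X)
    (h : Injective p) (s : Σ e, Fin (k e)) : cpos (confMk p w h) s = p s :=
  congrFun (lpos_labelledMk p w) s

theorem clab_mk (p : (Σ e, Fin (k e)) → M) (w : ∀ e, Fin (k e) → (W e).X)
    (h : Injective p) (e : E) (i : Fin (k e)) : clab (confMk p w h) e i = w e i :=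
  (congrArg (pr₂ (A := M.triv)) (entry_labelledMk p w e i)).trans (pr₂_pair (A := M.triv) _ _)

theorem isRegular_confMk {T : QPVar} {p : T → (Σ e, Fin (k e)) → M}
    {w : T → ∀ e, Fin (k e) → (W e).X} (hp : ∀ s, IsRegular fun t => p t s)
    (hw : ∀ e i, IsRegular fun t => w t e i) (h : ∀ t, Injective (p t)) :
    IsRegular fun t => confMk (p t) (w t) (h t) :=
  isRegular_mkSub (isRegular_labelledMk hp hw) _

theorem conf_ext {x y : (conf M W k).X} (h : ∀ s, cpos x s = cpos y s)
    (h' : ∀ e i, clab x e i = clab y e i) : x = y :=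
  val_injective (proj_ext fun e => pow_ext fun i =>
    prod_ext (A := M.triv) (B := W e) (h ⟨e, i⟩) (h' e i))

theorem orb_conf {x x' : (conf M W k).X} : (conf M W k).Orb x x' ↔
    ∃ σ : ∀ e, Perm (Fin (k e)), (∀ e i, cpos x ⟨e, σ e i⟩ = cpos x' ⟨e, i⟩) ∧
      ∀ e i, (W e).Orb (clab x e (σ e i)) (clab x' e i) := by
  refine orb_sub.trans (orb_pi.trans ?_)
  constructor
  · intro h
    choose σ hσ using fun e => orb_power.1 (h e)
    exact ⟨σ, fun e i => orb_triv.1 (orb_prod.1 (hσ e i)).1, fun e i => (orb_prod.1 (hσ e i)).2⟩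
  · rintro ⟨σ, h1, h2⟩ e
    exact orb_power.2 ⟨σ e, fun i => orb_prod.2 ⟨orb_triv.2 (h1 e i), h2 e i⟩⟩

end Conf

end GVar

/-! ### Types of points in a superposition of a configuration and a family of points -/

/-- Two families with the same numbers of elements over each value differ by a bijection of the
index sets. -/
theorem exists_equiv_of_card_fibre_eq {A B T : Type*} [Finite A] [Finite B] {f : A → T} {g : B → T}
    (h : ∀ t, Nat.card {a // f a = t} = Nat.card {b // g b = t}) :
    ∃ ε : A ≃ B, ∀ a, g (ε a) = f a := by
  let e : ∀ t, {a // f a = t} ≃ {b // g b = t} := fun t => Classical.choice (Finite.card_eq.1 (h t))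
  refine ⟨(Equiv.sigmaFiberEquiv f).symm.trans
    ((Equiv.sigmaCongrRight fun t => e t).trans (Equiv.sigmaFiberEquiv g)), fun a => ?_⟩
  exact (e (f a) ⟨a, rfl⟩).2

theorem card_eq_sum_card_fibre {A T : Type*} [Fintype A] [Fintype T] (f : A → T) :
    ∑ t, Nat.card {a // f a = t} = Fintype.card A := by
  rw [← Nat.card_eq_fintype_card, ← Nat.card_congr (Equiv.sigmaFiberEquiv f), Nat.card_sigma]

/-- The possible types of a point in the superposition of a configuration with labels of the kinds
`e ∈ E` and of a family of points: a point of the configuration with a label of kind `e` which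
occurs `r` times in the family, or a point which does not belong to the configuration and occurs
`r + 1` times in the family. -/
abbrev PointType (E : Type) (R : ℕ) : Type := E × Fin (R + 1) ⊕ Fin R

namespace PointType

variable {E : Type} {R : ℕ}

/-- The multiplicity in the family. -/
def mult : PointType E R → ℕ
  | Sum.inl q => q.2
  | Sum.inr r => r + 1

/-- The kind of the label in the configuration, if the point belongs to it. -/
def base : PointType E R → Option E
  | Sum.inl q => some q.1
  | Sum.inr _ => none

theorem ext {p q : PointType E R} (h : base p = base q) (h' : mult p = mult q) : p = q := by
  rcases p with ⟨e, r⟩ | r <;> rcases q with ⟨e', r'⟩ | r' <;> simp_all [base, mult, Fin.ext_iff]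

end PointType

open PointType

section Superposition

variable {E : Type} {R : ℕ} {k : E → ℕ} {l : ℕ}

/-- The index set of a configuration of `k_e` points of each kind and a family of `l` points. -/
abbrev Superpos (k : E → ℕ) (l : ℕ) : Type := (Σ e, Fin (k e)) ⊕ Fin l

/-- The map `c` to a set of points of given types places the points in accordance with the
types. -/
structure IsPlacement {S : Type} (q : S → PointType E R) (c : Superpos k l → S) : Prop where
  card_base : ∀ e s, Nat.card {i // c (Sum.inl ⟨e, i⟩) = s} = Nat.card {_u : Unit // base (q s) = some e}
  card_mult : ∀ s, Nat.card {i // c (Sum.inr i) = s} = mult (q s)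

/-- The permutation of the indices given by permutations of the indices of each kind. -/
def blockPerm (σ : ∀ e, Perm (Fin (k e))) (τ : Perm (Fin l)) :
    Perm (Superpos k l) := Equiv.sumCongr (Equiv.sigmaCongrRight σ) τ

namespace IsPlacement

variable {S S' : Type} {q : S → PointType E R} {q' : S' → PointType E R} {c c' : Superpos k l → S}

theorem comp_blockPerm (h : IsPlacement q c) (σ : ∀ e, Perm (Fin (k e)))
    (τ : Perm (Fin l)) : IsPlacement q fun j => c (blockPerm σ τ j) where
  card_base e s := by
    rw [← h.card_base e s]
    exact Nat.card_congr ((σ e).subtypeEquiv fun i => Iff.rfl)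
  card_mult s := by
    rw [← h.card_mult s]
    exact Nat.card_congr (τ.subtypeEquiv fun i => Iff.rfl)

theorem comp_equiv (h : IsPlacement q c) (β : S ≃ S') (hβ : ∀ s, q' (β s) = q s) :
    IsPlacement q' fun j => β (c j) where
  card_base e s := by
    obtain ⟨s, rfl⟩ := β.surjective s
    simp only [hβ, β.injective.eq_iff, h.card_base]
  card_mult s := by
    obtain ⟨s, rfl⟩ := β.surjective s
    simp only [hβ, β.injective.eq_iff, h.card_mult]

theorem surjective (h : IsPlacement q c) : Surjective c := by
  intro s
  rcases hq : q s with ⟨e, r⟩ | r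
  · have h1 := h.card_base e s
    have h2 : Nat.card {_u : Unit // base (q s) = some e} ≠ 0 := by
      have : Nonempty {_u : Unit // base (q s) = some e} := ⟨⟨(), by rw [hq]; rfl⟩⟩
      exact Nat.card_pos.ne'
    rw [← h1] at h2
    obtain ⟨⟨i, hi⟩⟩ := (Nat.card_ne_zero.1 h2).1
    exact ⟨_, hi⟩
  · have h1 := h.card_mult s
    have h2 : mult (q s) ≠ 0 := by rw [hq]; exact Nat.succ_ne_zero _
    rw [← h1] at h2
    obtain ⟨⟨i, hi⟩⟩ := (Nat.card_ne_zero.1 h2).1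
    exact ⟨_, hi⟩

/-- Two placements with the same set of points differ by a permutation of the indices. -/
theorem exists_blockPerm (h : IsPlacement q c) (h' : IsPlacement q c') :
    ∃ (σ : ∀ e, Perm (Fin (k e))) (τ : Perm (Fin l)),
      ∀ j, c' (blockPerm σ τ j) = c j := by
  choose σ hσ using fun e => exists_equiv_of_card_fibre_eq
    (f := fun i => c (Sum.inl ⟨e, i⟩)) (g := fun i => c' (Sum.inl ⟨e, i⟩))
    fun s => (h.card_base e s).trans (h'.card_base e s).symm
  obtain ⟨τ, hτ⟩ := exists_equiv_of_card_fibre_eq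
    (f := fun i => c (Sum.inr i)) (g := fun i => c' (Sum.inr i))
    fun s => (h.card_mult s).trans (h'.card_mult s).symm
  exact ⟨σ, τ, fun j => by rcases j with ⟨e, i⟩ | i; exacts [hσ e i, hτ i]⟩

/-- A placement is determined by its coincidences up to a bijection that preserves the types. -/
theorem exists_equiv {c' : Superpos k l → S'} (h : IsPlacement q c) (h' : IsPlacement q' c')
    (hc : ∀ j j', c j = c j' ↔ c' j = c' j') :
    ∃ θ : S ≃ S', (∀ j, θ (c j) = c' j) ∧ ∀ s, q' (θ s) = q s := by
  choose d hd using h.surjective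
  let θ : S → S' := fun s => c' (d s)
  have hθ : ∀ j, θ (c j) = c' j := fun j => (hc _ _).1 (hd (c j))
  have hi : Injective θ := fun s s' hs => by
    rw [← hd s, ← hd s']
    exact (hc _ _).2 hs
  have hs : Surjective θ := fun s' => by
    obtain ⟨j, rfl⟩ := h'.surjective s'
    exact ⟨c j, hθ j⟩
  have hcs : ∀ j s, c' j = θ s ↔ c j = s := fun j s => by rw [← hθ, hi.eq_iff]
  refine ⟨Equiv.ofBijective θ ⟨hi, hs⟩, hθ, fun s => ext ?_ ?_⟩
  · have h1 : ∀ e, base (q s) = some e ↔ base (q' (θ s)) = some e := fun e => by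
      have h2 := h'.card_base e (θ s)
      simp only [hcs, h.card_base e s] at h2
      by_cases h3 : base (q s) = some e <;> by_cases h4 : base (q' (θ s)) = some e <;>
        simp_all
    exact Option.ext fun e => (h1 e).symm
  · have h2 := h'.card_mult (θ s)
    simp only [hcs, h.card_mult s] at h2
    exact h2.symm

theorem sum_mult [Fintype S] (h : IsPlacement q c) : ∑ s, mult (q s) = l := by
  rw [← Fintype.card_fin l, ← card_eq_sum_card_fibre fun i : Fin l => c (Sum.inr i)]
  exact sum_congr rfl fun s _ => (h.card_mult s).symm

theorem card_base_eq [Finite S] (h : IsPlacement q c) (e : E) :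
    Nat.card {s // base (q s) = some e} = k e := by
  classical
  let _ : Fintype S := Fintype.ofFinite S
  rw [← Fintype.card_fin (k e), ← card_eq_sum_card_fibre fun i : Fin (k e) => c (Sum.inl ⟨e, i⟩),
    sum_congr rfl fun s _ => h.card_base e s, Nat.card_eq_fintype_card, Fintype.card_subtype,
    Finset.card_filter]
  refine sum_congr rfl fun s _ => ?_
  by_cases h3 : base (q s) = some e <;> simp [h3]

end IsPlacement

/-- The set of the places of a superposition with `κ_q` points of type `q`. -/
abbrev Places (κ : PointType E R → ℕ) : Type := Σ q, Fin (κ q)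

/-- The numbers `κ_q` of points of type `q` are those of a superposition of `k_e` points of each
kind and of `l` points. -/
def IsCompatible [Fintype E] (k : E → ℕ) (l : ℕ) (κ : PointType E R → ℕ) : Prop :=
  (∀ e, ∑ r, κ (Sum.inl (e, r)) = k e) ∧ ∑ q, κ q * mult q = l

/-- The places of points which belong to the configuration. -/
def placeOf {κ : PointType E R → ℕ} (e : E) (x : Σ r, Fin (κ (Sum.inl (e, r)))) : Places κ :=
  ⟨Sum.inl (e, x.1), x.2⟩

theorem placeOf_injective {κ : PointType E R → ℕ} (e : E) :
    Injective (placeOf (κ := κ) e) := by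
  rintro ⟨r, a⟩ ⟨r', a'⟩ h
  obtain rfl : r = r' := by simpa [placeOf] using congrArg Sigma.fst h
  have h' := eq_of_heq (Sigma.mk.inj h).2
  exact congrArg _ h'

/-- The map to the places defined by bijections. -/
def placement {κ : PointType E R → ℕ} (ε : ∀ e, Fin (k e) ≃ Σ r, Fin (κ (Sum.inl (e, r))))
    (δ : Fin l ≃ Σ s : Places κ, Fin (mult s.1)) : Superpos k l → Places κ
  | Sum.inl j => placeOf j.1 (ε j.1 j.2)
  | Sum.inr i => (δ i).1

theorem isPlacement_placement {κ : PointType E R → ℕ}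
    (ε : ∀ e, Fin (k e) ≃ Σ r, Fin (κ (Sum.inl (e, r))))
    (δ : Fin l ≃ Σ s : Places κ, Fin (mult s.1)) :
    IsPlacement (fun s : Places κ => s.1) (placement ε δ) where
  card_base e s := by
    rcases s with ⟨⟨e', r⟩ | r, a⟩
    · by_cases h : e' = e
      · subst h
        have h1 : ∀ i, placement ε δ (Sum.inl ⟨e', i⟩) = ⟨Sum.inl (e', r), a⟩ ↔
            i = (ε e').symm ⟨r, a⟩ := fun i => by
          rw [Equiv.eq_symm_apply]
          exact placeOf_injective e'
            |>.eq_iff (a := ε e' i) (b := (⟨r, a⟩ : Σ r, Fin (κ (Sum.inl (e', r)))))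
        simp only [h1]
        simp [base]
      · have h1 : ∀ i, placement ε δ (Sum.inl ⟨e, i⟩) ≠ ⟨Sum.inl (e', r), a⟩ := fun i hi => by
          have h3 := congrArg Sigma.fst hi
          simp only [placement, placeOf, Sum.inl.injEq, Prod.mk.injEq] at h3
          exact h h3.1.symm
        simp [h1, base, h]
    · have h1 : ∀ i, placement ε δ (Sum.inl ⟨e, i⟩) ≠ ⟨Sum.inr r, a⟩ := fun i hi => by
        have h3 := congrArg Sigma.fst hi
        simp [placement, placeOf] at h3
      simp [h1, base]
  card_mult s := by
    refine (Nat.card_congr ((δ.subtypeEquiv (q := fun x => x.1 = s) fun i => Iff.rfl).trans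
      (Equiv.sigmaSubtype s))).trans ?_
    rw [Nat.card_eq_fintype_card, Fintype.card_fin]

theorem exists_placement [Fintype E] {κ : PointType E R → ℕ} (h : IsCompatible k l κ) :
    Nonempty ((∀ e, Fin (k e) ≃ Σ r, Fin (κ (Sum.inl (e, r)))) ×
      (Fin l ≃ Σ s : Places κ, Fin (mult s.1))) := by
  refine ⟨fun e => Fintype.equivOfCardEq ?_, Fintype.equivOfCardEq ?_⟩
  · simp [h.1]
  · rw [Fintype.card_fin, Fintype.card_sigma, ← h.2]
    simp only [Fintype.card_fin]
    rw [Fintype.sum_sigma]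
    simp

/-- The points of a superposition have types. -/
theorem exists_isPlacement {X : Type} (m : Superpos k l → X)
    (hm : Injective fun s => m (Sum.inl s)) (hl : l ≤ R) :
    ∃ q : Set.range m → PointType E R, IsPlacement q (Set.rangeFactorization m) := by
  classical
  let n : Set.range m → ℕ := fun p => Nat.card {i : Fin l // m (Sum.inr i) = p}
  have hn : ∀ p, n p ≤ R := fun p => (Nat.card_le_card_of_injective _
    Subtype.val_injective).trans (by simpa using hl)
  have hn0 : ∀ p : Set.range m, (¬ ∃ s, m (Sum.inl s) = p) → n p ≠ 0 := fun p hp => by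
    obtain ⟨p, j, rfl⟩ := p
    rcases j with s | i
    · exact absurd ⟨s, rfl⟩ hp
    · have : Nonempty {i' : Fin l // m (Sum.inr i') = m (Sum.inr i)} := ⟨⟨i, rfl⟩⟩
      exact Nat.card_pos.ne'
  let q : Set.range m → PointType E R := fun p =>
    if h : ∃ s, m (Sum.inl s) = p then Sum.inl (h.choose.1, ⟨n p, Nat.lt_succ_of_le (hn p)⟩)
    else Sum.inr ⟨n p - 1, by have := hn p; have := hn0 p h; omega⟩
  have hfac : ∀ j p, Set.rangeFactorization m j = p ↔ m j = p := fun j p => Subtype.ext_iff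
  refine ⟨q, fun e p => ?_, fun p => ?_⟩
  · simp only [hfac]
    by_cases h : ∃ s, m (Sum.inl s) = p
    · have hq : base (q p) = some h.choose.1 := by simp only [q, dif_pos h, base]
      have hs := h.choose_spec
      generalize h.choose = s at hq hs
      obtain ⟨e', a⟩ := s
      have h1 : ∀ i, m (Sum.inl ⟨e, i⟩) = p ↔ (⟨e, i⟩ : Σ e, Fin (k e)) = ⟨e', a⟩ := fun i => by
        rw [← hs]
        exact hm.eq_iff
      simp only [h1, hq]
      by_cases he : e' = e
      · subst he
        simp
      · have h2 : ∀ i, (⟨e, i⟩ : Σ e, Fin (k e)) ≠ ⟨e', a⟩ := fun i hi =>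
          he (congrArg Sigma.fst hi).symm
        simp [h2, he]
    · have hq : base (q p) = none := by simp only [q, dif_neg h, base]
      have h1 : ∀ i, m (Sum.inl ⟨e, i⟩) ≠ p := fun i hi => h ⟨_, hi⟩
      simp [hq, h1]
  · simp only [hfac]
    by_cases h : ∃ s, m (Sum.inl s) = p
    · simp only [q, dif_pos h, mult, n]
    · simp only [q, dif_neg h, mult]
      exact (Nat.succ_pred_eq_of_ne_zero (hn0 p h)).symm

end Superposition

namespace GVar

section Reindex

variable {E₁ E : Type} [Fintype E₁] [Fintype E] {M : QPVar}

/-- The class of a space of labelled configurations depends only on the isomorphism classes of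
the varieties of labels that occur. -/
theorem quotientRingHom_conf_reindex {ι : E₁ → E} (hι : Injective ι) {k : E → ℕ}
    (hk : ∀ e, k e ≠ 0 → ∃ e₁, ι e₁ = e) {W₁ : E₁ → GVar} {W : E → GVar}
    (hW : ∀ e, GVar.Iso (W₁ e) (W (ι e))) :
    quotientRingHom (conf M W₁ fun e => k (ι e)).cls = quotientRingHom (conf M W k).cls := by
  choose γ ψ hψ hψ' hs using hW
  have horb : ∀ e (x x' : (W (ι e)).X), (W (ι e)).Orb x x' ↔
      (W₁ e).Orb ((ψ e).symm x) ((ψ e).symm x') := fun e x x' => by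
    constructor
    · rintro ⟨g, rfl⟩
      refine ⟨(γ e).symm g, (ψ e).injective ?_⟩
      rw [hs, MulEquiv.apply_symm_apply, Equiv.apply_symm_apply, Equiv.apply_symm_apply]
    · rintro ⟨g, h⟩
      refine ⟨γ e g, ?_⟩
      rw [← (ψ e).apply_symm_apply x, ← hs, h, Equiv.apply_symm_apply]
  have hk' : ∀ s : Σ e, Fin (k e), ∃ s₁ : Σ e, Fin (k (ι e)),
      (⟨ι s₁.1, s₁.2⟩ : Σ e, Fin (k e)) = s := by
    rintro ⟨e, i⟩
    obtain ⟨e₁, rfl⟩ := hk e i.pos.ne'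
    exact ⟨⟨e₁, i⟩, rfl⟩
  have hinj : Injective
      fun s₁ : Σ e, Fin (k (ι e)) => (⟨ι s₁.1, s₁.2⟩ : Σ e, Fin (k e)) := by
    rintro ⟨e, i⟩ ⟨e', i'⟩ h
    obtain rfl : e = e' := hι (congrArg Sigma.fst h)
    simpa using h
  have hL : ∀ s : Σ e, Fin (k e), ∃ L : (conf M W₁ fun e => k (ι e)).X → (W s.1).X,
      IsRegular L ∧ ∀ s₁ : Σ e, Fin (k (ι e)), (⟨ι s₁.1, s₁.2⟩ : Σ e, Fin (k e)) = s →
        ∀ y, HEq (L y) (ψ s₁.1 (clab y s₁.1 s₁.2)) := by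
    intro s
    obtain ⟨s₁, rfl⟩ := hk' s
    refine ⟨fun y => ψ s₁.1 (clab y s₁.1 s₁.2), (hψ _).comp (isRegular_clab _ _), ?_⟩
    intro s₂ h y
    rw [hinj h]
  choose p hp using hk'
  choose L hLr hL using hL
  let f : (conf M W k).X → (conf M W₁ fun e => k (ι e)).X := fun x =>
    confMk (fun s => cpos x ⟨ι s.1, s.2⟩) (fun e i => (ψ e).symm (clab x (ι e) i))
      ((cpos_injective x).comp hinj)
  let g : (conf M W₁ fun e => k (ι e)).X → (conf M W k).X := fun y =>
    confMk (fun s => cpos y (p s)) (fun e i => L ⟨e, i⟩ y)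
      ((cpos_injective y).comp fun s s' h => by rw [← hp s, ← hp s', h])
  have hfp : ∀ x s, cpos (f x) s = cpos x ⟨ι s.1, s.2⟩ := fun x s => cpos_mk _ _ _ _
  have hfl : ∀ x e i, clab (f x) e i = (ψ e).symm (clab x (ι e) i) := fun x e i =>
    clab_mk _ _ _ _ _
  symm
  have hf : IsRegular f := isRegular_confMk
    (p := fun x (s : Σ e, Fin (k (ι e))) => cpos x ⟨ι s.1, s.2⟩)
    (w := fun x e i => (ψ e).symm (clab x (ι e) i)) (fun s => isRegular_cpos ⟨ι s.1, s.2⟩)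
    (fun e i => (hψ' e).comp (isRegular_clab (ι e) i)) _
  have hg : IsRegular g := isRegular_confMk (p := fun y s => cpos y (p s))
    (w := fun y e i => L ⟨e, i⟩ y) (fun s => isRegular_cpos (p s)) (fun e i => hLr ⟨e, i⟩) _
  refine quotientRingHom_cls_eq (A := conf M W k) (B := conf M W₁ fun e => k (ι e)) hf hg
    (fun x => conf_ext (fun s => ?_) fun e i => ?_)
    (fun y => conf_ext (fun s => ?_) fun e i => ?_) fun x x' => ?_
  · refine (cpos_mk _ _ _ _).trans ((hfp _ _).trans ?_)
    rw [hp]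
  · refine (clab_mk _ _ _ _ _).trans ?_
    have h1 := hL ⟨e, i⟩ (p ⟨e, i⟩) (hp _) (f x)
    rw [hfl, Equiv.apply_symm_apply] at h1
    have h2 : ∀ s : Σ e, Fin (k e), s = ⟨e, i⟩ → HEq (clab x s.1 s.2) (clab x e i) := by
      rintro s rfl
      rfl
    exact eq_of_heq (h1.trans (h2 _ (hp _)))
  · refine (hfp _ _).trans ((cpos_mk _ _ _ _).trans ?_)
    rw [hinj (hp ⟨ι s.1, s.2⟩)]
  · refine (hfl _ _ _).trans ?_
    rw [Equiv.symm_apply_eq]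
    exact (clab_mk _ _ _ _ _).trans (eq_of_heq (hL ⟨ι e, i⟩ ⟨e, i⟩ rfl y))
  · rw [orb_conf, orb_conf]
    constructor
    · rintro ⟨σ, h1, h2⟩
      refine ⟨fun e => σ (ι e), fun e i => ?_, fun e i => ?_⟩
      · rw [hfp, hfp]
        exact h1 _ _
      · rw [hfl, hfl]
        exact (horb _ _ _).1 (h2 _ _)
    · rintro ⟨σ, h1, h2⟩
      have h3 : ∀ e, ∃ τ : Perm (Fin (k e)),
          (∀ i, cpos x ⟨e, τ i⟩ = cpos x' ⟨e, i⟩) ∧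
            ∀ i, (W e).Orb (clab x e (τ i)) (clab x' e i) := by
        intro e
        rcases Nat.eq_zero_or_pos (k e) with h0 | h0
        · exact ⟨1, fun i => absurd i.pos h0.not_gt, fun i => absurd i.pos h0.not_gt⟩
        · obtain ⟨e₁, rfl⟩ := hk e h0.ne'
          refine ⟨σ e₁, fun i => ?_, fun i => ?_⟩
          · have h4 := h1 e₁ i
            rwa [hfp, hfp] at h4
          · have h4 := h2 e₁ i
            rw [hfl, hfl] at h4
            exact (horb _ _ _).2 h4
      choose τ h4 h5 using h3
      exact ⟨τ, h4, h5⟩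

end Reindex

end GVar

open PointType

namespace GVar

/-! ### Superpositions of a configuration and a family of points -/

section TypeLabel

variable {E : Type} {R : ℕ} {W : E → GVar} {V : GVar}

/-- The variety of labels of the points of a given type: the label in the configuration together
with the labels of the members of the family at the point. -/
def typeLabel (W : E → GVar) (V : GVar) : PointType E R → GVar
  | Sum.inl q => (W q.1).prod (V.power q.2)
  | Sum.inr r => V.power (r + 1)

/-- The labels of the members of the family at a point. -/
def famLabel : ∀ q : PointType E R, (typeLabel W V q).X → Fin (mult q) → V.X
  | Sum.inl q, w, t => entry (pr₂ (A := W q.1) (B := V.power q.2) w) t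
  | Sum.inr _, w, t => entry (A := V) w t

theorem isRegular_famLabel (q : PointType E R) (t : Fin (mult q)) :
    IsRegular fun w : (typeLabel W V q).X => famLabel q w t := by
  rcases q with q | r
  · exact (isRegular_entry (A := V) t).comp (isRegular_pr₂ (A := W q.1) (B := V.power q.2))
  · exact isRegular_entry (A := V) t

/-- The label with given components. -/
def typeLabelMk : ∀ q : PointType E R, (∀ e, base q = some e → (W e).X) → (Fin (mult q) → V.X) →
    (typeLabel W V q).X
  | Sum.inl q, w, v => pair (A := W q.1) (B := V.power q.2) (w q.1 rfl) (powMk v)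
  | Sum.inr _, _, v => powMk (A := V) v

theorem famLabel_typeLabelMk (q : PointType E R) (w : ∀ e, base q = some e → (W e).X)
    (v : Fin (mult q) → V.X) (t : Fin (mult q)) : famLabel q (typeLabelMk q w v) t = v t := by
  rcases q with q | r
  · exact (congrArg (fun z => entry (A := V) z t)
      (pr₂_pair (A := W q.1) (B := V.power q.2) _ _)).trans (entry_mk _ _)
  · exact entry_mk (A := V) _ _

theorem isRegular_typeLabelMk {T : QPVar} (q : PointType E R)
    {w : T → ∀ e, base q = some e → (W e).X} {v : T → Fin (mult q) → V.X}
    (hw : ∀ e h, IsRegular fun t => w t e h) (hv : ∀ i, IsRegular fun t => v t i) :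
    IsRegular fun t => typeLabelMk (W := W) q (w t) (v t) := by
  rcases q with q | r
  · exact isRegular_pair (A := W q.1) (B := V.power q.2) (hw q.1 rfl) (isRegular_powMk hv)
  · exact isRegular_powMk (A := V) hv

theorem Orb.famLabel {q : PointType E R} {w w' : (typeLabel W V q).X}
    (h : (typeLabel W V q).Orb w w') : ∃ τ : Perm (Fin (mult q)),
      ∀ t, V.Orb (famLabel q w (τ t)) (famLabel q w' t) := by
  rcases q with q | r
  · exact orb_power.1 (orb_prod.1 h).2
  · exact orb_power.1 h

theorem orb_typeLabel_inl {q : E × Fin (R + 1)}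
    {w w' : (typeLabel W V (Sum.inl q : PointType E R)).X}
    (h : (W q.1).Orb (pr₁ (A := W q.1) (B := V.power q.2) w) (pr₁ (A := W q.1) (B := V.power q.2) w'))
    (τ : Perm (Fin (mult (Sum.inl q : PointType E R))))
    (hτ : ∀ t, V.Orb (GVar.famLabel _ w (τ t)) (GVar.famLabel _ w' t)) :
    (typeLabel W V (Sum.inl q : PointType E R)).Orb w w' :=
  orb_prod.2 ⟨h, orb_power.2 ⟨τ, hτ⟩⟩

theorem orb_typeLabel_inr {r : Fin R} {w w' : (typeLabel W V (Sum.inr r : PointType E R)).X}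
    (τ : Perm (Fin (mult (Sum.inr r : PointType E R))))
    (hτ : ∀ t, V.Orb (GVar.famLabel _ w (τ t)) (GVar.famLabel _ w' t)) :
    (typeLabel W V (Sum.inr r : PointType E R)).Orb w w' :=
  orb_power.2 ⟨τ, hτ⟩

end TypeLabel

section Superposition

variable {E : Type} [Fintype E] {R : ℕ} {M : QPVar} {W : E → GVar} {V : GVar} {k : E → ℕ} {l : ℕ}

/-- The space of pairs of a configuration of distinct points of `M` with labels in the `W_e` and a
family of `l` points of `M` with labels in `V`. -/
abbrev super (M : QPVar) (W : E → GVar) (V : GVar) (k : E → ℕ) (l : ℕ) : GVar :=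
  (conf M W k).prod ((M.triv.prod V).power l)

/-- The points of `M` of a superposition. -/
def spos (x : (super M W V k l).X) : Superpos k l → M
  | Sum.inl s => cpos (pr₁ x) s
  | Sum.inr i => pr₁ (A := M.triv) (B := V) (entry (pr₂ x) i)

/-- The labels of the family. -/
def flab (x : (super M W V k l).X) (i : Fin l) : V.X :=
  pr₂ (A := M.triv) (B := V) (entry (pr₂ x) i)

theorem isRegular_spos (j : Superpos k l) : IsRegular fun x : (super M W V k l).X => spos x j := by
  rcases j with s | i
  · exact (isRegular_cpos s).comp isRegular_pr₁
  · exact (isRegular_pr₁ (A := M.triv)).comp ((isRegular_entry i).comp isRegular_pr₂)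

theorem isRegular_flab (i : Fin l) : IsRegular fun x : (super M W V k l).X => flab x i :=
  (isRegular_pr₂ (A := M.triv)).comp ((isRegular_entry i).comp isRegular_pr₂)

theorem super_ext {x y : (super M W V k l).X} (h : ∀ j, spos x j = spos y j)
    (h' : ∀ e i, clab (pr₁ x) e i = clab (pr₁ y) e i) (h'' : ∀ i, flab x i = flab y i) : x = y :=
  prod_ext (conf_ext (fun s => h (Sum.inl s)) h')
    (pow_ext fun i => prod_ext (A := M.triv) (h (Sum.inr i)) (h'' i))

theorem orb_super {x x' : (super M W V k l).X} : (super M W V k l).Orb x x' ↔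
    ∃ (σ : ∀ e, Perm (Fin (k e))) (τ : Perm (Fin l)),
      (∀ j, spos x (blockPerm σ τ j) = spos x' j) ∧
      (∀ e i, (W e).Orb (clab (pr₁ x) e (σ e i)) (clab (pr₁ x') e i)) ∧
      ∀ i, V.Orb (flab x (τ i)) (flab x' i) := by
  refine orb_prod.trans ?_
  rw [orb_conf, orb_power]
  constructor
  · rintro ⟨⟨σ, h1, h2⟩, τ, h3⟩
    refine ⟨σ, τ, ?_, h2, fun i => (orb_prod.1 (h3 i)).2⟩
    rintro (⟨e, i⟩ | i)
    · exact h1 e i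
    · exact orb_triv.1 (orb_prod.1 (h3 i)).1
  · rintro ⟨σ, τ, h1, h2, h3⟩
    exact ⟨⟨σ, fun e i => h1 (Sum.inl ⟨e, i⟩), h2⟩, τ,
      fun i => orb_prod.2 ⟨orb_triv.2 (h1 (Sum.inr i)), h3 i⟩⟩

/-- The permutation of the indices given by an element of the group. -/
def superPerm : (super M W V k l).G →* Perm (Superpos k l) :=
  ((Equiv.Perm.sumCongrHom _ _).comp
    (((Equiv.Perm.sigmaCongrRightHom _).comp (MonoidHom.pi fun e =>
      (SemidirectProduct.rightHom : Wreath (M.triv.prod (W e)).G (k e) →* _).comp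
        (Pi.evalMonoidHom (fun e => Wreath (M.triv.prod (W e)).G (k e)) e))).prodMap
    (SemidirectProduct.rightHom : Wreath (M.triv.prod V).G l →* _))).comp
      (prodG (A := conf M W k) (B := (M.triv.prod V).power l)).toMonoidHom

theorem spos_smul (g : (super M W V k l).G) (x : (super M W V k l).X) (j : Superpos k l) :
    spos (g • x) j = spos x ((superPerm g)⁻¹ j) := by
  rcases j with s | i
  · refine (congrArg (fun z => cpos z s) (pr₁_smul g x)).trans ?_
    exact lpos_smul _ _ _
  · refine (congrArg (fun z => pr₁ (A := M.triv) (B := V) (entry z i)) (pr₂_smul g x)).trans ?_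
    refine (congrArg (pr₁ (A := M.triv) (B := V)) (entry_smul _ _ i)).trans ?_
    exact pr₁_smul _ _

theorem exists_superPerm_inv_eq (σ : ∀ e, Perm (Fin (k e))) (τ : Perm (Fin l)) :
    ∃ g : (super M W V k l).G, (superPerm g)⁻¹ = blockPerm σ τ := by
  refine ⟨prodG.symm ((fun e => ⟨1, (σ e)⁻¹⟩ :
    ∀ e, Wreath (M.triv.prod (W e)).G (k e)), powG.symm ⟨1, τ⁻¹⟩), ?_⟩
  ext j
  rcases j with s | i <;> rfl

theorem exists_blockPerm_eq (g : (super M W V k l).G) :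
    ∃ (σ : ∀ e, Perm (Fin (k e))) (τ : Perm (Fin l)),
      (superPerm g)⁻¹ = blockPerm σ τ := by
  refine ⟨fun e => ((show ∀ e, Wreath (M.triv.prod (W e)).G (k e) from
    (prodG g).1) e).right⁻¹, (powG (prodG g).2).right⁻¹, ?_⟩
  ext j
  rcases j with s | i <;> rfl

section Stratum

variable {κ : PointType E R → ℕ} (ε : ∀ e, Fin (k e) ≃ Σ r, Fin (κ (Sum.inl (e, r))))
  (δ : Fin l ≃ Σ s : Places κ, Fin (mult s.1))

/-- The label in the configuration of a point of a given type. -/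
def baseLab (b : (conf M (typeLabel W V) κ).X) (e : E) (x : Σ r, Fin (κ (Sum.inl (e, r)))) :
    (W e).X :=
  pr₁ (A := W e) (B := V.power x.1) (clab b (Sum.inl (e, x.1)) x.2)

/-- The labels of the members of the family at the points of given types. -/
def famLab (b : (conf M (typeLabel W V) κ).X) (u : Σ s : Places κ, Fin (mult s.1)) : V.X :=
  famLabel u.1.1 (clab b u.1.1 u.1.2) u.2

omit [Fintype E] in
theorem placement_inl_injective : Injective fun s => placement ε δ (Sum.inl s) := by
  rintro ⟨e, i⟩ ⟨e', i'⟩ h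
  obtain rfl : e = e' := Option.some.inj (congrArg (fun s : Places κ => base s.1) h)
  have h' := (ε e).injective (placeOf_injective e h)
  exact congrArg _ h'

/-- The superposition with given points of each type. -/
def superOf (b : (conf M (typeLabel W V) κ).X) : (super M W V k l).X :=
  pair (confMk (fun s => cpos b (placement ε δ (Sum.inl s))) (fun e i => baseLab b e (ε e i))
    ((cpos_injective b).comp (placement_inl_injective ε δ)))
    (powMk fun i => pair (A := M.triv) (cpos b (placement ε δ (Sum.inr i))) (famLab b (δ i)))

theorem spos_superOf (b : (conf M (typeLabel W V) κ).X) (j : Superpos k l) :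
    spos (superOf ε δ b) j = cpos b (placement ε δ j) := by
  rcases j with s | i
  · refine (congrArg (fun z => cpos z s) (pr₁_pair _ _)).trans ?_
    exact cpos_mk _ _ _ _
  · refine (congrArg (fun z => pr₁ (A := M.triv) (B := V) (entry z i)) (pr₂_pair _ _)).trans ?_
    refine (congrArg (pr₁ (A := M.triv) (B := V)) (entry_mk _ i)).trans ?_
    exact pr₁_pair (A := M.triv) _ _

theorem clab_superOf (b : (conf M (typeLabel W V) κ).X) (e : E) (i : Fin (k e)) :
    clab (pr₁ (superOf ε δ b)) e i = baseLab b e (ε e i) := by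
  refine (congrArg (fun z => clab z e i) (pr₁_pair _ _)).trans ?_
  exact clab_mk _ _ _ _ _

theorem flab_superOf (b : (conf M (typeLabel W V) κ).X) (i : Fin l) :
    flab (superOf ε δ b) i = famLab b (δ i) := by
  refine (congrArg (fun z => pr₂ (A := M.triv) (B := V) (entry z i)) (pr₂_pair _ _)).trans ?_
  refine (congrArg (pr₂ (A := M.triv) (B := V)) (entry_mk _ i)).trans ?_
  exact pr₂_pair (A := M.triv) _ _

theorem isRegular_superOf : IsRegular (superOf (M := M) (W := W) (V := V) ε δ) := by
  refine isRegular_pair (isRegular_confMk (fun s => isRegular_cpos _) (fun e i => ?_) _)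
    (isRegular_powMk fun i => isRegular_pair (A := M.triv) (isRegular_cpos _) ?_)
  · exact (isRegular_pr₁ (A := W e)).comp (isRegular_clab _ _)
  · exact (isRegular_famLabel _ _).comp (isRegular_clab _ _)

theorem superOf_injective : Injective (superOf (M := M) (W := W) (V := V) ε δ) := by
  intro b b' h
  have h1 : ∀ s, cpos b s = cpos b' s := fun s => by
    obtain ⟨j, rfl⟩ := (isPlacement_placement ε δ).surjective s
    rw [← spos_superOf, ← spos_superOf, h]
  have h2 : ∀ e x, baseLab b e x = baseLab b' e x := fun e x => by
    obtain ⟨i, rfl⟩ := (ε e).surjective x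
    rw [← clab_superOf ε δ, ← clab_superOf ε δ, h]
  have h3 : ∀ u, famLab b u = famLab b' u := fun u => by
    obtain ⟨i, rfl⟩ := δ.surjective u
    rw [← flab_superOf ε δ, ← flab_superOf ε δ, h]
  refine conf_ext h1 fun q i => ?_
  rcases q with ⟨e, r⟩ | r
  · exact prod_ext (A := W e) (B := V.power r) (h2 e ⟨r, i⟩)
      (pow_ext fun t => h3 ⟨⟨Sum.inl (e, r), i⟩, t⟩)
  · exact pow_ext (A := V) fun t => h3 ⟨⟨Sum.inr r, i⟩, t⟩

theorem orb_superOf_of_orb {b b' : (conf M (typeLabel W V) κ).X}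
    (h : (conf M (typeLabel W V) κ).Orb b b') :
    (super M W V k l).Orb (superOf ε δ b) (superOf ε δ b') := by
  obtain ⟨σ, h1, h2⟩ := orb_conf.1 h
  choose τ hτ using fun s : Places κ => (h2 s.1 s.2).famLabel
  let F : (Σ s : Places κ, Fin (mult s.1)) → Σ s : Places κ, Fin (mult s.1) :=
    fun u => ⟨⟨u.1.1, σ u.1.1 u.1.2⟩, τ u.1 u.2⟩
  have hF : Injective F := by
    rintro ⟨⟨q, i⟩, t⟩ ⟨⟨q', i'⟩, t'⟩ hu
    obtain rfl : q = q' := congrArg (fun u => u.1.1) hu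
    have h3 := congrArg Sigma.fst hu
    obtain rfl : i = i' := (σ q).injective (eq_of_heq (Sigma.mk.inj h3).2)
    obtain rfl : t = t' := (τ ⟨q, i⟩).injective (eq_of_heq (Sigma.mk.inj hu).2)
    rfl
  let Fe := Equiv.ofBijective F (Finite.injective_iff_bijective.1 hF)
  let G : ∀ e, (Σ r, Fin (κ (Sum.inl (e, r)))) ≃ Σ r, Fin (κ (Sum.inl (e, r))) := fun e =>
    Equiv.sigmaCongrRight fun r => σ (Sum.inl (e, r))
  refine orb_super.2 ⟨fun e => (ε e).trans ((G e).trans (ε e).symm), δ.trans (Fe.trans δ.symm),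
    ?_, fun e i => ?_, fun i => ?_⟩
  · rintro (⟨e, i⟩ | i)
    · rw [spos_superOf, spos_superOf]
      have h4 : placement ε δ (blockPerm (fun e => (ε e).trans ((G e).trans (ε e).symm))
          (δ.trans (Fe.trans δ.symm)) (Sum.inl ⟨e, i⟩)) = placeOf e (G e (ε e i)) :=
        congrArg (placeOf e) ((ε e).apply_symm_apply _)
      rw [h4]
      exact h1 (Sum.inl (e, (ε e i).1)) (ε e i).2
    · rw [spos_superOf, spos_superOf]
      have h4 : placement ε δ (blockPerm (fun e => (ε e).trans ((G e).trans (ε e).symm))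
          (δ.trans (Fe.trans δ.symm)) (Sum.inr i)) = (F (δ i)).1 :=
        congrArg Sigma.fst (δ.apply_symm_apply _)
      rw [h4]
      exact h1 (δ i).1.1 (δ i).1.2
  · rw [clab_superOf, clab_superOf]
    have h4 : ε e (((ε e).trans ((G e).trans (ε e).symm)) i) = G e (ε e i) :=
      (ε e).apply_symm_apply _
    rw [h4]
    exact (orb_prod.1 (h2 (Sum.inl (e, (ε e i).1)) (ε e i).2)).1
  · rw [flab_superOf, flab_superOf]
    have h4 : δ ((δ.trans (Fe.trans δ.symm)) i) = F (δ i) := δ.apply_symm_apply _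
    rw [h4]
    exact hτ (δ i).1 (δ i).2

/-- An element of the group that relates two superpositions preserves the coincidences of indices, so
it permutes the points of the configurations. -/
theorem orb_of_orb_superOf {b b' : (conf M (typeLabel W V) κ).X}
    (h : (super M W V k l).Orb (superOf ε δ b) (superOf ε δ b')) :
    (conf M (typeLabel W V) κ).Orb b b' := by
  obtain ⟨σ, τ, h1, h2, h3⟩ := orb_super.1 h
  have hp := isPlacement_placement ε δ
  have h1' : ∀ j, cpos b (placement ε δ (blockPerm σ τ j)) = cpos b' (placement ε δ j) :=
    fun j => by rw [← spos_superOf, ← spos_superOf, h1]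
  obtain ⟨θ, hθ, hθq⟩ := hp.exists_equiv (hp.comp_blockPerm σ τ) fun j j' => by
    rw [← (cpos_injective b').eq_iff, ← h1', ← h1', (cpos_injective b).eq_iff]
  have hθ' : ∀ q (i : Fin (κ q)), ∃ i', θ ⟨q, i⟩ = ⟨q, i'⟩ := fun q i => by
    have h4 := hθq ⟨q, i⟩
    generalize θ ⟨q, i⟩ = s' at h4
    obtain ⟨q', i'⟩ := s'
    obtain rfl : q' = q := h4
    exact ⟨i', rfl⟩
  choose ρ hρ using hθ'
  have hρi : ∀ q, Injective (ρ q) := fun q i i' hi => by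
    have h4 : θ ⟨q, i⟩ = θ ⟨q, i'⟩ :=
      (hρ q i).trans ((congrArg (Sigma.mk q) hi).trans (hρ q i').symm)
    exact eq_of_heq (Sigma.mk.inj (θ.injective h4)).2
  let ω : ∀ q, Perm (Fin (κ q)) := fun q =>
    Equiv.ofBijective _ (Finite.injective_iff_bijective.1 (hρi q))
  have hω : ∀ s : Places κ, θ s = ⟨s.1, ω s.1 s.2⟩ := fun s => hρ s.1 s.2
  have h5 : ∀ s : Places κ, cpos b (θ s) = cpos b' s := fun s => by
    obtain ⟨j, rfl⟩ := hp.surjective s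
    rw [hθ, h1']
  have h6 : ∀ (s : Places κ) (t : Fin (mult s.1)), ∃ t' : Fin (mult s.1),
      δ (τ (δ.symm ⟨s, t⟩)) = ⟨⟨s.1, ω s.1 s.2⟩, t'⟩ := fun s t => by
    have h7 : (δ (τ (δ.symm ⟨s, t⟩))).1 = ⟨s.1, ω s.1 s.2⟩ := by
      rw [← hω]
      have h8 := hθ (Sum.inr (δ.symm ⟨s, t⟩))
      have h9 : placement ε δ (Sum.inr (δ.symm ⟨s, t⟩)) = s :=
        congrArg Sigma.fst (δ.apply_symm_apply _)
      rw [h9] at h8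
      exact h8.symm
    generalize δ (τ (δ.symm ⟨s, t⟩)) = u at h7
    obtain ⟨s', t'⟩ := u
    obtain rfl : s' = ⟨s.1, ω s.1 s.2⟩ := h7
    exact ⟨t', rfl⟩
  choose η hη using h6
  have hηi : ∀ s, Injective (η s) := fun s t t' ht => by
    have h7 : δ (τ (δ.symm ⟨s, t⟩)) = δ (τ (δ.symm ⟨s, t'⟩)) := by rw [hη, hη, ht]
    exact eq_of_heq (Sigma.mk.inj (δ.symm.injective (τ.injective (δ.injective h7)))).2
  let χ : ∀ s : Places κ, Perm (Fin (mult s.1)) := fun s =>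
    Equiv.ofBijective _ (Finite.injective_iff_bijective.1 (hηi s))
  have hfam : ∀ (q : PointType E R) (i : Fin (κ q)) (t : Fin (mult q)),
      V.Orb (famLabel q (clab b q (ω q i)) (χ ⟨q, i⟩ t)) (famLabel q (clab b' q i) t) :=
    fun q i t => by
      have h7 := h3 (δ.symm ⟨⟨q, i⟩, t⟩)
      rw [flab_superOf, flab_superOf, Equiv.apply_symm_apply, hη] at h7
      exact h7
  refine orb_conf.2 ⟨ω, fun q i => ?_, fun q i => ?_⟩
  · rw [← h5]
    exact congrArg (cpos b) (hω ⟨q, i⟩).symm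
  · rcases q with ⟨e, r⟩ | r
    · refine orb_typeLabel_inl ?_ (χ ⟨_, i⟩) (hfam _ i)
      have h7 := h2 e ((ε e).symm ⟨r, i⟩)
      rw [clab_superOf, clab_superOf, Equiv.apply_symm_apply] at h7
      have h8 : ε e (σ e ((ε e).symm ⟨r, i⟩)) = ⟨r, ω (Sum.inl (e, r)) i⟩ := by
        apply placeOf_injective e
        have h9 := hθ (Sum.inl ⟨e, (ε e).symm ⟨r, i⟩⟩)
        have h10 : placement ε δ (Sum.inl ⟨e, (ε e).symm ⟨r, i⟩⟩) = ⟨Sum.inl (e, r), i⟩ :=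
          congrArg (placeOf e) ((ε e).apply_symm_apply _)
        rw [h10, hω] at h9
        exact h9.symm
      rw [h8] at h7
      exact h7
    · exact orb_typeLabel_inr (χ ⟨_, i⟩) (hfam _ i)

/-- The points of the stratum are parametrized by the configurations of points of given types. -/
theorem exists_inverse_superOf (h : IsLocallyClosed {x : (super M W V k l).X |
      (fun j j' => spos x j = spos x j') = fun j j' => placement ε δ j = placement ε δ j'}) :
    ∃ ψ : (super M W V k l).X.sub _ h → (conf M (typeLabel W V) κ).X,
      IsRegular ψ ∧ ∀ z, superOf ε δ (ψ z) = incl z := by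
  have hp := isPlacement_placement ε δ
  choose d hd using hp.surjective
  have hz : ∀ (z : (super M W V k l).X.sub _ h) j j',
      spos (incl z) j = spos (incl z) j' ↔ placement ε δ j = placement ε δ j' := fun z j j' => by
    have h1 : (fun j j' => spos (incl z) j = spos (incl z) j') =
      fun j j' => placement ε δ j = placement ε δ j' := incl_mem z
    exact iff_of_eq (congrFun (congrFun h1 j) j')
  have hbase : ∀ (q : PointType E R) (i : Fin (κ q)), ∃ w : (super M W V k l).X →
      ∀ e, base q = some e → (W e).X, (∀ e h, IsRegular fun x => w x e h) ∧
        ∀ (e : E) (r : Fin (R + 1)) (hq : q = Sum.inl (e, r)) x,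
          w x e (by rw [hq]; rfl) = clab (pr₁ x) e ((ε e).symm ⟨r, Fin.cast (by rw [hq]) i⟩) := by
    rintro (⟨e, r⟩ | r) i
    · refine ⟨fun x e' he => cast (congrArg (fun e => ((W e).X : Type)) (Option.some.inj he))
        (clab (pr₁ x) e ((ε e).symm ⟨r, i⟩)), fun e' he => ?_, fun e' r' hq x => ?_⟩
      · obtain rfl : e = e' := Option.some.inj he
        exact (isRegular_clab e _).comp isRegular_pr₁
      · obtain ⟨rfl, rfl⟩ : e = e' ∧ r = r' := by simpa using hq
        rfl
    · exact ⟨fun _ e he => by simp [base] at he, fun e he => by simp [base] at he,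
        fun e r hq => by simp at hq⟩
  choose w hw hwe using hbase
  let ψ : (super M W V k l).X.sub _ h → (conf M (typeLabel W V) κ).X := fun z =>
    confMk (fun s => spos (incl z) (d s))
      (fun q i => typeLabelMk q (w q i (incl z)) fun t => flab (incl z) (δ.symm ⟨⟨q, i⟩, t⟩))
      (fun s s' hs => by rw [← hd s, ← hd s']; exact (hz z _ _).1 hs)
  refine ⟨ψ, ?_, fun z => super_ext (fun j => ?_) (fun e i => ?_) fun i => ?_⟩
  · refine isRegular_confMk (p := fun z s => spos (incl z) (d s))
      (w := fun z q i => typeLabelMk q (w q i (incl z)) fun t => flab (incl z) (δ.symm ⟨⟨q, i⟩, t⟩))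
      (fun s => (isRegular_spos _).comp isRegular_incl) (fun q i => ?_) _
    exact isRegular_typeLabelMk q (fun e he => (hw q i e he).comp isRegular_incl)
      fun t => (isRegular_flab _).comp isRegular_incl
  · rw [spos_superOf]
    exact (cpos_mk _ _ _ _).trans ((hz z _ _).2 (hd _))
  · rw [clab_superOf]
    refine (congrArg (pr₁ (A := W e) (B := V.power (ε e i).1)) (clab_mk _ _ _ _ _)).trans ?_
    refine (pr₁_pair (A := W e) (B := V.power (ε e i).1) _ _).trans ?_
    refine (hwe _ _ e (ε e i).1 rfl _).trans ?_
    exact congrArg (clab _ e) ((ε e).symm_apply_apply i)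
  · rw [flab_superOf]
    refine (congrArg (fun y => famLabel (δ i).1.1 y (δ i).2) (clab_mk _ _ _ _ _)).trans ?_
    refine (famLabel_typeLabelMk _ _ _ _).trans ?_
    exact congrArg (flab _) (δ.symm_apply_apply i)

end Stratum

end Superposition

end GVar

theorem IsPlacement.isCompatible {E : Type} [Fintype E] {R : ℕ} {k : E → ℕ} {l : ℕ}
    {κ : PointType E R → ℕ} {c : Superpos k l → Places κ}
    (h : IsPlacement (fun s : Places κ => s.1) c) : IsCompatible k l κ := by
  classical
  constructor
  · intro e
    rw [← h.card_base_eq e]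
    have h1 : {s : Places κ // base s.1 = some e} ≃ Σ r, Fin (κ (Sum.inl (e, r))) :=
      { toFun := fun s => match s with
          | ⟨⟨Sum.inl q, i⟩, hs⟩ => ⟨q.2, Fin.cast (by rw [← Option.some.inj hs]) i⟩
        invFun := fun x => ⟨placeOf e x, rfl⟩
        left_inv := by
          rintro ⟨⟨⟨e', r⟩ | r, i⟩, hs⟩
          · obtain rfl : e' = e := Option.some.inj hs
            rfl
          · simp [base] at hs
        right_inv := fun x => rfl }
    rw [Nat.card_congr h1, Nat.card_sigma]
    simp
  · rw [← h.sum_mult, Fintype.sum_sigma]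
    simp

namespace GVar

section Superposition

variable {E : Type} [Fintype E] {R : ℕ} {M : QPVar} {W : E → GVar} {V : GVar} {k : E → ℕ} {l : ℕ}

/-- The space of superpositions is stratified by the numbers of points of each type. -/
theorem quotientRingHom_super (hl : l ≤ R) (S : Finset (PointType E R → ℕ))
    (hS : ∀ κ, κ ∈ S ↔ IsCompatible k l κ) : quotientRingHom (super M W V k l).cls =
      ∑ κ ∈ S, quotientRingHom (conf M (typeLabel W V) κ).cls := by
  classical
  let _ : MulAction (super M W V k l).G (Superpos k l → Superpos k l → Prop) :=
    { smul := fun g s j j' => s ((superPerm g)⁻¹ j) ((superPerm g)⁻¹ j')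
      one_smul := fun s => by
        funext j j'
        show s ((superPerm 1)⁻¹ j) ((superPerm 1)⁻¹ j') = _
        rw [map_one, inv_one]
        rfl
      mul_smul := fun g h s => by
        funext j j'
        show s ((superPerm (g * h))⁻¹ j) ((superPerm (g * h))⁻¹ j') = _
        rw [map_mul, mul_inv_rev]
        rfl }
  let pd : ∀ o : S, (∀ e, Fin (k e) ≃ Σ r, Fin (o.1 (Sum.inl (e, r)))) ×
      (Fin l ≃ Σ s : Places o.1, Fin (mult s.1)) := fun o =>
    (exists_placement ((hS o.1).1 o.2)).some
  let c : ∀ o : S, Superpos k l → Places o.1 := fun o => placement (pd o).1 (pd o).2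
  have hc : ∀ o, IsPlacement (fun s : Places o.1 => s.1) (c o) := fun o =>
    isPlacement_placement _ _
  rw [quotientRingHom_cls_eq_sum_strata (A := super M W V k l)
    (f := fun x j j' => spos x j = spos x j')
    (fun g s s' h j j' => (show ∀ j j', s j j' → s' j j' from h) _ _) (fun g x => ?_) (fun s => ?_) (O := S)
    (fun o j j' => c o j = c o j') (fun x => ?_) (fun o o' g h => ?_)
    (fun o => conf M (typeLabel W V) o.1) (fun o => superOf (pd o).1 (pd o).2)
    (fun o => isRegular_superOf _ _) (fun o => superOf_injective _ _) (fun o b => ?_)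
    (fun o h => exists_inverse_superOf _ _ h)
    (fun o b b' => ⟨orb_superOf_of_orb _ _, orb_of_orb_superOf _ _⟩)]
  · exact Finset.sum_coe_sort S fun κ => quotientRingHom (conf M (typeLabel W V) κ).cls
  · funext j j'
    show (_ = _) = (spos x ((superPerm g)⁻¹ j) = spos x ((superPerm g)⁻¹ j'))
    rw [spos_smul, spos_smul]
  · have : {x : (super M W V k l).X | s ≤ fun j j' => spos x j = spos x j'} =
        ⋂ (j : Superpos k l) (j' : Superpos k l) (_ : s j j'), {x | spos x j = spos x j'} := by
      ext x
      simp only [Set.mem_iInter]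
      exact Iff.rfl
    rw [this]
    exact isClosed_iInter fun j => isClosed_iInter fun j' => isClosed_iInter fun _ =>
      isClosed_eq (isRegular_spos j) (isRegular_spos j')
  · obtain ⟨q, hq⟩ := exists_isPlacement (spos x) (cpos_injective (pr₁ x)) hl
    let _ : Fintype (Set.range (spos x)) := Fintype.ofFinite _
    let κ : PointType E R → ℕ := fun t => Nat.card {p // q p = t}
    let β : Set.range (spos x) ≃ Places κ := (Equiv.sigmaFiberEquiv q).symm.trans
      (Equiv.sigmaCongrRight fun t => Finite.equivFin {p // q p = t})
    have hβ : ∀ p, (β p).1 = q p := fun p => rfl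
    have hκ : IsPlacement (fun s : Places κ => s.1) fun j => β (Set.rangeFactorization (spos x) j) :=
      hq.comp_equiv β hβ
    have hκS : κ ∈ S := (hS κ).2 hκ.isCompatible
    obtain ⟨σ, τ, hστ⟩ := hκ.exists_blockPerm (hc ⟨κ, hκS⟩)
    obtain ⟨g, hg⟩ := exists_superPerm_inv_eq (M := M) (W := W) (V := V) σ τ
    refine ⟨⟨κ, hκS⟩, g, ?_⟩
    funext j j'
    show (c _ ((superPerm g)⁻¹ j) = c _ ((superPerm g)⁻¹ j')) = _
    rw [hg, hστ, hστ, β.injective.eq_iff, Subtype.ext_iff]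
    rfl
  · obtain ⟨σ, τ, hg⟩ := exists_blockPerm_eq g
    have h1 : ∀ j j', c o (blockPerm σ τ j) = c o (blockPerm σ τ j') ↔ c o' j = c o' j' :=
      fun j j' => by
        rw [← hg]
        exact iff_of_eq (congrFun (congrFun h j) j')
    obtain ⟨θ, -, hθ⟩ := ((hc o).comp_blockPerm σ τ).exists_equiv (hc o') h1
    refine Subtype.ext (funext fun q => ?_)
    have h2 : ∀ κ : PointType E R → ℕ, Nat.card {s : Places κ // s.1 = q} = κ q := fun κ => by
      rw [Nat.card_congr (Equiv.sigmaSubtype q), Nat.card_eq_fintype_card, Fintype.card_fin]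
    rw [← h2 o.1, ← h2 o'.1]
    exact Nat.card_congr (θ.subtypeEquiv fun s => by rw [hθ])
  · funext j j'
    rw [spos_superOf, spos_superOf, (cpos_injective b).eq_iff]

end Superposition

end GVar

open GVar

/-! ### Generating series of labelled configurations -/

theorem coeffSeries_mul_expandHom {R : Type*} [CommRing R] (m : ℕ) (A B : oneSeries R) (n : ℕ) :
    coeffSeries n (A * expandHom m B) = ∑ l ∈ Finset.range (n + 1) with l * (m + 1) ≤ n,
      coeffSeries (n - l * (m + 1)) A * coeffSeries l B := by
  have hinj : Set.InjOn (fun l => (n - l * (m + 1), l * (m + 1)))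
      (((Finset.range (n + 1)).filter fun l => l * (m + 1) ≤ n : Finset ℕ) : Set ℕ) :=
    fun l _ l' _ h => Nat.eq_of_mul_eq_mul_right m.succ_pos (congrArg Prod.snd h)
  have h1 : ∀ l, coeffSeries l B = coeffSeries (l * (m + 1)) (expandHom m B) := fun l => by
    rw [mul_comm, coeffSeries_expandHom_mul]
  refine (coeffSeries_mul n A (expandHom m B)).trans (Eq.trans ?_
    ((Finset.sum_image (g := fun l => (n - l * (m + 1), l * (m + 1)))
      (f := fun p => coeffSeries p.1 A * coeffSeries p.2 (expandHom m B)) hinj).trans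
      (sum_congr rfl fun l _ => congrArg _ (h1 l).symm)))
  symm
  refine Finset.sum_subset (fun p hp => ?_) fun p hp hp' => ?_
  · obtain ⟨l, hl, rfl⟩ := Finset.mem_image.1 hp
    exact mem_antidiagonal.2 (Nat.sub_add_cancel (Finset.mem_filter.1 hl).2)
  · rw [coeffSeries_expandHom_of_not_dvd, mul_zero]
    rintro ⟨l, hl⟩
    have h2 := mem_antidiagonal.1 hp
    rw [mul_comm] at hl
    refine hp' (Finset.mem_image.2 ⟨l, Finset.mem_filter.2 ⟨Finset.mem_range.2 ?_, by omega⟩, ?_⟩)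
    · have h3 : l ≤ l * (m + 1) := Nat.le_mul_of_pos_right l m.succ_pos
      omega
    · exact Prod.ext (by simp only; omega) hl.symm

section Weight

variable {E : Type} [Fintype E] {w : E → ℕ}

open Classical in
/-- The families of numbers `k_e` with `∑ k_e w_e = n`. -/
def weightSet (w : E → ℕ) (n : ℕ) : Finset (E → ℕ) :=
  (Fintype.piFinset fun _ => Finset.range (n + 1)).filter fun k => ∑ e, k e * w e = n

theorem mem_weightSet (hw : ∀ e, 0 < w e) {n : ℕ} {k : E → ℕ} :
    k ∈ weightSet w n ↔ ∑ e, k e * w e = n := by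
  classical
  rw [weightSet, Finset.mem_filter, Fintype.mem_piFinset]
  exact ⟨fun h => h.2, fun h =>
    ⟨fun e => Finset.mem_range.2 (Nat.lt_succ_of_le (le_of_sum_mul_eq hw h e)), h⟩⟩

/-- The sum of the classes of the spaces of configurations of points of `M` with labels in the
`W_e`, of total weight `n`. -/
def confSum (M : QPVar) (w : E → ℕ) (W : E → GVar) (n : ℕ) : K0Var :=
  ∑ k ∈ weightSet w n, quotientRingHom (conf M W k).cls

theorem quotientRingHom_conf_zero (M : QPVar) (W : E → GVar) :
    quotientRingHom (conf M W fun _ => 0).cls = 1 := by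
  rw [← map_one quotientRingHom, ← cls_pt]
  have h : ∀ x y : (conf M W fun _ => 0).X, x = y := fun x y =>
    conf_ext (fun s => s.2.elim0) fun e i => i.elim0
  let x₀ : (conf M W fun _ => 0).X :=
    confMk (fun s => s.2.elim0) (fun e i => i.elim0) fun s => s.2.elim0
  refine quotientRingHom_cls_eq (A := conf M W fun _ => 0) (B := GVar.pt)
    (φ := fun _ => (default : QPVar.pt)) (ψ := fun _ => x₀)
    (isRegular_const _) (isRegular_const _) (fun x => h _ _)
    (fun y => Subsingleton.elim (α := QPVar.pt) _ _) fun x x' => ?_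
  rw [h x x']
  exact ⟨fun _ => Orb.refl _, fun _ => Orb.refl _⟩

theorem confSum_zero (hw : ∀ e, 0 < w e) (M : QPVar) (W : E → GVar) : confSum M w W 0 = 1 := by
  have : weightSet w 0 = {fun _ => 0} := by
    ext k
    rw [mem_weightSet hw, Finset.mem_singleton, Finset.sum_eq_zero_iff]
    constructor
    · intro h
      funext e
      exact (Nat.mul_eq_zero.1 (h e (Finset.mem_univ e))).resolve_right (hw e).ne'
    · rintro rfl e _
      exact zero_mul _
  rw [confSum, this, Finset.sum_singleton, quotientRingHom_conf_zero]

/-- The sum of the classes of configurations of weight `n` depends only on the isomorphism classes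
of the varieties of labels of weight at most `n`. -/
theorem confSum_reindex {E₁ : Type} [Fintype E₁] (hw : ∀ e, 0 < w e) {ι : E₁ → E}
    (hι : Injective ι) {n : ℕ} (hn : ∀ e, w e ≤ n → ∃ e₁, ι e₁ = e) {W₁ : E₁ → GVar}
    {W : E → GVar} (hW : ∀ e, GVar.Iso (W₁ e) (W (ι e))) (M : QPVar) :
    confSum M (fun e => w (ι e)) W₁ n = confSum M w W n := by
  classical
  have hsum : ∀ k : E → ℕ, (∀ e, k e ≠ 0 → ∃ e₁, ι e₁ = e) →
      ∑ e, k (ι e) * w (ι e) = ∑ e, k e * w e := fun k hk => by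
    rw [← Finset.sum_image (g := ι) (f := fun e => k e * w e) fun _ _ _ _ h => hι h]
    refine Finset.sum_subset (Finset.subset_univ _) fun e _ he => ?_
    have : k e = 0 := by
      by_contra h
      obtain ⟨e₁, rfl⟩ := hk e h
      exact he (Finset.mem_image_of_mem ι (Finset.mem_univ _))
    rw [this, zero_mul]
  have hk : ∀ k ∈ weightSet w n, ∀ e, k e ≠ 0 → ∃ e₁, ι e₁ = e := fun k hk e he => hn e (by
    rw [← (mem_weightSet hw).1 hk]
    calc w e ≤ k e * w e := Nat.le_mul_of_pos_left _ (Nat.pos_of_ne_zero he)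
      _ ≤ ∑ e, k e * w e := Finset.single_le_sum (f := fun e => k e * w e)
          (fun _ _ => Nat.zero_le _) (Finset.mem_univ e))
  symm
  refine Finset.sum_bij' (i := fun k _ e => k (ι e)) (j := fun k _ => Function.extend ι k 0)
    (fun k hks => ?_) (fun k hks => ?_) (fun k hks => ?_) (fun k hks => ?_) fun k hks => ?_
  · rw [mem_weightSet fun e => hw _, hsum k (hk k hks), (mem_weightSet hw).1 hks]
  · rw [mem_weightSet hw, ← hsum _ fun e he => ?_]
    · simp only [hι.extend_apply]
      exact (mem_weightSet fun e => hw _).1 hks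
    · by_contra h
      exact he (Function.extend_apply' _ _ _ h)
  · funext e
    by_cases h : ∃ e₁, ι e₁ = e
    · obtain ⟨e₁, rfl⟩ := h
      exact hι.extend_apply _ _ _
    · rw [Function.extend_apply' _ _ _ h]
      by_contra h'
      exact h (hk k hks e (Ne.symm h'))
  · funext e
    exact hι.extend_apply _ _ _
  · exact (quotientRingHom_conf_reindex hι (hk k hks) hW).symm

/-- The weights of the points of a superposition of a configuration and a family of points of
weight `m + 1`. -/
def typeWeight {E : Type} {R : ℕ} (w : E → ℕ) (m : ℕ) : PointType E R → ℕ
  | Sum.inl q => w q.1 + q.2 * (m + 1)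
  | Sum.inr r => (r + 1) * (m + 1)

theorem typeWeight_pos {E : Type} {w : E → ℕ} {R : ℕ} (hw : ∀ e, 0 < w e) (m : ℕ) (q : PointType E R) :
    0 < typeWeight w m q := by
  rcases q with q | r
  · exact Nat.add_pos_left (hw _) _
  · exact Nat.mul_pos (Nat.succ_pos _) (Nat.succ_pos _)

theorem sum_typeWeight {R : ℕ} (w : E → ℕ) (m : ℕ) (κ : PointType E R → ℕ) :
    ∑ q, κ q * typeWeight w m q = ∑ e, (∑ r, κ (Sum.inl (e, r))) * w e +
      (∑ q, κ q * mult q) * (m + 1) := by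
  rw [Fintype.sum_sum_type, Fintype.sum_sum_type, Fintype.sum_prod_type, Fintype.sum_prod_type,
    add_mul, ← add_assoc, Finset.sum_mul, Finset.sum_mul, ← Finset.sum_add_distrib]
  congr 1
  · refine sum_congr rfl fun e _ => ?_
    rw [Finset.sum_mul, Finset.sum_mul, ← Finset.sum_add_distrib]
    refine sum_congr rfl fun r _ => ?_
    simp only [typeWeight, mult]
    ring
  · refine sum_congr rfl fun r _ => ?_
    simp only [typeWeight, mult]
    ring

/-- The multiplication of the generating series of configurations by a series `λ_{MV}(t^{m+1})`
amounts to a change of the labels. -/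
theorem confSum_typeWeight (hw : ∀ e, 0 < w e) (M : QPVar) (W : E → GVar) (V : GVar) (m : ℕ)
    {n R : ℕ} (hn : n ≤ R) :
    confSum M (typeWeight (R := R) w m) (typeLabel W V) n =
      ∑ l ∈ Finset.range (n + 1) with l * (m + 1) ≤ n,
        confSum M w W (n - l * (m + 1)) * quotientRingHom ((M.triv.prod V).power l).cls := by
  classical
  -- the number of points of the family and the numbers of labels in a superposition of type `κ`
  let g : (PointType E R → ℕ) → Σ _ : ℕ, E → ℕ := fun κ =>
    ⟨∑ q, κ q * mult q, fun e => ∑ r, κ (Sum.inl (e, r))⟩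
  have hg : ∀ κ (x : Σ _ : ℕ, E → ℕ), g κ = x ↔ IsCompatible x.2 x.1 κ := fun κ x => by
    obtain ⟨l, k⟩ := x
    rw [Sigma.mk.injEq, heq_eq_eq]
    exact ⟨fun h => ⟨fun e => congrFun h.2 e, h.1⟩, fun h => ⟨h.2, funext h.1⟩⟩
  have hw' := typeWeight_pos (R := R) hw m
  have h1 : ∀ l ∈ (Finset.range (n + 1)).filter fun l => l * (m + 1) ≤ n,
      ∀ k ∈ weightSet w (n - l * (m + 1)),
        quotientRingHom (conf M W k).cls * quotientRingHom ((M.triv.prod V).power l).cls =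
        ∑ κ ∈ weightSet (typeWeight (R := R) w m) n with g κ = ⟨l, k⟩,
          quotientRingHom (conf M (typeLabel W V) κ).cls := by
    intro l hl k hk
    have hl1 := (Finset.mem_filter.1 hl).2
    have hl2 := Finset.mem_range.1 (Finset.mem_filter.1 hl).1
    have hk' := (mem_weightSet hw).1 hk
    rw [← map_mul, ← GVar.cls_prod]
    refine quotientRingHom_super (R := R) (by omega) _ fun κ => ?_
    rw [Finset.mem_filter, hg, mem_weightSet hw']
    refine ⟨fun h => h.2, fun h => ⟨?_, h⟩⟩
    rw [sum_typeWeight, h.2, sum_congr rfl fun e _ => by rw [h.1 e], hk']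
    omega
  have h2 : ∑ l ∈ Finset.range (n + 1) with l * (m + 1) ≤ n,
        confSum M w W (n - l * (m + 1)) * quotientRingHom ((M.triv.prod V).power l).cls =
      ∑ l ∈ Finset.range (n + 1) with l * (m + 1) ≤ n, ∑ k ∈ weightSet w (n - l * (m + 1)),
        ∑ κ ∈ weightSet (typeWeight (R := R) w m) n with g κ = ⟨l, k⟩,
          quotientRingHom (conf M (typeLabel W V) κ).cls :=
    sum_congr rfl fun l hl => by
      rw [confSum, Finset.sum_mul]
      exact sum_congr rfl (h1 l hl)
  rw [h2, Finset.sum_sigma', confSum]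
  refine (Finset.sum_fiberwise_of_maps_to (fun κ hκ => ?_) _).symm
  have hκ' := (mem_weightSet hw').1 hκ
  rw [sum_typeWeight] at hκ'
  have h3 : ∑ q, κ q * mult q ≤ (∑ q, κ q * mult q) * (m + 1) :=
    Nat.le_mul_of_pos_right _ m.succ_pos
  refine Finset.mem_sigma.2 ⟨Finset.mem_filter.2 ⟨Finset.mem_range.2 ?_, ?_⟩,
    (mem_weightSet hw).2 ?_⟩
  · show ∑ q, κ q * mult q < n + 1
    omega
  · show (∑ q, κ q * mult q) * (m + 1) ≤ n
    omega
  · show ∑ e, (∑ r, κ (Sum.inl (e, r))) * w e = n - (∑ q, κ q * mult q) * (m + 1)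
    omega

/-! ### Formal series of labels -/

/-- The series `1 + ∑ W_e t^{w_e}` with coefficients in the free abelian group on the isomorphism
classes of varieties with actions of finite groups. -/
def labelSeries (w : E → ℕ) (W : E → GVar) : oneSeries (FreeAbelianGroup GClass) :=
  mkSeries (fun n => if n = 0 then 1 else ∑ e, if w e = n then gen (W e) else 0) (if_pos rfl)

theorem coeffSeries_labelSeries (hw : ∀ e, 0 < w e) (W : E → GVar) (n : ℕ) :
    coeffSeries n (labelSeries w W) =
      (if n = 0 then 1 else 0) + ∑ e, if w e = n then gen (W e) else 0 := by
  refine (coeffSeries_mkSeries _ _ _).trans ?_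
  by_cases h : n = 0
  · rw [if_pos h, if_pos h, Finset.sum_eq_zero fun e _ => if_neg (by have := hw e; omega), add_zero]
  · rw [if_neg h, if_neg h, zero_add]

end Weight

theorem gen_power_zero (A : GVar) : gen (A.power 0) = 1 := gen_eq A.power_zero_iso

/-- The series `1 + ∑ Aⁿ tⁿ` with coefficients in the free abelian group. -/
def freeZetaSeries (A : GVar) : oneSeries (FreeAbelianGroup GClass) :=
  mkSeries (fun n => gen (A.power n)) (gen_power_zero A)

theorem coeffSeries_freeZetaSeries (A : GVar) (n : ℕ) :
    coeffSeries n (freeZetaSeries A) = gen (A.power n) := coeffSeries_mkSeries _ _ n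

/-- The series of Cartesian powers as a function of the isomorphism class. -/
def freeZeta : GClass → Additive (oneSeries (FreeAbelianGroup GClass)) :=
  Quotient.lift (fun A : GVar => Additive.ofMul (freeZetaSeries A)) fun _ _ h =>
    congrArg Additive.ofMul (oneSeries_ext fun n => by
      rw [coeffSeries_freeZetaSeries, coeffSeries_freeZetaSeries]
      exact gen_eq (Iso.power h n))

/-- The λ-structure on the free abelian group on the isomorphism classes of varieties with actions
of finite groups that is given by the Cartesian powers. -/
def freeLambda : LambdaStructure (FreeAbelianGroup GClass) where
  series a := (FreeAbelianGroup.lift freeZeta a).toMul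
  series_add a b := congrArg Additive.toMul (map_add (FreeAbelianGroup.lift freeZeta) a b)
  coeff_one a := by
    show coeffOneHom (FreeAbelianGroup.lift freeZeta a) = a
    induction a using FreeAbelianGroup.induction_on with
    | zero => rw [map_zero, map_zero]
    | of c =>
      induction c using Quotient.inductionOn with
      | h A =>
      refine (congrArg coeffOneHom (FreeAbelianGroup.lift_apply_of _ _)).trans ?_
      exact (coeffSeries_freeZetaSeries A 1).trans (gen_eq A.power_one_iso)
    | neg c hc => rw [map_neg, map_neg, hc]
    | add a b ha hb => rw [map_add, map_add, ha, hb]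

theorem coeffSeries_freeLambda (A : GVar) (n : ℕ) :
    coeffSeries n (freeLambda.series (gen A)) = gen (A.power n) :=
  (congrArg (fun s => coeffSeries n (Additive.toMul s)) (FreeAbelianGroup.lift_apply_of _ _)).trans
    (coeffSeries_freeZetaSeries A n)

/-- The homomorphism from the free abelian group to `K₀(Var_ℂ)` that sends `(X, G)` to
`[X / G]`. -/
def freeQuotient : FreeAbelianGroup GClass →+* K0Var :=
  quotientRingHom.comp (Ideal.Quotient.mk _)

theorem freeQuotient_gen (A : GVar) : freeQuotient (gen A) = quotientRingHom A.cls := rfl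

theorem mapSeries_freeLambda (a : FreeAbelianGroup GClass) :
    mapSeries freeQuotient (freeLambda.series a) = symLambda.series (freeQuotient a) := by
  induction a using FreeAbelianGroup.induction_on with
  | zero =>
    rw [map_zero, LambdaStructure.series_zero, LambdaStructure.series_zero]
    exact map_one (mapSeriesHom freeQuotient)
  | of c =>
    induction c using Quotient.inductionOn with
    | h A =>
    refine Eq.trans (oneSeries_ext fun n => ?_) (isLambdaHom_quotientRingHom A.cls).symm
    rw [coeffSeries_mapSeries, coeffSeries_mapSeries, zeta_series_cls, coeffSeries_zetaSeries]
    exact congrArg freeQuotient (coeffSeries_freeLambda A n)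
  | neg c hc =>
    rw [map_neg, LambdaStructure.series_neg, LambdaStructure.series_neg, ← hc]
    exact map_inv (mapSeriesHom freeQuotient) _
  | add a b ha hb =>
    rw [map_add, LambdaStructure.series_add, LambdaStructure.series_add, ← ha, ← hb]
    exact map_mul (mapSeriesHom freeQuotient) _ _

theorem coeffSeries_symLambda_prod (M : QPVar) (V : GVar) (n : ℕ) :
    coeffSeries n (symLambda.series (M.cls * freeQuotient (gen V))) =
      quotientRingHom ((M.triv.prod V).power n).cls := by
  have h : M.cls * freeQuotient (gen V) = quotientRingHom (M.triv.prod V).cls := by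
    rw [GVar.cls_prod, map_mul, ← trivHom_cls, quotientRingHom_trivHom]
    rfl
  rw [h, isLambdaHom_quotientRingHom, coeffSeries_mapSeries, zeta_series_cls,
    coeffSeries_zetaSeries]

section Weight

variable {E : Type} [Fintype E] {w : E → ℕ}

theorem labelSeries_typeWeight (hw : ∀ e, 0 < w e) (W : E → GVar) (V : GVar) (m R : ℕ) :
    EqMod R (labelSeries (typeWeight (R := R) w m) (typeLabel W V))
      (labelSeries w W * expandHom m (freeLambda.series (gen V))) := by
  intro n hn
  have h0 : ∀ f : ℕ → FreeAbelianGroup GClass,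
      ∑ r : Fin (R + 1), (if (r : ℕ) * (m + 1) ≤ n then f r else 0) =
        ∑ l ∈ Finset.range (n + 1) with l * (m + 1) ≤ n, f l := fun f => by
    rw [Fin.sum_univ_eq_sum_range (fun r => if r * (m + 1) ≤ n then f r else 0), Finset.sum_filter]
    refine (Finset.sum_subset (Finset.range_subset_range.2 (by omega)) fun l _ hl => ?_).symm
    rw [Finset.mem_range, not_lt] at hl
    exact if_neg fun h => by
      have : l ≤ l * (m + 1) := Nat.le_mul_of_pos_right l m.succ_pos
      omega
  rw [coeffSeries_mul_expandHom, coeffSeries_labelSeries (typeWeight_pos hw m),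
    Fintype.sum_sum_type, Fintype.sum_prod_type]
  simp only [coeffSeries_labelSeries hw, coeffSeries_freeLambda, add_mul, Finset.sum_mul]
  rw [Finset.sum_add_distrib, ← h0, ← h0]
  simp only [typeWeight, typeLabel]
  rw [Fin.sum_univ_succ]
  have h1 : ∀ r : Fin R, (if (r.succ : ℕ) * (m + 1) ≤ n then
      (if n - (r.succ : ℕ) * (m + 1) = 0 then (1 : FreeAbelianGroup GClass) else 0) *
        gen (V.power r.succ) else 0) =
      if ((r : ℕ) + 1) * (m + 1) = n then gen (V.power (r + 1)) else 0 := fun r => by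
    rw [Fin.val_succ]
    by_cases h : ((r : ℕ) + 1) * (m + 1) = n
    · rw [if_pos h, if_pos h.le, if_pos (by omega), one_mul]
    · rw [if_neg h]
      split_ifs
      · omega
      · rw [zero_mul]
      · rfl
  have h2 : (if ((0 : Fin (R + 1)) : ℕ) * (m + 1) ≤ n then
      (if n - ((0 : Fin (R + 1)) : ℕ) * (m + 1) = 0 then (1 : FreeAbelianGroup GClass) else 0) *
        gen (V.power ((0 : Fin (R + 1)) : ℕ)) else 0) = if n = 0 then 1 else 0 := by
    simp [gen_power_zero]
  rw [h2, sum_congr rfl fun r _ => h1 r]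
  refine Eq.trans ?_ (add_assoc _ _ _).symm
  refine congrArg₂ _ rfl ((add_comm _ _).trans (congrArg₂ _ rfl ?_))
  rw [Finset.sum_comm]
  refine sum_congr rfl fun r _ => ?_
  by_cases h : (r : ℕ) * (m + 1) ≤ n
  · rw [if_pos h]
    refine sum_congr rfl fun e _ => ?_
    by_cases h3 : w e + (r : ℕ) * (m + 1) = n
    · refine (if_pos h3).trans ?_
      rw [if_pos (by omega), GVar.gen_mul]
    · refine (if_neg h3).trans ?_
      rw [if_neg (by omega), zero_mul]
  · rw [if_neg h]
    exact Finset.sum_eq_zero fun e _ => if_neg (by omega)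

end Weight

/-! ### The geometric power structure -/

/-- The number of generators equal to `c`. -/
def labelCount (c : GClass) : FreeAbelianGroup GClass →+ ℤ :=
  open Classical in FreeAbelianGroup.lift fun d => if d = c then 1 else 0

open Classical in
theorem labelCount_gen (c : GClass) (A : GVar) :
    labelCount c (gen A) = if (Quotient.mk _ A : GClass) = c then 1 else 0 :=
  FreeAbelianGroup.lift_apply_of _ _

/-- The weight and the isomorphism class of a label. -/
def labelType {E : Type} (w : E → ℕ) (W : E → GVar) (e : E) : ℕ × GClass :=
  (w e, Quotient.mk _ (W e))

section

variable {E : Type} [Fintype E] {w : E → ℕ} {E' : Type} [Fintype E'] {w' : E' → ℕ}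

theorem labelCount_labelSeries (hw : ∀ e, 0 < w e) (W : E → GVar) (c : GClass) {j : ℕ}
    (hj : j ≠ 0) : labelCount c (coeffSeries j (labelSeries w W)) =
      Nat.card {e // labelType w W e = (j, c)} := by
  classical
  rw [coeffSeries_labelSeries hw, if_neg hj, zero_add, map_sum, Nat.card_eq_fintype_card,
    Fintype.card_subtype, Finset.card_filter, Nat.cast_sum]
  refine sum_congr rfl fun e _ => ?_
  by_cases h : w e = j
  · rw [if_pos h, labelCount_gen, Nat.cast_ite, Nat.cast_one, Nat.cast_zero]
    exact if_congr ⟨fun h' => Prod.ext h h', fun h' => congrArg Prod.snd h'⟩ rfl rfl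
  · rw [if_neg h, map_zero, if_neg fun h' => h (congrArg Prod.fst h'), Nat.cast_zero]

/-- The classes of the spaces of configurations of weight at most `N` are determined by the formal
series of the labels modulo `t^(N+1)`. -/
theorem confSum_eq_of_eqMod (hw : ∀ e, 0 < w e) (hw' : ∀ e, 0 < w' e) {W : E → GVar}
    {W' : E' → GVar} {N : ℕ} (h : EqMod N (labelSeries w W) (labelSeries w' W')) (M : QPVar)
    {n : ℕ} (hn : n ≤ N) : confSum M w W n = confSum M w' W' n := by
  classical
  have hcard : ∀ t, Nat.card {e : {e // w e ≤ N} // labelType w W e = t} =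
      Nat.card {e : {e // w' e ≤ N} // labelType w' W' e = t} := by
    rintro ⟨j, c⟩
    have hsub : ∀ {E : Type} [Fintype E] (w : E → ℕ) (W : E → GVar) (_ : j ≤ N),
        Nat.card {e : {e // w e ≤ N} // labelType w W e = (j, c)} =
        Nat.card {e // labelType w W e = (j, c)} := fun {E} _ w W hj =>
      Nat.card_congr (Equiv.subtypeSubtypeEquivSubtype (p := fun e => w e ≤ N)
        (q := fun e => labelType w W e = (j, c)) fun h => (congrArg Prod.fst h).le.trans hj)
    have hempty : ∀ {E : Type} [Fintype E] (w : E → ℕ) (W : E → GVar) (_ : ∀ e, 0 < w e)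
        (_ : j = 0 ∨ N < j),
        Nat.card {e : {e // w e ≤ N} // labelType w W e = (j, c)} = 0 :=
      fun w W hw hj => by
        refine Nat.card_eq_zero.2 (Or.inl ⟨fun e => ?_⟩)
        have h1 : w e.1 = j := congrArg Prod.fst e.2
        have h2 := hw e.1
        have h3 := e.1.2
        omega
    by_cases hj : j = 0 ∨ N < j
    · rw [hempty w W hw hj, hempty w' W' hw' hj]
    · rw [not_or, not_lt] at hj
      rw [hsub w W hj.2, hsub w' W' hj.2]
      have h1 := congrArg (labelCount c) (h j hj.2)
      rw [labelCount_labelSeries hw W c hj.1, labelCount_labelSeries hw' W' c hj.1] at h1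
      exact Nat.cast_injective h1
  obtain ⟨ε, hε⟩ := exists_equiv_of_card_fibre_eq hcard
  rw [← confSum_reindex hw (ι := Subtype.val) Subtype.val_injective (W₁ := fun e : {e // w e ≤ N} =>
      W e) (fun e he => ⟨⟨e, he.trans hn⟩, rfl⟩) (fun e => Iso.refl _) M,
    ← confSum_reindex hw' (ι := fun e => (ε e).1) (Subtype.val_injective.comp ε.injective)
      (W₁ := fun e : {e // w e ≤ N} => W e)
      (fun e he => ⟨ε.symm ⟨e, he.trans hn⟩, by rw [Equiv.apply_symm_apply]⟩)
      (fun e => Quotient.exact (congrArg Prod.snd (hε e)).symm) M]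
  congr 1
  funext e
  exact (congrArg Prod.fst (hε e)).symm

/-- The generating series of configurations of points of `M` with labels in the `W_e`. -/
def confSeries (hw : ∀ e, 0 < w e) (M : QPVar) (W : E → GVar) : oneSeries K0Var :=
  mkSeries (confSum M w W) (confSum_zero hw M W)

theorem coeffSeries_confSeries (hw : ∀ e, 0 < w e) (M : QPVar) (W : E → GVar) (n : ℕ) :
    coeffSeries n (confSeries hw M W) = confSum M w W n := coeffSeries_mkSeries _ _ n

end

/-- Up to the order `N`, the series `s` is a formal series of labels and `g` is the generating
series of the configurations of points of `M` with these labels. -/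
def IsConfPair (M : QPVar) (N : ℕ) (s : oneSeries (FreeAbelianGroup GClass))
    (g : oneSeries K0Var) : Prop :=
  ∃ (E : Type) (_ : Fintype E) (w : E → ℕ) (W : E → GVar) (hw : ∀ e, 0 < w e),
    EqMod N s (labelSeries w W) ∧ EqMod N g (confSeries hw M W)

namespace IsConfPair

variable {M : QPVar} {N : ℕ} {s s' : oneSeries (FreeAbelianGroup GClass)} {g g' : oneSeries K0Var}

theorem eqMod (h : IsConfPair M N s g) (h' : IsConfPair M N s' g') (hs : EqMod N s s') :
    EqMod N g g' := by
  obtain ⟨E, _, w, W, hw, h1, h2⟩ := h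
  obtain ⟨E', _, w', W', hw', h1', h2'⟩ := h'
  refine h2.trans (EqMod.trans (fun n hn => ?_) h2'.symm)
  rw [coeffSeries_confSeries, coeffSeries_confSeries]
  exact confSum_eq_of_eqMod hw hw' (h1.symm.trans (hs.trans h1')) M hn

theorem one : IsConfPair M N 1 1 := by
  refine ⟨Empty, inferInstance, Empty.elim, Empty.elim, fun e => e.elim, fun n _ => ?_,
    fun n _ => ?_⟩
  · rw [coeffSeries_labelSeries fun e => e.elim]
    rcases n with _ | n
    · rw [coeffSeries_zero]
      simp
    · rw [coeffSeries_one n.succ_ne_zero]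
      simp
  · rcases n with _ | n
    · rw [coeffSeries_zero, coeffSeries_zero]
    · rw [coeffSeries_one n.succ_ne_zero, coeffSeries_confSeries, confSum, Finset.sum_eq_zero]
      intro k hk
      have := (mem_weightSet fun e : Empty => e.elim).1 hk
      simp at this

theorem mul_gen (h : IsConfPair M N s g) (m : ℕ) (V : GVar) :
    IsConfPair M N (s * expandHom m (freeLambda.series (gen V)))
      (g * expandHom m (symLambda.series (M.cls * freeQuotient (gen V)))) := by
  obtain ⟨E, _, w, W, hw, h1, h2⟩ := h
  refine ⟨PointType E N, inferInstance, typeWeight w m, typeLabel W V, typeWeight_pos hw m,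
    (h1.mul (EqMod.refl N _)).trans (labelSeries_typeWeight hw W V m N).symm,
    (h2.mul (EqMod.refl N _)).trans fun n hn => ?_⟩
  rw [coeffSeries_confSeries, confSum_typeWeight hw M W V m hn, coeffSeries_mul_expandHom]
  refine sum_congr rfl fun l _ => ?_
  rw [coeffSeries_confSeries, coeffSeries_symLambda_prod]

theorem mul_closure (h : IsConfPair M N s g) (m : ℕ) {a : FreeAbelianGroup GClass}
    (ha : a ∈ AddSubmonoid.closure (Set.range FreeAbelianGroup.of)) :
    IsConfPair M N (s * expandHom m (freeLambda.series a))
      (g * expandHom m (symLambda.series (M.cls * freeQuotient a))) := by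
  induction ha using AddSubmonoid.closure_induction generalizing s g with
  | mem a ha =>
    obtain ⟨c, rfl⟩ := ha
    induction c using Quotient.inductionOn with
    | h V => exact h.mul_gen m V
  | zero =>
    rw [map_zero, mul_zero, LambdaStructure.series_zero, LambdaStructure.series_zero, map_one,
      map_one, mul_one, mul_one]
    exact h
  | add a b _ _ ha hb =>
    rw [map_add, mul_add, LambdaStructure.series_add, LambdaStructure.series_add, map_mul,
      map_mul, ← mul_assoc, ← mul_assoc]
    exact hb (ha h)

theorem mul_partialProd (h : IsConfPair M N s g) {a : ℕ → FreeAbelianGroup GClass}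
    (ha : ∀ i, a i ∈ AddSubmonoid.closure (Set.range FreeAbelianGroup.of)) (n : ℕ) :
    IsConfPair M N (s * freeLambda.partialProd n a)
      (g * symLambda.partialProd n (M.cls • fun i => freeQuotient (a i))) := by
  induction n with
  | zero =>
    rw [LambdaStructure.partialProd, LambdaStructure.partialProd, Finset.prod_range_zero,
      Finset.prod_range_zero, mul_one, mul_one]
    exact h
  | succ n ih =>
    rw [LambdaStructure.partialProd_succ, LambdaStructure.partialProd_succ, ← mul_assoc,
      ← mul_assoc]
    exact ih.mul_closure n (ha n)

end IsConfPair

theorem exists_eq_sub (a : FreeAbelianGroup GClass) :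
    ∃ u ∈ AddSubmonoid.closure (Set.range (FreeAbelianGroup.of (α := GClass))),
      ∃ v ∈ AddSubmonoid.closure (Set.range (FreeAbelianGroup.of (α := GClass))), a + v = u := by
  induction a using FreeAbelianGroup.induction_on with
  | zero => exact ⟨0, zero_mem _, 0, zero_mem _, add_zero _⟩
  | of c => exact ⟨_, AddSubmonoid.subset_closure ⟨c, rfl⟩, 0, zero_mem _, add_zero _⟩
  | neg c _ => exact ⟨0, zero_mem _, _, AddSubmonoid.subset_closure ⟨c, rfl⟩, neg_add_cancel _⟩
  | add a b ha hb =>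
    obtain ⟨u, hu, v, hv, h⟩ := ha
    obtain ⟨u', hu', v', hv', h'⟩ := hb
    exact ⟨u + u', add_mem hu hu', v + v', add_mem hv hv', by rw [add_add_add_comm, h, h']⟩

theorem mapSeries_freeQuotient_infProd (b : ℕ → FreeAbelianGroup GClass) :
    mapSeries freeQuotient (freeLambda.infProd b) =
      symLambda.infProd fun i => freeQuotient (b i) :=
  oneSeries_ext fun n => by
    have h2 : mapSeriesHom freeQuotient (freeLambda.partialProd n b) =
        symLambda.partialProd n fun i => freeQuotient (b i) := by
      rw [LambdaStructure.partialProd, map_prod]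
      refine prod_congr rfl fun i _ => ?_
      rw [mapSeries_expandHom, mapSeries_freeLambda]
    rw [coeffSeries_mapSeries, freeLambda.infProd_eqMod le_rfl b n le_rfl,
      symLambda.infProd_eqMod le_rfl _ n le_rfl, ← h2]
    exact (coeffSeries_mapSeries _ _ _).symm

/-- The power of the series `1 + ∑ [W_e / G_e] t^{w_e}` in the power structure of symmetric powers
is the generating series of configurations.  For series of labels that are products of series of
Cartesian powers this is `IsConfPair.mul_partialProd`; in general the formal series of labels is a
quotient of two such products. -/
theorem power_labelSeries {E : Type} [Fintype E] {w : E → ℕ} (hw : ∀ e, 0 < w e) (M : QPVar)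
    (W : E → GVar) : symLambda.power (mapSeries freeQuotient (labelSeries w W)) M.cls =
      confSeries hw M W := by
  refine eq_of_eqMod fun N => ?_
  -- the coordinates are differences of sums of varieties: `b = u - v`
  set b := freeLambda.logCoord (labelSeries w W) with hb
  choose u hu v hv huv using fun i => exists_eq_sub (b i)
  have hF : EqMod N (labelSeries w W) (freeLambda.partialProd N b) := by
    rw [← freeLambda.infProd_logCoord (labelSeries w W)]
    exact freeLambda.infProd_eqMod le_rfl b
  have h1 : IsConfPair M N (labelSeries w W) (confSeries hw M W) :=
    ⟨E, _, w, W, hw, EqMod.refl _ _, EqMod.refl _ _⟩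
  have h2 := (h1.mul_partialProd hv N).eqMod (IsConfPair.one.mul_partialProd hu N) (by
    rw [one_mul, ← show b + v = u from funext huv, LambdaStructure.partialProd_add]
    exact hF.mul (EqMod.refl _ _))
  rw [one_mul] at h2
  have h3 : (M.cls • fun i => freeQuotient (u i)) =
      (M.cls • fun i => freeQuotient (b i)) + M.cls • fun i => freeQuotient (v i) := by
    rw [← smul_add]
    congr 1
    funext i
    rw [← huv, map_add, Pi.add_apply]
  rw [h3, LambdaStructure.partialProd_add] at h2
  rw [← freeLambda.infProd_logCoord (labelSeries w W), mapSeries_freeQuotient_infProd,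
    LambdaStructure.power_infProd]
  exact (symLambda.infProd_eqMod le_rfl _).trans h2.of_mul_right.symm

section LabelledConf

variable {A : ℕ → QPVar} {M : QPVar} {n : ℕ} {k : Fin n → ℕ}

/-- The complement of the big diagonal with the action of `∏ S_{k_i}`. -/
def offConf (M : QPVar) (k : Fin n → ℕ) : GVar :=
  (blockPower (fun _ => M) k).sub (offDiagonal M k) (isOpen_offDiagonal M k).isLocallyClosed
    (smul_mem_offDiagonal M k)

/-- A component of a point of `∏ B_i^{k_i}`. -/
def blockEntry {B : Fin n → QPVar} (z : (blockPower B k).X) (j : Σ i : Fin n, Fin (k i)) : B j.1 :=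
  piEquiv (fun j : Σ i : Fin n, Fin (k i) => B j.1) z j

/-- The points of a configuration with labels. -/
def lcPos (z : (labelledConf A M k).X) (j : Σ i : Fin n, Fin (k i)) : M :=
  blockEntry (B := fun _ => M)
    (val (pr₁ (A := offConf M k) (B := blockPower (fun i : Fin n => A (i + 1)) k) z)) j

/-- The labels of a configuration with labels. -/
def lcLab (z : (labelledConf A M k).X) (j : Σ i : Fin n, Fin (k i)) : A (j.1 + 1) :=
  blockEntry (B := fun i : Fin n => A (i + 1))
    (pr₂ (A := offConf M k) (B := blockPower (fun i : Fin n => A (i + 1)) k) z) j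

theorem lc_ext {z z' : (labelledConf A M k).X} (h : ∀ j, lcPos z j = lcPos z' j)
    (h' : ∀ j, lcLab z j = lcLab z' j) : z = z' :=
  prod_ext (A := offConf M k) (B := blockPower (fun i : Fin n => A (i + 1)) k)
    (val_injective ((piEquiv fun _ : Σ i : Fin n, Fin (k i) => M).injective (_root_.funext h)))
    ((piEquiv fun j : Σ i : Fin n, Fin (k i) => A (j.1 + 1)).injective (_root_.funext h'))

theorem lcPos_smul (s : ∀ i : Fin n, Perm (Fin (k i))) (z : (labelledConf A M k).X)
    (j : Σ i : Fin n, Fin (k i)) :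
    lcPos (HSMul.hSMul (α := (labelledConf A M k).G) s z) j = lcPos z ⟨j.1, (s j.1)⁻¹ j.2⟩ :=
  (congrArg (fun t => blockEntry (B := fun _ => M) (val t) j)
    (pr₁_smul (A := offConf M k) (B := blockPower (fun i : Fin n => A (i + 1)) k) (s, s) z)).trans
    (piEquiv_blockSmul (fun _ => M) k s _ j)

theorem lcLab_smul (s : ∀ i : Fin n, Perm (Fin (k i))) (z : (labelledConf A M k).X)
    (j : Σ i : Fin n, Fin (k i)) :
    lcLab (HSMul.hSMul (α := (labelledConf A M k).G) s z) j = lcLab z ⟨j.1, (s j.1)⁻¹ j.2⟩ :=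
  (congrArg (fun t => blockEntry (B := fun i : Fin n => A (i + 1)) t j)
    (pr₂_smul (A := offConf M k) (B := blockPower (fun i : Fin n => A (i + 1)) k) (s, s) z)).trans
    (piEquiv_blockSmul (fun i : Fin n => A (i + 1)) k s _ j)

theorem lcPos_injective (z : (labelledConf A M k).X) : Injective (lcPos z) :=
  val_mem (pr₁ (A := offConf M k) (B := blockPower (fun i : Fin n => A (i + 1)) k) z)

theorem isRegular_lcPos (j : Σ i : Fin n, Fin (k i)) :
    IsRegular fun z : (labelledConf A M k).X => lcPos z j :=
  (isRegular_piEquiv_apply (fun _ : Σ i : Fin n, Fin (k i) => M) j).comp (isRegular_val.comp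
    (isRegular_pr₁ (A := offConf M k) (B := blockPower (fun i : Fin n => A (i + 1)) k)))

theorem isRegular_lcLab (j : Σ i : Fin n, Fin (k i)) :
    IsRegular fun z : (labelledConf A M k).X => lcLab z j :=
  (isRegular_piEquiv_apply (fun j : Σ i : Fin n, Fin (k i) => A (j.1 + 1)) j).comp
    (isRegular_pr₂ (A := offConf M k) (B := blockPower (fun i : Fin n => A (i + 1)) k))

/-- The point of `∏ B_i^{k_i}` with given components. -/
def blockMk {B : Fin n → QPVar} (p : ∀ j : Σ i : Fin n, Fin (k i), B j.1) : (blockPower B k).X :=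
  (piEquiv fun j : Σ i : Fin n, Fin (k i) => B j.1).symm p

theorem blockEntry_mk {B : Fin n → QPVar} (p : ∀ j : Σ i : Fin n, Fin (k i), B j.1) :
    blockEntry (blockMk p) = p := Equiv.apply_symm_apply _ _

theorem isRegular_blockMk {B : Fin n → QPVar} {T : QPVar}
    {p : T → ∀ j : Σ i : Fin n, Fin (k i), B j.1} (hp : ∀ j, IsRegular fun t => p t j) :
    IsRegular fun t => blockMk (p t) :=
  isRegular_pi (X := fun j : Σ i : Fin n, Fin (k i) => B j.1) fun j =>
    (isRegular_congr fun t => congrFun (blockEntry_mk (p t)) j).2 (hp j)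

theorem blockMk_mem_offDiagonal {p : (Σ i : Fin n, Fin (k i)) → M} (hp : Injective p) :
    blockMk (B := fun _ => M) p ∈ offDiagonal M k :=
  (congrArg Injective (blockEntry_mk (B := fun _ => M) p)).mpr hp

/-- The configuration with given points and labels. -/
def lcMk (p : (Σ i : Fin n, Fin (k i)) → M) (l : ∀ j : Σ i : Fin n, Fin (k i), A (j.1 + 1))
    (hp : Injective p) : (labelledConf A M k).X :=
  pair (A := offConf M k) (B := blockPower (fun i : Fin n => A (i + 1)) k)
    (mkSub _ _ (blockMk p) (blockMk_mem_offDiagonal hp))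
    (blockMk (B := fun i : Fin n => A (i + 1)) l)

theorem lcPos_mk (p : (Σ i : Fin n, Fin (k i)) → M)
    (l : ∀ j : Σ i : Fin n, Fin (k i), A (j.1 + 1)) (hp : Injective p) :
    lcPos (lcMk p l hp) = p :=
  (congrArg (fun t => blockEntry (B := fun _ => M) (val t)) (pr₁_pair (A := offConf M k)
    (B := blockPower (fun i : Fin n => A (i + 1)) k) _ _)).trans (blockEntry_mk _)

theorem lcLab_mk (p : (Σ i : Fin n, Fin (k i)) → M)
    (l : ∀ j : Σ i : Fin n, Fin (k i), A (j.1 + 1)) (hp : Injective p) :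
    lcLab (lcMk p l hp) = l :=
  (congrArg (blockEntry (B := fun i : Fin n => A (i + 1))) (pr₂_pair (A := offConf M k)
    (B := blockPower (fun i : Fin n => A (i + 1)) k) _ _)).trans (blockEntry_mk _)

theorem isRegular_lcMk {T : QPVar} {p : T → (Σ i : Fin n, Fin (k i)) → M}
    {l : T → ∀ j : Σ i : Fin n, Fin (k i), A (j.1 + 1)} (hp : ∀ j, IsRegular fun t => p t j)
    (hl : ∀ j, IsRegular fun t => l t j) (h : ∀ t, Injective (p t)) :
    IsRegular fun t => lcMk (p t) (l t) (h t) :=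
  isRegular_pair (A := offConf M k) (B := blockPower (fun i : Fin n => A (i + 1)) k)
    (isRegular_mkSub (isRegular_blockMk (B := fun _ => M) hp) fun t => blockMk_mem_offDiagonal (h t))
    (isRegular_blockMk (B := fun i : Fin n => A (i + 1)) hl)

/-- A configuration with labels, with the labels of each kind joined to the points. -/
def lcToConf (z : (labelledConf A M k).X) : (conf M (fun i : Fin n => (A (i + 1)).triv) k).X :=
  confMk (W := fun i : Fin n => (A (i + 1)).triv) (lcPos z) (fun e i => lcLab z ⟨e, i⟩)
    (lcPos_injective z)

/-- A configuration with labels, with the labels separated from the points. -/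
def confToLc (y : (conf M (fun i : Fin n => (A (i + 1)).triv) k).X) : (labelledConf A M k).X :=
  lcMk (cpos y) (fun j => clab (W := fun i : Fin n => (A (i + 1)).triv) y j.1 j.2)
    (cpos_injective y)

theorem isRegular_lcToConf : IsRegular (lcToConf (A := A) (M := M) (k := k)) :=
  isRegular_confMk (W := fun i : Fin n => (A (i + 1)).triv) (p := fun z => lcPos z)
    (w := fun z e i => lcLab z ⟨e, i⟩) (fun s => isRegular_lcPos s)
    (fun e i => isRegular_lcLab ⟨e, i⟩) fun z => lcPos_injective z

theorem isRegular_confToLc : IsRegular (confToLc (A := A) (M := M) (k := k)) :=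
  isRegular_lcMk
    (p := fun y => cpos (W := fun i : Fin n => (A (i + 1)).triv) y)
    (l := fun y j => clab (W := fun i : Fin n => (A (i + 1)).triv) y j.1 j.2)
    (fun j => isRegular_cpos (W := fun i : Fin n => (A (i + 1)).triv) j)
    (fun j => isRegular_clab (W := fun i : Fin n => (A (i + 1)).triv) j.1 j.2)
    fun y => cpos_injective y

/-- The two models of the space of configurations, with the labels of the same kind in one factor
or separately with each group of points, have the same quotients. -/
theorem quotientRingHom_labelledConf (A : ℕ → QPVar) (M : QPVar) {n : ℕ} (k : Fin n → ℕ) :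
    quotientRingHom (labelledConf A M k).cls =
      quotientRingHom (conf M (fun i : Fin n => (A (i + 1)).triv) k).cls := by
  have hψ₁ : ∀ (y : (conf M (fun i : Fin n => (A (i + 1)).triv) k).X) j,
      lcPos (confToLc y) j = cpos y j := fun y j => congrFun (lcPos_mk _ _ _) j
  have hψ₂ : ∀ (y : (conf M (fun i : Fin n => (A (i + 1)).triv) k).X) j,
      lcLab (confToLc y) j = clab y j.1 j.2 := fun y j => congrFun (lcLab_mk _ _ _) j
  have hφ₁ : ∀ (z : (labelledConf A M k).X) j, cpos (lcToConf z) j = lcPos z j :=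
    fun z j => cpos_mk _ _ _ j
  have hφ₂ : ∀ (z : (labelledConf A M k).X) e i, clab (lcToConf z) e i = lcLab z ⟨e, i⟩ :=
    fun z e i => clab_mk _ _ _ e i
  refine quotientRingHom_cls_eq isRegular_lcToConf isRegular_confToLc
    (fun z => lc_ext (fun j => (hψ₁ _ j).trans (hφ₁ z j)) fun j => (hψ₂ _ j).trans (hφ₂ z _ _))
    (fun y => conf_ext (fun j => (hφ₁ _ j).trans (hψ₁ y j)) fun e i =>
      (hφ₂ _ e i).trans (hψ₂ y ⟨e, i⟩)) fun z z' => ?_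
  rw [orb_conf]
  constructor
  · rintro ⟨s, rfl⟩
    refine ⟨fun e => (show ∀ i : Fin n, Perm (Fin (k i)) from s) e |>.symm,
      fun e i => ?_, fun e i => orb_triv.2 ?_⟩
    · exact (hφ₁ _ _).trans ((lcPos_smul s z ⟨e, i⟩).symm.trans (hφ₁ _ _).symm)
    · exact (hφ₂ _ _ _).trans ((lcLab_smul s z ⟨e, i⟩).symm.trans (hφ₂ _ _ _).symm)
  · rintro ⟨σ, h1, h2⟩
    refine ⟨fun e => (σ e)⁻¹, lc_ext (fun j => ?_) fun j => ?_⟩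
    · refine (lcPos_smul (fun e => (σ e)⁻¹) z j).trans ?_
      rw [inv_inv, ← hφ₁, ← hφ₁]
      exact h1 j.1 j.2
    · refine (lcLab_smul (fun e => (σ e)⁻¹) z j).trans ?_
      rw [inv_inv]
      exact (hφ₂ z j.1 (σ j.1 j.2)).symm.trans ((orb_triv.1 (h2 j.1 j.2)).trans (hφ₂ z' j.1 j.2))

end LabelledConf

theorem isGeometric_symLambda : IsGeometric symLambda.powerStructure := by
  intro A M B hB n
  let w : Fin n → ℕ := fun i => i + 1
  have hw : ∀ i, 0 < w i := fun i => Nat.succ_pos _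
  let W : Fin n → GVar := fun i => (A (i + 1)).triv
  have hBW : EqMod n B (mapSeries freeQuotient (labelSeries w W)) := by
    intro m hm
    rw [coeffSeries_mapSeries, coeffSeries_labelSeries hw]
    rcases m with _ | m
    · rw [coeffSeries_zero, if_pos rfl, Finset.sum_eq_zero fun i _ => if_neg (hw i).ne', add_zero,
        map_one]
    · rw [if_neg m.succ_ne_zero, zero_add, Finset.sum_eq_single (⟨m, hm⟩ : Fin n), if_pos rfl,
        freeQuotient_gen, hB _ m.succ_pos, ← trivHom_cls, quotientRingHom_trivHom]
      · exact fun i _ hi => if_neg fun h => hi (Fin.ext (Nat.succ_injective h))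
      · exact fun h => absurd (Finset.mem_univ _) h
  refine (LambdaStructure.EqMod.power hBW M.cls n le_rfl).trans ?_
  rw [power_labelSeries hw, coeffSeries_confSeries, confSum]
  have hcomm : ∀ k : Fin n → ℕ, ∑ i, k i * w i = ∑ i : Fin n, ((i : ℕ) + 1) * k i := fun k =>
    sum_congr rfl fun i _ => mul_comm _ _
  refine Finset.sum_bij' (i := fun k hk i =>
    ⟨k i, Nat.lt_succ_of_le (le_of_sum_mul_eq hw ((mem_weightSet hw).1 hk) i)⟩)
    (j := fun k _ i => (k i : ℕ)) (fun k hk => ?_) (fun k hk => ?_) (fun _ _ => rfl)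
    (fun _ _ => rfl) fun k hk => ?_
  · exact Finset.mem_filter.2 ⟨Finset.mem_univ _, (hcomm k).symm.trans ((mem_weightSet hw).1 hk)⟩
  · exact (mem_weightSet hw).2 ((hcomm _).trans (Finset.mem_filter.1 hk).2)
  · rw [← quotientRingHom_cls, quotientRingHom_labelledConf]

/-! ### Cycles in the inertia varieties of Cartesian powers -/

theorem minimalPeriod_of_semiconj {S T : Type*} {σ : S → S} {τ : T → T} {ι : S → T}
    (hι : Injective ι) (h : Function.Semiconj ι σ τ) (a : S) :
    Function.minimalPeriod τ (ι a) = Function.minimalPeriod σ a :=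
  Function.minimalPeriod_eq_minimalPeriod_iff.2 fun m => by
    show τ^[m] (ι a) = ι a ↔ σ^[m] a = a
    rw [← h.iterate_right m a, hι.eq_iff]

namespace GVar

section Join

variable {A : GVar} {n i j : ℕ} (e : Fin i ⊕ Fin j ≃ Fin n)

/-- The point of `Xⁿ` with given parts in `Xⁱ` and `Xʲ`, where `i + j = n`. -/
def join (x : (A.power i).X) (y : (A.power j).X) : (A.power n).X :=
  powMk fun c => Sum.elim (entry x) (entry y) (e.symm c)

theorem entry_join_inl (x : (A.power i).X) (y : (A.power j).X) (a : Fin i) :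
    entry (join e x y) (e (Sum.inl a)) = entry x a :=
  (entry_mk _ _).trans (by rw [Equiv.symm_apply_apply]; rfl)

theorem entry_join_inr (x : (A.power i).X) (y : (A.power j).X) (b : Fin j) :
    entry (join e x y) (e (Sum.inr b)) = entry y b :=
  (entry_mk _ _).trans (by rw [Equiv.symm_apply_apply]; rfl)

/-- The element of `G_n` with given parts in `G_i` and `G_j`. -/
def joinG (v : (A.power i).G) (w : (A.power j).G) : (A.power n).G :=
  powG.symm (wreathSum e (powG v, powG w))

theorem joinG_smul (v : (A.power i).G) (w : (A.power j).G) (x : (A.power i).X)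
    (y : (A.power j).X) : joinG e v w • join e x y = join e (v • x) (w • y) := by
  refine pow_ext (forall_sum_block e (fun a => ?_) fun b => ?_)
  · rw [entry_join_inl, entry_smul, entry_smul, joinG, MulEquiv.apply_symm_apply,
      wreathSum_left_inl, wreathSum_right, sumPerm_inv_inl, entry_join_inl]
  · rw [entry_join_inr, entry_smul, entry_smul, joinG, MulEquiv.apply_symm_apply,
      wreathSum_left_inr, wreathSum_right, sumPerm_inv_inr, entry_join_inr]

theorem isRegular_join {T : QPVar} {φ : T → (A.power i).X} {ψ : T → (A.power j).X}
    (hφ : IsRegular φ) (hψ : IsRegular ψ) : IsRegular fun t => join e (φ t) (ψ t) :=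
  isRegular_powMk (forall_sum_block e
    (fun a => by
      simp only [Equiv.symm_apply_apply, Sum.elim_inl]
      exact (isRegular_entry a).comp hφ)
    fun b => by
      simp only [Equiv.symm_apply_apply, Sum.elim_inr]
      exact (isRegular_entry b).comp hψ)

theorem join_injective {x x' : (A.power i).X} {y y' : (A.power j).X}
    (h : join e x y = join e x' y') : x = x' ∧ y = y' :=
  ⟨pow_ext fun a => by rw [← entry_join_inl e x y, h, entry_join_inl],
    pow_ext fun b => by rw [← entry_join_inr e x y, h, entry_join_inr]⟩

theorem join_restrict (z : (A.power n).X) :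
    join e (powMk fun a => entry z (e (Sum.inl a))) (powMk fun b => entry z (e (Sum.inr b))) = z :=
  pow_ext (forall_sum_block e (fun a => by rw [entry_join_inl, entry_mk])
    fun b => by rw [entry_join_inr, entry_mk])

theorem joinG_injective {v v' : (A.power i).G} {w w' : (A.power j).G}
    (h : joinG e v w = joinG e v' w') : v = v' ∧ w = w' :=
  Prod.ext_iff.1 (wreathSum_injective e (powG.symm.injective h))

end Join

section Cycles

variable {A : GVar} {n : ℕ}

/-- The length of the cycle of `a` in an element of `G_n`. -/
def cycleLength (w : (A.power n).G) (a : Fin n) : ℕ := Function.minimalPeriod (powG w).right a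

theorem cycleLength_conj (g w : (A.power n).G) (a : Fin n) :
    cycleLength (g * w * g⁻¹) ((powG g).right a) = cycleLength w a := by
  refine minimalPeriod_of_semiconj (ι := (powG g).right) (Equiv.injective _) (fun b => ?_) a
  simp

theorem cycleLength_apply (w : (A.power n).G) (a : Fin n) :
    cycleLength w ((powG w).right a) = cycleLength w a :=
  minimalPeriod_of_semiconj (Equiv.injective _) (fun _ => rfl) a

theorem cycleLength_joinG_inl {i j : ℕ} (e : Fin i ⊕ Fin j ≃ Fin n) (v : (A.power i).G)
    (w : (A.power j).G) (a : Fin i) :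
    cycleLength (joinG e v w) (e (Sum.inl a)) = cycleLength v a :=
  minimalPeriod_of_semiconj (ι := fun a => e (Sum.inl a)) (e.injective.comp Sum.inl_injective)
    (fun b => (sumPerm_inl e _ b).symm) a

theorem cycleLength_joinG_inr {i j : ℕ} (e : Fin i ⊕ Fin j ≃ Fin n) (v : (A.power i).G)
    (w : (A.power j).G) (b : Fin j) :
    cycleLength (joinG e v w) (e (Sum.inr b)) = cycleLength w b :=
  minimalPeriod_of_semiconj (ι := fun b => e (Sum.inr b)) (e.injective.comp Sum.inr_injective)
    (fun b => (sumPerm_inr e _ b).symm) b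

variable (A n) in
/-- The elements of `G_n` with all cycle lengths in `L`. -/
def cycleSet (L : Set ℕ) : Set (A.power n).G := {w | ∀ a, cycleLength w a ∈ L}

theorem cycleSet_conj (L : Set ℕ) (g w : (A.power n).G) (hw : w ∈ cycleSet A n L) :
    g * w * g⁻¹ ∈ cycleSet A n L := fun a => by
  rw [← (powG g).right.apply_symm_apply a, cycleLength_conj]
  exact hw _

variable (A) in
/-- The part of the inertia variety of `(Xⁿ, G_n)` with all cycle lengths in `L`. -/
abbrev cyclePart (L : Set ℕ) (n : ℕ) : GVar :=
  (A.power n).inertiaOn (cycleSet A n L) (cycleSet_conj L)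

theorem cyclePart_cls_of_forall {L : Set ℕ} (h : ∀ w : (A.power n).G, ∀ a, cycleLength w a ∈ L) :
    (cyclePart A L n).cls = inertiaRingHom (A.power n).cls := by
  have : cycleSet A n L = Set.univ := Set.eq_univ_of_forall h
  rw [inertiaRingHom_cls, inertia_cls_eq_inertiaOn_univ, cyclePart]
  congr

theorem cyclePart_zero_cls (L : Set ℕ) : (cyclePart A L 0).cls = 1 := by
  rw [cyclePart_cls_of_forall fun _ a => a.elim0, power_zero_cls, map_one]

section Join

variable {i j : ℕ} (e : Fin i ⊕ Fin j ≃ Fin n) {L L' : Set ℕ}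

theorem joinG_mem (x : ((cyclePart A L i).prod (cyclePart A L' j)).X) :
    joinG e (onElt (pr₁ x)) (onElt (pr₂ x)) ∈ cycleSet A n (L ∪ L') :=
  forall_sum_block e
    (fun a => Or.inl ((cycleLength_joinG_inl _ _ _ a).symm ▸ onElt_mem (pr₁ x) a))
    fun b => Or.inr ((cycleLength_joinG_inr _ _ _ b).symm ▸ onElt_mem (pr₂ x) b)

theorem joinG_smul_join (x : ((cyclePart A L i).prod (cyclePart A L' j)).X) :
    joinG e (onElt (pr₁ x)) (onElt (pr₂ x)) • join e (onPos (pr₁ x)) (onPos (pr₂ x)) =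
      join e (onPos (pr₁ x)) (onPos (pr₂ x)) := by
  rw [joinG_smul, onElt_smul_pos, onElt_smul_pos]

/-- The point of the inertia variety of `(Xⁿ, G_n)` with given parts over two blocks. -/
def cycleJoin (x : ((cyclePart A L i).prod (cyclePart A L' j)).X) : (cyclePart A (L ∪ L') n).X :=
  onMk _ _ (joinG_smul_join e x) (joinG_mem e x)

theorem onElt_cycleJoin (x : ((cyclePart A L i).prod (cyclePart A L' j)).X) :
    onElt (cycleJoin e x) = joinG e (onElt (pr₁ x)) (onElt (pr₂ x)) := onElt_mk _ _ _ _

theorem onPos_cycleJoin (x : ((cyclePart A L i).prod (cyclePart A L' j)).X) :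
    onPos (cycleJoin e x) = join e (onPos (pr₁ x)) (onPos (pr₂ x)) := onPos_mk _ _ _ _

theorem isRegular_cycleJoin : IsRegular (cycleJoin (A := A) (L := L) (L' := L') e) :=
  isRegular_onMk (f := fun x => joinG e (onElt (pr₁ x)) (onElt (pr₂ x)))
    (((isLocallyConstant_onElt.comp_continuous isRegular_pr₁.continuous).prodMk
      (isLocallyConstant_onElt.comp_continuous isRegular_pr₂.continuous)).comp
      fun p => joinG e p.1 p.2).isOpen_fiber (isRegular_join _ (isRegular_onPos.comp isRegular_pr₁)
      (isRegular_onPos.comp isRegular_pr₂)) (joinG_smul_join e) (joinG_mem e)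

theorem cycleJoin_injective : Injective (cycleJoin (A := A) (L := L) (L' := L') e) := by
  intro x y h
  have h1 := congrArg onElt h
  have h2 := congrArg onPos h
  rw [onElt_cycleJoin, onElt_cycleJoin] at h1
  rw [onPos_cycleJoin, onPos_cycleJoin] at h2
  have h1 := joinG_injective _ h1
  have h2 := join_injective _ h2
  exact prod_ext (on_ext h1.1 h2.1) (on_ext h1.2 h2.2)

theorem joinG_mul (v v' : (A.power i).G) (w w' : (A.power j).G) :
    joinG e (v * v') (w * w') = joinG e v w * joinG e v' w' :=
  powG.injective (by
    rw [map_mul, joinG, joinG, joinG, MulEquiv.apply_symm_apply, MulEquiv.apply_symm_apply,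
      MulEquiv.apply_symm_apply, ← map_mul, Prod.mk_mul_mk, map_mul, map_mul])

theorem cycleJoin_smul (g : ((cyclePart A L i).prod (cyclePart A L' j)).G)
    (x : ((cyclePart A L i).prod (cyclePart A L' j)).X) :
    cycleJoin e (g • x) =
      (onG (A := A.power n) (hK := cycleSet_conj (L ∪ L'))).symm
        (joinG e (onG (prodG g).1) (onG (prodG g).2)) • cycleJoin e x := by
  refine on_ext ?_ ?_
  · have h1 : (joinG e (onG (prodG g).1) (onG (prodG g).2))⁻¹ =
        joinG e (onG (prodG g).1)⁻¹ (onG (prodG g).2)⁻¹ := by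
      rw [inv_eq_iff_mul_eq_one, ← joinG_mul, mul_inv_cancel, mul_inv_cancel]
      exact map_one (powG.symm.toMonoidHom.comp (wreathSum e))
    rw [onElt_cycleJoin, onElt_smul, onElt_cycleJoin, pr₁_smul, pr₂_smul, onElt_smul, onElt_smul,
      MulEquiv.apply_symm_apply, h1, joinG_mul, joinG_mul]
  · rw [onPos_cycleJoin, onPos_smul, onPos_cycleJoin, pr₁_smul, pr₂_smul, onPos_smul, onPos_smul,
      MulEquiv.apply_symm_apply, joinG_smul]

end Join

theorem cyclePart_union {L L' : Set ℕ} (hL : Disjoint L L') (n : ℕ) :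
    (cyclePart A (L ∪ L') n).cls = ∑ p ∈ antidiagonal n,
      (cyclePart A L p.1).cls * (cyclePart A L' p.2).cls := by
  let f : (cyclePart A (L ∪ L') n).X → Set (Fin n) := fun z => {a | cycleLength (onElt z) a ∈ L}
  have hf : ∀ z a, a ∈ f z ↔ cycleLength (onElt z) a ∈ L := fun _ _ => Iff.rfl
  -- the parts of an element for which the cycles with lengths in `L` form the first block
  have hsplit : ∀ (o : {p // p ∈ antidiagonal n}) (u : (A.power n).G),
      ∃ v w, {a | cycleLength u a ∈ L} = blockSet o → joinG (blockEquiv o) v w = u := fun o u => by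
    by_cases h : {a | cycleLength u a ∈ L} = blockSet o
    · obtain ⟨p, hp⟩ := mem_range_wreathSum (blockEquiv o) (w := powG u) fun a => by
        have h1 : (powG u).right (blockEquiv o (Sum.inl a)) ∈ blockSet o := by
          rw [← h, Set.mem_ofPred_eq, cycleLength_apply]
          exact h.symm.subset ⟨a, rfl⟩
        exact h1.imp fun _ => Eq.symm
      exact ⟨powG.symm p.1, powG.symm p.2, fun _ => powG.injective hp⟩
    · exact ⟨1, 1, fun h' => absurd h' h⟩
  choose v w hvw using hsplit
  refine cls_eq_sum_antidiagonal (P := cyclePart A (L ∪ L') n) (onG.trans powG) (f := f)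
    (fun w z => ?_) (fun S => ?_)
    (fun i => cyclePart A L i) (fun i => cyclePart A L' i) (fun i => onG.trans powG)
    (fun i => onG.trans powG) (fun o => cycleJoin (blockEquiv o))
    (fun o => isRegular_cycleJoin _) (fun o => cycleJoin_injective _)
    (fun o => cycleJoin_smul _)
    (fun o x => ?_) (fun o h => ?_)
  · ext a
    obtain ⟨b, rfl⟩ := (powG (onG w)).right.surjective a
    refine Iff.trans ?_ (Equiv.injective _).mem_set_image.symm
    rw [hf, hf, onElt_smul, cycleLength_conj]
  · exact (isClopen_onElt_mem {g | S ⊆ {a | cycleLength g a ∈ L}}).isClosed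
  · refine Set.ext (forall_sum_block (blockEquiv o) (fun a => ?_) fun b => ?_)
    · rw [hf, onElt_cycleJoin, cycleLength_joinG_inl]
      exact iff_of_true (onElt_mem (pr₁ x) a) ⟨a, rfl⟩
    · rw [hf, onElt_cycleJoin, cycleLength_joinG_inr]
      refine iff_of_false (hL.notMem_of_mem_right (onElt_mem (pr₂ x) b)) ?_
      rintro ⟨a, ha⟩
      exact Sum.inl_ne_inr ((blockEquiv o).injective ha)
  · have hz : ∀ z : (cyclePart A (L ∪ L') n).X.sub _ h,
        joinG (blockEquiv o) (v o (onElt (incl z))) (w o (onElt (incl z))) = onElt (incl z) :=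
      fun z => hvw o _ (incl_mem z)
    have hv : ∀ z : (cyclePart A (L ∪ L') n).X.sub _ h, v o (onElt (incl z)) ∈ cycleSet A _ L :=
      fun z a => by
        rw [← cycleLength_joinG_inl (blockEquiv o) _ (w o (onElt (incl z))), hz]
        exact (show f (incl z) = blockSet o from incl_mem z).symm.subset ⟨a, rfl⟩
    have hw : ∀ z : (cyclePart A (L ∪ L') n).X.sub _ h, w o (onElt (incl z)) ∈ cycleSet A _ L' :=
      fun z b => by
        have h1 := onElt_mem (incl z) (blockEquiv o (Sum.inr b))
        rw [← cycleLength_joinG_inr (blockEquiv o) (v o (onElt (incl z))), hz]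
        refine h1.resolve_left fun h2 => ?_
        obtain ⟨a, ha⟩ := (show f (incl z) = blockSet o from incl_mem z).subset h2
        exact Sum.inl_ne_inr ((blockEquiv o).injective ha)
    have hfix := fun z : (cyclePart A (L ∪ L') n).X.sub _ h => by
      have h1 := onElt_smul_pos (incl z)
      rw [← hz z, ← join_restrict (blockEquiv o) (onPos (incl z)), joinG_smul] at h1
      exact join_injective _ h1
    have hlc : IsLocallyConstant fun z : (cyclePart A (L ∪ L') n).X.sub _ h => onElt (incl z) :=
      isLocallyConstant_onElt.comp_continuous isRegular_incl.continuous
    have hentry : ∀ c, IsRegular fun z : (cyclePart A (L ∪ L') n).X.sub _ h =>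
        entry (onPos (incl z)) c := fun c =>
      (isRegular_entry c).comp (isRegular_onPos.comp isRegular_incl)
    refine ⟨fun z => pair (onMk _ _ (hfix z).1 (hv z)) (onMk _ _ (hfix z).2 (hw z)),
      isRegular_pair
        (isRegular_onMk (hlc.comp (v o)).isOpen_fiber (isRegular_powMk fun a => hentry _) _ _)
        (isRegular_onMk (hlc.comp (w o)).isOpen_fiber (isRegular_powMk fun b => hentry _) _ _),
      fun z => on_ext ?_ ?_⟩
    · rw [onElt_cycleJoin, pr₁_pair, pr₂_pair, onElt_mk, onElt_mk, hz]
    · rw [onPos_cycleJoin, pr₁_pair, pr₂_pair, onPos_mk, onPos_mk, join_restrict]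

end Cycles

end GVar

/-! ### Cycles of one and the same length -/

theorem exists_blocks {n r : ℕ} [NeZero r] (σ : Perm (Fin n))
    (h : ∀ a, Function.minimalPeriod σ a = r) :
    ∃ (k : ℕ) (e : Fin k × Fin r ≃ Fin n), ∀ a b,
      σ.SameCycle a b ↔ (e.symm a).1 = (e.symm b).1 := by
  let Ω := MulAction.orbitRel.Quotient (Subgroup.zpowers σ) (Fin n)
  let q : Fin n → Ω := Quotient.mk _
  let β : Ω ≃ Fin (Nat.card Ω) := Finite.equivFin Ω
  obtain ⟨ε, hε⟩ := exists_equiv_of_card_fibre_eq (f := fun p : Ω × Fin r => p.1) (g := q)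
    fun t => by
      obtain ⟨x, rfl⟩ := Quotient.exists_rep t
      have h1 : {b // q b = Quotient.mk _ x} ≃ MulAction.orbit (Subgroup.zpowers σ) x :=
        Equiv.subtypeEquivRight fun b => Quotient.eq (r := MulAction.orbitRel _ _)
      have h2 : {p : Ω × Fin r // p.1 = Quotient.mk _ x} ≃ Fin r :=
        { toFun := fun p => p.1.2, invFun := fun a => ⟨(_, a), rfl⟩,
          left_inv := fun ⟨p, hp⟩ => Subtype.ext (Prod.ext hp.symm rfl), right_inv := fun _ => rfl }
      rw [Nat.card_congr h1, Nat.card_congr h2, Nat.card_congr (MulAction.orbitZPowersEquiv σ x),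
        Nat.card_zmod, Nat.card_eq_fintype_card, Fintype.card_fin]
      exact (h x).symm
  refine ⟨_, (β.symm.prodCongr (Equiv.refl _)).trans ε, fun a b => ?_⟩
  have h3 : ∀ a, (((β.symm.prodCongr (Equiv.refl (Fin r))).trans ε).symm a).1 = β (q a) := fun a => by
    have h4 := hε (ε.symm a)
    rw [Equiv.apply_symm_apply] at h4
    exact congrArg β h4.symm
  rw [h3, h3, β.injective.eq_iff]
  refine Iff.trans ?_ (Quotient.eq (r := MulAction.orbitRel _ _)).symm
  exact ⟨fun ⟨m, hm⟩ => (MulAction.orbitRel _ _).symm ⟨⟨σ ^ m, m, rfl⟩, hm⟩,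
    fun h => Equiv.Perm.SameCycle.symm (let ⟨⟨_, m, hm⟩, h'⟩ := h
      ⟨m, (congrArg (· b) hm).trans h'⟩)⟩

theorem exists_iterate_eq {r : ℕ} (σ : Fin r → Fin r) {a : Fin r}
    (h : Function.minimalPeriod σ a = r) (b : Fin r) : ∃ m, σ^[m] a = b := by
  have h1 : Injective fun m : Fin r => σ^[m] a := fun m m' hm =>
    Fin.ext (Function.iterate_injOn_Iio_minimalPeriod (h.symm ▸ m.2) (h.symm ▸ m'.2) hm)
  obtain ⟨m, hm⟩ := Finite.surjective_of_injective h1 b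
  exact ⟨m, hm⟩

section Nest

variable {G : Type} [Group G] {n k r : ℕ} (e : Fin k × Fin r ≃ Fin n)

/-- The action of the iterated wreath product on the set of `k` blocks of `r` elements. -/
def nestPerm : GVar.Wreath (GVar.Wreath G r) k →* Perm (Fin n) :=
  e.permCongrHom.toMonoidHom.comp (MonoidHom.toHomPerm
    { toFun := fun w p => (w.right p.1, (w.left (w.right p.1)).right p.2)
      map_one' := rfl
      map_mul' := fun v w => funext fun p => Prod.ext rfl (by
        show ((v * w).left ((v * w).right p.1)).right p.2 =
          (v.left (v.right (w.right p.1))).right ((w.left (w.right p.1)).right p.2)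
        rw [wreath_mul_left, wreath_mul_right]
        show (v.left (v.right (w.right p.1))).right
          ((w.left (v.right.symm (v.right (w.right p.1)))).right p.2) = _
        rw [Equiv.symm_apply_apply]) })

theorem nestPerm_apply (w : GVar.Wreath (GVar.Wreath G r) k) (i : Fin k) (a : Fin r) :
    nestPerm e w (e (i, a)) = e (w.right i, (w.left (w.right i)).right a) := by
  exact congrArg (fun p => e (w.right p.1, (w.left (w.right p.1)).right p.2))
    (e.symm_apply_apply (i, a))

theorem nestPerm_inv_apply (w : GVar.Wreath (GVar.Wreath G r) k) (i : Fin k) (a : Fin r) :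
    (nestPerm e w)⁻¹ (e (i, a)) = e (w.right⁻¹ i, (w.left i).right⁻¹ a) := by
  rw [Equiv.Perm.inv_eq_iff_eq, nestPerm_apply]
  simp

/-- The embedding of the iterated wreath product defined by a decomposition of the set of `n`
elements into `k` blocks of `r` elements. -/
def nestHom : GVar.Wreath (GVar.Wreath G r) k →* GVar.Wreath G n :=
  wreathHom (nestPerm e) (fun w c => (w.left (e.symm c).1).left (e.symm c).2) fun v w c => by
    obtain ⟨⟨i, a⟩, rfl⟩ := e.surjective c
    rw [nestPerm_inv_apply, Equiv.symm_apply_apply, Equiv.symm_apply_apply]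
    rfl

theorem nestHom_left (w : GVar.Wreath (GVar.Wreath G r) k) (i : Fin k) (a : Fin r) :
    (nestHom e w).left (e (i, a)) = (w.left i).left a :=
  congrArg (fun p : Fin k × Fin r => (w.left p.1).left p.2) (e.symm_apply_apply (i, a))

theorem nestHom_right (w : GVar.Wreath (GVar.Wreath G r) k) :
    (nestHom e w).right = nestPerm e w := rfl

theorem forall_nest {P : Fin n → Prop} (h : ∀ i a, P (e (i, a))) (c : Fin n) : P c := by
  obtain ⟨⟨i, a⟩, rfl⟩ := e.surjective c
  exact h i a

theorem nestHom_injective [NeZero r] : Injective (nestHom (G := G) e) := by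
  intro v w h
  have h1 : ∀ i a, (v.right i, (v.left (v.right i)).right a) =
      (w.right i, (w.left (w.right i)).right a) := fun i a => e.injective (by
    rw [← nestPerm_apply, ← nestPerm_apply, ← nestHom_right, h, nestHom_right])
  have h2 : ∀ i, v.right i = w.right i := fun i => congrArg Prod.fst (h1 i 0)
  refine wreath_ext (fun i => wreath_ext (fun a => ?_) fun a => ?_) h2
  · rw [← nestHom_left e v, h, nestHom_left]
  · obtain ⟨i, rfl⟩ := v.right.surjective i
    have h3 := congrArg Prod.snd (h1 i a)
    rwa [← h2] at h3

/-- The elements that permute the blocks form the iterated wreath product. -/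
theorem mem_range_nestHom [NeZero r] {u : GVar.Wreath G n}
    (h : ∀ i a a', (e.symm (u.right (e (i, a)))).1 = (e.symm (u.right (e (i, a')))).1) :
    u ∈ (nestHom (G := G) e).range := by
  let s : Fin k → Fin k := fun i => (e.symm (u.right (e (i, 0)))).1
  let t : Fin k → Fin r → Fin r := fun i a => (e.symm (u.right (e (i, a)))).2
  have hst : ∀ i a, u.right (e (i, a)) = e (s i, t i a) := fun i a => by
    rw [← Equiv.symm_apply_eq]
    exact Prod.ext (h i a 0) rfl
  have hs : Surjective s := fun j => by
    obtain ⟨c, hc⟩ := u.right.surjective (e (j, 0))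
    obtain ⟨⟨i, a⟩, rfl⟩ := e.surjective c
    exact ⟨i, congrArg Prod.fst (e.injective ((hst i a).symm.trans hc))⟩
  have ht : ∀ i, Injective (t i) := fun i a a' haa => by
    have h1 : u.right (e (i, a)) = u.right (e (i, a')) := by rw [hst, hst, haa]
    exact congrArg Prod.snd (e.injective (u.right.injective h1))
  let s' : Perm (Fin k) := Equiv.ofBijective s (Finite.surjective_iff_bijective.1 hs)
  let t' : Fin k → Perm (Fin r) := fun i =>
    Equiv.ofBijective (t i) (Finite.injective_iff_bijective.1 (ht i))
  refine ⟨⟨fun i => ⟨fun a => u.left (e (i, a)), t' (s'.symm i)⟩, s'⟩,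
    wreath_ext (forall_nest e fun i a => nestHom_left e _ i a) (forall_nest e fun i a => ?_)⟩
  rw [nestHom_right, nestPerm_apply, hst]
  show e (s' i, t' (s'.symm (s' i)) a) = _
  rw [Equiv.symm_apply_apply]
  rfl

end Nest

namespace GVar

section Nest

variable {A : GVar} {n k r : ℕ} (e : Fin k × Fin r ≃ Fin n)

/-- The point of `Xⁿ` with given parts in `k` blocks of `r` components. -/
def nest (x : Fin k → (A.power r).X) : (A.power n).X :=
  powMk fun c => entry (x (e.symm c).1) (e.symm c).2

theorem entry_nest (x : Fin k → (A.power r).X) (i : Fin k) (a : Fin r) :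
    entry (nest e x) (e (i, a)) = entry (x i) a :=
  (entry_mk _ _).trans (by rw [Equiv.symm_apply_apply])

theorem nest_restrict (z : (A.power n).X) :
    nest e (fun i => powMk fun a => entry z (e (i, a))) = z :=
  pow_ext (forall_nest e fun i a => by rw [entry_nest, entry_mk])

theorem nest_injective : Injective (nest (A := A) e) := fun x y h =>
  funext fun i => pow_ext fun a => by rw [← entry_nest e x, h, entry_nest]

theorem isRegular_nest {T : QPVar} {φ : T → Fin k → (A.power r).X}
    (hφ : ∀ i, IsRegular fun t => φ t i) : IsRegular fun t => nest e (φ t) :=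
  isRegular_powMk fun _ => (isRegular_entry _).comp (hφ _)

theorem nestHom_smul (w : Wreath (Wreath A.G r) k) (x : Fin k → (A.power r).X) :
    (powG.symm (nestHom e w) : (A.power n).G) • nest e x =
      nest e fun i => (powG.symm (w.left i) : (A.power r).G) • x (w.right⁻¹ i) :=
  pow_ext (forall_nest e fun i a => by
    rw [entry_smul, entry_nest, entry_smul, MulEquiv.apply_symm_apply, MulEquiv.apply_symm_apply,
      nestHom_left, nestHom_right, nestPerm_inv_apply, entry_nest])

/-- The element of `G_n` with given parts in `k` blocks of `r` components. -/
def nestElt (u : Fin k → (A.power r).G) : (A.power n).G :=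
  powG.symm (nestHom e ⟨fun i => powG (u i), 1⟩)

theorem nestElt_smul (u : Fin k → (A.power r).G) (x : Fin k → (A.power r).X) :
    nestElt e u • nest e x = nest e fun i => u i • x i :=
  (nestHom_smul e _ x).trans (by simp)

theorem cycleLength_nestElt (u : Fin k → (A.power r).G) (i : Fin k) (a : Fin r) :
    cycleLength (nestElt e u) (e (i, a)) = cycleLength (u i) a :=
  minimalPeriod_of_semiconj (ι := fun a => e (i, a))
    (fun _ _ h => congrArg Prod.snd (e.injective h))
    (fun b => (nestPerm_apply e ⟨fun i => powG (u i), 1⟩ i b).symm) a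

theorem nestElt_injective [NeZero r] : Injective (nestElt (A := A) e) := fun _ _ h =>
  funext fun i => powG.injective (congrArg (fun w : Wreath (Wreath A.G r) k => w.left i)
    (nestHom_injective e (powG.symm.injective h)))

theorem nestElt_conj (w : Wreath (Wreath A.G r) k) (u : Fin k → (A.power r).G) :
    powG.symm (nestHom e w) * nestElt e u * (powG.symm (nestHom e w))⁻¹ =
      nestElt e fun i => powG.symm (w.left i) * u (w.right⁻¹ i) * (powG.symm (w.left i))⁻¹ := by
  rw [mul_inv_eq_iff_eq_mul, nestElt, nestElt, ← map_mul, ← map_mul, ← map_mul, ← map_mul]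
  congr 2
  refine wreath_ext (fun i => ?_) fun i => ?_
  · show w.left i * powG (u (w.right⁻¹ i)) =
      powG (powG.symm (w.left i) * u (w.right⁻¹ i) * (powG.symm (w.left i))⁻¹) * w.left i
    rw [map_mul, map_mul, map_inv, MulEquiv.apply_symm_apply, inv_mul_cancel_right]
  · rw [wreath_mul_right, wreath_mul_right, mul_one, one_mul]

/-- The point of the inertia variety of `(Xⁿ, G_n)` with given parts in `k` blocks. -/
def cycleNest (L : Set ℕ) (z : ((cyclePart A L r).power k).X) : (cyclePart A L n).X :=
  onMk (nestElt e fun i => onElt (entry z i)) (nest e fun i => onPos (entry z i))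
    (by rw [nestElt_smul]; congr 1; funext i; exact onElt_smul_pos _)
    (forall_nest e fun i a => by
      rw [cycleLength_nestElt]
      exact onElt_mem (entry z i) a)

theorem onElt_cycleNest (L : Set ℕ) (z : ((cyclePart A L r).power k).X) :
    onElt (cycleNest e L z) = nestElt e fun i => onElt (entry z i) := onElt_mk _ _ _ _

theorem onPos_cycleNest (L : Set ℕ) (z : ((cyclePart A L r).power k).X) :
    onPos (cycleNest e L z) = nest e fun i => onPos (entry z i) := onPos_mk _ _ _ _

theorem isLocallyConstant_pi {T I S : Type*} [TopologicalSpace T] [Finite I] {f : T → I → S}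
    (hf : ∀ i, IsLocallyConstant fun t => f t i) : IsLocallyConstant f :=
  (IsLocallyConstant.iff_eventually_eq f).2 fun t =>
    (Filter.eventually_all.2 fun i => (hf i).eventually_eq t).mono fun _ h => funext h

theorem isRegular_cycleNest (L : Set ℕ) : IsRegular (cycleNest (A := A) e L) :=
  isRegular_onMk (f := fun z => nestElt e fun i => onElt (entry z i))
    (((isLocallyConstant_pi fun i => isLocallyConstant_onElt.comp_continuous
      (isRegular_entry i).continuous).comp (nestElt e)).isOpen_fiber)
    (isRegular_nest e fun i => isRegular_onPos.comp (isRegular_entry i)) _ _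

theorem cycleNest_injective [NeZero r] (L : Set ℕ) :
    Injective (cycleNest (A := A) e L) := fun x y h => by
  have h1 := congrArg onElt h
  have h2 := congrArg onPos h
  rw [onElt_cycleNest, onElt_cycleNest] at h1
  rw [onPos_cycleNest, onPos_cycleNest] at h2
  exact pow_ext fun i => on_ext (congrFun (nestElt_injective e h1) i)
    (congrFun (nest_injective e h2) i)

/-- The homomorphism from the group of the `k`-th power of the inertia variety of `(Xʳ, G_r)` to
the iterated wreath product. -/
def cycleNestHom (L : Set ℕ) : ((cyclePart A L r).power k).G →* Wreath (Wreath A.G r) k :=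
  (wreathMap (onG.trans powG).toMonoidHom k).comp powG.toMonoidHom

theorem cycleNestHom_injective (L : Set ℕ) :
    Injective (cycleNestHom (A := A) (r := r) (k := k) L) :=
  (wreathMap_injective (f := (onG.trans powG).toMonoidHom) (onG.trans powG).injective k).comp
    powG.injective

theorem cycleNest_smul (L : Set ℕ) (g : ((cyclePart A L r).power k).G)
    (z : ((cyclePart A L r).power k).X) : cycleNest e L (g • z) =
      (onG (A := A.power n) (hK := cycleSet_conj L)).symm
        (powG.symm (nestHom e (cycleNestHom L g))) • cycleNest e L z := by
  have hl : ∀ i, powG.symm ((cycleNestHom L g).left i) = onG ((powG g).left i) := fun i =>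
    powG.symm_apply_apply _
  refine on_ext ?_ ?_
  · rw [onElt_cycleNest, onElt_smul, onElt_cycleNest, MulEquiv.apply_symm_apply, nestElt_conj]
    congr 1
    funext i
    rw [entry_smul, onElt_smul, hl]
    rfl
  · rw [onPos_cycleNest, onPos_smul, onPos_cycleNest, MulEquiv.apply_symm_apply, nestHom_smul]
    congr 1
    funext i
    rw [entry_smul, onPos_smul, hl]
    rfl

/-- The relation to lie in the same cycle. -/
def cycleRel (w : (A.power n).G) : Set (Fin n × Fin n) :=
  {p | (powG w).right.SameCycle p.1 p.2}

theorem mem_cycleRel_conj (g w : (A.power n).G) (p : Fin n × Fin n) :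
    p ∈ cycleRel (g * w * g⁻¹) ↔ ((powG g).right⁻¹ p.1, (powG g).right⁻¹ p.2) ∈ cycleRel w :=
  Equiv.Perm.sameCycle_conj (g := (powG g).right) (f := (powG w).right)

/-- The relation to lie in the same block. -/
def blockRel : Set (Fin n × Fin n) := {p | (e.symm p.1).1 = (e.symm p.2).1}

theorem cycleRel_cycleNest [NeZero r] (z : ((cyclePart A {r} r).power k).X) :
    cycleRel (onElt (cycleNest e {r} z)) = blockRel e := by
  rw [onElt_cycleNest]
  set u : Wreath (Wreath A.G r) k := ⟨fun i => powG (onElt (entry z i)), 1⟩ with hu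
  ext ⟨c, d⟩
  obtain ⟨⟨i, a⟩, rfl⟩ := e.surjective c
  obtain ⟨⟨j, b⟩, rfl⟩ := e.surjective d
  show (nestPerm e u).SameCycle (e (i, a)) (e (j, b)) ↔ (e.symm (e (i, a))).1 = (e.symm (e (j, b))).1
  rw [Equiv.symm_apply_apply, Equiv.symm_apply_apply]
  constructor
  · rintro ⟨m, hm⟩
    have h1 : (u ^ m).right = 1 :=
      (map_zpow (SemidirectProduct.rightHom (φ := mulAutArrow)) u m).trans (one_zpow m)
    rw [← map_zpow, nestPerm_apply, h1] at hm
    simpa using congrArg (fun c => (e.symm c).1) hm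
  · rintro (rfl : i = j)
    obtain ⟨m, rfl⟩ := exists_iterate_eq (powG (onElt (entry z i))).right
      (onElt_mem (entry z i) a) b
    refine ⟨m, ?_⟩
    have h2 : Function.Semiconj (fun a => e (i, a)) (powG (onElt (entry z i))).right
        (nestPerm e u) := fun b => (nestPerm_apply e u i b).symm
    rw [zpow_natCast, Equiv.Perm.coe_pow]
    exact (h2.iterate_right m a).symm

theorem exists_nestElt [NeZero r] (u : (A.power n).G) :
    ∃ v, cycleRel u = blockRel e → nestElt e v = u := by
  by_cases h : cycleRel u = blockRel e
  · have h1 : ∀ i a, (e.symm ((powG u).right (e (i, a)))).1 = i := fun i a => by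
      have h2 : (e (i, a), (powG u).right (e (i, a))) ∈ blockRel e := by
        rw [← h]
        exact ⟨1, by rw [zpow_one]⟩
      refine (show _ = _ from h2).symm.trans ?_
      rw [Equiv.symm_apply_apply]
    obtain ⟨w, hw⟩ := mem_range_nestHom e (u := powG u) fun i a a' => by rw [h1, h1]
    refine ⟨fun i => powG.symm (w.left i), fun _ => powG.injective
      ((MulEquiv.apply_symm_apply _ _).trans (Eq.trans (congrArg (nestHom e) ?_) hw))⟩
    refine wreath_ext (fun i => MulEquiv.apply_symm_apply _ _) fun i => ?_
    have h3 := h1 i 0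
    rw [← hw, nestHom_right, nestPerm_apply, Equiv.symm_apply_apply] at h3
    exact h3.symm
  · exact ⟨1, fun h' => absurd h' h⟩

/-- The part of the inertia variety of `(X^{kr}, G_{kr})` with all cycles of length `r` is induced
from the `k`-th power of the corresponding part for `(Xʳ, G_r)`: the cycles of such an element
form `k` blocks of `r` elements, and all decompositions into such blocks are conjugate. -/
theorem cyclePart_singleton [NeZero r] (e : Fin k × Fin r ≃ Fin n) :
    (cyclePart A {r} n).cls = ((cyclePart A {r} r).power k).cls := by
  let ρ : (cyclePart A {r} n).G →* Perm (Fin n) :=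
    SemidirectProduct.rightHom.comp (onG.trans powG).toMonoidHom
  let _ : MulAction (cyclePart A {r} n).G (Set (Fin n × Fin n)) :=
    { smul := fun g S => {p : Fin n × Fin n | ((ρ g)⁻¹ p.1, (ρ g)⁻¹ p.2) ∈ S}
      one_smul := fun S => by
        show {p : Fin n × Fin n | ((ρ 1)⁻¹ p.1, (ρ 1)⁻¹ p.2) ∈ S} = S
        rw [map_one]
        rfl
      mul_smul := fun g h S => by
        show {p : Fin n × Fin n | ((ρ (g * h))⁻¹ p.1, (ρ (g * h))⁻¹ p.2) ∈ S} = _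
        rw [map_mul]
        rfl }
  have hs : ∀ (g : (cyclePart A {r} n).G) (S : Set (Fin n × Fin n)) (p : Fin n × Fin n),
      p ∈ g • S ↔ ((ρ g)⁻¹ p.1, (ρ g)⁻¹ p.2) ∈ S := fun _ _ _ => Iff.rfl
  let j : ((cyclePart A {r} r).power k).G →* (cyclePart A {r} n).G :=
    (onG (A := A.power n) (hK := cycleSet_conj {r})).symm.toMonoidHom.comp
      (powG.symm.toMonoidHom.comp ((nestHom e).comp (cycleNestHom {r})))
  have hj : Injective j :=
    (onG (A := A.power n) (hK := cycleSet_conj {r})).symm.injective.comp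
      (powG.symm.injective.comp ((nestHom_injective e).comp (cycleNestHom_injective {r})))
  choose v hv using exists_nestElt (A := A) e
  refine (cls_eq_sum_strata_of_isClosed (A := cyclePart A {r} n) (I := Set (Fin n × Fin n))
    (f := fun z => cycleRel (onElt z)) (fun g z => ?_) (fun i => ?_) (O := Unit)
    (fun _ => blockRel e) (fun z => ⟨(), ?_⟩) (fun _ _ _ _ => rfl)
    (fun _ => (cyclePart A {r} r).power k)
    (fun _ => j) (fun _ => hj)
    (fun _ g h => ?_) (fun _ => cycleNest e {r}) (fun _ => isRegular_cycleNest e {r})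
    (fun _ => cycleNest_injective e {r}) (fun _ => cycleNest_smul e {r})
    (fun _ => cycleRel_cycleNest e) fun _ h => ?_).trans (Fintype.sum_unique _)
  · ext p
    rw [hs, onElt_smul, mem_cycleRel_conj]
    rfl
  · exact (isClopen_onElt_mem {g | cycleRel g = i}).isClosed
  · obtain ⟨k', e', he'⟩ := exists_blocks (r := r) (powG (onElt z)).right (onElt_mem z)
    obtain rfl : k' = k := by
      have h1 := (Fintype.card_congr e').trans (Fintype.card_congr e).symm
      rw [Fintype.card_prod, Fintype.card_prod, Fintype.card_fin, Fintype.card_fin,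
        Fintype.card_fin] at h1
      exact Nat.eq_of_mul_eq_mul_right (NeZero.pos r) h1
    refine ⟨onG.symm (powG.symm ⟨1, e.symm.trans e'⟩), ?_⟩
    ext p
    refine Iff.trans ?_ (he' p.1 p.2).symm
    show (e.symm (e (e'.symm p.1))).1 = (e.symm (e (e'.symm p.2))).1 ↔ _
    rw [Equiv.symm_apply_apply, Equiv.symm_apply_apply]
  · obtain ⟨w, hw⟩ := mem_range_nestHom e (u := powG (onG g)) fun i a a' => by
      have h1 : ((ρ g) (e (i, a)), (ρ g) (e (i, a'))) ∈ blockRel e := by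
        rw [← h, hs]
        show (e.symm ((ρ g)⁻¹ (ρ g (e (i, a))))).1 = (e.symm ((ρ g)⁻¹ (ρ g (e (i, a'))))).1
        rw [Equiv.Perm.inv_def, Equiv.symm_apply_apply, Equiv.symm_apply_apply,
          Equiv.symm_apply_apply, Equiv.symm_apply_apply]
      exact h1
    refine ⟨powG.symm ⟨fun i => onG.symm (powG.symm (w.left i)), w.right⟩, onG.injective
      (powG.injective (Eq.trans ?_ hw))⟩
    exact congrArg (nestHom e) (wreath_ext (fun i => rfl) fun i => rfl)
  · have hz : ∀ z : (cyclePart A {r} n).X.sub _ h, nestElt e (v (onElt (incl z))) = onElt (incl z) :=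
      fun z => hv _ (incl_mem z)
    have hmem : ∀ (z : (cyclePart A {r} n).X.sub _ h) i, v (onElt (incl z)) i ∈ cycleSet A r {r} :=
      fun z i a => by
        rw [← cycleLength_nestElt e, hz]
        exact onElt_mem (incl z) _
    have hfix : ∀ (z : (cyclePart A {r} n).X.sub _ h) i, v (onElt (incl z)) i •
        (powMk fun a => entry (onPos (incl z)) (e (i, a)) : (A.power r).X) =
        powMk fun a => entry (onPos (incl z)) (e (i, a)) := fun z i => by
      have h1 := onElt_smul_pos (incl z)
      rw [← hz z, ← nest_restrict e (onPos (incl z)), nestElt_smul] at h1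
      exact congrFun (nest_injective e h1) i
    have hlc : IsLocallyConstant fun z : (cyclePart A {r} n).X.sub _ h => onElt (incl z) :=
      isLocallyConstant_onElt.comp_continuous isRegular_incl.continuous
    refine ⟨fun z => powMk fun i => onMk _ _ (hfix z i) (hmem z i), isRegular_powMk fun i =>
      isRegular_onMk (hlc.comp fun u => v u i).isOpen_fiber (isRegular_powMk fun a =>
        (isRegular_entry _).comp (isRegular_onPos.comp isRegular_incl)) _ _,
      fun z => on_ext ?_ ?_⟩
    · rw [onElt_cycleNest]
      simp only [entry_mk, onElt_mk]
      exact hz z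
    · rw [onPos_cycleNest]
      simp only [entry_mk, onPos_mk]
      exact nest_restrict e _

end Nest

/-! ### The homomorphism `α` and Cartesian powers -/


variable {A : GVar} {n : ℕ}

variable (A) in
/-- The generating series of the parts of the inertia varieties of the powers with all cycle
lengths in `L`. -/
def cycleSeries (L : Set ℕ) : oneSeries K0fGr :=
  mkSeries (fun n => (cyclePart A L n).cls) (cyclePart_zero_cls L)

theorem coeffSeries_cycleSeries (L : Set ℕ) (n : ℕ) :
    coeffSeries n (A.cycleSeries L) = (cyclePart A L n).cls := coeffSeries_mkSeries _ _ n

theorem cycleSeries_union {L L' : Set ℕ} (h : Disjoint L L') :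
    A.cycleSeries (L ∪ L') = A.cycleSeries L * A.cycleSeries L' := oneSeries_ext fun n => by
  rw [coeffSeries_cycleSeries, cyclePart_union h, coeffSeries_mul]
  exact sum_congr rfl fun p _ => by rw [coeffSeries_cycleSeries, coeffSeries_cycleSeries]

theorem cycleSeries_singleton (r : ℕ) : A.cycleSeries {r + 1} =
    expandHom r (zeta.series (cyclePart A {r + 1} (r + 1)).cls) := oneSeries_ext fun m => by
  rw [coeffSeries_cycleSeries]
  by_cases hd : (r + 1) ∣ m
  · obtain ⟨k, rfl⟩ := hd
    rw [coeffSeries_expandHom_mul, zeta_series_cls, coeffSeries_zetaSeries]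
    exact cyclePart_singleton (finProdFinEquiv.trans (finCongr (mul_comm k (r + 1))))
  · rw [coeffSeries_expandHom_of_not_dvd _ _ hd]
    have : IsEmpty (cyclePart A {r + 1} m).X := ⟨fun z => hd (by
      obtain ⟨k, e, -⟩ := exists_blocks (r := r + 1) (powG (onElt z)).right (onElt_mem z)
      have h1 := Fintype.card_congr e
      rw [Fintype.card_prod, Fintype.card_fin, Fintype.card_fin, Fintype.card_fin] at h1
      exact ⟨k, by rw [← h1, mul_comm]⟩)⟩
    exact cls_eq_zero_of_isEmpty

theorem cycleSeries_Icc (N : ℕ) : A.cycleSeries (Set.Icc 1 N) = ∏ r ∈ Finset.range N,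
    expandHom r (zeta.series (cyclePart A {r + 1} (r + 1)).cls) := by
  induction N with
  | zero =>
    refine oneSeries_ext fun n => ?_
    rw [Finset.prod_range_zero]
    rcases n with _ | n
    · rw [coeffSeries_zero, coeffSeries_zero]
    · rw [coeffSeries_one n.succ_ne_zero, coeffSeries_cycleSeries]
      have : IsEmpty (cyclePart A (Set.Icc 1 0) (n + 1)).X :=
        ⟨fun z => absurd (onElt_mem z 0) (by simp)⟩
      exact cls_eq_zero_of_isEmpty
  | succ N ih =>
    have h : Set.Icc 1 (N + 1) = Set.Icc 1 N ∪ {N + 1} := by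
      ext x
      simp only [Set.mem_Icc, Set.mem_union, Set.mem_singleton_iff]
      omega
    rw [h, cycleSeries_union (by simp), cycleSeries_singleton, ih, Finset.prod_range_succ]

/-- The inertia varieties of the powers decompose according to the lengths of the cycles. -/
theorem mapSeries_inertiaRingHom_zeta (A : GVar) (N : ℕ) :
    EqMod N (mapSeries inertiaRingHom (zeta.series A.cls)) (∏ r ∈ Finset.range N,
      expandHom r (zeta.series (cyclePart A {r + 1} (r + 1)).cls)) := by
  intro n hn
  rw [← cycleSeries_Icc, coeffSeries_cycleSeries, coeffSeries_mapSeries, zeta_series_cls,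
    coeffSeries_zetaSeries]
  exact (cyclePart_cls_of_forall (L := Set.Icc 1 N) fun w a =>
    ⟨Function.minimalPeriod_pos_of_mem_periodicPts
      (Function.Injective.mem_periodicPts (Equiv.injective _) a),
    (Function.minimalPeriod_le_card.trans (Fintype.card_fin n).le).trans hn⟩).symm

/-! ### Roots of group elements -/

theorem quotientRingHom_inertiaRingHom_pow_succ (k : ℕ) (a : K0fGr) :
    quotientRingHom ((inertiaRingHom ^ (k + 1)) a) =
      quotientRingHom ((inertiaRingHom ^ k) (inertiaRingHom a)) := by
  rw [pow_succ]
  rfl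

section Root

variable {Y : GVar} {H : Type} [Group H] [Finite H] {j : H →* Y.G} {a : Y.G} {r : ℕ}

theorem pow_smul_eq (hax : ∀ x : Y.X, a • x = x) (i : ℕ) (x : Y.X) : a ^ i • x = x := by
  induction i with
  | zero => rw [pow_zero, one_smul]
  | succ i ih => rw [pow_succ, mul_smul, hax, ih]

/-- Let the group be generated by a subgroup and a central element `a` that acts trivially, its
powers `1, a, …, a^(r-1)` representing the cosets. Then the part of the inertia variety over every
coset is, for the action of the subgroup, the inertia variety of the subgroup. -/
theorem inertia_comap_cls (ha : ∀ g, a * g = g * a) (hax : ∀ x : Y.X, a • x = x)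
    (hj : Bijective fun p : H × Fin r => j p.1 * a ^ (p.2 : ℕ)) :
    (Y.inertia.comap (inertiaG.symm.toMonoidHom.comp j)).cls = r • (Y.comap j).inertia.cls := by
  let e : H × Fin r ≃ Y.G := Equiv.ofBijective _ hj
  have he : ∀ h i, e (h, i) = j h * a ^ (i : ℕ) := fun _ _ => rfl
  have hc : ∀ (i : ℕ) (g : Y.G), a ^ i * g = g * a ^ i := fun i g =>
    (Commute.pow_left (ha g) i : Commute (a ^ i) g)
  let C := Y.inertia.comap (inertiaG.symm.toMonoidHom.comp j)
  let el : C.X → Y.G := fun z => elt (comapVal z)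
  have hel : ∀ (h : C.G) (z : C.X), el (h • z) = j (comapG h) * el z * (j (comapG h))⁻¹ :=
    fun h z => elt_smul (A := Y) _ _
  have hlc : IsLocallyConstant el := fun S => (isClopen_elt_mem S).isOpen
  let f : C.X → Fin r := fun z => (e.symm (el z)).2
  have hf : IsLocallyConstant f := hlc.comp fun g => (e.symm g).2
  have hinv : ∀ (h : C.G) (z : C.X), f (h • z) = f z := fun h z => by
    obtain ⟨⟨b, i⟩, hb⟩ := e.surjective (el z)
    have h1 : el (h • z) = e (comapG h * b * (comapG h)⁻¹, i) := by
      rw [hel, ← hb, he, he, map_mul, map_mul, map_inv]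
      simp only [mul_assoc, hc]
    show (e.symm (el (h • z))).2 = (e.symm (el z)).2
    rw [h1, ← hb, e.symm_apply_apply, e.symm_apply_apply]
  refine (cls_eq_sum_fibres (A := C) f (fun i => (hf.isOpen_fiber i).isLocallyClosed) hinv).trans ?_
  refine (sum_congr rfl fun i _ => ?_).trans
    ((Finset.sum_const _).trans (by rw [Finset.card_univ, Fintype.card_fin]))
  have h1 : ∀ z : (Y.comap j).inertia.X,
      (j (comapG (elt z)) * a ^ (i : ℕ)) • comapVal (pos z) = comapVal (pos z) := fun z => by
    rw [mul_smul, pow_smul_eq hax, ← comapVal_smul, elt_smul_pos]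
  let F : (Y.comap j).inertia.X → C.X := fun z => comapMk (inertiaMk _ _ (h1 z))
  have hF : ∀ z, el (F z) = e (comapG (elt z), i) := fun z => elt_mk _ _ (h1 z)
  have hFm : ∀ z, f (F z) = i := fun z => by
    show (e.symm (el (F z))).2 = i
    rw [hF, e.symm_apply_apply]
  have hFr : IsRegular F := isRegular_comapMk.comp (isRegular_inertiaMk
    (f := fun z : (Y.comap j).inertia.X => j (comapG (elt z)) * a ^ (i : ℕ))
    (fun g => (isClopen_elt_mem {t : (Y.comap j).G | j (comapG t) * a ^ (i : ℕ) = g}).isOpen)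
    (isRegular_comapVal.comp isRegular_pos) h1)
  let Z := C.sub {z | f z = i} (hf.isOpen_fiber i).isLocallyClosed
    fun g x hx => (hinv g x).trans hx
  have h2 : ∀ z : Z.X, el (val z) = e ((e.symm (el (val z))).1, i) := fun z => by
    have h3 : (e.symm (el (val z))).2 = i := val_mem z
    exact (e.apply_symm_apply (el (val z))).symm.trans (congrArg e (Prod.ext rfl h3))
  have h4 : ∀ z : Z.X, (comapG.symm (e.symm (el (val z))).1 : (Y.comap j).G) •
      comapMk (j := j) (pos (comapVal (val z))) = comapMk (pos (comapVal (val z))) := fun z =>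
    comapVal_injective (by
      rw [comapVal_smul, comapVal_mk, MulEquiv.apply_symm_apply]
      have h5 : el (val z) • pos (comapVal (val z)) = pos (comapVal (val z)) := elt_smul_pos _
      rwa [h2, he, mul_smul, pow_smul_eq hax] at h5)
  have hGr : IsRegular fun z : Z.X => inertiaMk _ _ (h4 z) := isRegular_inertiaMk
    (f := fun z : Z.X => (comapG.symm (e.symm (el (val z))).1 : (Y.comap j).G))
    (((hlc.comp_continuous isRegular_val.continuous).comp fun g =>
      (comapG.symm (e.symm g).1 : (Y.comap j).G)).isOpen_fiber)
    (isRegular_comapMk.comp (isRegular_pos.comp (isRegular_comapVal.comp isRegular_val))) h4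
  refine (cls_eq (iso_of_inverse (A := (Y.comap j).inertia) (B := Z)
    (inertiaG.trans (comapG.trans (comapG.symm.trans subG.symm)))
    (isRegular_mkSub hFr hFm) hGr (fun z => inertia_ext ?_ ?_)
    (fun z => val_injective (comapVal_injective (inertia_ext ?_ ?_)))
    fun h z => val_injective (comapVal_injective (inertia_ext ?_ ?_)))).symm
  · rw [elt_mk]
    apply comapG.injective
    rw [MulEquiv.apply_symm_apply]
    show (e.symm (el (F z))).1 = _
    rw [hF, e.symm_apply_apply]
  · rw [pos_mk]
    exact pos_mk _ _ (h1 _)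
  · refine (elt_mk _ _ (h1 _)).trans ?_
    rw [elt_mk, MulEquiv.apply_symm_apply]
    exact (h2 z).symm
  · refine (pos_mk _ _ (h1 _)).trans ?_
    rw [pos_mk]
    rfl
  · refine (elt_mk _ _ (h1 _)).trans (Eq.trans ?_ (hel _ _).symm)
    refine Eq.trans ?_ (congrArg (fun t => _ * t * _) (hF z).symm)
    rw [he, elt_smul, map_mul, map_mul, map_inv, map_mul, map_mul, map_inv]
    simp only [mul_assoc, hc]
    rfl
  · refine (pos_mk _ _ (h1 _)).trans (Eq.trans ?_ (pos_smul (A := Y) _ _).symm)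
    refine Eq.trans ?_ (congrArg (_ • ·) (pos_mk _ _ (h1 _)).symm)
    rw [pos_smul, comapVal_smul]
    rfl

/-- If the group is generated by a subgroup and a central element `a` that acts trivially, its
powers `1, a, …, a^(r-1)` representing the cosets of the subgroup, then the passage to the subgroup
divides the generalized Euler characteristic of order `k` by `r^k`. -/
theorem quotientRingHom_inertia_pow_comap (k : ℕ) (ha : ∀ g, a * g = g * a)
    (hax : ∀ x : Y.X, a • x = x)
    (hj : Bijective fun p : H × Fin r => j p.1 * a ^ (p.2 : ℕ)) :
    quotientRingHom ((inertiaRingHom ^ k) Y.cls) =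
      r ^ k • quotientRingHom ((inertiaRingHom ^ k) (Y.comap j).cls) := by
  induction k generalizing Y with
  | zero =>
    rw [pow_zero, pow_zero, one_smul]
    refine quotientRingHom_cls_eq (A := Y) (B := Y.comap j) (φ := fun x => x) (ψ := fun x => x)
      (isRegular_id _) (isRegular_id _) (fun _ => rfl) (fun _ => rfl) fun x x' => ?_
    constructor
    · rintro ⟨g, rfl⟩
      obtain ⟨⟨h, i⟩, rfl⟩ := hj.2 g
      refine ⟨h, ?_⟩
      show j h • x = (j h * a ^ (i : ℕ)) • x
      rw [mul_smul, pow_smul_eq hax]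
    · rintro ⟨h, rfl⟩
      exact ⟨j h, rfl⟩
  | succ k ih =>
    rw [quotientRingHom_inertiaRingHom_pow_succ, quotientRingHom_inertiaRingHom_pow_succ,
      inertiaRingHom_cls, inertiaRingHom_cls,
      ih (Y := Y.inertia) (j := inertiaG.symm.toMonoidHom.comp j) (a := inertiaG.symm a)
        (fun g => ha _) (fun z => ?_) hj, inertia_comap_cls ha hax hj, map_nsmul, map_nsmul,
      smul_smul, pow_succ]
    refine inertia_ext ?_ ?_
    · rw [elt_smul, MulEquiv.apply_symm_apply, ha, mul_inv_cancel_right]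
    · rw [pos_smul, MulEquiv.apply_symm_apply, hax]

end Root

end GVar

/-! ### Elements of a wreath product with a single cycle -/

section Rot

variable {G : Type} [Group G] {r : ℕ} [NeZero r]

/-- The element of `G_r` over the standard cycle with the cycle product `g`. -/
def rot (r : ℕ) [NeZero r] (g : G) : GVar.Wreath G r :=
  ⟨fun a => if a = 0 then g else 1, Equiv.addRight 1⟩

/-- The diagonal embedding `G → G_r`. -/
def diag (r : ℕ) : G →* GVar.Wreath G r :=
  wreathHom 1 (fun h _ => h) fun _ _ _ => rfl

omit [NeZero r] in
theorem diag_left (h : G) (a : Fin r) : (diag r h).left a = h := rfl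

omit [NeZero r] in
theorem diag_right (h : G) : (diag r h).right = 1 := rfl

theorem rot_left (g : G) (a : Fin r) : (rot r g).left a = if a = 0 then g else 1 := rfl

theorem rot_right_apply (g : G) (a : Fin r) : (rot r g).right a = a + 1 := rfl

theorem rot_right_inv_apply (g : G) (a : Fin r) : (rot r g).right⁻¹ a = a - 1 :=
  Equiv.Perm.inv_eq_iff_eq.2 (sub_add_cancel a 1).symm

theorem ofNat_add_one (m : ℕ) : Fin.ofNat r m + 1 = Fin.ofNat r (m + 1) :=
  Fin.ext (by simp [Fin.val_add])

theorem ofNat_val (i : Fin r) : Fin.ofNat r i = i := Fin.ext (Nat.mod_eq_of_lt i.2)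

theorem rot_iterate_apply (g : G) (m : ℕ) (a : Fin r) :
    (rot r g).right^[m] a = a + Fin.ofNat r m := by
  induction m with
  | zero => exact (add_zero a).symm
  | succ m ih =>
    rw [Function.iterate_succ_apply', ih, rot_right_apply, add_assoc, ofNat_add_one]

theorem rot_pow_right_apply (g : G) (m : ℕ) (a : Fin r) :
    (rot r g ^ m).right a = a + Fin.ofNat r m := by
  rw [← rot_iterate_apply g, Equiv.Perm.iterate_eq_pow]
  exact congrArg (fun σ : Perm (Fin r) => σ a)
    (map_pow (SemidirectProduct.rightHom : GVar.Wreath G r →* _) (rot r g) m)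

theorem minimalPeriod_rot (g : G) (a : Fin r) :
    Function.minimalPeriod (rot r g).right a = r := by
  have h : ∀ m, Function.IsPeriodicPt (rot r g).right m a ↔ r ∣ m := fun m => by
    show (rot r g).right^[m] a = a ↔ _
    rw [rot_iterate_apply, add_eq_left, Fin.ext_iff, Nat.dvd_iff_mod_eq_zero]
    rfl
  exact Nat.dvd_antisymm ((h r).2 dvd_rfl).minimalPeriod_dvd
    ((h _).1 (Function.isPeriodicPt_minimalPeriod _ _))

theorem diag_mul_rot {g g' h : G} (H : h * g = g' * h) :
    diag r h * rot r g = rot r g' * diag r h := by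
  refine wreath_ext (fun a => ?_) fun a => ?_
  · rw [wreath_mul_left, wreath_mul_left, diag_left, diag_left, diag_right, inv_one, rot_left,
      rot_left, Equiv.Perm.one_apply]
    split_ifs
    · exact H
    · rw [mul_one, one_mul]
  · rfl

/-- The elements conjugating `rot r g` to `rot r g'`; for `g = g'`, the centralizer. -/
theorem exists_eq_diag_mul_rot_pow {g g' : G} {u : GVar.Wreath G r}
    (H : u * rot r g = rot r g' * u) :
    ∃ (h : G) (i : Fin r), h * g = g' * h ∧ u = diag r h * rot r g ^ (i : ℕ) := by
  set i := u.right 0 with hi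
  set v := u * (rot r g ^ (i : ℕ))⁻¹ with hv
  have huv : u = v * rot r g ^ (i : ℕ) := (inv_mul_cancel_right _ _).symm
  have hvw : v * rot r g = rot r g' * v := by
    have hc : (rot r g ^ (i : ℕ))⁻¹ * rot r g = rot r g * (rot r g ^ (i : ℕ))⁻¹ :=
      (((Commute.refl (rot r g)).pow_left i).inv_left : Commute _ _)
    rw [hv, mul_assoc, hc, ← mul_assoc, H, mul_assoc]
  have hr : ∀ a, v.right (a + 1) = v.right a + 1 := fun a =>
    congrArg (fun w : GVar.Wreath G r => w.right a) hvw
  have hm : ∀ m, v.right (Fin.ofNat r m) = v.right 0 + Fin.ofNat r m := fun m => by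
    induction m with
    | zero => exact (add_zero _).symm
    | succ m ih => rw [← ofNat_add_one, hr, ih, add_assoc]
  have h0 : v.right 0 = 0 := by
    have h1 : u.right 0 = v.right ((rot r g ^ (i : ℕ)).right 0) :=
      congrArg (fun w : GVar.Wreath G r => w.right 0) huv
    rw [rot_pow_right_apply, zero_add, hm, ofNat_val, ← hi] at h1
    exact add_eq_right.1 h1.symm
  have hv1 : ∀ a, v.right a = a := fun a => by
    rw [← ofNat_val a, hm, h0, zero_add]
  have hl : ∀ a, v.left a * (rot r g).left a = (rot r g').left a * v.left (a - 1) := fun a => by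
    have h1 : v.left a * (rot r g).left (v.right⁻¹ a) =
        (rot r g').left a * v.left ((rot r g').right⁻¹ a) :=
      congrArg (fun w : GVar.Wreath G r => w.left a) hvw
    rwa [rot_right_inv_apply, Equiv.Perm.inv_eq_iff_eq.2 (hv1 a).symm] at h1
  have hc : ∀ m, v.left (Fin.ofNat r m) = v.left 0 := fun m => by
    induction m with
    | zero => rfl
    | succ m ih =>
      by_cases h : Fin.ofNat r (m + 1) = 0
      · rw [h]
      · have h1 := hl (Fin.ofNat r (m + 1))
        rwa [rot_left, rot_left, if_neg h, if_neg h, mul_one, one_mul, ← ofNat_add_one,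
          add_sub_cancel_right, ih, ofNat_add_one] at h1
  have hc' : ∀ a, v.left a = v.left 0 := fun a => by rw [← ofNat_val a, hc]
  refine ⟨v.left 0, i, ?_, huv.trans (congrArg (· * _) (wreath_ext hc' hv1))⟩
  have h1 := hl 0
  rwa [rot_left, rot_left, if_pos rfl, if_pos rfl, hc' (0 - 1)] at h1

/-- The product of the labels along the first `m` steps of the cycle of `0`. -/
def cycleProd (w : GVar.Wreath G r) : ℕ → G
  | 0 => 1
  | m + 1 => w.left (w.right^[m + 1] 0) * cycleProd w m

/-- An element of the wreath product with a single cycle is conjugate to the element over the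
standard cycle with the product of its components around the cycle. -/
theorem exists_mul_rot_eq {w : GVar.Wreath G r} (hw : Function.minimalPeriod w.right 0 = r) :
    ∃ (u : GVar.Wreath G r) (g : G), u * rot r g = w * u := by
  have hmod : ∀ m, w.right^[m % r] 0 = w.right^[m] 0 := fun m =>
    (congrArg (fun q => w.right^[m % q] 0) hw.symm).trans Function.iterate_mod_minimalPeriod_eq
  have hs : Surjective fun m : Fin r => w.right^[m] 0 := fun b => by
    obtain ⟨m, hm⟩ := exists_iterate_eq w.right hw b
    exact ⟨Fin.ofNat r m, (hmod m).trans hm⟩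
  let τ : Perm (Fin r) := Equiv.ofBijective _ ⟨Finite.injective_iff_surjective.2 hs, hs⟩
  have hτ : ∀ m, τ (Fin.ofNat r m) = w.right^[m] 0 := hmod
  have hτ1 : ∀ i, τ (i + 1) = w.right (τ i) := fun i => by
    rw [← ofNat_val i, ofNat_add_one, hτ, hτ, Function.iterate_succ_apply']
  -- the components of `u` along the cycle are the partial products, so that the components of
  -- `u * rot r g` and `w * u` agree except at the start of the cycle; `g` closes the cycle
  refine ⟨⟨fun a => cycleProd w (τ.symm a), τ⟩,
    w.left 0 * cycleProd w ((0 - 1 : Fin r) : ℕ), wreath_ext (fun a => ?_) hτ1⟩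
  obtain ⟨i, rfl⟩ := τ.surjective a
  have h1 : w.right⁻¹ (τ i) = τ (i - 1) := Equiv.Perm.inv_eq_iff_eq.2 (by
    rw [← hτ1, sub_add_cancel])
  rw [wreath_mul_left, wreath_mul_left, h1]
  show cycleProd w (τ.symm (τ i)) * (rot r _).left (τ.symm (τ i)) =
    w.left (τ i) * cycleProd w (τ.symm (τ (i - 1)))
  rw [Equiv.symm_apply_apply, Equiv.symm_apply_apply, rot_left]
  by_cases hi : i = 0
  · subst hi
    rw [if_pos rfl]
    exact one_mul _
  · have h2 : (i : ℕ) = ((i - 1 : Fin r) : ℕ) + 1 := by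
      rw [Fin.val_sub_one_of_ne_zero hi]
      have h3 : (i : ℕ) ≠ 0 := fun h => hi (Fin.ext h)
      omega
    rw [if_neg hi, mul_one]
    conv_lhs => rw [h2]
    show w.left (w.right^[_ + 1] 0) * _ = _
    rw [← h2]
    rfl

end Rot

namespace GVar

variable {A : GVar} {r : ℕ} [NeZero r]

variable (r) in
/-- The element of the group of the `r`-th power over the standard cycle with the cycle product
`g`. -/
def rotElt (g : A.G) : (A.power r).G := powG.symm (rot r g)

theorem rotElt_mem (g : A.G) : rotElt r g ∈ cycleSet A r {r} := fun a => by
  show Function.minimalPeriod _ a = r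
  rw [rotElt, MulEquiv.apply_symm_apply, minimalPeriod_rot]

theorem cyclePart_self_cls [Fintype (ConjClasses A.G)] : (cyclePart A {r} r).cls =
    ∑ c : ConjClasses A.G, ((A.power r).fixed (rotElt r (Quotient.out c))).cls := by
  refine inertiaOn_cls (A := A.power r) (fun c : ConjClasses A.G => rotElt r (Quotient.out c))
    (fun c => rotElt_mem _) (fun w hw => ?_) fun c c' u h => ?_
  · obtain ⟨u, g, h⟩ := exists_mul_rot_eq (w := powG w) (hw 0)
    obtain ⟨k, hk⟩ := isConj_iff.1 (ConjClasses.mk_eq_mk_iff_isConj.1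
      (Quotient.out_eq (ConjClasses.mk g)))
    refine ⟨ConjClasses.mk g, powG.symm (u * diag r k), ?_⟩
    apply powG.injective
    rw [map_mul, map_mul, map_inv, rotElt, MulEquiv.apply_symm_apply, MulEquiv.apply_symm_apply,
      mul_inv_eq_iff_eq_mul, mul_assoc, diag_mul_rot (mul_inv_eq_iff_eq_mul.1 hk), ← mul_assoc, h,
      mul_assoc]
  · have h1 : powG u * rot r (Quotient.out c) = rot r (Quotient.out c') * powG u := by
      have h2 := congrArg powG (mul_inv_eq_iff_eq_mul.1 h)
      rwa [map_mul, map_mul, rotElt, rotElt, MulEquiv.apply_symm_apply,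
        MulEquiv.apply_symm_apply] at h2
    obtain ⟨k, -, hk, -⟩ := exists_eq_diag_mul_rot_pow h1
    have h3 : ConjClasses.mk (Quotient.out c) = ConjClasses.mk (Quotient.out c') :=
      ConjClasses.mk_eq_mk_iff_isConj.2 (isConj_iff.2 ⟨k, mul_inv_eq_iff_eq_mul.2 hk⟩)
    exact (Quotient.out_eq c).symm.trans (h3.trans (Quotient.out_eq c'))

section Fixed

variable {g : A.G}

/-- The diagonal embedding of the centralizer of `g` into the centralizer of the element over the
standard cycle with the cycle product `g`. -/
def diagHom (r : ℕ) [NeZero r] (g : A.G) :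
    Subgroup.centralizer {g} →* ((A.power r).fixed (rotElt r g)).G :=
  fixedG.symm.toMonoidHom.comp
    ((powG.symm.toMonoidHom.comp ((diag r).comp (Subgroup.subtype _))).codRestrict _ fun h =>
      Subgroup.mem_centralizer_singleton_iff.2 (by
        have h1 := congrArg (powG (A := A) (n := r)).symm (diag_mul_rot (r := r)
          (Subgroup.mem_centralizer_singleton_iff.1 h.2))
        rwa [map_mul, map_mul] at h1))

/-- The element over the standard cycle as an element of its centralizer. -/
def rotCentral (r : ℕ) [NeZero r] (g : A.G) : ((A.power r).fixed (rotElt r g)).G :=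
  fixedG.symm ⟨rotElt r g, Subgroup.mem_centralizer_singleton_iff.2 rfl⟩

theorem diagHom_bijective : Bijective fun p : Subgroup.centralizer {g} × Fin r =>
    diagHom r g p.1 * rotCentral r g ^ (p.2 : ℕ) := by
  have hp : ∀ p : Subgroup.centralizer {g} × Fin r,
      powG (fixedG (diagHom r g p.1 * rotCentral r g ^ (p.2 : ℕ))).1 =
        diag r p.1.1 * rot r g ^ (p.2 : ℕ) := fun _ => rfl
  constructor
  · rintro ⟨h, i⟩ ⟨h', i'⟩ H
    have H' : diag r h.1 * rot r g ^ (i : ℕ) = diag r h'.1 * rot r g ^ (i' : ℕ) := by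
      rw [← hp (h, i), ← hp (h', i')]
      exact congrArg (fun t => powG (fixedG t).1) H
    have hi : i = i' := by
      have h1 := congrArg (fun w : Wreath A.G r => w.right 0) H'
      simp only [wreath_mul_right, diag_right, one_mul, rot_pow_right_apply, ofNat_val, zero_add] at h1
      exact h1
    subst hi
    have h2 : (diag r h.1).left 0 = (diag r h'.1).left 0 :=
      congrArg (fun w : Wreath A.G r => w.left 0) (mul_right_cancel H')
    exact Prod.ext (Subtype.ext h2) rfl
  · intro u
    have h1 := congrArg powG (Subgroup.mem_centralizer_singleton_iff.1 (fixedG u).2)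
    rw [map_mul, map_mul] at h1
    obtain ⟨h, i, hh, hu⟩ := exists_eq_diag_mul_rot_pow h1
    exact ⟨(⟨h, Subgroup.mem_centralizer_singleton_iff.2 hh⟩, i),
      fixedG.injective (Subtype.ext (powG.injective ((hp _).trans hu.symm)))⟩

theorem entry_rotElt_smul (z : (A.power r).X) (a : Fin r) :
    entry (rotElt r g • z) a = (if a = 0 then g else 1) • entry z (a - 1) := by
  rw [entry_smul, rotElt, MulEquiv.apply_symm_apply, rot_left, rot_right_inv_apply]

theorem entry_of_rotElt_smul {z : (A.power r).X} (hz : rotElt r g • z = z) (a : Fin r) :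
    entry z a = entry z 0 := by
  have h : ∀ m, entry z (Fin.ofNat r m) = entry z 0 := fun m => by
    induction m with
    | zero => rfl
    | succ m ih =>
      by_cases h : Fin.ofNat r (m + 1) = 0
      · rw [h]
      · have h1 := congrArg (fun w => entry w (Fin.ofNat r (m + 1))) hz
        simp only [entry_rotElt_smul] at h1
        rwa [if_neg h, one_smul, ← ofNat_add_one, add_sub_cancel_right, ih, ofNat_add_one,
          eq_comm] at h1
  rw [← ofNat_val a, h]

theorem smul_entry_of_rotElt_smul {z : (A.power r).X} (hz : rotElt r g • z = z) :
    g • entry z 0 = entry z 0 := by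
  have h1 : entry (rotElt r g • z) 0 = entry z 0 := congrArg (fun w => entry w 0) hz
  rwa [entry_rotElt_smul, if_pos rfl, entry_of_rotElt_smul hz] at h1

theorem rotElt_smul_powMk {x : A.X} (hx : g • x = x) :
    rotElt r g • (powMk fun _ => x : (A.power r).X) = powMk fun _ => x := by
  refine pow_ext fun a => ?_
  rw [entry_rotElt_smul, entry_mk, entry_mk]
  split_ifs
  · exact hx
  · exact one_smul _ _

/-- The diagonal map identifies the fixed points of `g` with the fixed points of the element over
the standard cycle. -/
theorem comap_diagHom_cls :
    (((A.power r).fixed (rotElt r g)).comap (diagHom r g)).cls = (A.fixed g).cls := by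
  have h1 : ∀ z : (((A.power r).fixed (rotElt r g)).comap (diagHom r g)).X,
      g • entry (fixedVal (comapVal z)) 0 = entry (fixedVal (comapVal z)) 0 :=
    fun z => smul_entry_of_rotElt_smul (smul_fixedVal _)
  have h2 : ∀ x : (A.fixed g).X, rotElt r g • (powMk fun _ => fixedVal x : (A.power r).X) =
      powMk fun _ => fixedVal x := fun x => rotElt_smul_powMk (smul_fixedVal x)
  refine cls_eq (iso_of_inverse (comapG.trans fixedG.symm)
    (isRegular_fixedMk ((isRegular_entry 0).comp (isRegular_fixedVal.comp isRegular_comapVal)) h1)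
    (isRegular_comapMk.comp (isRegular_fixedMk
      (isRegular_powMk fun _ => isRegular_fixedVal) h2))
    (fun z => comapVal_injective (fixedVal_injective (pow_ext fun a => ?_)))
    (fun x => fixedVal_injective ?_) fun h z => fixedVal_injective ?_)
  · rw [comapVal_mk, fixedVal_mk, entry_mk, fixedVal_mk]
    exact (entry_of_rotElt_smul (smul_fixedVal _) a).symm
  · rw [fixedVal_mk, comapVal_mk, fixedVal_mk, entry_mk]
  · rw [fixedVal_mk, fixedVal_smul, fixedVal_mk, comapVal_smul, fixedVal_smul, entry_smul]
    rfl

end Fixed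

/-- The contribution of the cycles of length `r`, in terms of the generalized Euler characteristic
of order `k + 1`. -/
theorem quotientRingHom_cyclePart_self (k : ℕ) :
    quotientRingHom ((inertiaRingHom ^ k) (cyclePart A {r} r).cls) =
      r ^ k • quotientRingHom ((inertiaRingHom ^ (k + 1)) A.cls) := by
  let _ : Fintype (ConjClasses A.G) := Fintype.ofFinite _
  rw [quotientRingHom_inertiaRingHom_pow_succ, inertiaRingHom_cls, inertia_cls_eq_finsum,
    finsum_eq_sum_of_fintype, cyclePart_self_cls, map_sum, map_sum, map_sum, map_sum,
    Finset.smul_sum]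
  refine sum_congr rfl fun c _ => ?_
  rw [quotientRingHom_inertia_pow_comap (j := diagHom r (Quotient.out c))
    (a := rotCentral r (Quotient.out c)) k (fun u => ?_) (fun x => ?_) diagHom_bijective,
    comap_diagHom_cls]
  · exact fixedG.injective (Subtype.ext
      (Subgroup.mem_centralizer_singleton_iff.1 (fixedG u).2).symm)
  · exact fixedVal_injective (smul_fixedVal x)

end GVar

/-! ### The product defining the λ-structures of higher order -/

section EulerProduct

variable {R : Type*} [CommRing R]

variable (R) in
/-- The series `1 - t^m` for `m ≥ 1`. -/
def oneSub (m : ℕ) : oneSeries R :=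
  expandHom (m - 1) ⟨1 - PowerSeries.X, by
    show PowerSeries.constantCoeff _ = 1
    rw [map_sub, map_one, PowerSeries.constantCoeff_X, sub_zero]⟩

theorem oneSub_val {m : ℕ} (hm : m ≠ 0) : (oneSub R m).1 = 1 - PowerSeries.X ^ m := by
  obtain ⟨m, rfl⟩ := Nat.exists_eq_succ_of_ne_zero hm
  refine (expandHom_val _ _).trans ?_
  rw [map_sub, map_one, PowerSeries.expand_X]
  rfl

theorem EqMod.pow {n : ℕ} {A B : oneSeries R} (h : EqMod n A B) (m : ℕ) :
    EqMod n (A ^ m) (B ^ m) := by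
  rw [← Finset.card_range m, ← Finset.prod_const, ← Finset.prod_const]
  exact EqMod.prod _ fun _ _ => h

theorem expandHom_oneSub (s : ℕ) {m : ℕ} (hm : m ≠ 0) :
    expandHom s (oneSub R m) = oneSub R (m * (s + 1)) := by
  rw [oneSub, oneSub, expandHom_expandHom, Nat.sub_add_cancel (Nat.one_le_iff_ne_zero.2 hm),
    mul_comm]

theorem oneSub_eqMod_one {n m : ℕ} (h : n < m) : EqMod n (oneSub R m) 1 :=
  (expandHom_eqMod_one (m - 1) _).mono (Nat.le_sub_one_of_lt h)

variable (R) in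
/-- The product of the factors of `eulerProduct` with `r_1, …, r_k ≤ N`. -/
def partialEuler (N k : ℕ) : oneSeries R :=
  ∏ r ∈ Fintype.piFinset (fun _ : Fin k => Finset.Icc 1 N),
    oneSub R (∏ i, r i) ^ (∏ i, r i ^ (i : ℕ))

theorem prod_ne_zero_of_mem {N k : ℕ} {r : Fin k → ℕ}
    (hr : r ∈ Fintype.piFinset (fun _ : Fin k => Finset.Icc 1 N)) : ∏ i, r i ≠ 0 :=
  Finset.prod_ne_zero_iff.2 fun i _ =>
    Nat.one_le_iff_ne_zero.1 (Finset.mem_Icc.1 (Fintype.mem_piFinset.1 hr i)).1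

theorem coeffSeries_eulerProduct (k n : ℕ) :
    coeffSeries n (eulerProduct R k) = coeffSeries n (partialEuler R n k) := by
  rw [coeffSeries, coeffSeries, eulerProduct, PowerSeries.coeff_mk, partialEuler, Submonoid.coe_finsetProd]
  congr 1
  refine prod_congr rfl fun r hr => ?_
  rw [SubmonoidClass.coe_pow, oneSub_val (prod_ne_zero_of_mem hr)]

theorem partialEuler_eqMod {n N : ℕ} (h : n ≤ N) (k : ℕ) :
    EqMod n (partialEuler R N k) (partialEuler R n k) := by
  have hs : Fintype.piFinset (fun _ : Fin k => Finset.Icc 1 n) ⊆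
      Fintype.piFinset (fun _ : Fin k => Finset.Icc 1 N) :=
    Fintype.piFinset_subset _ _ fun _ => Finset.Icc_subset_Icc_right h
  have h0 : EqMod n (∏ r ∈ Fintype.piFinset (fun _ : Fin k => Finset.Icc 1 N) \
      Fintype.piFinset (fun _ : Fin k => Finset.Icc 1 n),
      oneSub R (∏ i, r i) ^ (∏ i, r i ^ (i : ℕ))) 1 := by
    refine (EqMod.prod (g := fun _ => 1) _ fun r hr => ?_).trans
      (by rw [Finset.prod_const_one]; exact EqMod.refl n 1)
    obtain ⟨hr, hr'⟩ := Finset.mem_sdiff.1 hr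
    rw [Fintype.mem_piFinset, not_forall] at hr'
    obtain ⟨i, hi⟩ := hr'
    have h1 := (Finset.mem_Icc.1 (Fintype.mem_piFinset.1 hr i)).1
    have h2 : n < r i := by
      rw [Finset.mem_Icc] at hi
      omega
    have h3 : r i ≤ ∏ i, r i := Nat.le_of_dvd (Nat.pos_of_ne_zero (prod_ne_zero_of_mem hr))
      (Finset.dvd_prod_of_mem r (Finset.mem_univ i))
    have h4 := (oneSub_eqMod_one (R := R) (h2.trans_le h3)).pow (∏ i, r i ^ (i : ℕ))
    rwa [one_pow] at h4
  rw [partialEuler, ← Finset.prod_sdiff hs]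
  have h1 := h0.mul (EqMod.refl n (partialEuler R n k))
  rwa [one_mul] at h1

theorem eulerProduct_eqMod (N k : ℕ) : EqMod N (eulerProduct R k) (partialEuler R N k) :=
  fun n hn => (coeffSeries_eulerProduct k n).trans (partialEuler_eqMod hn k n le_rfl).symm

/-- Splitting off the index `r_{k+1}`. -/
theorem partialEuler_succ (N k : ℕ) : partialEuler R N (k + 1) =
    ∏ s ∈ Finset.range N, expandHom s (partialEuler R N k ^ (s + 1) ^ k) := by
  have h1 : partialEuler R N (k + 1) = ∏ p ∈ Finset.Icc 1 N ×ˢ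
      Fintype.piFinset (fun _ : Fin k => Finset.Icc 1 N),
        (oneSub R ((∏ i, p.2 i) * p.1) ^ (∏ i, p.2 i ^ (i : ℕ))) ^ p.1 ^ k := by
    refine (Finset.prod_equiv (Fin.snocEquiv fun _ : Fin (k + 1) => ℕ) (fun p => ?_)
      fun p _ => ?_).symm
    · rw [Finset.mem_product, Fintype.mem_piFinset, Fintype.mem_piFinset, Fin.forall_fin_succ']
      simp [Fin.snocEquiv, and_comm]
    · rw [Fin.prod_univ_castSucc, Fin.prod_univ_castSucc, ← pow_mul]
      simp [Fin.snocEquiv]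
  rw [h1, Finset.prod_product]
  have h2 : ∀ f : ℕ → oneSeries R, ∏ s ∈ Finset.Icc 1 N, f s = ∏ s ∈ Finset.range N, f (s + 1) := by
    intro f
    rw [Finset.range_eq_Ico, Finset.prod_Ico_add' f 0 N 1]
    rfl
  rw [h2]
  refine prod_congr rfl fun s _ => ?_
  rw [partialEuler, map_pow, map_prod]
  simp only [Finset.prod_pow]
  congr 1
  refine prod_congr rfl fun r hr => ?_
  rw [map_pow, expandHom_oneSub s (prod_ne_zero_of_mem hr)]

/-- The factorization of the product of order `k + 1` by its last index. -/
theorem eulerProduct_succ_eqMod (N k : ℕ) : EqMod N (eulerProduct R (k + 1))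
    (∏ s ∈ Finset.range N, expandHom s (eulerProduct R k ^ (s + 1) ^ k)) := by
  refine (eulerProduct_eqMod N (k + 1)).trans ?_
  rw [partialEuler_succ]
  refine EqMod.prod _ fun s _ => ?_
  exact (((eulerProduct_eqMod N k).pow _).expandHom s).symm

theorem eulerProduct_zero : eulerProduct R 0 = oneSub R 1 := eq_of_eqMod fun N => by
  have h : partialEuler R N 0 = oneSub R 1 := by simp [partialEuler]
  exact h ▸ eulerProduct_eqMod N 0

theorem coeffSeries_one_eulerProduct (k : ℕ) : coeffSeries 1 (eulerProduct R k) = -1 := by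
  have h : partialEuler R 1 k = oneSub R 1 := by
    simp [partialEuler, Fintype.piFinset_singleton]
  rw [coeffSeries_eulerProduct, h, coeffSeries, oneSub_val one_ne_zero, pow_one, map_sub,
    PowerSeries.coeff_one_X, PowerSeries.coeff_one, if_neg one_ne_zero, zero_sub]

end EulerProduct

namespace LambdaStructure

variable {R : Type*} [CommRing R] (l : LambdaStructure R)

/-- The power with a fixed exponent. -/
def powerHom (m : R) : oneSeries R →* oneSeries R :=
  MonoidHom.mk' (fun A => l.power A m) fun A B => l.power_mul A B m

theorem power_nsmul (A : oneSeries R) (n : ℕ) (m : R) :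
    l.power A (n • m) = l.power (A ^ n) m := by
  refine Eq.trans ?_ (map_pow (l.powerHom m) A n).symm
  induction n with
  | zero =>
    rw [zero_smul, pow_zero]
    exact l.powerStructure.pow_zero A
  | succ n ih =>
    rw [succ_nsmul, pow_succ, ← ih]
    exact l.powerStructure.pow_add A _ _

/-- The λ-structure defined by a power structure and a series `1 - t + ⋯`. -/
def ofPower (A : oneSeries R) (hA : coeffSeries 1 A = -1) : LambdaStructure R where
  series a := l.power A (-a)
  series_add a b := by
    rw [neg_add]
    exact l.powerStructure.pow_add A _ _
  coeff_one a := by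
    refine (l.powerStructure.coeff_one_pow A _).trans ?_
    rw [hA, neg_mul_neg, mul_one]

end LambdaStructure

theorem symLambda_series_neg_one : symLambda.series (-1) = oneSub K0Var 1 := by
  have h : ∀ n, coeffSeries n (symLambda.series 1) = 1 := fun n => by
    have h1 : (1 : K0Var) = QPVar.pt.cls := rfl
    have : Subsingleton (QPVar.pt.triv.power n).X :=
      ⟨fun _ _ => pow_ext fun _ => Subsingleton.elim (α := QPVar.pt) _ _⟩
    rw [h1, coeffSeries_symLambda, ← h1, ← map_one quotientRingHom, ← cls_pt]
    exact quotientRingHom_cls_eq (φ := fun _ => (default : QPVar.pt))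
      (ψ := fun _ => powMk (A := QPVar.pt.triv) fun _ => (default : QPVar.pt))
      (isRegular_const _) (isRegular_const _) (fun _ => Subsingleton.elim _ _)
      (fun _ => Subsingleton.elim (α := QPVar.pt) _ _) fun _ _ =>
        ⟨fun _ => ⟨1, Subsingleton.elim (α := QPVar.pt) _ _⟩, fun _ => ⟨1, Subsingleton.elim _ _⟩⟩
  rw [LambdaStructure.series_neg, inv_eq_iff_mul_eq_one]
  refine Subtype.ext ?_
  have h2 : (symLambda.series 1).1 = PowerSeries.mk 1 := PowerSeries.ext fun n =>
    (h n).trans (PowerSeries.coeff_mk n 1).symm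
  rw [Submonoid.coe_mul, h2, oneSub_val one_ne_zero, pow_one]
  exact PowerSeries.mk_one_mul_one_sub_eq_one K0Var

/-! ### The generalized Euler characteristics of higher order -/

theorem EqMod.mapSeries {R S : Type*} [CommRing R] [CommRing S] (φ : R →+* S) {n : ℕ}
    {A B : oneSeries R} (h : EqMod n A B) :
    EqMod n (Motivic.mapSeries φ A) (Motivic.mapSeries φ B) := fun m hm => by
  rw [coeffSeries_mapSeries, coeffSeries_mapSeries, h m hm]

theorem comp_cls_eq_eulerChar (k : ℕ) (A : GVar) :
    (quotientRingHom.comp (inertiaRingHom ^ k)) A.cls = A.eulerChar k := by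
  induction k generalizing A with
  | zero => exact quotientRingHom_cls A
  | succ k ih =>
    let _ : Fintype (ConjClasses A.G) := Fintype.ofFinite _
    refine (quotientRingHom_inertiaRingHom_pow_succ k _).trans ?_
    rw [inertiaRingHom_cls, inertia_cls_eq_finsum, eulerChar, finsum_eq_sum_of_fintype,
      finsum_eq_sum_of_fintype, map_sum, map_sum]
    exact sum_congr rfl fun c _ => ih _

/-- The λ-structure `λ^(k)`. -/
def eulerLambda (k : ℕ) : LambdaStructure K0Var :=
  symLambda.ofPower (eulerProduct K0Var k) (coeffSeries_one_eulerProduct k)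

theorem eulerLambda_series (k : ℕ) (a : K0Var) :
    (eulerLambda k).series a = symLambda.power (eulerProduct K0Var k) (-a) := rfl

theorem isLambdaHom_eulerLambda (k : ℕ) :
    IsLambdaHom zeta (eulerLambda k) (quotientRingHom.comp (inertiaRingHom ^ k)) := by
  induction k with
  | zero =>
    intro a
    rw [eulerLambda_series, eulerProduct_zero, ← symLambda_series_neg_one,
      LambdaStructure.power_series, neg_mul_neg, mul_one]
    exact isLambdaHom_quotientRingHom a
  | succ k ih =>
    refine isLambdaHom_of_cls fun A => eq_of_eqMod fun N => ?_
    set φ := quotientRingHom.comp (inertiaRingHom ^ k) with hφ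
    set x := (quotientRingHom.comp (inertiaRingHom ^ (k + 1))) A.cls with hx
    have h1 : mapSeries (quotientRingHom.comp (inertiaRingHom ^ (k + 1))) (zeta.series A.cls) =
        mapSeries φ (mapSeries inertiaRingHom (zeta.series A.cls)) := oneSeries_ext fun n => by
      rw [coeffSeries_mapSeries, coeffSeries_mapSeries, coeffSeries_mapSeries]
      exact quotientRingHom_inertiaRingHom_pow_succ k _
    rw [h1, eulerLambda_series]
    refine EqMod.trans ?_ ((mapSeries_inertiaRingHom_zeta A N).mapSeries φ).symm
    refine (LambdaStructure.EqMod.power (l := symLambda) (eulerProduct_succ_eqMod N k) (-x)).trans ?_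
    refine (congrArg (EqMod N _) ?_).mp (EqMod.refl N _)
    refine (map_prod (symLambda.powerHom (-x)) _ _).trans
      (Eq.trans ?_ (map_prod (mapSeriesHom φ) _ _).symm)
    refine prod_congr rfl fun r _ => ?_
    rw [mapSeries_expandHom, ← ih]
    refine (symLambda.power_expandHom r _ _).trans (congrArg (expandHom r) ?_)
    rw [eulerLambda_series, ← LambdaStructure.power_nsmul, smul_neg]
    refine congrArg (fun y => symLambda.power _ (-y)) ?_
    exact (quotientRingHom_cyclePart_self (A := A) (r := r + 1) k).symm

end Motivic

end

theorem mainTheorem2 :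
    (∀ A : GVar, ∃ π : A.X → A.quotient, A.IsQuotient A.quotient π) ∧
    ∃ (p : K0fGr →+* K0Var) (α : K0fGr →+* K0fGr) (ζ : LambdaStructure K0fGr)
      (P : PowerStructure K0Var),
      (∀ A : GVar, p A.cls = A.quotient.cls) ∧
      (∀ A : GVar, α A.cls = ∑ᶠ c : ConjClasses A.G, (A.fixed (Quotient.out c)).cls) ∧
      (∀ (A : GVar) (n : ℕ), coeffSeries n (ζ.series A.cls) = (A.power n).cls) ∧
      IsGeometric P ∧
      ∀ k : ℕ,
        (∀ A : GVar, (p.comp (α ^ k)) A.cls = A.eulerChar k) ∧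
        ∃ l : LambdaStructure K0Var,
          (∀ a : K0Var, l.series a = P.pow (eulerProduct K0Var k) (-a)) ∧
          IsLambdaHom ζ l (p.comp (α ^ k)) ∧
          ∀ A : GVar, mapSeries (p.comp (α ^ k)) (ζ.series A.cls) =
            P.pow (eulerProduct K0Var k) (-(A.eulerChar k)) := by
  refine ⟨GVar.exists_isQuotient_quotient, quotientRingHom, inertiaRingHom, zeta,
    symLambda.powerStructure, quotientRingHom_cls, fun A => ?_, fun A n => ?_,
    isGeometric_symLambda, fun k => ⟨comp_cls_eq_eulerChar k, eulerLambda k, eulerLambda_series k,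
      isLambdaHom_eulerLambda k, fun A => ?_⟩⟩
  · rw [inertiaRingHom_cls, GVar.inertia_cls_eq_finsum]
  · rw [zeta_series_cls, GVar.coeffSeries_zetaSeries]
  · rw [← isLambdaHom_eulerLambda k A.cls, comp_cls_eq_eulerChar]
    rfl
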